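/- **Definitions.** Let $n\ge 0$, and let $DY_h(\mathfrak{gl}_n)$ be the $h$-adically completed associative $\mathbb C[[h]]$-algebra with generators $l_{ij}^{(k)}$ ($1\le i,j\le n$, $k\in\mathbb Z$) and $c$. Put $$l_{ij}^{+}(u)=\delta_{ij}-h\sum_{k\ge 0}l_{ij}^{(k)}u^{-k-1},\qquad l_{ij}^{-}(u)=\delta_{ij}+h\sum_{k<0}l_{ij}^{(k)}u^{-k-1},\qquad L^\pm(u)=(l^\pm_{ij}(u)).$$ The defining relations are $[L^\pm(u),c]=0$, $$R(u-v)L_1^\pm(u)L_2^\pm(v)=L_2^\pm(v)L_1^\pm(u)R(u-v),$$ $$R(u-v-\tfrac12hc)L_1^+(u)L_2^-(v)=L_2^-(v)L_1^+(u)R(u-v+\tfrac12hc),$$ where $R(u)=I+\frac hu P$, $P$ is the permutation operator of $\mathbb C^n\otimes\mathbb C^n$, and $R$ is expanded in powers of $u^{-1}$. Write $u_\pm=u\pm\frac14hc$ and $\delta(u-v)=\sum_{k\in\mathbb Z}u^{-k-1}v^k$; shifts by multiples of $hc$ are expanded in powers of $h$. Below, $[\,\cdot\,]_{|u|>|v|}$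 and $[\,\cdot\,]_{|v|>|u|}$ denote the expansion of a rational function in the indicated region. **Theorem.** The matrices have unique Gauss decompositions $$L^\pm(u)=F^\pm(u)\,\mathrm{diag}(k_1^\pm(u),\dots,k_n^\pm(u))\,E^\pm(u)$$ with $F^\pm=(f^\pm_{ij})$ lower unitriangular and $E^\pm=(e^\pm_{ij})$ upper unitriangular, with entries power series in $u^{\mp1}$ over $DY_h(\mathfrak{gl}_n)$, and all $k_i^\pm(u)$ are invertible. Put, for $1\le i\le n-1$, $$X_i^+(u)=e_{i,i+1}^+(u_-)-e_{i,i+1}^-(u_+),\qquad X_i^-(u)=f_{i+1,i}^+(u_+)-f_{i+1,i}^-(u_-).$$ Then the following identities of formal series hold in $DY_h(\mathfrak{gl}_n)$ for all admissible indices. In (6)-(9) the rational functions are expanded in $|u|>|v|$ for $k^+$ and in $|v|>|u|$ for $k^-$. 1. $k_i^\pm(u)k_j^\pm(v)=k_j^\pm(v)k_i^\pm(u)$. 2. $\Big[\frac{u_--v_++h}{u_--v_+}\Big]_{|u|>|v|}k_i^+(u)k_i^-(v)=\Big[\frac{u_+-v_-+h}{u_+-v_-}\Big]_{|u|>|v|}k_i^-(v)k_i^+(u)$.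 3. $k_i^+(u)k_j^-(v)=k_j^-(v)k_i^+(u)$ for $i<j$. 4. $\Big[\frac{(u_+-v_-)^2}{(u_+-v_-)^2-h^2}\Big]_{|v|>|u|}k_i^-(u)k_j^+(v)=\Big[\frac{(u_--v_+)^2}{(u_--v_+)^2-h^2}\Big]_{|v|>|u|}k_j^+(v)k_i^-(u)$ for $i<j$. 5. $k_j^\pm(u)^{-1}X_i^+(v)k_j^\pm(u)=X_i^+(v)$ and $k_j^\pm(u)X_i^-(v)k_j^\pm(u)^{-1}=X_i^-(v)$ for $j\ne i,i+1$. 6. $k_i^\pm(u)^{-1}X_i^+(v)k_i^\pm(u)=\frac{u_\pm-v+h}{u_\pm-v}X_i^+(v)$. 7. $k_i^\pm(u)X_i^-(v)k_i^\pm(u)^{-1}=\frac{u_\mp-v+h}{u_\mp-v}X_i^-(v)$. 8. $k_{i+1}^\pm(u)^{-1}X_i^+(v)k_{i+1}^\pm(u)=\frac{u_\pm-v-h}{u_\pm-v}X_i^+(v)$. 9. $k_{i+1}^\pm(u)X_i^-(v)k_{i+1}^\pm(u)^{-1}=\frac{u_\mp-v-h}{u_\mp-v}X_i^-(v)$. 10.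 $(u-v\mp h)X_i^\pm(u)X_i^\pm(v)=(u-v\pm h)X_i^\pm(v)X_i^\pm(u)$. 11. $(u-v+h)X_i^+(u)X_{i+1}^+(v)=(u-v)X_{i+1}^+(v)X_i^+(u)$. 12. $(u-v)X_i^-(u)X_{i+1}^-(v)=(u-v+h)X_{i+1}^-(v)X_i^-(u)$. 13. $X_i^\pm(u_1)X_i^\pm(u_2)X_j^\pm(v)-2X_i^\pm(u_1)X_j^\pm(v)X_i^\pm(u_2)+X_j^\pm(v)X_i^\pm(u_1)X_i^\pm(u_2)+\{u_1\leftrightarrow u_2\}=0$ for $|i-j|=1$. 14. $X_i^\pm(u)X_j^\pm(v)=X_j^\pm(v)X_i^\pm(u)$ for $|i-j|>1$. 15. $[X_i^+(u),X_j^-(v)]=h\,\delta_{ij}\big\{\delta(u_--v_+)k_{i+1}^+(u_-)k_i^+(u_-)^{-1}-\delta(u_+-v_-)k_{i+1}^-(v_-)k_i^-(v_-)^{-1}\big\}$. -/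

import Mathlib

noncomputable section

namespace YangianDouble

/-- The two signs `±` that label the series, the Gaussian components and the currents. -/
inductive Sgn
  | plus
  | minus

/-- The sign as an integer. -/
def Sgn.val : Sgn → ℤ
  | .plus => 1
  | .minus => -1

section FormalSeries

variable (A : Type*) [Ring A] [Algebra (PowerSeries ℂ) A]

/-- The deformation parameter `h`, as an element of a `ℂ[[h]]`-algebra. -/
def hPar : A := algebraMap (PowerSeries ℂ) A PowerSeries.X

variable {A}

/-- `z * h * x` for a complex number `z` (used for the shifts `h c / 2` and `h c / 4`). -/
def hMul (z : ℂ) (x : A) : A := algebraMap (PowerSeries ℂ) A (PowerSeries.C z) * hPar A * x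

/-- A formal series in `u⁻¹` (sign `+`) or in `u` (sign `-`), read as the family of its coefficients:
`ser ε φ m` is the coefficient of `u ^ m`. -/
def ser (ε : Sgn) (φ : PowerSeries A) (m : ℤ) : A :=
  match ε with
  | .plus => if m ≤ 0 then PowerSeries.coeff (-m).toNat φ else 0
  | .minus => if 0 ≤ m then PowerSeries.coeff m.toNat φ else 0

/-! ### Expansions of rational functions of `x - y`

A rational function of degree at most `0` is expanded in the region `|x| > |y|`, as an element of
`A[y][[x⁻¹]]`, that is, of `PowerSeries (Polynomial A)`. -/

/-- `(x - y - s) / x = 1 - (y + s) x⁻¹`. -/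
def lin (s : A) : PowerSeries (Polynomial A) :=
  1 - PowerSeries.C (Polynomial.X + Polynomial.C s) * PowerSeries.X

/-- `1 / (x - y - t) = x⁻¹ * (1 - (y + t) x⁻¹)⁻¹`. -/
def pole (t : A) : PowerSeries (Polynomial A) :=
  PowerSeries.X * PowerSeries.invOfUnit (lin t) 1

/-- `(x - y - s) / (x - y - t)`. -/
def ratioXY (s t : A) : PowerSeries (Polynomial A) :=
  lin s * PowerSeries.invOfUnit (lin t) 1

/-- `(x - y - t)² / ((x - y - t)² - h²)`. -/
def squareXY (t : A) : PowerSeries (Polynomial A) :=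
  lin t ^ 2 * PowerSeries.invOfUnit
    (lin t ^ 2 - PowerSeries.C (Polynomial.C (hPar A)) ^ 2 * PowerSeries.X ^ 2) 1

/-- The coefficient of `x ^ a * y ^ b` in an element of `A[y][[x⁻¹]]`. -/
def coeffXY (φ : PowerSeries (Polynomial A)) (a b : ℤ) : A :=
  if a ≤ 0 ∧ 0 ≤ b then (PowerSeries.coeff (-a).toNat φ).coeff b.toNat else 0

/-- `(u - v - s) / (u - v - t)`, expanded in `|u| > |v|` for the sign `+` and in `|v| > |u|` for the
sign `-` (there it is `(v - u + s) / (v - u + t)`); the value at `a b` is the coefficient of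
`u ^ a * v ^ b`. -/
def ratio (ε : Sgn) (s t : A) (a b : ℤ) : A :=
  match ε with
  | .plus => coeffXY (ratioXY s t) a b
  | .minus => coeffXY (ratioXY (-s) (-t)) b a

/-- `(u - v - t)² / ((u - v - t)² - h²)`, expanded in `|v| > |u|`, where it is
`(v - u + t)² / ((v - u + t)² - h²)`. -/
def square (t : A) (a b : ℤ) : A := coeffXY (squareXY (-t)) b a

/-- Yang's R-matrix `R(u - v - t) = I + h / (u - v - t) * P`, expanded in powers of `u⁻¹`. -/
def RMatrix (n : ℕ) (t : A) : Matrix (Fin n × Fin n) (Fin n × Fin n) (ℤ → ℤ → A) := fun p q =>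
  coeffXY ((if p = q then 1 else 0) +
    (if p = q.swap then PowerSeries.C (Polynomial.C (hPar A)) * pole t else 0))

/-! ### Products of formal series in two variables -/

/-- The product of two series in `u, v` whose product has finite coefficient sums. -/
def finProd (F G : ℤ → ℤ → A) (a b : ℤ) : A :=
  ∑ᶠ p : ℤ × ℤ, F p.1 p.2 * G (a - p.1) (b - p.2)

/-- The corresponding product of matrices. -/
def matProd {ι : Type*} [Fintype ι] (M N : Matrix ι ι (ℤ → ℤ → A)) : Matrix ι ι (ℤ → ℤ → A) :=
  fun p q a b => ∑ r, finProd (M p r) (N r q) a b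

/-- `∑ i, f i = s` in the `h`-adic topology (unconditional convergence). -/
def HasHSum {ι : Type*} (f : ι → A) (s : A) : Prop :=
  ∀ N : ℕ, ∃ S₀ : Finset ι, ∀ S : Finset ι, S₀ ⊆ S →
    ∃ x : A, s - ∑ i ∈ S, f i = hPar A ^ N * x

/-- `F(u,v) * G(u,v) = H(u,v)`: the coefficient sums of the product converge `h`-adically to the
coefficients of `H`. -/
def IsProd (F G H : ℤ → ℤ → A) : Prop :=
  ∀ a b : ℤ, HasHSum (fun p : ℤ × ℤ => F p.1 p.2 * G (a - p.1) (b - p.2)) (H a b)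

/-- A series in `u` alone as a series in `u, v`. -/
def inU (G : ℤ → A) (a b : ℤ) : A := if b = 0 then G a else 0

/-- A series in `v` alone as a series in `u, v`. -/
def inV (G : ℤ → A) (a b : ℤ) : A := if a = 0 then G b else 0

/-- `(u - v - s) * F(u,v)`. -/
def mulLin (s : A) (F : ℤ → ℤ → A) (a b : ℤ) : A := F (a - 1) b - F a (b - 1) - s * F a b

/-! ### The matrices `L^±(u)` -/

variable {n : ℕ}

/-- `l^+_{ij}(u) = δ_{ij} - h ∑_{k ≥ 0} l_{ij}^{(k)} u^{-k-1}` as a power series in `u⁻¹`, and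
`l^-_{ij}(u) = δ_{ij} + h ∑_{k < 0} l_{ij}^{(k)} u^{-k-1}` as a power series in `u`. -/
def LMatrix (l : Fin n → Fin n → ℤ → A) (ε : Sgn) : Matrix (Fin n) (Fin n) (PowerSeries A) :=
  fun i j =>
    match ε with
    | .plus => (1 : Matrix (Fin n) (Fin n) (PowerSeries A)) i j -
        PowerSeries.C (hPar A) * (PowerSeries.X * PowerSeries.mk fun k : ℕ => l i j (k : ℤ))
    | .minus => (1 : Matrix (Fin n) (Fin n) (PowerSeries A)) i j +
        PowerSeries.C (hPar A) * PowerSeries.mk fun m : ℕ => l i j (-(m : ℤ) - 1)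

/-- `L₁(u) L₂(v)` for `L₁ = L ⊗ id`, `L₂ = id ⊗ L'`. -/
def L12 (ε ε' : Sgn) (L L' : Matrix (Fin n) (Fin n) (PowerSeries A)) :
    Matrix (Fin n × Fin n) (Fin n × Fin n) (ℤ → ℤ → A) :=
  fun p q a b => ser ε (L p.1 q.1) a * ser ε' (L' p.2 q.2) b

/-- `L₂(v) L₁(u)` for `L₁ = L ⊗ id`, `L₂ = id ⊗ L'`. -/
def L21 (ε ε' : Sgn) (L L' : Matrix (Fin n) (Fin n) (PowerSeries A)) :
    Matrix (Fin n × Fin n) (Fin n × Fin n) (ℤ → ℤ → A) :=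
  fun p q a b => ser ε' (L' p.2 q.2) b * ser ε (L p.1 q.1) a

end FormalSeries

/-! ### The algebra `DY_h(gl_n)` -/

/-- The generators `l_{ij}^{(k)}` and `c`. -/
inductive Gen (n : ℕ)
  | l (i j : Fin n) (k : ℤ)
  | c

/-- The free associative `ℂ[[h]]`-algebra on the generators. -/
abbrev Free (n : ℕ) : Type := FreeAlgebra (PowerSeries ℂ) (Gen n)

/-- `L^±(u)` over the free algebra. -/
def freeL (n : ℕ) (ε : Sgn) : Matrix (Fin n) (Fin n) (PowerSeries (Free n)) :=
  LMatrix (fun i j k => FreeAlgebra.ι (PowerSeries ℂ) (Gen.l i j k)) ε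

/-- `c` in the free algebra. -/
def freeC (n : ℕ) : Free n := FreeAlgebra.ι (PowerSeries ℂ) Gen.c

/-- The defining relations, coefficient by coefficient. They are imposed exactly as written, for the
series `L^±` (which contain the `l_{ij}^{(k)}` multiplied by `h`), and no `h`-torsion is divided out, so
that whatever holds here also holds in every `h`-adically complete quotient:
`[L^±(u), c] = 0`,
`R(u-v) L₁^±(u) L₂^±(v) = L₂^±(v) L₁^±(u) R(u-v)`,
`R(u-v-hc/2) L₁^+(u) L₂^-(v) = L₂^-(v) L₁^+(u) R(u-v+hc/2)`. -/
inductive Rel (n : ℕ) : Free n → Free n → Prop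
  | central (ε : Sgn) (i j : Fin n) (r : ℕ) :
      Rel n (PowerSeries.coeff r (freeL n ε i j) * freeC n)
        (freeC n * PowerSeries.coeff r (freeL n ε i j))
  | same (ε : Sgn) (p q : Fin n × Fin n) (a b : ℤ) :
      Rel n (matProd (RMatrix n 0) (L12 ε ε (freeL n ε) (freeL n ε)) p q a b)
        (matProd (L21 ε ε (freeL n ε) (freeL n ε)) (RMatrix n 0) p q a b)
  | mixed (p q : Fin n × Fin n) (a b : ℤ) :
      Rel n
        (matProd (RMatrix n (hMul (1 / 2) (freeC n)))
          (L12 .plus .minus (freeL n .plus) (freeL n .minus)) p q a b)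
        (matProd (L21 .plus .minus (freeL n .plus) (freeL n .minus))
          (RMatrix n (-hMul (1 / 2) (freeC n))) p q a b)

/-- The defining relations together with `h ^ N = 0`. -/
inductive LevelRel (n N : ℕ) : Free n → Free n → Prop
  | rel {x y : Free n} (h : Rel n x y) : LevelRel n N x y
  | pow : LevelRel n N (hPar (Free n) ^ N) 0

/-- The `ℂ[[h]]`-algebra with the generators and relations above, modulo `h ^ N`. -/
def Level (n N : ℕ) : Type := RingQuot (LevelRel n N)

instance (n N : ℕ) : Ring (Level n N) := inferInstanceAs (Ring (RingQuot (LevelRel n N)))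

instance (n N : ℕ) : Algebra (PowerSeries ℂ) (Level n N) :=
  inferInstanceAs (Algebra (PowerSeries ℂ) (RingQuot (LevelRel n N)))

/-- The quotient map from the free algebra. -/
def toLevel (n N : ℕ) : Free n →ₐ[PowerSeries ℂ] Level n N :=
  RingQuot.mkAlgHom (PowerSeries ℂ) (LevelRel n N)

theorem toLevel_rel {n N : ℕ} {x y : Free n} (h : LevelRel n N x y) :
    toLevel n N x = toLevel n N y :=
  RingQuot.mkAlgHom_rel (PowerSeries ℂ) h

theorem level_hPar_pow (n N : ℕ) : hPar (Level n N) ^ N = 0 := by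
  have h := toLevel_rel (LevelRel.pow (n := n) (N := N))
  simpa [hPar] using h

/-- The projection from the quotient by `h ^ (N+1)` to the quotient by `h ^ N`. -/
def transition (n N : ℕ) : Level n (N + 1) →ₐ[PowerSeries ℂ] Level n N :=
  RingQuot.liftAlgHom (PowerSeries ℂ) ⟨toLevel n N, by
    rintro x y (h | _)
    · exact toLevel_rel (LevelRel.rel h)
    · have h := level_hPar_pow n N
      simp only [hPar] at h ⊢
      simp [pow_succ, h]⟩

theorem transition_toLevel (n N : ℕ) (x : Free n) :
    transition n N (toLevel n (N + 1) x) = toLevel n N x :=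
  RingQuot.liftAlgHom_mkAlgHom_apply (PowerSeries ℂ) _ _ x

/-- The `h`-adic completion: compatible families in the quotients by `h ^ N`. -/
def completion (n : ℕ) : Subalgebra (PowerSeries ℂ) (∀ N : ℕ, Level n N) where
  carrier := {x | ∀ N, transition n N (x (N + 1)) = x N}
  mul_mem' := by
    intro x y hx hy N
    simp only [Pi.mul_apply, map_mul, hx N, hy N]
  add_mem' := by
    intro x y hx hy N
    simp only [Pi.add_apply, map_add, hx N, hy N]
  algebraMap_mem' := by
    intro r N
    simp only [Pi.algebraMap_apply, AlgHom.commutes]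

/-- The (`h`-adically complete) Yangian double `DY_h(gl_n)`. -/
abbrev DY (n : ℕ) : Type := completion n

/-- The canonical map from the free algebra. -/
def toDY (n : ℕ) : Free n →ₐ[PowerSeries ℂ] DY n :=
  AlgHom.codRestrict (AlgHom.pi fun N => toLevel n N) (completion n)
    fun x N => transition_toLevel n N x

/-- The image of a generator in `DY_h(gl_n)`. -/
def gen {n : ℕ} (g : Gen n) : DY n := toDY n (FreeAlgebra.ι (PowerSeries ℂ) g)

/-- The element `c` of `DY_h(gl_n)`. -/
def cElt (n : ℕ) : DY n := gen Gen.c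

/-- The matrices `L^±(u)` over `DY_h(gl_n)`. -/
def L (n : ℕ) (ε : Sgn) : Matrix (Fin n) (Fin n) (PowerSeries (DY n)) :=
  LMatrix (fun i j k => gen (Gen.l i j k)) ε

/-- The `h`-adically convergent sum `∑ i, h ^ i * x i`. -/
def hSum {n : ℕ} (x : ℕ → DY n) : DY n :=
  ⟨fun N => ∑ i ∈ Finset.range N, hPar (Level n N) ^ i * (x i).1 N, by
    intro N
    have h1 : transition n N (hPar (Level n (N + 1))) = hPar (Level n N) := by
      simp [hPar]
    have h2 : ∀ i, transition n N ((x i).1 (N + 1)) = (x i).1 N := fun i => (x i).2 N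
    simp only [map_sum, map_mul, map_pow, h1, h2]
    rw [Finset.sum_range_succ, level_hPar_pow, zero_mul, add_zero]⟩

/-- The shifted series `G(u + h κ) = ∑ j, G_j (u + h κ) ^ j`, where `(u + h κ) ^ j` is expanded in
powers of `h` for every integer `j`. -/
def shift {n : ℕ} (κ : DY n) (G : ℤ → DY n) (m : ℤ) : DY n :=
  hSum fun i => (Ring.choose (m + i) i : ℤ) • (κ ^ i * G (m + i))

/-- `c / 4`. -/
def quarter (n : ℕ) : DY n := algebraMap (PowerSeries ℂ) (DY n) (PowerSeries.C (1 / 4)) * cElt n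

/-- `δ(u - v) = ∑ k, u ^ (-k-1) * v ^ k`. -/
def delta (n : ℕ) (a b : ℤ) : DY n := if a + b = -1 then 1 else 0

/-- `δ((u + h κ) - (v + h μ))`. -/
def deltaShift {n : ℕ} (κ μ : DY n) (a b : ℤ) : DY n :=
  shift κ (fun a' => shift μ (delta n a') b) a

/-! ### Gaussian components and currents -/

/-- The data of a Gauss decomposition: entries of the lower triangular, the diagonal and the upper
triangular factor. -/
structure GaussData (n : ℕ) where
  F : Matrix (Fin n) (Fin n) (PowerSeries (DY n))
  k : Fin n → PowerSeries (DY n)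
  E : Matrix (Fin n) (Fin n) (PowerSeries (DY n))

/-- `M = F * diag(k) * E` with `F` lower and `E` upper unitriangular. -/
structure IsGauss {n : ℕ} (M : Matrix (Fin n) (Fin n) (PowerSeries (DY n))) (D : GaussData n) :
    Prop where
  F_diag : ∀ i, D.F i i = 1
  F_upper : ∀ i j, i < j → D.F i j = 0
  E_diag : ∀ i, D.E i i = 1
  E_lower : ∀ i j, j < i → D.E i j = 0
  eq : M = D.F * Matrix.diagonal D.k * D.E

/-- The index `i`, for `1 ≤ i ≤ n - 1`, among `1, …, n`. -/
def lo {n : ℕ} (i : Fin (n - 1)) : Fin n := ⟨i.val, by omega⟩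

/-- The index `i + 1`, for `1 ≤ i ≤ n - 1`, among `1, …, n`. -/
def up {n : ℕ} (i : Fin (n - 1)) : Fin n := ⟨i.val + 1, by omega⟩

variable {n : ℕ}

/-- The currents
`X_i^+(u) = e_{i,i+1}^+(u - hc/4) - e_{i,i+1}^-(u + hc/4)` and
`X_i^-(u) = f_{i+1,i}^+(u + hc/4) - f_{i+1,i}^-(u - hc/4)`. -/
def X (D : Sgn → GaussData n) (σ : Sgn) (i : Fin (n - 1)) (m : ℤ) : DY n :=
  match σ with
  | .plus => shift (-quarter n) (ser .plus ((D .plus).E (lo i) (up i))) m -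
      shift (quarter n) (ser .minus ((D .minus).E (lo i) (up i))) m
  | .minus => shift (quarter n) (ser .plus ((D .plus).F (up i) (lo i))) m -
      shift (-quarter n) (ser .minus ((D .minus).F (up i) (lo i))) m

/-- The series `k_i^±(u)`. -/
def K (D : Sgn → GaussData n) (ε : Sgn) (i : Fin n) : ℤ → DY n := ser ε ((D ε).k i)

/-- `k_j^ε(u)⁻¹ X(v) k_j^ε(u)` for `σ = +` and `k_j^ε(u) X(v) k_j^ε(u)⁻¹` for `σ = -`, as a series
in `u, v`. -/
def conjK (D : Sgn → GaussData n) (ε σ : Sgn) (j : Fin n) (Y : ℤ → DY n) (a b : ℤ) : DY n :=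
  match σ with
  | .plus => ser ε (Ring.inverse ((D ε).k j) * PowerSeries.C (Y b) * (D ε).k j) a
  | .minus => ser ε ((D ε).k j * PowerSeries.C (Y b) * Ring.inverse ((D ε).k j)) a

/-- `k_{i+1}^±(u) k_i^±(u)⁻¹`. -/
def phi (D : Sgn → GaussData n) (ε : Sgn) (i : Fin (n - 1)) : ℤ → DY n :=
  ser ε ((D ε).k (up i) * Ring.inverse ((D ε).k (lo i)))

/-- `h c / 2` in `DY_h(gl_n)`. -/
def hcHalf (n : ℕ) : DY n := hMul (1 / 2) (cElt n)

/-- The element `t` with `u_{εσ} - v = u - v - t`, where `u_± = u ± h c / 4`. -/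
def tShift (n : ℕ) (ε σ : Sgn) : DY n := -((ε.val * σ.val) • hMul (1 / 4) (cElt n))

/-- One half of the cubic Serre expression. -/
def serre (D : Sgn → GaussData n) (σ : Sgn) (i j : Fin (n - 1)) (a₁ a₂ b : ℤ) : DY n :=
  X D σ i a₁ * X D σ i a₂ * X D σ j b - 2 * (X D σ i a₁ * X D σ j b * X D σ i a₂) +
    X D σ j b * X D σ i a₁ * X D σ i a₂

end YangianDouble

end

/-!
# Gaussian generators of the Yangian double

All relations are proved modulo `h ^ N` for every `N`. In the quotient `Level n N` the element `h` is
nilpotent, and so is every shift by a multiple of `h c`; the coefficients of `L^±(u)` lie in the centralizer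
of `c`, over which `h` and `c` are central. This is the setting of the structure `RLLData`. Nothing is lost,
since the kernel of the projection from the completed algebra is generated by `h ^ N`
(`exists_of_proj_eq_zero`), so that `h`-adically convergent products may be computed modulo `h ^ N`.

Clearing denominators in the defining relations gives polynomial identities in `u - v` between series
(`SeriesRLL`). The factors `u - v - t` with `t` central and nilpotent are central regular elements in the
ring of series in two variables, and hence become invertible in some overring (`exists_localization`). There
the relations are RLL relations `ρ R(g) L₁ L'₂ = ρ' L'₂ L₁ R(g')` with scalar parameters
(`RLLData.exists_pair`), between two matrices in the factorized form `F * diag(k) * E`; this is a `Pair`.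

The relations between the components of a pair are pure algebra over a ring. Leading blocks of a factorized
matrix are factorized by the leading blocks of the factors, and the same holds for trailing blocks of the
inverse; as the inverse matrices satisfy an RLL relation as well, a pair may be restricted to consecutive
indices (`Pair.block`). So neighbouring components need computations of rank at most three only
(`Pair.e_k_zero`, `Pair.e_f`, `Pair.rank_three`). The relation between `L` and the inverse of `L'` makes
components with distant indices commute (`Pair.far`). Transposition over the opposite ring (`Pair.op`) and the
antipodal dual (`Pair.dual`) give the mirror images of each relation. The rank three relations imply the Serre
relations for the components: multiplied by the differences of the three variables, they reduce to
`smul_serre`, which rests on the partial fraction identity for `1 / (uᵢ - uⱼ)`.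

Back in the ring of series, the relations carry factors `u - v - t` with a shift `t` that depends on the signs.
The arguments of the components are shifted in the currents in such a way that all these factors become
`u - v`; then the relations for the signs `++`, `+-`, `-+` and `--` are added with signs, the terms in one
variable cancel, and the relations of the currents `X^+` remain (`RLLData.cur_self`, `RLLData.cur_succ`,
`RLLData.cur_serre`). Transposition turns them into those of `X^-` (`RLLData.op`). In the commutator of `X^+`
and `X^-` the four relations contribute the expansions of `1 / (u - v)` in both regions, which add up to delta
functions (`RLLData.cur_curF`); their products with shifted series are computed by means of `sum_choose_sh`.

Denominators are removed by uniqueness: a series with powers of one of the variables bounded on one side vanishes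
if its product with `u - v - t`, for nilpotent `t`, does. Accordingly the expansions of rational functions are characterized
by their products with their denominators (`mulLin_ratio`, `mulLin_mulLin_square`).

A Gauss decomposition exists since `L^±(u)` is the identity modulo `h`, so that all elements to be inverted
are units (`exists_gauss`), and it is unique (`Gauss.unique`).
-/

noncomputable section

namespace YangianDouble

universe u

/-! ### RLL relations over an algebra -/

section RLL

open Matrix

variable {Z S : Type*} [CommRing Z] [Ring S] [Algebra Z S] {ι : Type*}

/-- The relation `ρ R(g) L₁ L'₂ = ρ' L'₂ L₁ R(g')`, where `R(g) = 1 + g P`, written out in entries. -/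
def RLL (ρ g ρ' g' : Z) (L L' : Matrix ι ι S) : Prop :=
  ∀ i j k l, ρ • (L i j * L' k l + g • (L k j * L' i l)) =
    ρ' • (L' k l * L i j + g' • (L' k j * L i l))

variable {ρ g ρ' g' : Z} {L L' : Matrix ι ι S}

theorem RLL.submatrix {κ : Type*} (h : RLL ρ g ρ' g' L L') (e : κ → ι) :
    RLL ρ g ρ' g' (L.submatrix e e) (L'.submatrix e e) := fun i j k l =>
  h (e i) (e j) (e k) (e l)

theorem RLL.op (h : RLL ρ g ρ' g' L L') :
    RLL ρ' g' ρ g (Lᵀ.map MulOpposite.op) (L'ᵀ.map MulOpposite.op) := fun i j k l => by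
  have := h j i l k
  apply MulOpposite.unop_injective
  simpa [Matrix.map_apply] using this.symm

theorem RLL.of_smul {μ : Z} (hμ : IsUnit μ) (h : RLL (μ * ρ) g (μ * ρ') g' L L') :
    RLL ρ g ρ' g' L L' := fun i j k l => by
  have := h i j k l
  rw [mul_smul, mul_smul] at this
  exact hμ.smul_left_cancel.1 this

variable [DecidableEq ι]

/-- `A ⊗ 1`. -/
def amp₁ (A : Matrix ι ι S) : Matrix (ι × ι) (ι × ι) S :=
  fun p q => if p.2 = q.2 then A p.1 q.1 else 0

/-- `1 ⊗ A`. -/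
def amp₂ (A : Matrix ι ι S) : Matrix (ι × ι) (ι × ι) S :=
  fun p q => if p.1 = q.1 then A p.2 q.2 else 0

/-- The permutation operator. -/
def perm (ι S : Type*) [Ring S] [DecidableEq ι] : Matrix (ι × ι) (ι × ι) S :=
  fun p q => if p = q.swap then 1 else 0

theorem amp₁_one : amp₁ (1 : Matrix ι ι S) = 1 := by
  ext p q
  simp only [amp₁, Matrix.one_apply, Prod.ext_iff]
  grind

variable [Fintype ι]

theorem amp₁_mul_amp₂ (A B : Matrix ι ι S) (p q : ι × ι) :
    (amp₁ A * amp₂ B) p q = A p.1 q.1 * B p.2 q.2 := by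
  rw [Matrix.mul_apply, Finset.sum_eq_single (q.1, p.2)]
  · simp [amp₁, amp₂]
  · rintro ⟨a, b⟩ - hb
    by_cases h1 : p.2 = b
    · by_cases h2 : a = q.1
      · exact absurd (by simp [h1, h2]) hb
      · simp [amp₂, h2]
    · simp [amp₁, h1]
  · simp

theorem amp₂_mul_amp₁ (A B : Matrix ι ι S) (p q : ι × ι) :
    (amp₂ A * amp₁ B) p q = A p.2 q.2 * B p.1 q.1 := by
  rw [Matrix.mul_apply, Finset.sum_eq_single (p.1, q.2)]
  · simp [amp₁, amp₂]
  · rintro ⟨a, b⟩ - hb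
    by_cases h1 : p.1 = a
    · by_cases h2 : b = q.2
      · exact absurd (by simp [h1, h2]) hb
      · simp [amp₁, h2]
    · simp [amp₂, h1]
  · simp

theorem perm_mul (A : Matrix (ι × ι) (ι × ι) S) (p q : ι × ι) :
    (perm ι S * A) p q = A p.swap q := by
  rw [Matrix.mul_apply, Finset.sum_eq_single p.swap]
  · simp [perm]
  · intro r _ hr
    rw [perm, if_neg, zero_mul]
    rintro rfl
    simp at hr
  · simp

theorem mul_perm (A : Matrix (ι × ι) (ι × ι) S) (p q : ι × ι) :
    (A * perm ι S) p q = A p q.swap := by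
  rw [Matrix.mul_apply, Finset.sum_eq_single q.swap]
  · simp [perm]
  · intro r _ hr
    rw [perm, if_neg hr, mul_zero]
  · simp

theorem perm_mul_perm : perm ι S * perm ι S = 1 := by
  ext p q
  rw [perm_mul, Matrix.one_apply, perm]
  simp [Prod.ext_iff, and_comm]

theorem perm_mul_amp₁ (A : Matrix ι ι S) : perm ι S * amp₁ A = amp₂ A * perm ι S := by
  ext p q
  rw [perm_mul, mul_perm]
  simp [amp₁, amp₂]

theorem perm_mul_amp₂ (A : Matrix ι ι S) : perm ι S * amp₂ A = amp₁ A * perm ι S := by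
  ext p q
  rw [perm_mul, mul_perm]
  simp [amp₁, amp₂]

theorem amp₁_mul (A B : Matrix ι ι S) : amp₁ A * amp₁ B = amp₁ (A * B) := by
  ext p q
  rw [Matrix.mul_apply, Fintype.sum_prod_type, amp₁, Matrix.mul_apply]
  by_cases h : p.2 = q.2
  · simp only [amp₁, h, if_true]
    refine Finset.sum_congr rfl fun a _ => ?_
    rw [Finset.sum_eq_single q.2] <;> simp +contextual [eq_comm]
  · rw [if_neg h]
    refine Finset.sum_eq_zero fun a _ => Finset.sum_eq_zero fun b _ => ?_
    by_cases h1 : p.2 = b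
    · simp [amp₁, ← h1, h]
    · simp [amp₁, h1]

theorem amp₂_eq (A : Matrix ι ι S) : amp₂ A = perm ι S * amp₁ A * perm ι S := by
  rw [perm_mul_amp₁, mul_assoc, perm_mul_perm, mul_one]

theorem amp₂_mul (A B : Matrix ι ι S) : amp₂ A * amp₂ B = amp₂ (A * B) := by
  rw [amp₂_eq, amp₂_eq, amp₂_eq, ← amp₁_mul]
  simp only [mul_assoc]
  rw [← mul_assoc (perm ι S) (perm ι S), perm_mul_perm, one_mul]

theorem amp₂_one : amp₂ (1 : Matrix ι ι S) = 1 := by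
  rw [amp₂_eq, amp₁_one, mul_one, perm_mul_perm]

theorem RLL.iff_matrix : RLL ρ g ρ' g' L L' ↔
    ρ • ((1 + g • perm ι S) * (amp₁ L * amp₂ L')) =
      ρ' • (amp₂ L' * amp₁ L * (1 + g' • perm ι S)) := by
  constructor
  · intro h
    ext p q
    have := h p.1 q.1 p.2 q.2
    simpa [add_mul, mul_add, perm_mul, mul_perm, amp₁_mul_amp₂, amp₂_mul_amp₁] using this
  · intro h i j k l
    have := congrFun (congrFun h (i, k)) (j, l)
    simpa [add_mul, mul_add, perm_mul, mul_perm, amp₁_mul_amp₂, amp₂_mul_amp₁] using this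

/-- The R-matrix moved to the other side, by `(1 - g P) (1 + g P) = 1 - g²`. -/
theorem RLL.cross (h : RLL ρ g ρ' g' L L') :
    (ρ * (1 - g ^ 2)) • (amp₁ L * amp₂ L' * (1 - g' • perm ι S)) =
      (ρ' * (1 - g' ^ 2)) • ((1 - g • perm ι S) * (amp₂ L' * amp₁ L)) := by
  rw [RLL.iff_matrix] at h
  have hR : ∀ x : Z, (1 - x • perm ι S) * (1 + x • perm ι S) =
      (1 - x ^ 2) • (1 : Matrix (ι × ι) (ι × ι) S) := fun x => by
    simp only [sub_mul, mul_add, one_mul, mul_one, smul_mul_assoc, mul_smul_comm, perm_mul_perm]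
    module
  have hR' : ∀ x : Z, (1 + x • perm ι S) * (1 - x • perm ι S) =
      (1 - x ^ 2) • (1 : Matrix (ι × ι) (ι × ι) S) := fun x => by
    simp only [mul_sub, add_mul, one_mul, mul_one, smul_mul_assoc, mul_smul_comm, perm_mul_perm]
    module
  have h2 := congrArg (fun X => (1 - g • perm ι S) * X * (1 - g' • perm ι S)) h
  simp only [mul_smul_comm, smul_mul_assoc] at h2
  rw [← mul_assoc (1 - g • perm ι S) (1 + g • perm ι S), hR, mul_assoc (1 - g • perm ι S),
    mul_assoc _ (1 + g' • perm ι S), hR'] at h2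
  simpa [smul_smul] using h2

/-- Exchange of the two matrices, by means of `R(g) R(-g) = 1 - g ^ 2`. -/
theorem RLL.swap (h : RLL ρ g ρ' g' L L') :
    RLL (ρ' * (1 - g' ^ 2)) (-g) (ρ * (1 - g ^ 2)) (-g') L' L := by
  rw [RLL.iff_matrix]
  have h2 := congrArg (fun X => perm ι S * X * perm ι S) h.cross
  have e1 : perm ι S * (amp₁ L * amp₂ L' * (1 - g' • perm ι S)) * perm ι S =
      amp₂ L * amp₁ L' * (1 - g' • perm ι S) := by
    have : (1 - g' • perm ι S) * perm ι S = perm ι S * (1 - g' • perm ι S) := by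
      simp [sub_mul, mul_sub]
    rw [mul_assoc, mul_assoc (amp₁ L * amp₂ L'), this, ← mul_assoc (perm ι S),
      ← mul_assoc (perm ι S), perm_mul_amp₁, mul_assoc (amp₂ L), perm_mul_amp₂]
    simp only [mul_assoc]
    rw [← mul_assoc (perm ι S) (perm ι S), perm_mul_perm, one_mul]
  have e2 : perm ι S * ((1 - g • perm ι S) * (amp₂ L' * amp₁ L)) * perm ι S =
      (1 - g • perm ι S) * (amp₁ L' * amp₂ L) := by
    have : perm ι S * (1 - g • perm ι S) = (1 - g • perm ι S) * perm ι S := by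
      simp [sub_mul, mul_sub]
    rw [← mul_assoc, this, mul_assoc, mul_assoc, mul_assoc, ← perm_mul_amp₂, ← mul_assoc (amp₂ L'),
      ← perm_mul_amp₁, mul_assoc, ← mul_assoc, mul_assoc _ (perm ι S) (perm ι S * _),
      ← mul_assoc (perm ι S) (perm ι S), perm_mul_perm, one_mul]
  simp only [mul_smul_comm, smul_mul_assoc] at h2
  rw [e1, e2] at h2
  simpa [sub_eq_add_neg, mul_assoc] using h2.symm

/-- The inverse matrices satisfy an RLL relation with `-g` and `-g'` in place of `g` and `g'`. -/
theorem RLL.inv (h : RLL ρ g ρ' g' L L') {M M' : Matrix ι ι S} (hM : M * L = 1) (hM2 : L * M = 1)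
    (hM' : M' * L' = 1) (hM2' : L' * M' = 1) :
    RLL (ρ * (1 - g ^ 2)) (-g') (ρ' * (1 - g' ^ 2)) (-g) M M' := by
  rw [RLL.iff_matrix]
  have h2 := congrArg (fun X => amp₂ M' * (amp₁ M * X * amp₁ M) * amp₂ M') h.cross
  have a1 : amp₁ M * amp₁ L = 1 := by rw [amp₁_mul, hM, amp₁_one]
  have a2 : amp₁ L * amp₁ M = 1 := by rw [amp₁_mul, hM2, amp₁_one]
  have a3 : amp₂ M' * amp₂ L' = 1 := by rw [amp₂_mul, hM', amp₂_one]
  have a4 : amp₂ L' * amp₂ M' = 1 := by rw [amp₂_mul, hM2', amp₂_one]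
  simp only [mul_smul_comm, smul_mul_assoc] at h2
  have e1 : amp₂ M' * (amp₁ M * (amp₁ L * amp₂ L' * (1 - g' • perm ι S)) * amp₁ M) * amp₂ M' =
      (1 - g' • perm ι S) * (amp₁ M * amp₂ M') := by
    calc _ = amp₂ M' * ((amp₁ M * amp₁ L) * amp₂ L') * (1 - g' • perm ι S) *
        (amp₁ M * amp₂ M') := by simp only [mul_assoc]
      _ = _ := by rw [a1, one_mul, a3, one_mul]
  have e2 : amp₂ M' * (amp₁ M * ((1 - g • perm ι S) * (amp₂ L' * amp₁ L)) * amp₁ M) * amp₂ M' =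
      amp₂ M' * amp₁ M * (1 - g • perm ι S) := by
    calc _ = amp₂ M' * amp₁ M * (1 - g • perm ι S) * (amp₂ L' * (amp₁ L * amp₁ M) * amp₂ M') := by
          simp only [mul_assoc]
      _ = _ := by rw [a2, mul_one, a4, mul_one]
  rw [e1, e2] at h2
  simpa [sub_eq_add_neg] using h2

/-- The relation between `L` and the inverse `M'` of `L'`. -/
theorem RLL.mixed_inv (h : RLL ρ g ρ' g' L L') {M' : Matrix ι ι S}
    (hM' : M' * L' = 1) (hM2' : L' * M' = 1) (i j k l : ι) :
    ρ • (M' k l * L i j + if i = l then g • (M' * L) k j else 0) =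
      ρ' • (L i j * M' k l + if k = j then g' • (L * M') i l else 0) := by
  rw [RLL.iff_matrix] at h
  have h2 := congrArg (fun X => amp₂ M' * X * amp₂ M') h
  have a3 : amp₂ M' * amp₂ L' = 1 := by rw [amp₂_mul, hM', amp₂_one]
  have a4 : amp₂ L' * amp₂ M' = 1 := by rw [amp₂_mul, hM2', amp₂_one]
  simp only [mul_smul_comm, smul_mul_assoc] at h2
  have e1 : amp₂ M' * ((1 + g • perm ι S) * (amp₁ L * amp₂ L')) * amp₂ M' =
      amp₂ M' * amp₁ L + g • (amp₂ (M' * L) * perm ι S) := by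
    calc _ = amp₂ M' * ((1 + g • perm ι S) * amp₁ L) * (amp₂ L' * amp₂ M') := by
          simp only [mul_assoc]
      _ = _ := by
        rw [a4, mul_one, add_mul, one_mul, smul_mul_assoc, perm_mul_amp₁, mul_add, mul_smul_comm,
          ← mul_assoc, amp₂_mul]
  have e2 : amp₂ M' * (amp₂ L' * amp₁ L * (1 + g' • perm ι S)) * amp₂ M' =
      amp₁ L * amp₂ M' + g' • (amp₁ (L * M') * perm ι S) := by
    calc _ = (amp₂ M' * amp₂ L') * (amp₁ L * ((1 + g' • perm ι S) * amp₂ M')) := by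
          simp only [mul_assoc]
      _ = _ := by
        rw [a3, one_mul, add_mul, one_mul, smul_mul_assoc, perm_mul_amp₂, mul_add, mul_smul_comm,
          ← mul_assoc, amp₁_mul]
  rw [e1, e2] at h2
  have h3 := congrFun (congrFun h2 (i, k)) (j, l)
  simpa [mul_perm, amp₂_mul_amp₁, amp₁_mul_amp₂, amp₁, amp₂] using h3

end RLL

/-! ### Gauss decompositions over a ring -/

section Gauss

open Matrix

/-- A unitriangular factorization `F * diag(k) * E` with invertible diagonal part. -/
structure Gauss (n : ℕ) (S : Type*) [Ring S] where
  F : Matrix (Fin n) (Fin n) S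
  k : Fin n → S
  E : Matrix (Fin n) (Fin n) S
  F_diag : ∀ i, F i i = 1
  F_upper : ∀ i j, i < j → F i j = 0
  E_diag : ∀ i, E i i = 1
  E_lower : ∀ i j, j < i → E i j = 0
  k_unit : ∀ i, IsUnit (k i)

variable {n : ℕ} {S : Type*} [Ring S]

/-- The product of the three factors. -/
def Gauss.mat (D : Gauss n S) : Matrix (Fin n) (Fin n) S := D.F * diagonal D.k * D.E

theorem mul_diagonal_mul_apply (A B : Matrix (Fin n) (Fin n) S) (k : Fin n → S) (i j : Fin n) :
    (A * diagonal k * B) i j = ∑ a, A i a * k a * B a j := by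
  rw [Matrix.mul_apply]
  simp only [Matrix.mul_diagonal]

theorem Gauss.mat_apply (D : Gauss n S) (i j : Fin n) :
    D.mat i j = ∑ a, D.F i a * D.k a * D.E a j := by
  rw [Gauss.mat, mul_diagonal_mul_apply]

theorem exists_inv_of_upper {E : Matrix (Fin n) (Fin n) S} (h1 : ∀ i, E i i = 1)
    (h2 : ∀ i j, j < i → E i j = 0) :
    ∃ X : Matrix (Fin n) (Fin n) S, (∀ i, X i i = 1) ∧ (∀ i j, j < i → X i j = 0) ∧
      E * X = 1 ∧ X * E = 1 := by
  have hpow : ∀ m : ℕ, ∀ i j : Fin n, j.val < i.val + m → ((1 - E) ^ m) i j = 0 := by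
    intro m
    induction m with
    | zero => intro i j h; simp [Matrix.one_apply]; omega
    | succ m ih =>
      intro i j h
      rw [pow_succ, Matrix.mul_apply]
      refine Finset.sum_eq_zero fun a _ => ?_
      by_cases ha : a.val < i.val + m
      · rw [ih i a ha, zero_mul]
      · have : (1 - E) a j = 0 := by
          rcases eq_or_ne a j with rfl | hne
          · simp [h1]
          · rw [Matrix.sub_apply, Matrix.one_apply_ne hne, h2 a j (by omega), sub_zero]
        rw [this, mul_zero]
  have hnil : IsNilpotent (1 - E) := ⟨n, by ext i j; exact hpow n i j (by omega)⟩
  obtain ⟨u, hu⟩ := by simpa using hnil.isUnit_one_sub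
  have hX : E * (↑u⁻¹ : Matrix (Fin n) (Fin n) S) = 1 := by rw [← hu, Units.mul_inv]
  have hX' : (↑u⁻¹ : Matrix (Fin n) (Fin n) S) * E = 1 := by rw [← hu, Units.inv_mul]
  set X : Matrix (Fin n) (Fin n) S := ↑u⁻¹ with hXdef
  have key : ∀ i j : Fin n, (∀ a, i < a → X a j = 0) → X i j = (1 : Matrix (Fin n) (Fin n) S) i j := by
    intro i j h
    rw [← hX, Matrix.mul_apply, Finset.sum_eq_single i]
    · rw [h1, one_mul]
    · intro a _ ha
      rcases lt_or_gt_of_ne ha with h' | h'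
      · rw [h2 _ _ h', zero_mul]
      · rw [h a h', mul_zero]
    · simp
  have hlow : ∀ m : ℕ, ∀ i j : Fin n, n - i.val ≤ m → j < i → X i j = 0 := by
    intro m
    induction m with
    | zero => intro i j h; omega
    | succ m ih =>
      intro i j h hij
      rw [key i j fun a ha => ih a j (by omega) (by omega), Matrix.one_apply_ne (by omega)]
  refine ⟨X, fun i => ?_, fun i j hij => hlow n i j (by omega) hij, hX, hX'⟩
  rw [key i i fun a ha => hlow n a i (by omega) ha, Matrix.one_apply_eq]

theorem exists_inv_of_lower {F : Matrix (Fin n) (Fin n) S} (h1 : ∀ i, F i i = 1)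
    (h2 : ∀ i j, i < j → F i j = 0) :
    ∃ X : Matrix (Fin n) (Fin n) S, (∀ i, X i i = 1) ∧ (∀ i j, i < j → X i j = 0) ∧
      F * X = 1 ∧ X * F = 1 := by
  obtain ⟨X, hX1, hX2, hX3, hX4⟩ := exists_inv_of_upper (E := F.submatrix Fin.rev Fin.rev)
    (fun i => h1 _) (fun i j hij => h2 _ _ (Fin.rev_lt_rev.2 hij))
  have hF : (F.submatrix Fin.rev Fin.rev).submatrix Fin.rev Fin.rev = F := by ext; simp
  have hr : ∀ A B : Matrix (Fin n) (Fin n) S, (A * B).submatrix Fin.rev Fin.rev =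
      A.submatrix Fin.rev Fin.rev * B.submatrix Fin.rev Fin.rev := fun A B =>
    (Matrix.submatrix_mul_equiv A B _ Fin.revPerm _).symm
  refine ⟨X.submatrix Fin.rev Fin.rev, fun i => hX1 _,
    fun i j hij => hX2 _ _ (Fin.rev_lt_rev.2 hij), ?_, ?_⟩
  · rw [← hF, ← hr, hX3]; ext; simp [Matrix.one_apply]
  · rw [← hF, ← hr, hX4]; ext; simp [Matrix.one_apply]

/-- The inverse of `F * diag(k) * E` is an upper triangular times a lower triangular matrix. -/
theorem Gauss.exists_inv (D : Gauss n S) : ∃ U W : Matrix (Fin n) (Fin n) S,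
    (∀ i, U i i = 1) ∧ (∀ i j, j < i → U i j = 0) ∧ D.E * U = 1 ∧ U * D.E = 1 ∧
    (∀ i, W i i = 1) ∧ (∀ i j, i < j → W i j = 0) ∧ D.F * W = 1 ∧ W * D.F = 1 ∧
    D.mat * (U * diagonal (fun i => Ring.inverse (D.k i)) * W) = 1 ∧
    (U * diagonal (fun i => Ring.inverse (D.k i)) * W) * D.mat = 1 := by
  obtain ⟨U, h1, h2, h3, h4⟩ := exists_inv_of_upper D.E_diag D.E_lower
  obtain ⟨W, g1, g2, g3, g4⟩ := exists_inv_of_lower D.F_diag D.F_upper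
  refine ⟨U, W, h1, h2, h3, h4, g1, g2, g3, g4, ?_, ?_⟩
  · have : diagonal D.k * diagonal (fun i => Ring.inverse (D.k i)) = 1 := by
      rw [diagonal_mul_diagonal, ← diagonal_one]
      congr 1; ext i; exact Ring.mul_inverse_cancel _ (D.k_unit i)
    calc _ = D.F * (diagonal D.k * ((D.E * U) * diagonal (fun i => Ring.inverse (D.k i)))) * W := by
          simp only [Gauss.mat, Matrix.mul_assoc]
      _ = 1 := by rw [h3, Matrix.one_mul, this, Matrix.mul_one, g3]
  · have : diagonal (fun i => Ring.inverse (D.k i)) * diagonal D.k = 1 := by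
      rw [diagonal_mul_diagonal, ← diagonal_one]
      congr 1; ext i; exact Ring.inverse_mul_cancel _ (D.k_unit i)
    calc _ = U * (diagonal (fun i => Ring.inverse (D.k i)) * ((W * D.F) * diagonal D.k)) * D.E := by
          simp only [Gauss.mat, Matrix.mul_assoc]
      _ = 1 := by rw [g4, Matrix.one_mul, this, Matrix.mul_one, h4]

/-- The factorization of the block with the indices `e 0 < e 1 < ⋯`. -/
def Gauss.block (D : Gauss n S) {m : ℕ} (e : Fin m → Fin n) (he : StrictMono e) : Gauss m S where
  F := D.F.submatrix e e
  k := D.k ∘ e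
  E := D.E.submatrix e e
  F_diag _ := D.F_diag _
  F_upper _ _ h := D.F_upper _ _ (he h)
  E_diag _ := D.E_diag _
  E_lower _ _ h := D.E_lower _ _ (he h)
  k_unit _ := D.k_unit _

/-- The factorization of the transposed matrix over the opposite ring. -/
def Gauss.op (D : Gauss n S) : Gauss n Sᵐᵒᵖ where
  F := D.Eᵀ.map MulOpposite.op
  k i := MulOpposite.op (D.k i)
  E := D.Fᵀ.map MulOpposite.op
  F_diag i := by simp [D.E_diag]
  F_upper i j h := by simp [D.E_lower _ _ h]
  E_diag i := by simp [D.F_diag]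
  E_lower i j h := by simp [D.F_upper _ _ h]
  k_unit i := (D.k_unit i).op

theorem Gauss.op_mat (D : Gauss n S) : D.op.mat = D.matᵀ.map MulOpposite.op := by
  ext i j
  simp [Gauss.mat_apply, Gauss.op, mul_assoc, Matrix.map_apply]

/-- The image of a factorization under a ring homomorphism. -/
def Gauss.map {S' : Type*} [Ring S'] (D : Gauss n S) (f : S →+* S') : Gauss n S' where
  F := D.F.map f
  k i := f (D.k i)
  E := D.E.map f
  F_diag i := by simp [D.F_diag]
  F_upper i j h := by simp [D.F_upper _ _ h]
  E_diag i := by simp [D.E_diag]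
  E_lower i j h := by simp [D.E_lower _ _ h]
  k_unit i := (D.k_unit i).map f

theorem Gauss.map_mat {S' : Type*} [Ring S'] (D : Gauss n S) (f : S →+* S') :
    (D.map f).mat = D.mat.map f := by
  ext i j
  simp [Gauss.mat_apply, Gauss.map, Matrix.map_apply]

theorem submatrix_mul_of_range {m : ℕ} {A B : Matrix (Fin n) (Fin n) S} {e : Fin m → Fin n}
    (he : Function.Injective e)
    (h : ∀ i j x, x ∉ Set.range e → A (e i) x * B x (e j) = 0) :
    (A * B).submatrix e e = A.submatrix e e * B.submatrix e e := by
  ext i j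
  rw [Matrix.submatrix_apply, Matrix.mul_apply, Matrix.mul_apply]
  exact (Fintype.sum_of_injective e he _ _ (fun x hx => h i j x hx) (fun _ => rfl)).symm

theorem submatrix_tri {m : ℕ} {A B : Matrix (Fin n) (Fin n) S} {k : Fin n → S} {e : Fin m → Fin n}
    (he : Function.Injective e)
    (h : ∀ i j x, x ∉ Set.range e → A (e i) x = 0 ∨ B x (e j) = 0) :
    (A * diagonal k * B).submatrix e e =
      A.submatrix e e * diagonal (k ∘ e) * B.submatrix e e := by
  rw [submatrix_mul_of_range he]
  · congr 1
    ext i j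
    simp [Matrix.mul_diagonal]
  · intro i j x hx
    rw [Matrix.mul_diagonal]
    rcases h i j x hx with h | h <;> simp [h]

theorem Gauss.block_mat (D : Gauss n S) {m : ℕ} (e : Fin m → Fin n) (he : StrictMono e)
    (hr : ∀ i j, j ≤ e i → j ∈ Set.range e) : (D.block e he).mat = D.mat.submatrix e e := by
  rw [Gauss.mat, Gauss.mat, submatrix_tri he.injective]
  · rfl
  · intro i j x hx
    left
    exact D.F_upper _ _ (not_le.1 fun h => hx (hr i x h))

/-- The lower right block of the inverse of `F * diag(k) * E` inverts the product of the lower right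
blocks. -/
theorem Gauss.exists_inv_block (D : Gauss n S) {m : ℕ} (e : Fin m → Fin n) (he : StrictMono e)
    (hr : ∀ i j, e i ≤ j → j ∈ Set.range e) : ∃ M : Matrix (Fin n) (Fin n) S,
    D.mat * M = 1 ∧ M * D.mat = 1 ∧ (D.block e he).mat * M.submatrix e e = 1 ∧
      M.submatrix e e * (D.block e he).mat = 1 := by
  obtain ⟨U, W, h1, h2, h3, h4, g1, g2, g3, g4, m1, m2⟩ := D.exists_inv
  refine ⟨_, m1, m2, ?_, ?_⟩ <;>
  rw [submatrix_tri he.injective (fun i j x hx =>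
      Or.inl (h2 _ _ (not_le.1 fun h => hx (hr i x h)))), Gauss.mat]
  all_goals
    have one : (1 : Matrix (Fin n) (Fin n) S).submatrix e e = 1 := submatrix_one _ he.injective
    have EU : D.E.submatrix e e * U.submatrix e e = 1 := by
      rw [← submatrix_mul_of_range he.injective (fun i j x hx => by
        rw [D.E_lower _ _ (not_le.1 fun h => hx (hr i x h)), zero_mul]), h3, one]
    have UE : U.submatrix e e * D.E.submatrix e e = 1 := by
      rw [← submatrix_mul_of_range he.injective (fun i j x hx => by
        rw [h2 _ _ (not_le.1 fun h => hx (hr i x h)), zero_mul]), h4, one]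
    have FW : D.F.submatrix e e * W.submatrix e e = 1 := by
      rw [← submatrix_mul_of_range he.injective (fun i j x hx => by
        rw [g2 _ _ (not_le.1 fun h => hx (hr j x h)), mul_zero]), g3, one]
    have WF : W.submatrix e e * D.F.submatrix e e = 1 := by
      rw [← submatrix_mul_of_range he.injective (fun i j x hx => by
        rw [D.F_upper _ _ (not_le.1 fun h => hx (hr j x h)), mul_zero]), g4, one]
  · have hk : diagonal (D.k ∘ e) * diagonal ((fun i => Ring.inverse (D.k i)) ∘ e) = 1 := by
      rw [diagonal_mul_diagonal, ← diagonal_one]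
      congr 1; ext i; exact Ring.mul_inverse_cancel _ (D.k_unit (e i))
    calc _ = D.F.submatrix e e * (diagonal (D.k ∘ e) * ((D.E.submatrix e e * U.submatrix e e) *
          diagonal ((fun i => Ring.inverse (D.k i)) ∘ e))) * W.submatrix e e := by
          simp only [Gauss.block, Matrix.mul_assoc]
      _ = 1 := by rw [EU, Matrix.one_mul, hk, Matrix.mul_one, FW]
  · have hk : diagonal ((fun i => Ring.inverse (D.k i)) ∘ e) * diagonal (D.k ∘ e) = 1 := by
      rw [diagonal_mul_diagonal, ← diagonal_one]
      congr 1; ext i; exact Ring.inverse_mul_cancel _ (D.k_unit (e i))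
    calc _ = U.submatrix e e * (diagonal ((fun i => Ring.inverse (D.k i)) ∘ e) *
          ((W.submatrix e e * D.F.submatrix e e) * diagonal (D.k ∘ e))) * D.E.submatrix e e := by
          simp only [Gauss.block, Matrix.mul_assoc]
      _ = 1 := by rw [WF, Matrix.one_mul, hk, Matrix.mul_one, UE]

variable {Z : Type*} [CommRing Z] [Algebra Z S]

/-- If `d` commutes, up to a scalar, with all entries of `F * diag(k) * E`, then it commutes with the
entries of `F` and `E`, and up to the same scalar with those of `k`. -/
theorem Gauss.commute_of_mat (D : Gauss n S) {ρ ρ' : Z} (hρ : IsUnit ρ) (hρ' : IsUnit ρ') {d : S}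
    (h : ∀ i j, ρ • (d * D.mat i j) = ρ' • (D.mat i j * d)) :
    (∀ i j, Commute d (D.F i j)) ∧ (∀ i j, Commute d (D.E i j)) ∧
      ∀ i, ρ • (d * D.k i) = ρ' • (D.k i * d) := by
  obtain ⟨U, W, h1, h2, h3, h4, g1, g2, g3, g4, -, -⟩ := D.exists_inv
  have hd : ρ • (diagonal (fun _ => d) * D.mat) = ρ' • (D.mat * diagonal (fun _ => d)) := by
    ext i j
    simpa [Matrix.diagonal_mul, Matrix.mul_diagonal] using h i j
  set X := W * diagonal (fun _ => d) * D.F with hX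
  set Y := D.E * diagonal (fun _ => d) * U with hY
  have hXY : ρ • (X * diagonal D.k) = ρ' • (diagonal D.k * Y) := by
    have := congrArg (fun A => W * A * U) hd
    simp only [mul_smul_comm, smul_mul_assoc] at this
    have e1 : W * (diagonal (fun _ => d) * D.mat) * U = X * diagonal D.k := by
      calc _ = X * diagonal D.k * (D.E * U) := by
            simp only [Gauss.mat, hX, Matrix.mul_assoc]
        _ = _ := by rw [h3, Matrix.mul_one]
    have e2 : W * (D.mat * diagonal (fun _ => d)) * U = diagonal D.k * Y := by
      calc _ = (W * D.F) * (diagonal D.k * Y) := by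
            simp only [Gauss.mat, hY, Matrix.mul_assoc]
        _ = _ := by rw [g4, Matrix.one_mul]
    rwa [e1, e2] at this
  have hXs : ∀ i j, X i j = ∑ a, W i a * d * D.F a j := fun i j => by
    rw [hX, mul_diagonal_mul_apply]
  have hYs : ∀ i j, Y i j = ∑ a, D.E i a * d * U a j := fun i j => by
    rw [hY, mul_diagonal_mul_apply]
  have hXd : ∀ i, X i i = d := fun i => by
    rw [hXs, Finset.sum_eq_single i]
    · rw [g1, D.F_diag, one_mul, mul_one]
    · intro a _ ha
      rcases lt_or_gt_of_ne ha with h' | h'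
      · rw [D.F_upper _ _ h', mul_zero]
      · rw [g2 _ _ h', zero_mul, zero_mul]
    · simp
  have hYd : ∀ i, Y i i = d := fun i => by
    rw [hYs, Finset.sum_eq_single i]
    · rw [h1, D.E_diag, one_mul, mul_one]
    · intro a _ ha
      rcases lt_or_gt_of_ne ha with h' | h'
      · rw [D.E_lower _ _ h', zero_mul, zero_mul]
      · rw [h2 _ _ h', mul_zero]
    · simp
  have hXu : ∀ i j, i < j → X i j = 0 := fun i j hij => by
    rw [hXs]
    refine Finset.sum_eq_zero fun a _ => ?_
    rcases lt_or_ge i a with h' | h'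
    · rw [g2 _ _ h', zero_mul, zero_mul]
    · rw [D.F_upper _ _ (lt_of_le_of_lt h' hij), mul_zero]
  have hYl : ∀ i j, j < i → Y i j = 0 := fun i j hij => by
    rw [hYs]
    refine Finset.sum_eq_zero fun a _ => ?_
    rcases lt_or_ge a i with h' | h'
    · rw [D.E_lower _ _ h', zero_mul, zero_mul]
    · rw [h2 _ _ (lt_of_lt_of_le hij h'), mul_zero]
  have hent : ∀ i j, ρ • (X i j * D.k j) = ρ' • (D.k i * Y i j) := fun i j => by
    simpa [Matrix.diagonal_mul, Matrix.mul_diagonal] using congrFun (congrFun hXY i) j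
  have hXeq : X = diagonal (fun _ => d) := by
    ext i j
    rcases lt_trichotomy i j with hij | rfl | hij
    · rw [hXu i j hij, diagonal_apply_ne _ hij.ne]
    · rw [hXd, diagonal_apply_eq]
    · have := hent i j
      rw [hYl i j hij, mul_zero, smul_zero, hρ.smul_eq_zero] at this
      rw [(D.k_unit j).mul_left_eq_zero.1 this, diagonal_apply_ne _ hij.ne']
  have hYeq : Y = diagonal (fun _ => d) := by
    ext i j
    rcases lt_trichotomy i j with hij | rfl | hij
    · have := hent i j
      rw [hXu i j hij, zero_mul, smul_zero, eq_comm, hρ'.smul_eq_zero] at this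
      rw [(D.k_unit i).mul_right_eq_zero.1 this, diagonal_apply_ne _ hij.ne]
    · rw [hYd, diagonal_apply_eq]
    · rw [hYl i j hij, diagonal_apply_ne _ hij.ne']
  have hF : diagonal (fun _ => d) * D.F = D.F * diagonal (fun _ => d) := by
    rw [← hXeq, hX, ← Matrix.mul_assoc, ← Matrix.mul_assoc, g3, Matrix.one_mul, ← hX, hXeq]
  have hE : diagonal (fun _ => d) * D.E = D.E * diagonal (fun _ => d) := by
    rw [← hYeq, hY, Matrix.mul_assoc, h4, Matrix.mul_one, ← hY, hYeq]
  refine ⟨fun i j => ?_, fun i j => ?_, fun i => ?_⟩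
  · show _ = _
    simpa [Matrix.diagonal_mul, Matrix.mul_diagonal] using congrFun (congrFun hF i) j
  · show _ = _
    simpa [Matrix.diagonal_mul, Matrix.mul_diagonal] using congrFun (congrFun hE i) j
  · rw [← hXd i, hent, hYd, hXd]

end Gauss

/-! ### Relations between Gaussian components -/

section Pair

open Matrix

variable {Z S : Type*} [CommRing Z] [Ring S] [Algebra Z S] {n m : ℕ}

/-- Two matrices in factorized form that satisfy an RLL relation with invertible scalars. -/
structure Pair (ρ g ρ' g' : Z) (D D' : Gauss n S) : Prop where
  rll : RLL ρ g ρ' g' D.mat D'.mat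
  left : IsUnit ρ
  right : IsUnit ρ'
  add : IsUnit (1 + g)
  sub : IsUnit (1 - g)
  add' : IsUnit (1 + g')
  sub' : IsUnit (1 - g')

variable {ρ g ρ' g' : Z} {D D' : Gauss n S}

theorem isUnit_one_sub_sq {x : Z} (h : IsUnit (1 + x)) (h' : IsUnit (1 - x)) :
    IsUnit (1 - x ^ 2) := by
  convert h.mul h' using 1
  ring

theorem Pair.swap (p : Pair ρ g ρ' g' D D') :
    Pair (ρ' * (1 - g' ^ 2)) (-g) (ρ * (1 - g ^ 2)) (-g') D' D where
  rll := p.rll.swap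
  left := p.right.mul (isUnit_one_sub_sq p.add' p.sub')
  right := p.left.mul (isUnit_one_sub_sq p.add p.sub)
  add := by simpa [← sub_eq_add_neg] using p.sub
  sub := by simpa using p.add
  add' := by simpa [← sub_eq_add_neg] using p.sub'
  sub' := by simpa using p.add'

theorem Pair.op (p : Pair ρ g ρ' g' D D') : Pair ρ' g' ρ g D.op D'.op where
  rll := by
    rw [Gauss.op_mat, Gauss.op_mat]
    exact p.rll.op
  left := p.right
  right := p.left
  add := p.add'
  sub := p.sub'
  add' := p.add
  sub' := p.sub

theorem Pair.block_of_lower (p : Pair ρ g ρ' g' D D') (e : Fin m → Fin n) (he : StrictMono e)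
    (hr : ∀ i j, j ≤ e i → j ∈ Set.range e) : Pair ρ g ρ' g' (D.block e he) (D'.block e he) where
  rll := by
    rw [Gauss.block_mat _ _ _ hr, Gauss.block_mat _ _ _ hr]
    exact p.rll.submatrix e
  left := p.left
  right := p.right
  add := p.add
  sub := p.sub
  add' := p.add'
  sub' := p.sub'

theorem Pair.block_of_upper (p : Pair ρ g ρ' g' D D') (e : Fin m → Fin n) (he : StrictMono e)
    (hr : ∀ i j, e i ≤ j → j ∈ Set.range e) : Pair ρ g ρ' g' (D.block e he) (D'.block e he) where
  rll := by
    obtain ⟨M, h1, h2, h3, h4⟩ := D.exists_inv_block e he hr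
    obtain ⟨M', h1', h2', h3', h4'⟩ := D'.exists_inv_block e he hr
    have := ((p.rll.inv h2 h1 h2' h1').submatrix e).inv h3 h4 h3' h4'
    simp only [neg_neg, even_two.neg_pow] at this
    refine RLL.of_smul (μ := (1 - g ^ 2) * (1 - g' ^ 2))
      ((isUnit_one_sub_sq p.add p.sub).mul (isUnit_one_sub_sq p.add' p.sub')) ?_
    convert this using 1 <;> ring
  left := p.left
  right := p.right
  add := p.add
  sub := p.sub
  add' := p.add'
  sub' := p.sub'

/-- The indices `a, a + 1, …, a + m - 1`. -/
def seg (a m n : ℕ) (h : a + m ≤ n) (i : Fin m) : Fin n := ⟨a + i.val, by omega⟩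

theorem seg_strictMono (a m n : ℕ) (h : a + m ≤ n) : StrictMono (seg a m n h) := fun i j hij => by
  simp only [seg, Fin.lt_def] at *
  omega

/-- The factorized pair cut out by consecutive indices. A leading block of `L` is the product of the leading
blocks of the factors, so that the relation restricts to it; for a trailing block the same holds for the
inverse matrices. -/
theorem Pair.block (p : Pair ρ g ρ' g' D D') (a : ℕ) (h : a + m ≤ n) :
    Pair ρ g ρ' g' (D.block _ (seg_strictMono a m n h)) (D'.block _ (seg_strictMono a m n h)) := by
  have q := p.block_of_lower (seg 0 (a + m) n (by omega)) (seg_strictMono _ _ _ _) (fun i j hj =>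
    ⟨⟨j.val, by simp only [seg, Fin.le_def] at hj; omega⟩, by simp [seg]⟩)
  have r := q.block_of_upper (seg a m (a + m) le_rfl) (seg_strictMono _ _ _ _) (fun i j hj =>
    have hj' : a + i.val ≤ j.val := hj
    ⟨⟨j.val - a, by omega⟩, by
      ext
      simp only [seg]
      omega⟩)
  have hcomp : seg 0 (a + m) n (by omega) ∘ seg a m (a + m) le_rfl = seg a m n h := by
    ext i
    simp [seg]
  have hb : ∀ D : Gauss n S, (D.block (seg 0 (a + m) n (by omega)) (seg_strictMono _ _ _ _)).block
      (seg a m (a + m) le_rfl) (seg_strictMono _ _ _ _) =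
      D.block _ (seg_strictMono a m n h) := fun D => by
    simp only [Gauss.block, Matrix.submatrix_submatrix, Function.comp_assoc, hcomp]
  rwa [hb, hb] at r

/-! ### The antipodal dual -/

/-- The upper unitriangular inverse of `E`. -/
def Gauss.U (D : Gauss n S) : Matrix (Fin n) (Fin n) S := D.exists_inv.choose

/-- The lower unitriangular inverse of `F`. -/
def Gauss.W (D : Gauss n S) : Matrix (Fin n) (Fin n) S := D.exists_inv.choose_spec.choose

theorem Gauss.inv_spec (D : Gauss n S) :
    (∀ i, D.U i i = 1) ∧ (∀ i j, j < i → D.U i j = 0) ∧ D.E * D.U = 1 ∧ D.U * D.E = 1 ∧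
    (∀ i, D.W i i = 1) ∧ (∀ i j, i < j → D.W i j = 0) ∧ D.F * D.W = 1 ∧ D.W * D.F = 1 ∧
    D.mat * (D.U * diagonal (fun i => Ring.inverse (D.k i)) * D.W) = 1 ∧
    (D.U * diagonal (fun i => Ring.inverse (D.k i)) * D.W) * D.mat = 1 :=
  D.exists_inv.choose_spec.choose_spec

/-- The inverse matrix, transposed at the antidiagonal and read over the opposite ring; it is again
in factorized form. -/
def Gauss.dual (D : Gauss n S) : Gauss n Sᵐᵒᵖ where
  F i j := MulOpposite.op (D.W j.rev i.rev)
  k i := MulOpposite.op (Ring.inverse (D.k i.rev))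
  E i j := MulOpposite.op (D.U j.rev i.rev)
  F_diag i := by simp [D.inv_spec.2.2.2.2.1]
  F_upper i j h := by simp [D.inv_spec.2.2.2.2.2.1 _ _ (Fin.rev_lt_rev.2 h)]
  E_diag i := by simp [D.inv_spec.1]
  E_lower i j h := by simp [D.inv_spec.2.1 _ _ (Fin.rev_lt_rev.2 h)]
  k_unit i := (D.k_unit _).ringInverse.op

theorem Gauss.dual_mat (D : Gauss n S) :
    D.dual.mat = ((D.U * diagonal (fun i => Ring.inverse (D.k i)) * D.W)ᵀ.map
      MulOpposite.op).submatrix Fin.rev Fin.rev := by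
  ext i j
  rw [Gauss.mat_apply, Matrix.submatrix_apply, Matrix.map_apply, Matrix.transpose_apply,
    mul_diagonal_mul_apply, Finset.op_sum, ← Equiv.sum_comp Fin.revPerm]
  simp [Gauss.dual, mul_assoc]

/-- The dual pair has the index `n - 1` in place of `0`, so that every relation in the first row gives one in
the last column. -/
theorem Pair.dual (p : Pair ρ g ρ' g' D D') :
    Pair (ρ' * (1 - g' ^ 2)) (-g) (ρ * (1 - g ^ 2)) (-g') D.dual D'.dual where
  rll := by
    rw [Gauss.dual_mat, Gauss.dual_mat]
    have h1 := D.inv_spec.2.2.2.2.2.2.2.2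
    have h2 := D'.inv_spec.2.2.2.2.2.2.2.2
    exact ((p.rll.inv h1.2 h1.1 h2.2 h2.1).op).submatrix Fin.rev
  left := p.right.mul (isUnit_one_sub_sq p.add' p.sub')
  right := p.left.mul (isUnit_one_sub_sq p.add p.sub)
  add := by simpa [← sub_eq_add_neg] using p.sub
  sub := by simpa using p.add
  add' := by simpa [← sub_eq_add_neg] using p.sub'
  sub' := by simpa using p.add'

theorem Gauss.U_two (D : Gauss 2 S) : D.U 0 1 = -D.E 0 1 := by
  have h := congrFun (congrFun D.inv_spec.2.2.1 0) 1
  have h1 := D.inv_spec.1 1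
  simp only [Matrix.mul_apply, Fin.sum_univ_two, D.E_diag, h1] at h
  simp at h
  exact eq_neg_of_add_eq_zero_left h

theorem Gauss.U_three (D : Gauss 3 S) : D.U 0 1 = -D.E 0 1 ∧ D.U 1 2 = -D.E 1 2 ∧
    D.U 0 2 = D.E 0 1 * D.E 1 2 - D.E 0 2 := by
  have h := D.inv_spec.2.2.1
  have hd := D.inv_spec.1
  have hl := D.inv_spec.2.1
  have h01 := congrFun (congrFun h 0) 1
  have h12 := congrFun (congrFun h 1) 2
  have h02 := congrFun (congrFun h 0) 2
  simp only [Matrix.mul_apply, Fin.sum_univ_three, D.E_diag, hd, hl 2 1 (by decide),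
    D.E_lower 1 0 (by decide)] at h01 h12 h02
  simp at h01 h12 h02
  have e01 := eq_neg_of_add_eq_zero_left h01
  have e12 := eq_neg_of_add_eq_zero_left h12
  refine ⟨e01, e12, ?_⟩
  rw [e12] at h02
  rw [← sub_eq_zero, ← h02]
  noncomm_ring

theorem Gauss.W_three (D : Gauss 3 S) : D.W 2 1 = -D.F 2 1 := by
  have h := D.inv_spec.2.2.2.2.2.2.1
  have hd := D.inv_spec.2.2.2.2.1
  have hl := D.inv_spec.2.2.2.2.2.1
  have h21 := congrFun (congrFun h 2) 1
  simp only [Matrix.mul_apply, Fin.sum_univ_three, D.F_diag, hd, hl 0 1 (by decide)] at h21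
  simp at h21
  exact eq_neg_of_add_eq_zero_right h21

end Pair

section PairRelations

open Matrix

variable {Z S : Type*} [CommRing Z] [Ring S] [Algebra Z S] {n m : ℕ} {ρ g ρ' g' : Z}

/-! ### Relations in the first row -/

section Row

variable {D D' : Gauss (m + 1) S}

theorem Gauss.mat_zero (D : Gauss (m + 1) S) (j : Fin (m + 1)) : D.mat 0 j = D.k 0 * D.E 0 j := by
  rw [Gauss.mat_apply, Finset.sum_eq_single 0]
  · rw [D.F_diag, one_mul]
  · intro a _ ha
    rw [D.F_upper _ _ (Fin.pos_iff_ne_zero.2 ha), zero_mul, zero_mul]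
  · simp

theorem Gauss.mat_zero_right (D : Gauss (m + 1) S) (i : Fin (m + 1)) :
    D.mat i 0 = D.F i 0 * D.k 0 := by
  rw [Gauss.mat_apply, Finset.sum_eq_single 0]
  · rw [D.E_diag, mul_one]
  · intro a _ ha
    rw [D.E_lower _ _ (Fin.pos_iff_ne_zero.2 ha), mul_zero]
  · simp

theorem Pair.k_zero_k_zero (p : Pair ρ g ρ' g' D D') :
    (ρ * (1 + g)) • (D.k 0 * D'.k 0) = (ρ' * (1 + g')) • (D'.k 0 * D.k 0) := by
  have h := p.rll 0 0 0 0
  simp only [Gauss.mat_zero, Gauss.E_diag, mul_one] at h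
  rw [mul_smul, mul_smul, add_smul, add_smul, one_smul, one_smul, h]

theorem Pair.e_k_zero (p : Pair ρ g ρ' g' D D') (l : Fin (m + 1)) :
    D'.E 0 l * D.k 0 = D.k 0 * ((1 + g') • D'.E 0 l - g' • D.E 0 l) := by
  have h := p.rll 0 0 0 l
  have hk := p.k_zero_k_zero
  simp only [Gauss.mat_zero, Gauss.E_diag, mul_one] at h
  have h1 : ρ' • (D'.k 0 * (D'.E 0 l * D.k 0)) =
      ρ' • (D'.k 0 * (D.k 0 * ((1 + g') • D'.E 0 l - g' • D.E 0 l))) := by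
    have h2 : (ρ * (1 + g)) • (D.k 0 * (D'.k 0 * D'.E 0 l)) =
        (ρ' * (1 + g')) • (D'.k 0 * (D.k 0 * D'.E 0 l)) := by
      rw [← mul_assoc, ← smul_mul_assoc, hk, smul_mul_assoc, mul_assoc]
    simp only [mul_assoc, smul_add, smul_smul, mul_sub, mul_smul_comm, smul_sub] at h h2 ⊢
    rw [mul_add, mul_one, add_smul, h] at h2
    rw [eq_sub_iff_add_eq]
    exact h2
  exact (D'.k_unit 0).mul_left_cancel (p.right.smul_left_cancel.1 h1)

theorem Pair.e_k_zero' (p : Pair ρ g ρ' g' D D') (l : Fin (m + 1)) :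
    D.E 0 l * D'.k 0 = D'.k 0 * ((1 - g') • D.E 0 l + g' • D'.E 0 l) := by
  simpa [sub_eq_add_neg] using p.swap.e_k_zero l

theorem Pair.f_k_zero (p : Pair ρ g ρ' g' D D') (l : Fin (m + 1)) :
    D.k 0 * D'.F l 0 = ((1 + g) • D'.F l 0 - g • D.F l 0) * D.k 0 := by
  have := congrArg MulOpposite.unop (p.op.e_k_zero l)
  simpa [Gauss.op] using this

theorem Pair.e_e_zero (p : Pair ρ g ρ' g' D D') (j l : Fin (m + 1)) :
    (1 + g') • (((1 - g') • D.E 0 j + g' • D'.E 0 j) * D'.E 0 l) =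
      ((1 + g') • D'.E 0 l - g' • D.E 0 l) * D.E 0 j +
        g' • (((1 + g') • D'.E 0 j - g' • D.E 0 j) * D.E 0 l) := by
  have h := p.rll 0 j 0 l
  have hk := p.k_zero_k_zero
  simp only [Gauss.mat_zero] at h
  have e1 : D.k 0 * D.E 0 j * (D'.k 0 * D'.E 0 l) =
      D.k 0 * D'.k 0 * (((1 - g') • D.E 0 j + g' • D'.E 0 j) * D'.E 0 l) := by
    rw [mul_assoc, ← mul_assoc (D.E 0 j), p.e_k_zero']
    simp only [mul_assoc]
  have e2 : ∀ a b, D'.k 0 * D'.E 0 a * (D.k 0 * D.E 0 b) =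
      D'.k 0 * D.k 0 * (((1 + g') • D'.E 0 a - g' • D.E 0 a) * D.E 0 b) := fun a b => by
    rw [mul_assoc, ← mul_assoc (D'.E 0 a), p.e_k_zero]
    simp only [mul_assoc]
  rw [e1, e2, e2, ← one_smul Z (D.k 0 * D'.k 0 * _), smul_smul, ← add_smul, mul_one, smul_smul,
    ← smul_mul_assoc, hk, smul_mul_assoc, mul_smul, ← mul_smul_comm] at h
  rw [← mul_smul_comm g', ← mul_add] at h
  exact (D.k_unit 0).mul_left_cancel ((D'.k_unit 0).mul_left_cancel
    (by simpa only [mul_assoc] using p.right.smul_left_cancel.1 h))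

/-- The relation between two entries of the first row. -/
theorem Pair.e_e_zero_of_ne (p : Pair ρ g ρ' g' D D') (j l : Fin (m + 1)) :
    (1 + g') • (D.E 0 j * D'.E 0 l - D'.E 0 l * D.E 0 j +
        g' • ((D.E 0 j - D'.E 0 j) * (D.E 0 l - D'.E 0 l))) =
      g' • (D.E 0 j * D.E 0 l - D.E 0 l * D.E 0 j) := by
  have h := p.e_e_zero j l
  simp only [smul_add, smul_sub, smul_smul, add_mul, sub_mul, mul_add, mul_sub, smul_mul_assoc] at h ⊢
  rw [← sub_eq_zero] at h ⊢
  rw [← h]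
  module

theorem Pair.e_e_zero_self (p : Pair ρ g ρ' g' D D') (j : Fin (m + 1)) :
    D.E 0 j * D'.E 0 j - D'.E 0 j * D.E 0 j =
      -(g' • ((D.E 0 j - D'.E 0 j) * (D.E 0 j - D'.E 0 j))) := by
  have h := p.e_e_zero_of_ne j j
  rw [sub_self, smul_zero, p.add'.smul_eq_zero] at h
  exact eq_neg_of_add_eq_zero_left h

end Row

/-! ### Relations in rank two -/

section RankTwo

variable {D D' : Gauss 2 S}

/-- The relation `Pair.e_k_zero` for the dual pair. -/
theorem Pair.e_k_one (p : Pair ρ g ρ' g' D D') :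
    D'.E 0 1 * D.k 1 = D.k 1 * ((1 - g') • D'.E 0 1 + g' • D.E 0 1) := by
  have h := congrArg MulOpposite.unop (p.dual.e_k_zero 1)
  simp only [Gauss.dual, MulOpposite.unop_mul, MulOpposite.unop_sub, MulOpposite.unop_smul,
    MulOpposite.unop_op] at h
  rw [show (Fin.rev 1 : Fin 2) = 0 from rfl, show (Fin.rev 0 : Fin 2) = 1 from rfl,
    Gauss.U_two, Gauss.U_two] at h
  obtain ⟨u, hu⟩ := D.k_unit 1
  rw [← hu, Ring.inverse_unit] at h
  rw [← hu, ← Units.inv_mul_eq_iff_eq_mul, ← mul_assoc]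
  have h2 : ↑u⁻¹ * D'.E 0 1 = ((1 - g') • D'.E 0 1 + g' • D.E 0 1) * (↑u⁻¹ : S) := by
    calc _ = -(↑u⁻¹ * -D'.E 0 1) := by rw [mul_neg, neg_neg]
      _ = _ := by
        rw [h]
        simp only [smul_neg, neg_smul, add_mul, sub_mul, neg_mul, smul_mul_assoc]
        module
  rw [h2, mul_assoc, Units.inv_mul, mul_one]

theorem Pair.k_zero_k_one (p : Pair ρ g ρ' g' D D') :
    ρ • (D.k 0 * D'.k 1) = ρ' • (D'.k 1 * D.k 0) := by
  obtain ⟨-, -, -, -, -, -, -, -, h1, h2⟩ := D'.inv_spec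
  have hW := D'.inv_spec.2.2.2.2.1 1
  have hU := D'.inv_spec.1 1
  have hUl := D'.inv_spec.2.1 1 0 (by decide)
  have h := p.rll.mixed_inv h2 h1 0 0 1 1
  rw [mul_diagonal_mul_apply, Fin.sum_univ_two, hW, hU, hUl, Gauss.mat_zero, D.E_diag] at h
  simp only [zero_mul, zero_add, one_mul, mul_one, Fin.isValue, zero_ne_one, one_ne_zero, if_false,
    add_zero] at h
  obtain ⟨u, hu⟩ := D'.k_unit 1
  rw [← hu, Ring.inverse_unit] at h
  rw [← hu]
  have := congrArg (fun x => (u : S) * x * u) h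
  simp only [mul_smul_comm, smul_mul_assoc] at this
  rw [← mul_assoc, Units.mul_inv, one_mul, mul_assoc (u : S), Units.inv_mul_cancel_right] at this
  exact this

/-- The commutator of the off-diagonal components, from the entry of the RLL relation with indices
`(0, 1)` and `(1, 0)`. -/
theorem Pair.e_f (p : Pair ρ g ρ' g' D D') :
    D.E 0 1 * D'.F 1 0 - D'.F 1 0 * D.E 0 1 =
      g' • (D'.k 1 * Ring.inverse (D'.k 0)) - g • (Ring.inverse (D.k 0) * D.k 1) := by
  have h := p.rll 0 1 1 0
  have h11 : D.mat 1 1 = D.k 1 + D.F 1 0 * D.k 0 * D.E 0 1 := by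
    rw [Gauss.mat_apply, Fin.sum_univ_two, D.F_diag, D.E_diag, one_mul, mul_one, add_comm]
  have h11' : D'.mat 1 1 = D'.k 1 + D'.F 1 0 * D'.k 0 * D'.E 0 1 := by
    rw [Gauss.mat_apply, Fin.sum_univ_two, D'.F_diag, D'.E_diag, one_mul, mul_one, add_comm]
  rw [h11, h11', Gauss.mat_zero, Gauss.mat_zero_right, Gauss.mat_zero, Gauss.mat_zero,
    Gauss.E_diag, Gauss.E_diag, mul_one, mul_one] at h
  have hk := p.k_zero_k_zero
  have hek := p.e_k_zero 1
  have hek' := p.e_k_zero' 1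
  have hfk := p.f_k_zero 1
  have hkk := p.k_zero_k_one
  set a := D.k 0
  set a' := D'.k 0
  set e := D.E 0 1
  set e' := D'.E 0 1
  set f := D.F 1 0
  set f' := D'.F 1 0
  set d := D.k 1
  set d' := D'.k 1
  have q1 : a * e * (f' * a') = a * (e * f' - f' * e) * a' + (1 + g) • (f' * (a * a') *
      ((1 - g') • e + g' • e')) - g • (f * (a * a') * ((1 - g') • e + g' • e')) := by
    have : a * f' * (e * a') = ((1 + g) • f' - g • f) * a * (a' * ((1 - g') • e + g' • e')) := by
      rw [hfk, hek']
    calc _ = a * (e * f' - f' * e) * a' + a * f' * (e * a') := by noncomm_ring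
      _ = _ := by
        rw [this]
        simp only [sub_mul, smul_mul_assoc, mul_assoc]
        abel
  have q2 : f * a * e * a' = f * (a * a') * ((1 - g') • e + g' • e') := by
    rw [mul_assoc, hek']; simp only [mul_assoc]
  have q3 : f' * a' * (a * e) = f' * (a' * a) * e := by simp only [mul_assoc]
  have q4 : f' * a' * e' * a = f' * (a' * a) * ((1 + g') • e' - g' • e) := by
    rw [mul_assoc, hek]; simp only [mul_assoc]
  rw [add_mul, add_mul, q1, q2, q3, q4] at h
  have q5 : ∀ x, (ρ * (1 + g)) • (f' * (a * a') * x) = (ρ' * (1 + g')) • (f' * (a' * a) * x) :=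
    fun x => by
      rw [← smul_mul_assoc, ← mul_smul_comm, hk, mul_smul_comm, smul_mul_assoc]
  have q6 : ρ • (a * (e * f' - f' * e) * a' + g • (d * a')) = ρ' • (g' • (d' * a)) := by
    have q5' := q5 ((1 - g') • e + g' • e')
    simp only [mul_add, mul_sub, mul_smul_comm] at h q5' ⊢
    linear_combination (norm := module) h - q5'
  obtain ⟨u, hu⟩ := D.k_unit 0
  obtain ⟨u', hu'⟩ := D'.k_unit 0
  change ↑u = a at hu
  change ↑u' = a' at hu'
  have hi : Ring.inverse a = ↑u⁻¹ := by rw [← hu, Ring.inverse_unit]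
  have hi' : Ring.inverse a' = ↑u'⁻¹ := by rw [← hu', Ring.inverse_unit]
  rw [hi, hi']
  have q7 : ρ • (a * (e * f' - f' * e) * a') =
      ρ • (a * (g' • (d' * ↑u'⁻¹) - g • (↑u⁻¹ * d)) * a') := by
    have t1 : a * (g' • (d' * ↑u'⁻¹)) * a' = g' • (a * d') := by
      rw [mul_smul_comm, smul_mul_assoc, ← hu', ← mul_assoc, Units.inv_mul_cancel_right]
    have t2 : a * (g • (↑u⁻¹ * d)) * a' = g • (d * a') := by
      rw [mul_smul_comm, smul_mul_assoc, ← hu, Units.mul_inv_cancel_left]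
    have t3 : a * (g' • (d' * ↑u'⁻¹) - g • (↑u⁻¹ * d)) * a' = g' • (a * d') - g • (d * a') := by
      rw [mul_sub, sub_mul, t1, t2]
    rw [t3, smul_sub, smul_comm ρ g', hkk, eq_sub_iff_add_eq, ← smul_add, q6,
      smul_comm]
  have q8 := p.left.smul_left_cancel.1 q7
  exact (D.k_unit 0).mul_left_cancel ((D'.k_unit 0).mul_right_cancel q8)

end RankTwo

/-! ### Relations in rank three -/

section RankThree

variable {D D' : Gauss 3 S}

/-- The relations of adjacent off-diagonal components. They follow from the relation between `L` and the
inverse of `L'`, in which the first row of `L` and the last column and row of the inverse are monomial in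
the Gaussian components. -/
theorem Pair.rank_three (p : Pair ρ g ρ' g' D D') :
    D.E 0 1 * D'.E 1 2 - D'.E 1 2 * D.E 0 1 = g' • (D.E 0 2 - D'.E 0 2 -
      (D.E 0 1 - D'.E 0 1) * D'.E 1 2) ∧ Commute (D.E 0 1) (D'.F 2 1) := by
  obtain ⟨hU1, hUl, -, -, hW1, hWu, -, -, h1, h2⟩ := D'.inv_spec
  obtain ⟨hU01, hU12, hU02⟩ := D'.U_three
  have hm : ∀ i, D.mat 0 i = D.k 0 * D.E 0 i := fun i => D.mat_zero i
  have hM : ∀ i, (D'.U * diagonal (fun i => Ring.inverse (D'.k i)) * D'.W) i 2 =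
      D'.U i 2 * Ring.inverse (D'.k 2) := fun i => by
    rw [mul_diagonal_mul_apply, Fin.sum_univ_three, hW1, hWu 0 2 (by decide), hWu 1 2 (by decide)]
    simp
  have hM' : (D'.U * diagonal (fun i => Ring.inverse (D'.k i)) * D'.W) 2 1 =
      -(Ring.inverse (D'.k 2) * D'.F 2 1) := by
    rw [mul_diagonal_mul_apply, Fin.sum_univ_three, hU1, hUl 2 0 (by decide), hUl 2 1 (by decide),
      D'.W_three]
    simp
  have r1 := p.rll.mixed_inv h2 h1 0 1 1 2
  have r2 := p.rll.mixed_inv h2 h1 0 1 2 2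
  have r3 := p.rll.mixed_inv h2 h1 0 0 2 2
  have r4 := p.rll.mixed_inv h2 h1 0 0 1 2
  have r5 := p.rll.mixed_inv h2 h1 0 1 2 1
  have r6 := p.rll.mixed_inv h2 h1 0 0 2 1
  rw [Matrix.mul_apply (M := D.mat), Fin.sum_univ_three] at r1
  rw [hM'] at r5 r6
  simp only [hM, hm, hU1, hU12, hU02, D.E_diag, mul_one, one_mul] at r1 r2 r3 r4 r5 r6
  simp only [Fin.isValue, Fin.reduceEq, if_false, if_true, add_zero] at r1 r2 r3 r4 r5 r6
  obtain ⟨q, hq⟩ := (D'.k_unit 2).ringInverse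
  rw [← hq] at r1 r2 r3 r4 r5 r6
  obtain ⟨k, hk⟩ := D.k_unit 0
  rw [← hk] at r1 r2 r3 r4 r5 r6
  set a := D.E 0 1
  set c := D.E 0 2
  set a' := D'.E 0 1
  set b' := D'.E 1 2
  set c' := D'.E 0 2
  set f' := D'.F 2 1
  have qa : (q : S) * a = a * q := by
    rw [← mul_assoc, ← smul_mul_assoc, r3, smul_mul_assoc] at r2
    have := p.right.smul_left_cancel.1 r2
    simpa [mul_assoc] using this
  have bk : b' * k = k * b' := by
    have t : ρ' • (b' * k * q) = ρ' • (k * b' * q) := by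
      rw [mul_assoc, ← mul_smul_comm, ← r3, mul_smul_comm, ← mul_assoc]
      simpa [mul_assoc] using r4
    exact q.isUnit.mul_right_cancel (p.right.smul_left_cancel.1 t)
  have qf : (q : S) * f' * a = a * (q * f') := by
    have t1 : ρ • (q * f' * k * a) = ρ' • (k * a * (q * f')) := by simpa [mul_assoc] using r5
    have t2 : ρ • (q * f' * k) = ρ' • (k * (q * f')) := by simpa [mul_assoc] using r6
    rw [← smul_mul_assoc, t2, smul_mul_assoc] at t1
    have := p.right.smul_left_cancel.1 t1
    rw [mul_assoc, mul_assoc (k : S)] at this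
    exact k.isUnit.mul_left_cancel this
  constructor
  · have t : ρ' • (k * (b' * a) * q) = ρ' • (k * (a * b' - g' • (a' * b' - c' - a * b' + c)) * q) := by
      calc ρ' • (k * (b' * a) * q) = ρ' • (b' * (k * q) * a) := by
            rw [← mul_assoc, ← bk, mul_assoc, ← qa]; simp only [mul_assoc]
        _ = ρ • (b' * q * (k * a)) := by
            rw [← smul_mul_assoc, ← mul_smul_comm, ← r3, mul_smul_comm, smul_mul_assoc]
            simp only [mul_assoc]
        _ = -(ρ • (-b' * q * (k * a))) := by simp
        _ = _ := by
            rw [r1, ← smul_neg]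
            congr 1
            simp only [mul_sub, mul_add, sub_mul, add_mul, mul_smul_comm, smul_mul_assoc, neg_mul,
              mul_neg, mul_assoc]
            module
    have t2 := k.isUnit.mul_left_cancel (q.isUnit.mul_right_cancel (p.right.smul_left_cancel.1 t))
    rw [t2, sub_mul, sub_sub_cancel]
    congr 1
    abel
  · rw [mul_assoc, ← mul_assoc a, ← qa, mul_assoc] at qf
    exact (q.isUnit.mul_left_cancel qf).symm

end RankThree

end PairRelations

section PairGeneral

open Matrix

variable {Z S : Type*} [CommRing Z] [Ring S] [Algebra Z S] {n : ℕ} {ρ g ρ' g' : Z}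
  {D D' : Gauss n S}

/-! ### Relations between components with distant indices -/

/-- If `x` commutes with the entries of a matrix up to a scalar, then also with those of its inverse. -/
theorem smul_commute_of_inv {m : ℕ} {M T : Matrix (Fin m) (Fin m) S} (h1 : T * M = 1)
    (h2 : M * T = 1) {σ σ' : Z} {x : S} (h : ∀ k l, σ • (M k l * x) = σ' • (x * M k l)) (k l : Fin m) :
    σ • (x * T k l) = σ' • (T k l * x) := by
  have hM : σ • (M * diagonal (fun _ => x)) = σ' • (diagonal (fun _ => x) * M) := by
    ext i j
    simpa [Matrix.diagonal_mul, Matrix.mul_diagonal] using h i j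
  have := congrArg (fun A => T * A * T) hM
  simp only [mul_smul_comm, smul_mul_assoc] at this
  rw [← Matrix.mul_assoc T M, h1, Matrix.one_mul, ← Matrix.mul_assoc T, Matrix.mul_assoc _ M, h2,
    Matrix.mul_one] at this
  simpa [Matrix.diagonal_mul, Matrix.mul_diagonal] using congrFun (congrFun this k) l

/-- Components with indices below `a` against components with indices at least `a`: the former come
from the leading block of `L`, the latter from a block of the inverse of `L'`. -/
theorem Pair.far (p : Pair ρ g ρ' g' D D') (a : ℕ) :
    (∀ i j k l : Fin n, i.val < a → j.val < a → a ≤ k.val → a ≤ l.val →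
      Commute (D.E i j) (D'.E k l) ∧ Commute (D.E i j) (D'.F k l) ∧ Commute (D.E i j) (D'.k k) ∧
      Commute (D.F i j) (D'.E k l) ∧ Commute (D.k i) (D'.E k l)) ∧
    ∀ i k : Fin n, i.val < a → a ≤ k.val → ρ • (D.k i * D'.k k) = ρ' • (D'.k k * D.k i) := by
  rcases le_or_gt n a with hna | hna
  · exact ⟨fun i j k l _ _ h _ => absurd k.isLt (by omega), fun i k _ h => absurd k.isLt (by omega)⟩
  have hlow : ∀ i j, j ≤ seg 0 a n (by omega) i → j ∈ Set.range (seg 0 a n (by omega)) :=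
    fun i j hj => ⟨⟨j.val, by have : j.val ≤ 0 + i.val := hj; omega⟩, by simp [seg]⟩
  have hup : ∀ i j, seg a (n - a) n (by omega) i ≤ j → j ∈ Set.range (seg a (n - a) n (by omega)) :=
    fun i j hj => ⟨⟨j.val - a, by omega⟩, by
      have : a + i.val ≤ j.val := hj
      ext
      simp only [seg]
      omega⟩
  obtain ⟨M, m1, m2, m3, m4⟩ := D'.exists_inv_block _ (seg_strictMono a (n - a) n (by omega)) hup
  set T := D'.block _ (seg_strictMono a (n - a) n (by omega))
  set A := D.block _ (seg_strictMono 0 a n (by omega))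
  have hA : A.mat = D.mat.submatrix _ _ := D.block_mat _ _ hlow
  set u := seg 0 a n (by omega)
  set v := seg a (n - a) n (by omega)
  have huv : ∀ i k, u i ≠ v k := fun i k h => by
    have : 0 + i.val = a + k.val := congrArg Fin.val h
    omega
  have hd : ∀ k l, (∀ i j, Commute (M (v k) (v l)) (A.F i j)) ∧
      (∀ i j, Commute (M (v k) (v l)) (A.E i j)) ∧
      ∀ i, ρ • (M (v k) (v l) * A.k i) = ρ' • (A.k i * M (v k) (v l)) := fun k l => by
    refine A.commute_of_mat p.left p.right fun i j => ?_
    have := p.rll.mixed_inv m2 m1 (u i) (u j) (v k) (v l)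
    rw [if_neg (huv i l), if_neg (huv j k).symm, add_zero, add_zero] at this
    rw [hA]
    exact this
  have hx : ∀ x : S, (∀ k l, Commute (M (v k) (v l)) x) →
      (∀ i j, Commute x (T.F i j)) ∧ (∀ i j, Commute x (T.E i j)) ∧ ∀ i, Commute x (T.k i) :=
    fun x h => by
      obtain ⟨h1, h2, h3⟩ := T.commute_of_mat (Z := Z) (ρ := 1) (ρ' := 1) (d := x) isUnit_one
        isUnit_one (smul_commute_of_inv (Z := Z) (σ := 1) (σ' := 1) m3 m4 fun k l => by
          rw [one_smul, one_smul]
          exact h k l)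
      exact ⟨h1, h2, fun i => show _ = _ by simpa using h3 i⟩
  have hu : ∀ i : Fin n, i.val < a → ∃ i', u i' = i := fun i hi => ⟨⟨i.val, hi⟩, by simp [u, seg]⟩
  have hv : ∀ i : Fin n, a ≤ i.val → ∃ i', v i' = i := fun i hi => ⟨⟨i.val - a, by omega⟩, by
    ext
    simp only [v, seg]
    omega⟩
  have hk : ∀ i, (∀ k l, Commute (A.k i) (T.F k l)) ∧ (∀ k l, Commute (A.k i) (T.E k l)) ∧
      ∀ k, ρ • (A.k i * T.k k) = ρ' • (T.k k * A.k i) := fun i =>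
    T.commute_of_mat p.left p.right (smul_commute_of_inv m3 m4 fun k l => (hd k l).2.2 i)
  constructor
  · intro i j k l hi hj hk' hl
    obtain ⟨i, rfl⟩ := hu i hi
    obtain ⟨j, rfl⟩ := hu j hj
    obtain ⟨k, rfl⟩ := hv k hk'
    obtain ⟨l, rfl⟩ := hv l hl
    have hE := hx (A.E i j) fun k l => (hd k l).2.1 i j
    have hF := hx (A.F i j) fun k l => (hd k l).1 i j
    exact ⟨hE.2.1 k l, hE.1 k l, hE.2.2 k, hF.2.1 k l, (hk i).2.1 k l⟩
  · intro i k hi hk'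
    obtain ⟨i, rfl⟩ := hu i hi
    obtain ⟨k, rfl⟩ := hv k hk'
    exact (hk i).2.2 k

/-! ### Relations for arbitrary indices -/

theorem Pair.k_k_of_lt (p : Pair ρ g ρ' g' D D') {i j : Fin n} (h : i < j) :
    ρ • (D.k i * D'.k j) = ρ' • (D'.k j * D.k i) := (p.far j.val).2 i j h le_rfl

theorem Pair.k_k_self (p : Pair ρ g ρ' g' D D') (i : Fin n) :
    (ρ * (1 + g)) • (D.k i * D'.k i) = (ρ' * (1 + g')) • (D'.k i * D.k i) :=
  (p.block (m := 0 + 1) i.val (by omega)).k_zero_k_zero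

variable {i j l : Fin n}

theorem seg_zero (i : Fin n) (m : ℕ) (h : i.val + (m + 1) ≤ n) : seg i.val (m + 1) n h 0 = i := rfl

theorem seg_one {m : ℕ} (h : j.val = i.val + 1) (h' : i.val + (m + 2) ≤ n) :
    seg i.val (m + 2) n h' 1 = j := Fin.ext (by simp [seg, h])

theorem seg_two {m : ℕ} (h : l.val = i.val + 2) (h' : i.val + (m + 3) ≤ n) :
    seg i.val (m + 3) n h' 2 = l := Fin.ext h.symm

theorem Pair.e_k_left (p : Pair ρ g ρ' g' D D') (h : j.val = i.val + 1) :
    D'.E i j * D.k i = D.k i * ((1 + g') • D'.E i j - g' • D.E i j) := by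
  have := (p.block (m := 2) i.val (by omega)).e_k_zero 1
  simpa only [Gauss.block, Matrix.submatrix_apply, Function.comp_apply, seg_zero, seg_one h] using this

theorem Pair.e_k_right (p : Pair ρ g ρ' g' D D') (h : j.val = i.val + 1) :
    D'.E i j * D.k j = D.k j * ((1 - g') • D'.E i j + g' • D.E i j) := by
  have := (p.block (m := 2) i.val (by omega)).e_k_one
  simpa only [Gauss.block, Matrix.submatrix_apply, Function.comp_apply, seg_zero, seg_one h] using this

theorem Pair.e_k_far (p : Pair ρ g ρ' g' D D') (h : j.val = i.val + 1) (h1 : l ≠ i) (h2 : l ≠ j) :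
    D'.E i j * D.k l = D.k l * D'.E i j := by
  rcases lt_or_ge l.val i.val with hl | hl
  · exact ((p.far i.val).1 l l i j hl hl le_rfl (by omega)).2.2.2.2.symm
  · exact ((p.swap.far l.val).1 i j l l (by omega) (by omega) le_rfl le_rfl).2.2.1

theorem Pair.e_e_self (p : Pair ρ g ρ' g' D D') (h : j.val = i.val + 1) :
    D.E i j * D'.E i j - D'.E i j * D.E i j =
      -(g' • ((D.E i j - D'.E i j) * (D.E i j - D'.E i j))) := by
  have := (p.block (m := 2) i.val (by omega)).e_e_zero_self 1
  simpa only [Gauss.block, Matrix.submatrix_apply, Function.comp_apply, seg_zero, seg_one h] using this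

theorem Pair.e_e_far (p : Pair ρ g ρ' g' D D') {i' j' : Fin n} (h : j.val = i.val + 1)
    (h' : j'.val = i'.val + 1) (hij : i.val + 1 < i'.val ∨ i'.val + 1 < i.val) :
    Commute (D.E i j) (D'.E i' j') := by
  rcases hij with hij | hij
  · exact ((p.far i'.val).1 i j i' j' (by omega) (by omega) le_rfl (by omega)).1
  · exact ((p.swap.far i.val).1 i' j' i j (by omega) (by omega) le_rfl (by omega)).1.symm

theorem Pair.e_e_succ (p : Pair ρ g ρ' g' D D') (h : j.val = i.val + 1) (h' : l.val = i.val + 2) :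
    D.E i j * D'.E j l - D'.E j l * D.E i j =
      g' • (D.E i l - D'.E i l - (D.E i j - D'.E i j) * D'.E j l) := by
  have := (p.block (m := 3) i.val (by omega)).rank_three.1
  simpa only [Gauss.block, Matrix.submatrix_apply, Function.comp_apply, seg_zero, seg_one h,
    seg_two h'] using this

theorem Pair.e_e_row (p : Pair ρ g ρ' g' D D') (h : j.val = i.val + 1) (h' : l.val = i.val + 2) :
    (1 + g') • (D.E i j * D'.E i l - D'.E i l * D.E i j +
        g' • ((D.E i j - D'.E i j) * (D.E i l - D'.E i l))) =
      g' • (D.E i j * D.E i l - D.E i l * D.E i j) := by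
  have := (p.block (m := 3) i.val (by omega)).e_e_zero_of_ne 1 2
  simpa only [Gauss.block, Matrix.submatrix_apply, Function.comp_apply, seg_zero, seg_one h,
    seg_two h'] using this

/-- The last column of `E⁻¹` above the diagonal, up to sign. -/
def Gauss.Y (D : Gauss n S) (i j l : Fin n) : S := D.E i j * D.E j l - D.E i l

theorem Pair.e_e_column (p : Pair ρ g ρ' g' D D') (h : j.val = i.val + 1) (h' : l.val = i.val + 2) :
    (1 - g') • (D.E j l * D'.Y i j l - D'.Y i j l * D.E j l +
        g' • ((D.Y i j l - D'.Y i j l) * (D.E j l - D'.E j l))) =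
      -(g' • (D.E j l * D.Y i j l - D.Y i j l * D.E j l)) := by
  have := congrArg MulOpposite.unop
    ((p.block (m := 3) i.val (by omega)).dual.e_e_zero_of_ne 1 2)
  simp only [Gauss.dual, MulOpposite.unop_mul, MulOpposite.unop_sub, MulOpposite.unop_smul,
    MulOpposite.unop_op, MulOpposite.unop_add] at this
  rw [show (Fin.rev 1 : Fin 3) = 1 from rfl, show (Fin.rev 0 : Fin 3) = 2 from rfl,
    show (Fin.rev 2 : Fin 3) = 0 from rfl, (Gauss.U_three _).2.1, (Gauss.U_three _).2.1,
    (Gauss.U_three _).2.2, (Gauss.U_three _).2.2] at this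
  simp only [Gauss.block, Matrix.submatrix_apply, seg_zero, seg_one h, seg_two h'] at this
  change (1 + -g') • (D'.Y i j l * -D.E j l - -D.E j l * D'.Y i j l +
    -g' • ((D.Y i j l - D'.Y i j l) * (-D.E j l - -D'.E j l))) =
      -g' • (D.Y i j l * -D.E j l - -D.E j l * D.Y i j l) at this
  simp only [mul_neg, neg_mul, neg_smul, sub_neg_eq_add, neg_add_eq_sub, mul_sub] at this ⊢
  linear_combination (norm := module) this

theorem Pair.e_f_self (p : Pair ρ g ρ' g' D D') (h : j.val = i.val + 1) :
    D.E i j * D'.F j i - D'.F j i * D.E i j =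
      g' • (D'.k j * Ring.inverse (D'.k i)) - g • (Ring.inverse (D.k i) * D.k j) := by
  have := (p.block (m := 2) i.val (by omega)).e_f
  simpa only [Gauss.block, Matrix.submatrix_apply, Function.comp_apply, seg_zero, seg_one h] using this

/-- Components of `E` and `F` with different indices commute: by `Pair.far` for distant indices, and by
`Pair.rank_three` for adjacent ones, in the opposite ring if the index of `F` is the smaller one. -/
theorem Pair.e_f_of_ne (p : Pair ρ g ρ' g' D D') {i' j' : Fin n} (h : j.val = i.val + 1)
    (h' : j'.val = i'.val + 1) (hij : i ≠ i') : Commute (D.E i j) (D'.F j' i') := by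
  rcases lt_trichotomy i'.val (i.val + 1) with hij' | hij' | hij'
  · rcases lt_trichotomy i.val (i'.val + 1) with hi | hi | hi
    · omega
    · have hji : j' = i := Fin.ext (by omega)
      subst hji
      have := (p.swap.op.block (m := 3) i'.val (by omega)).rank_three.2
      simp only [Gauss.block, Matrix.submatrix_apply, seg_zero, seg_one h',
        seg_two (l := j) (i := i') (by omega)] at this
      have := congrArg MulOpposite.unop this.eq
      show _ = _
      simpa [Gauss.op] using this
    · exact ((p.swap.far i.val).1 j' i' i j (by omega) (by omega) le_rfl (by omega)).2.2.2.1 |>.symm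
  · have hji : j = i' := Fin.ext (by omega)
    subst hji
    have := (p.block (m := 3) i.val (by omega)).rank_three.2
    simpa only [Gauss.block, Matrix.submatrix_apply, seg_zero, seg_one h,
        seg_two (l := j') (i := i) (by omega)] using this
  · exact ((p.far i'.val).1 i j j' i' (by omega) (by omega) (by omega) le_rfl).2.1

end PairGeneral

/-! ### Formal series in two variables -/

section Series

variable {R : Type*} [Ring R]

theorem ser_plus_neg (φ : PowerSeries R) (m : ℕ) : ser .plus φ (-m) = PowerSeries.coeff m φ := by
  simp [ser]

theorem ser_minus_nat (φ : PowerSeries R) (m : ℕ) : ser .minus φ m = PowerSeries.coeff m φ := by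
  simp [ser]

theorem ser_plus_pos (φ : PowerSeries R) {m : ℤ} (h : 0 < m) : ser .plus φ m = 0 :=
  if_neg (not_le.2 h)

theorem ser_minus_neg (φ : PowerSeries R) {m : ℤ} (h : m < 0) : ser .minus φ m = 0 :=
  if_neg (not_le.2 h)

/-- The family of coefficients, as an additive map. -/
def serHom (R : Type*) [Ring R] (ε : Sgn) (m : ℤ) : PowerSeries R →+ R where
  toFun φ := ser ε φ m
  map_zero' := by cases ε <;> simp [ser]
  map_add' φ ψ := by
    cases ε <;> simp only [ser] <;> split_ifs <;> simp

theorem ser_add (ε : Sgn) (φ ψ : PowerSeries R) (m : ℤ) :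
    ser ε (φ + ψ) m = ser ε φ m + ser ε ψ m := (serHom R ε m).map_add φ ψ

theorem ser_sub (ε : Sgn) (φ ψ : PowerSeries R) (m : ℤ) :
    ser ε (φ - ψ) m = ser ε φ m - ser ε ψ m := (serHom R ε m).map_sub φ ψ

theorem ser_zero (ε : Sgn) (m : ℤ) : ser ε (0 : PowerSeries R) m = 0 := (serHom R ε m).map_zero

theorem ser_C_mul (ε : Sgn) (x : R) (φ : PowerSeries R) (m : ℤ) :
    ser ε (PowerSeries.C x * φ) m = x * ser ε φ m := by
  cases ε <;> simp only [ser] <;> split_ifs <;> simp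

theorem ser_mul_C (ε : Sgn) (x : R) (φ : PowerSeries R) (m : ℤ) :
    ser ε (φ * PowerSeries.C x) m = ser ε φ m * x := by
  cases ε <;> simp only [ser] <;> split_ifs <;> simp

theorem ser_map {R' : Type*} [Ring R'] (f : R →+* R') (ε : Sgn) (φ : PowerSeries R) (m : ℤ) :
    ser ε (PowerSeries.map f φ) m = f (ser ε φ m) := by
  cases ε <;> simp only [ser] <;> split_ifs <;> simp

theorem ser_injective (ε : Sgn) {φ ψ : PowerSeries R} (h : ∀ m, ser ε φ m = ser ε ψ m) : φ = ψ := by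
  ext m
  cases ε
  · simpa [ser_plus_neg] using h (-m)
  · simpa [ser_minus_nat] using h m

theorem ser_C (ε : Sgn) (x : R) (m : ℤ) : ser ε (PowerSeries.C x) m = if m = 0 then x else 0 := by
  cases ε <;> simp only [ser, PowerSeries.coeff_C] <;> grind

/-- `1` for the variable `u⁻¹` and `0` for the variable `u`: the exponent `d` for which `u ^ (-d)` and
`u ^ (1-d)` both are nonnegative powers of the variable. -/
def Sgn.deg : Sgn → ℤ
  | .plus => 1
  | .minus => 0

/-- The exponents of the powers of `u` that do not occur in a series of the given sign. -/
def Sgn.Outside : Sgn → ℤ → Prop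
  | .plus, a => 0 < a
  | .minus, a => a < 0

theorem ser_outside (ε : Sgn) (φ : PowerSeries R) {a : ℤ} (h : ε.Outside a) : ser ε φ a = 0 := by
  cases ε
  · exact ser_plus_pos _ h
  · exact ser_minus_neg _ h

/-- `u ^ (-d)` as a power series in the variable. -/
def kap (R : Type*) [Ring R] : Sgn → PowerSeries R
  | .plus => PowerSeries.X
  | .minus => 1

/-- `u ^ (1-d)` as a power series in the variable. -/
def lam (R : Type*) [Ring R] : Sgn → PowerSeries R
  | .plus => 1
  | .minus => PowerSeries.X

theorem ser_plus_X_mul (φ : PowerSeries R) (m : ℤ) :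
    ser .plus (PowerSeries.X * φ) m = ser .plus φ (m + 1) := by
  rcases lt_or_ge 0 m with h | h
  · rw [ser_plus_pos _ h, ser_plus_pos _ (by omega)]
  · obtain ⟨k, rfl⟩ : ∃ k : ℕ, m = -k := ⟨m.natAbs, by omega⟩
    rw [ser_plus_neg]
    cases k with
    | zero => rw [ser_plus_pos _ (by simp)]; simp
    | succ k =>
      rw [show (-((k + 1 : ℕ) : ℤ) + 1) = -(k : ℤ) by push_cast; ring, ser_plus_neg,
        PowerSeries.coeff_succ_X_mul]

theorem ser_minus_X_mul (φ : PowerSeries R) (m : ℤ) :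
    ser .minus (PowerSeries.X * φ) m = ser .minus φ (m - 1) := by
  rcases lt_or_ge m 0 with h | h
  · rw [ser_minus_neg _ h, ser_minus_neg _ (by omega)]
  · obtain ⟨k, rfl⟩ : ∃ k : ℕ, m = k := ⟨m.natAbs, by omega⟩
    rw [ser_minus_nat]
    cases k with
    | zero => rw [ser_minus_neg _ (by simp)]; simp
    | succ k =>
      rw [show (((k + 1 : ℕ) : ℤ) - 1) = (k : ℤ) by push_cast; ring, ser_minus_nat,
        PowerSeries.coeff_succ_X_mul]

theorem ser_kap_mul (ε : Sgn) (φ : PowerSeries R) (m : ℤ) :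
    ser ε (kap R ε * φ) m = ser ε φ (m + ε.deg) := by
  cases ε
  · exact ser_plus_X_mul φ m
  · simp [kap, Sgn.deg]

theorem ser_lam_mul (ε : Sgn) (φ : PowerSeries R) (m : ℤ) :
    ser ε (lam R ε * φ) m = ser ε φ (m + ε.deg - 1) := by
  cases ε
  · simp [lam, Sgn.deg]
  · simpa [Sgn.deg, lam] using ser_minus_X_mul φ m

theorem kap_commute (ε : Sgn) (φ : PowerSeries R) : Commute (kap R ε) φ := by
  cases ε
  · exact (PowerSeries.commute_X φ).symm
  · exact Commute.one_left φ

theorem lam_commute (ε : Sgn) (φ : PowerSeries R) : Commute (lam R ε) φ := by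
  cases ε
  · exact Commute.one_left φ
  · exact (PowerSeries.commute_X φ).symm

end Series

section TwoVariables

variable (B : Type*) [Ring B]

/-- Power series over `B` in two variables, which stand for `u^∓1` and `v^∓1`. -/
abbrev Two : Type _ := PowerSeries (PowerSeries B)

variable {B}

/-- A series in the first variable. -/
def fst : PowerSeries B →+* Two B := PowerSeries.map PowerSeries.C

/-- A series in the second variable. -/
def snd : PowerSeries B →+* Two B := PowerSeries.C

/-- The coefficient of `u ^ a * v ^ b`. -/
def fn (ε ε' : Sgn) (G : Two B) (a b : ℤ) : B := ser ε' (ser ε G a) b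

variable (ε ε' : Sgn)

theorem fn_sub (G H : Two B) (a b : ℤ) : fn ε ε' (G - H) a b = fn ε ε' G a b - fn ε ε' H a b := by
  simp [fn, ser_sub]

theorem fn_zero (a b : ℤ) : fn ε ε' (0 : Two B) a b = 0 := by
  simp [fn, ser_zero]

theorem fn_injective {G H : Two B} (h : fn ε ε' G = fn ε ε' H) : G = H :=
  ser_injective ε fun a => ser_injective ε' fun b => congrFun (congrFun h a) b

theorem fn_fst_mul_snd (φ φ' : PowerSeries B) (a b : ℤ) :
    fn ε ε' (fst φ * snd φ') a b = ser ε φ a * ser ε' φ' b := by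
  rw [fn, snd, ser_mul_C, fst, ser_map, ser_C_mul]

theorem fn_snd_mul_fst (φ φ' : PowerSeries B) (a b : ℤ) :
    fn ε ε' (snd φ' * fst φ) a b = ser ε' φ' b * ser ε φ a := by
  rw [fn, snd, ser_C_mul, fst, ser_map, ser_mul_C]

theorem fn_fst (φ : PowerSeries B) (a b : ℤ) :
    fn ε ε' (fst φ) a b = if b = 0 then ser ε φ a else 0 := by
  rw [fn, fst, ser_map, ser_C]

theorem fn_snd (φ : PowerSeries B) (a b : ℤ) :
    fn ε ε' (snd φ) a b = if a = 0 then ser ε' φ b else 0 := by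
  rw [fn, snd, ser_C]
  split_ifs
  · rfl
  · exact ser_zero _ _

theorem ser_fst_mul_snd_mul_fst (φ φ' ψ : PowerSeries B) (a b : ℤ) :
    fn ε ε' (fst φ * snd ψ * fst φ') a b = ser ε (φ * PowerSeries.C (ser ε' ψ b) * φ') a := by
  have h : ∀ m, PowerSeries.coeff m (fst φ * snd ψ * fst φ') =
      ∑ p ∈ Finset.HasAntidiagonal.antidiagonal m, PowerSeries.C (PowerSeries.coeff p.1 φ) * ψ *
        PowerSeries.C (PowerSeries.coeff p.2 φ') := fun m => by
    rw [PowerSeries.coeff_mul]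
    refine Finset.sum_congr rfl fun p _ => ?_
    rw [snd, PowerSeries.coeff_mul_C, fst, PowerSeries.coeff_map, PowerSeries.coeff_map]
  have h2 : ∀ m, ser ε' (PowerSeries.coeff m (fst φ * snd ψ * fst φ')) b =
      PowerSeries.coeff m (φ * PowerSeries.C (ser ε' ψ b) * φ') := fun m => by
    rw [h, PowerSeries.coeff_mul]
    change serHom B ε' b _ = _
    rw [map_sum]
    refine Finset.sum_congr rfl fun p _ => ?_
    change ser ε' _ b = _
    rw [ser_mul_C, ser_C_mul, PowerSeries.coeff_mul_C]
  rw [fn]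
  cases ε
  · rw [ser, ser]
    split_ifs
    · exact h2 _
    · exact ser_zero _ _
  · rw [ser, ser]
    split_ifs
    · exact h2 _
    · exact ser_zero _ _

/-- `κ = u ^ (-d) * v ^ (-d')`. -/
def kk : Two B := fst (kap B ε) * snd (kap B ε')

/-- `κ * (u - v - t)`. -/
def del (t : B) : Two B :=
  fst (lam B ε) * snd (kap B ε') - fst (kap B ε) * snd (lam B ε') -
    PowerSeries.C (PowerSeries.C t) * kk ε ε'

theorem fst_kap : fst (kap B ε) = kap (PowerSeries B) ε := by
  cases ε <;> simp [fst, kap]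

theorem fst_lam : fst (lam B ε) = lam (PowerSeries B) ε := by
  cases ε <;> simp [fst, lam]

theorem snd_kap_commute (G : Two B) : Commute (snd (kap B ε')) G := by
  ext1 m
  rw [snd, PowerSeries.coeff_C_mul, PowerSeries.coeff_mul_C]
  exact kap_commute ε' _

theorem snd_lam_commute (G : Two B) : Commute (snd (lam B ε')) G := by
  ext1 m
  rw [snd, PowerSeries.coeff_C_mul, PowerSeries.coeff_mul_C]
  exact lam_commute ε' _

theorem fst_kap_commute (G : Two B) : Commute (fst (kap B ε)) G := by
  rw [fst_kap]; exact kap_commute ε G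

theorem fst_lam_commute (G : Two B) : Commute (fst (lam B ε)) G := by
  rw [fst_lam]; exact lam_commute ε G

theorem kk_commute (G : Two B) : Commute (kk ε ε') G :=
  (fst_kap_commute ε G).mul_left (snd_kap_commute ε' G)

theorem CC_commute {t : B} (ht : t ∈ Subring.center B) (G : Two B) :
    Commute (PowerSeries.C (PowerSeries.C t)) G := by
  ext m r
  simp only [PowerSeries.coeff_C_mul, PowerSeries.coeff_mul_C]
  exact (Subring.mem_center_iff.1 ht _).symm

theorem del_commute {t : B} (ht : t ∈ Subring.center B) (G : Two B) : Commute (del ε ε' t) G :=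
  (((fst_lam_commute ε G).mul_left (snd_kap_commute ε' G)).sub_left
    ((fst_kap_commute ε G).mul_left (snd_lam_commute ε' G))).sub_left
    ((CC_commute ht G).mul_left (kk_commute ε ε' G))

theorem fn_CC_mul (t : B) (G : Two B) (a b : ℤ) :
    fn ε ε' (PowerSeries.C (PowerSeries.C t) * G) a b = t * fn ε ε' G a b := by
  rw [fn, ser_C_mul, ser_C_mul, fn]

theorem fn_kap_lam (G : Two B) (a b : ℤ) :
    fn ε ε' (fst (kap B ε) * G) a b = fn ε ε' G (a + ε.deg) b ∧
    fn ε ε' (fst (lam B ε) * G) a b = fn ε ε' G (a + ε.deg - 1) b ∧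
    fn ε ε' (snd (kap B ε') * G) a b = fn ε ε' G a (b + ε'.deg) ∧
    fn ε ε' (snd (lam B ε') * G) a b = fn ε ε' G a (b + ε'.deg - 1) := by
  refine ⟨?_, ?_, ?_, ?_⟩
  · rw [fn, fst_kap, ser_kap_mul, fn]
  · rw [fn, fst_lam, ser_lam_mul, fn]
  · rw [fn, snd, ser_C_mul, ser_kap_mul, fn]
  · rw [fn, snd, ser_C_mul, ser_lam_mul, fn]

theorem fn_kk_mul (G : Two B) (a b : ℤ) :
    fn ε ε' (kk ε ε' * G) a b = fn ε ε' G (a + ε.deg) (b + ε'.deg) := by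
  rw [kk, mul_assoc, (fn_kap_lam ε ε' _ _ _).1, (fn_kap_lam ε ε' _ _ _).2.2.1]

theorem fn_del_mul (t : B) (G : Two B) (a b : ℤ) :
    fn ε ε' (del ε ε' t * G) a b = mulLin t (fn ε ε' G) (a + ε.deg) (b + ε'.deg) := by
  rw [del, sub_mul, sub_mul, fn_sub, fn_sub, mul_assoc _ _ G, mul_assoc _ _ G, mul_assoc _ _ G,
    (fn_kap_lam ε ε' _ _ _).1, (fn_kap_lam ε ε' _ _ _).2.1, (fn_kap_lam ε ε' _ _ _).2.2.1,
    (fn_kap_lam ε ε' _ _ _).2.2.2, fn_CC_mul, fn_kk_mul, mulLin]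

/-- A series with powers of `u` only of the sign `ε` is determined by its product with
`u - v - t`. -/
theorem eq_zero_of_mulLin {t : B} (ht : IsNilpotent t) {F : ℤ → ℤ → B}
    (hF : ∀ a b, ε.Outside a → F a b = 0)
    (h : ∀ a b, mulLin t F a b = 0) : F = 0 := by
  cases ε with
  | plus =>
    have key : ∀ k : ℕ, ∀ a b : ℤ, 1 - (k : ℤ) ≤ a → F a b = 0 := by
      intro k
      induction k with
      | zero => intro a b hab; exact hF a b (show 0 < a by push_cast at hab; omega)
      | succ k ih =>
        intro a b hab
        have h1 := h (a + 1) b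
        rw [mulLin, add_sub_cancel_right, ih (a + 1) (b - 1) (by push_cast at hab; omega),
          ih (a + 1) b (by push_cast at hab; omega)] at h1
        simpa using h1
    ext a b
    exact key (1 - a).toNat a b (by omega)
  | minus =>
    obtain ⟨N, hN⟩ := ht
    have key : ∀ k : ℕ, ∀ a b : ℤ, a < k → F a b = 0 := by
      intro k
      induction k with
      | zero => intro a b hab; exact hF a b (show a < 0 by simpa using hab)
      | succ k ih =>
        intro a b hab
        rcases lt_or_ge a k with hak | hak
        · exact ih a b hak
        have hstep : ∀ b, F a b = -t * F a (b + 1) := fun b => by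
          have h1 := h a (b + 1)
          rw [mulLin, add_sub_cancel_right, ih (a - 1) (b + 1) (by push_cast at hab; omega)] at h1
          rw [zero_sub, sub_eq_zero] at h1
          rw [neg_mul, ← h1, neg_neg]
        have hpow : ∀ r : ℕ, ∀ b, F a b = (-t) ^ r * F a (b + r) := by
          intro r
          induction r with
          | zero => intro b; simp
          | succ r ihr =>
            intro b
            rw [ihr, hstep (b + r), ← mul_assoc, ← pow_succ]
            push_cast
            rw [add_assoc]
        rw [hpow N b, neg_pow, hN, mul_zero, zero_mul]
    ext a b
    exact key (a + 1).toNat a b (by omega)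

theorem fn_side (G : Two B) {a : ℤ} (b : ℤ) (h : ε.Outside a) : fn ε ε' G a b = 0 := by
  rw [fn, ser_outside _ _ h, ser_zero]

theorem fn_side_right (G : Two B) (a : ℤ) {b : ℤ} (h : ε'.Outside b) : fn ε ε' G a b = 0 :=
  ser_outside _ _ h

theorem del_regular {t : B} (ht : IsNilpotent t) {G : Two B} (h : del ε ε' t * G = 0) : G = 0 := by
  apply fn_injective ε ε'
  have h0 : fn ε ε' (0 : Two B) = 0 := by ext a b; exact fn_zero ε ε' a b
  rw [h0]
  refine eq_zero_of_mulLin ε ht (fun _ => fn_side ε ε' G) fun a b => ?_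
  have := fn_del_mul ε ε' t G (a - ε.deg) (b - ε'.deg)
  rw [h, fn_zero, sub_add_cancel, sub_add_cancel] at this
  exact this.symm

end TwoVariables

/-! ### Inverting central regular elements -/

/-- Central regular elements of a ring become invertible in some overring. -/
theorem exists_localization (T : Type u) [Ring T] : ∃ (S : Type u) (_ : Ring S) (f : T →+* S),
    Function.Injective f ∧ (∀ x ∈ Subring.center T, f x ∈ Subring.center S) ∧
    ∀ x ∈ Subring.center T, (∀ y, x * y = 0 → y = 0) → IsUnit (f x) := by
  let M : Submonoid (Subring.center T) :=
    { carrier := {x | ∀ y : T, (x : T) * y = 0 → y = 0}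
      mul_mem' := fun {a b} ha hb y h => hb y (ha _ (by rw [← mul_assoc]; exact h))
      one_mem' := fun y h => by simpa using h }
  refine ⟨LocalizedModule M T, inferInstance, LocalizedModule.numeratorRingHom, ?_, ?_, ?_⟩
  · intro x y hxy
    change LocalizedModule.mk x 1 = LocalizedModule.mk y 1 at hxy
    rw [LocalizedModule.mk_eq] at hxy
    obtain ⟨u, hu⟩ := hxy
    rw [one_smul, one_smul, ← sub_eq_zero, ← smul_sub] at hu
    exact sub_eq_zero.1 (u.2 _ hu)
  · intro x hx
    rw [Subring.mem_center_iff]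
    intro y
    induction y using LocalizedModule.induction_on with
    | h m s =>
      change LocalizedModule.mk m s * LocalizedModule.mk x 1 =
        LocalizedModule.mk x 1 * LocalizedModule.mk m s
      rw [LocalizedModule.mk_mul_mk, LocalizedModule.mk_mul_mk, mul_one, one_mul,
        Subring.mem_center_iff.1 hx m]
  · intro x hx hreg
    have e : (⟨⟨x, hx⟩, hreg⟩ : M) • (1 : T) = x := by
      change (⟨x, hx⟩ : Subring.center T) • (1 : T) = x
      rw [Subring.smul_def, smul_eq_mul, mul_one]
    have e' : LocalizedModule.mk x (⟨⟨x, hx⟩, hreg⟩ : M) = (1 : LocalizedModule M T) :=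
      (congrArg (LocalizedModule.mk · _) e.symm).trans
        ((LocalizedModule.mk_cancel (⟨⟨x, hx⟩, hreg⟩ : M) (1 : T)).trans
          OreLocalization.one_def.symm)
    have h1 : LocalizedModule.mk x 1 * LocalizedModule.mk 1 (⟨⟨x, hx⟩, hreg⟩ : M) =
        (1 : LocalizedModule M T) := by
      rw [LocalizedModule.mk_mul_mk, mul_one, one_mul, e']
    have h2 : LocalizedModule.mk 1 (⟨⟨x, hx⟩, hreg⟩ : M) * LocalizedModule.mk x 1 =
        (1 : LocalizedModule M T) := by
      rw [LocalizedModule.mk_mul_mk, one_mul, mul_one, e']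
    exact ⟨⟨_, _, h1, h2⟩, rfl⟩

/-! ### From RLL relations of formal series to factorized pairs -/

section ExistsPair

variable {B : Type*} [Ring B]

theorem mulLin_translate (t : B) (F : ℤ → ℤ → B) (d d' a b : ℤ) :
    mulLin t (fun a b => F (a + d) (b + d')) a b = mulLin t F (a + d) (b + d') := by
  simp only [mulLin, sub_add_eq_add_sub]

/-- `R(u-v-t) A₁(u) A'₂(v) = A'₂(v) A₁(u) R(u-v+t)`, multiplied by `(u-v-t)(u-v+t)`. -/
def SeriesRLL {n : ℕ} (h t : B) (ε ε' : Sgn) (A A' : Matrix (Fin n) (Fin n) (PowerSeries B)) :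
    Prop :=
  ∀ i j k l a b, mulLin (-t) (mulLin t (fun a b => ser ε (A i j) a * ser ε' (A' k l) b -
      ser ε' (A' k l) b * ser ε (A i j) a)) a b =
    h * (mulLin t (fun a b => ser ε' (A' k j) b * ser ε (A i l) a) a b -
      mulLin (-t) (fun a b => ser ε (A k j) a * ser ε' (A' i l) b) a b)

variable {n : ℕ} {h t : B} {ε ε' : Sgn} {A A' : Matrix (Fin n) (Fin n) (PowerSeries B)}

/-- `h κ`. -/
def eta (h : B) (ε ε' : Sgn) : Two B := PowerSeries.C (PowerSeries.C h) * kk ε ε'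

theorem eta_commute {h : B} (hh : h ∈ Subring.center B) (G : Two B) : Commute (eta h ε ε') G :=
  (CC_commute hh G).mul_left (kk_commute ε ε' G)

theorem fn_eta_mul (h : B) (G : Two B) (a b : ℤ) :
    fn ε ε' (eta h ε ε' * G) a b = h * fn ε ε' G (a + ε.deg) (b + ε'.deg) := by
  rw [eta, mul_assoc, fn_CC_mul, fn_kk_mul]

theorem SeriesRLL.two (H : SeriesRLL h t ε ε' A A') (i j k l : Fin n) :
    del ε ε' (-t) * (del ε ε' t * (fst (A i j) * snd (A' k l) - snd (A' k l) * fst (A i j))) =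
      eta h ε ε' * (del ε ε' t * (snd (A' k j) * fst (A i l)) -
        del ε ε' (-t) * (fst (A k j) * snd (A' i l))) := by
  apply fn_injective ε ε'
  ext a b
  have e1 : fn ε ε' (del ε ε' t * (fst (A i j) * snd (A' k l) - snd (A' k l) * fst (A i j))) =
      fun a b => mulLin t (fun a b => ser ε (A i j) a * ser ε' (A' k l) b -
      ser ε' (A' k l) b * ser ε (A i j) a) (a + ε.deg) (b + ε'.deg) := by
    ext a b
    rw [fn_del_mul]
    congr 1
    ext a b
    rw [fn_sub, fn_fst_mul_snd, fn_snd_mul_fst]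
  rw [fn_del_mul, e1, mulLin_translate, H i j k l, fn_eta_mul, fn_sub, fn_del_mul, fn_del_mul]
  congr 2
  · congr 1
    ext a b
    rw [fn_snd_mul_fst]
  · congr 1
    ext a b
    rw [fn_fst_mul_snd]

theorem mulLin_flip (t : B) (F : ℤ → ℤ → B) (a b : ℤ) :
    mulLin t (fun a b => F b a) a b = -mulLin (-t) F b a := by
  simp only [mulLin, neg_mul]
  abel

theorem mulLin_flip_flip (t : B) (F : ℤ → ℤ → B) (a b : ℤ) :
    mulLin (-t) (mulLin t (fun a b => F b a)) a b = mulLin t (mulLin (-t) F) b a := by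
  have e : mulLin t (fun a b => F b a) = fun a b => (fun b a => -mulLin (-t) F b a) b a := by
    ext a b; exact mulLin_flip t F a b
  rw [e, mulLin_flip, neg_neg]
  simp only [mulLin]
  noncomm_ring

/-- The relation of `SeriesRLL` with the two variables interchanged. -/
theorem SeriesRLL.two_flip (H : SeriesRLL h t ε' ε A A') (i j k l : Fin n) :
    del ε ε' (-t) * (del ε ε' t * (snd (A i j) * fst (A' k l) - fst (A' k l) * snd (A i j))) =
      eta h ε ε' * (del ε ε' t * (snd (A k j) * fst (A' i l)) -
        del ε ε' (-t) * (fst (A' k j) * snd (A i l))) := by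
  apply fn_injective ε ε'
  ext a b
  have e1 : fn ε ε' (del ε ε' t * (snd (A i j) * fst (A' k l) - fst (A' k l) * snd (A i j))) =
      fun a b => mulLin t (fun a b => (fun b a => ser ε' (A i j) b * ser ε (A' k l) a -
      ser ε (A' k l) a * ser ε' (A i j) b) b a) (a + ε.deg) (b + ε'.deg) := by
    ext a b
    rw [fn_del_mul]
    congr 1
    ext a b
    rw [fn_sub, fn_fst_mul_snd, fn_snd_mul_fst]
  have comm : mulLin t (mulLin (-t) (fun b a => ser ε' (A i j) b * ser ε (A' k l) a -
      ser ε (A' k l) a * ser ε' (A i j) b)) = mulLin (-t) (mulLin t (fun b a =>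
      ser ε' (A i j) b * ser ε (A' k l) a - ser ε (A' k l) a * ser ε' (A i j) b)) := by
    ext a b
    simp only [mulLin]
    noncomm_ring
  have e2 : ∀ a b : ℤ, mulLin t (fn ε ε' (snd (A k j) * fst (A' i l))) (a + ε.deg) (b + ε'.deg) =
      -mulLin (-t) (fun a b => ser ε' (A k j) a * ser ε (A' i l) b) (b + ε'.deg) (a + ε.deg) := fun a b => by
    rw [← mulLin_flip]
    congr 1
    ext a b
    rw [fn_snd_mul_fst]
  have e3 : ∀ a b : ℤ, mulLin (-t) (fn ε ε' (fst (A' k j) * snd (A i l))) (a + ε.deg) (b + ε'.deg) =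
      -mulLin t (fun a b => ser ε (A' k j) b * ser ε' (A i l) a) (b + ε'.deg) (a + ε.deg) := fun a b => by
    rw [← neg_neg t, ← mulLin_flip, neg_neg]
    congr 1
    ext a b
    rw [fn_fst_mul_snd]
  rw [fn_del_mul, e1, mulLin_translate, mulLin_flip_flip, comm, H i j k l, fn_eta_mul, fn_sub,
    fn_del_mul, fn_del_mul, e2, e3]
  congr 1
  abel

theorem isUnit_center {S : Type*} [Ring S] {x : S} (hx : x ∈ Subring.center S) (hu : IsUnit x) :
    IsUnit (⟨x, hx⟩ : Subring.center S) := by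
  obtain ⟨u, rfl⟩ := hu
  have hc : (↑u⁻¹ : S) ∈ Subring.center S := by
    rw [Subring.mem_center_iff]
    intro y
    have : Commute y u := Subring.mem_center_iff.1 hx y
    exact this.units_inv_right
  exact IsUnit.of_mul_eq_one ⟨_, hc⟩ (Subtype.ext u.mul_inv)

/-- Gauss decompositions of a pair of matrices `L^±(u)` that satisfies the defining relations, over a
ring in which `h` and `s = h c / 4` are central and nilpotent. -/
structure RLLData (n : ℕ) (B : Type*) [Ring B] where
  h : B
  s : B
  D : Sgn → Gauss n (PowerSeries B)
  h_center : h ∈ Subring.center B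
  s_center : s ∈ Subring.center B
  h_nil : IsNilpotent h
  s_nil : IsNilpotent s
  rel : ∀ ε ε' : Sgn, (ε = ε' ∨ ε = .plus) →
    SeriesRLL h ((ε.val - ε'.val) • s) ε ε' (D ε).mat (D ε').mat

/-- `t` with `R(u-v-t) L₁^ε(u) L₂^ε'(v) ∼ L₂^ε'(v) L₁^ε(u) R(u-v+t)`. -/
def RLLData.tau (d : RLLData n B) (ε ε' : Sgn) : B := (ε.val - ε'.val) • d.s

theorem RLLData.tau_center (d : RLLData n B) (ε ε' : Sgn) : d.tau ε ε' ∈ Subring.center B :=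
  zsmul_mem d.s_center _

theorem RLLData.tau_nil (d : RLLData n B) (ε ε' : Sgn) : IsNilpotent (d.tau ε ε') := by
  rw [RLLData.tau, ← Int.cast_smul_eq_zsmul ℤ, zsmul_eq_mul]
  exact (Int.cast_commute _ _).isNilpotent_mul_left d.s_nil

theorem RLLData.tau_self (d : RLLData n B) (ε : Sgn) : d.tau ε ε = 0 := by simp [RLLData.tau]

theorem neg_center {x : B} (hx : x ∈ Subring.center B) : -x ∈ Subring.center B := neg_mem hx

/-- The two Gauss decompositions, in the variables `u` and `v`, form a factorized pair over an overring
in which the relevant linear factors are invertible. -/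
theorem RLLData.exists_pair {B : Type u} [Ring B] (d : RLLData n B) (ε ε' : Sgn) :
    ∃ (S : Type u) (_ : Ring S) (f : Two B →+* S) (ρ g ρ' g' : Subring.center S),
      Function.Injective f ∧
      Pair ρ g ρ' g' ((d.D ε).map (f.comp fst)) ((d.D ε').map (f.comp snd)) ∧
      f (del ε ε' (d.tau ε ε')) * g = f (eta d.h ε ε') ∧
      f (del ε ε' (-d.tau ε ε')) * g' = f (eta d.h ε ε') ∧
      ((ε = ε' ∨ ε = .plus) → ρ = 1 ∧ ρ' = 1) ∧
      (¬ (ε = ε' ∨ ε = .plus) → ρ = 1 - g' ^ 2 ∧ ρ' = 1 - g ^ 2) ∧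
      (∀ x : B, x ∈ Subring.center B → f (PowerSeries.C (PowerSeries.C x)) ∈ Subring.center S) ∧
      IsUnit (f (del ε ε' (d.tau ε ε'))) ∧ IsUnit (f (del ε ε' (-d.tau ε ε'))) ∧
      (∀ y : S, Commute (f (del ε ε' (d.tau ε ε'))) y) ∧
      (∀ y : S, Commute (f (del ε ε' (-d.tau ε ε'))) y) ∧
      (∀ y : S, Commute (f (eta d.h ε ε')) y) := by
  obtain ⟨S, _, f, hf, hc, hu⟩ := exists_localization (Two B)
  have cen : ∀ x : Two B, (∀ G, Commute x G) → x ∈ Subring.center (Two B) := fun x hx =>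
    Subring.mem_center_iff.2 fun y => (hx y).symm
  set t := d.tau ε ε' with ht
  have ct : del ε ε' t ∈ Subring.center (Two B) := cen _ (del_commute ε ε' (d.tau_center ε ε'))
  have ct' : del ε ε' (-t) ∈ Subring.center (Two B) :=
    cen _ (del_commute ε ε' (neg_center (d.tau_center ε ε')))
  have ce : eta d.h ε ε' ∈ Subring.center (Two B) := cen _ fun G => eta_commute d.h_center G
  have ut := hu _ ct fun y hy => del_regular ε ε' (d.tau_nil ε ε') hy
  have ut' := hu _ ct' fun y hy => del_regular ε ε' (d.tau_nil ε ε').neg hy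
  obtain ⟨x, hx⟩ := isUnit_center (hc _ ct) ut
  obtain ⟨x', hx'⟩ := isUnit_center (hc _ ct') ut'
  have hxs : ((x : Subring.center S) : S) = f (del ε ε' t) := congrArg Subtype.val hx
  have hxs' : ((x' : Subring.center S) : S) = f (del ε ε' (-t)) := congrArg Subtype.val hx'
  set η : Subring.center S := ⟨f (eta d.h ε ε'), hc _ ce⟩ with hη
  have nil : IsNilpotent η := by
    obtain ⟨N, hN⟩ := d.h_nil
    refine ⟨N, Subtype.ext ?_⟩
    change (f (eta d.h ε ε')) ^ N = 0
    rw [← map_pow, eta, (CC_commute d.h_center _).mul_pow, ← map_pow, ← map_pow, hN]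
    simp
  set g : Subring.center S := η * ↑x⁻¹ with hg
  set g' : Subring.center S := η * ↑x'⁻¹ with hg'
  have gx : (x : Subring.center S) * g = η := by
    rw [hg, mul_left_comm, Units.mul_inv, mul_one]
  have gx' : (x' : Subring.center S) * g' = η := by
    rw [hg', mul_left_comm, Units.mul_inv, mul_one]
  have ng : IsNilpotent g := (Commute.all _ _).isNilpotent_mul_right nil
  have ng' : IsNilpotent g' := (Commute.all _ _).isNilpotent_mul_right nil
  have gs : f (del ε ε' t) * g = f (eta d.h ε ε') := by
    rw [← hxs]; exact congrArg Subtype.val gx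
  have gs' : f (del ε ε' (-t)) * g' = f (eta d.h ε ε') := by
    rw [← hxs']; exact congrArg Subtype.val gx'
  have solve : ∀ Y G F : S, f (del ε ε' (-t)) * (f (del ε ε' t) * Y) = f (eta d.h ε ε') *
      (f (del ε ε' t) * G - f (del ε ε' (-t)) * F) → Y = g' • G - g • F := fun Y G F hY => by
    have h1 : ((x' * x : (Subring.center S)ˣ) : Subring.center S) • Y =
        ((x' * x : (Subring.center S)ˣ) : Subring.center S) • (g' • G - g • F) := by
      have h2 : (x' : Subring.center S) • (x : Subring.center S) • Y =
          η • ((x : Subring.center S) • G - (x' : Subring.center S) • F) := by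
        simp only [Subring.smul_def, smul_eq_mul, hxs, hxs']
        exact hY
      rw [Units.val_mul, mul_smul, h2]
      have e1 : ((x' : Subring.center S) * x) * g' = η * x := by rw [← gx']; ring
      have e2 : ((x' : Subring.center S) * x) * g = η * x' := by rw [← gx]; ring
      rw [smul_sub, smul_sub, smul_smul, smul_smul, smul_smul, smul_smul, e1, e2]
    exact (Units.isUnit _).smul_left_cancel.1 h1
  have main : ∃ ρ ρ' : Subring.center S,
      Pair ρ g ρ' g' ((d.D ε).map (f.comp fst)) ((d.D ε').map (f.comp snd)) ∧
      ((ε = ε' ∨ ε = .plus) → ρ = 1 ∧ ρ' = 1) ∧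
      (¬ (ε = ε' ∨ ε = .plus) → ρ = 1 - g' ^ 2 ∧ ρ' = 1 - g ^ 2) := by
    by_cases hε : ε = ε' ∨ ε = .plus
    · refine ⟨1, 1, ⟨fun i j k l => ?_, isUnit_one, isUnit_one, ng.isUnit_one_add,
        ng.isUnit_one_sub, ng'.isUnit_one_add, ng'.isUnit_one_sub⟩, fun _ => ⟨rfl, rfl⟩,
        fun h => absurd hε h⟩
      have h2 := congrArg f ((d.rel ε ε' hε).two i j k l)
      simp only [map_mul, map_sub] at h2
      have h3 := solve _ _ _ h2
      simp only [Gauss.map_mat, Matrix.map_apply, RingHom.comp_apply, one_smul]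
      rw [sub_eq_iff_eq_add] at h3
      rw [h3]
      abel
    · have hε' : ε' = ε ∨ ε' = .plus := by
        cases ε <;> cases ε' <;> simp at hε ⊢
      have htt : (ε'.val - ε.val) • d.s = -t := by
        rw [ht, RLLData.tau, ← neg_smul, neg_sub]
      have p : Pair (1 : Subring.center S) (-g) 1 (-g') ((d.D ε').map (f.comp snd))
          ((d.D ε).map (f.comp fst)) := by
        refine ⟨fun i j k l => ?_, isUnit_one, isUnit_one, ng.neg.isUnit_one_add,
          ng.neg.isUnit_one_sub, ng'.neg.isUnit_one_add, ng'.neg.isUnit_one_sub⟩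
        have h1 := (d.rel ε' ε hε').two_flip i j k l
        rw [htt, neg_neg] at h1
        have h1' : del ε ε' (-t) * (del ε ε' t * (fst ((d.D ε).mat k l) * snd ((d.D ε').mat i j) -
            snd ((d.D ε').mat i j) * fst ((d.D ε).mat k l))) =
            eta d.h ε ε' * (del ε ε' t * (fst ((d.D ε).mat k j) * snd ((d.D ε').mat i l)) -
            del ε ε' (-t) * (snd ((d.D ε').mat k j) * fst ((d.D ε).mat i l))) := by
          rw [← neg_sub (snd _ * _), mul_neg, mul_neg, ← mul_assoc,
            (del_commute ε ε' (neg_center (d.tau_center ε ε')) _).eq, mul_assoc, h1, ← mul_neg,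
            neg_sub]
        have h2 := congrArg f h1'
        simp only [map_mul, map_sub] at h2
        have h3 := solve _ _ _ h2
        simp only [Gauss.map_mat, Matrix.map_apply, RingHom.comp_apply, one_smul]
        rw [sub_eq_iff_eq_add] at h3
        rw [h3, neg_smul, neg_smul]
        abel
      refine ⟨1 * (1 - (-g') ^ 2), 1 * (1 - (-g) ^ 2), ?_, fun h => absurd h hε, fun _ => ?_⟩
      · simpa using p.swap
      · simp
  obtain ⟨ρ, ρ', hp, h1, h2⟩ := main
  have cS : ∀ z : S, z ∈ Subring.center S → ∀ y, Commute z y := fun z hz y =>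
    (Subring.mem_center_iff.1 hz y).symm
  exact ⟨S, _, f, ρ, g, ρ', g', hf, hp, gs, gs', h1, h2,
    fun y hy => hc _ (cen _ (CC_commute hy)), ut, ut', cS _ (hc _ ct), cS _ (hc _ ct'),
    cS _ (hc _ ce)⟩

end ExistsPair

/-! ### Relations between Gaussian components as formal series -/

section SeriesRelations

variable {B : Type u} [Ring B] {n : ℕ} {ε ε' : Sgn}

theorem mulLin_fn_of_eta {h t : B} {G H : Two B} (e : del ε ε' t * G = eta h ε ε' * H) (a b : ℤ) :
    mulLin t (fn ε ε' G) a b = h * fn ε ε' H a b := by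
  have h1 := fn_del_mul ε ε' t G (a - ε.deg) (b - ε'.deg)
  rw [e, fn_eta_mul, sub_add_cancel, sub_add_cancel] at h1
  exact h1.symm

theorem del_add_eta (h t : B) : del ε ε' t + eta h ε ε' = del ε ε' (t - h) := by
  simp only [del, eta, map_sub, sub_mul]
  abel

theorem del_sub_eta (h t : B) : del ε ε' t - eta h ε ε' = del ε ε' (t + h) := by
  simp only [del, eta, map_add, add_mul]
  abel

variable (d : RLLData n B)

/-! #### Diagonal components -/

/-- The scalars in `Pair.k_k_self` are `1 + h / (u - v ∓ t)`; their denominators are cleared here. -/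
theorem RLLData.k_k_mixed (i : Fin n) (a b : ℤ) :
    mulLin (-d.tau .plus .minus) (mulLin (d.tau .plus .minus - d.h)
      (fun a b => ser .plus ((d.D .plus).k i) a * ser .minus ((d.D .minus).k i) b)) a b =
    mulLin (d.tau .plus .minus) (mulLin (-d.tau .plus .minus - d.h)
      (fun a b => ser .minus ((d.D .minus).k i) b * ser .plus ((d.D .plus).k i) a)) a b := by
  obtain ⟨S, _, f, ρ, g, ρ', g', hf, p, gs, gs', h1, -, -, -, -, ct, ct', ce⟩ :=
    d.exists_pair .plus .minus
  obtain ⟨rfl, rfl⟩ := h1 (Or.inr rfl)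
  have h := p.k_k_self i
  set x := del .plus .minus (d.tau .plus .minus)
  set x' := del .plus .minus (-d.tau .plus .minus)
  set η := eta d.h .plus .minus
  set k := (d.D .plus).k i
  set k' := (d.D .minus).k i
  have key : x' * ((x + η) * (fst k * snd k')) = x * ((x' + η) * (snd k' * fst k)) := by
    apply hf
    simp only [map_mul, map_add, ← gs]
    rw [← gs] at *
    have h2 : (1 + (g : S)) * (f (fst k) * f (snd k')) = (1 + (g' : S)) * (f (snd k') * f (fst k)) := by
      simpa [Subring.smul_def, Gauss.map] using h
    have e1 : f x + f x * g = f x * (1 + g) := by rw [mul_add, mul_one]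
    have e2 : f x' + f x * g = f x' * (1 + g') := by rw [mul_add, mul_one, gs']
    rw [e1, e2, mul_assoc (f x), h2, ← mul_assoc, ← mul_assoc, (ct' (f x)).eq]
    simp only [mul_assoc]
  rw [del_add_eta, del_add_eta] at key
  have key2 := congrFun (congrFun (congrArg (fn .plus .minus) key) (a - 1 - 1)) (b - 0 - 0)
  have tr : ∀ (s t : B) (G : Two B), fn .plus .minus (del .plus .minus t * (del .plus .minus s * G))
      (a - 1 - 1) (b - 0 - 0) = mulLin t (mulLin s (fn .plus .minus G)) a b := fun s t G => by
    have : fn .plus .minus (del .plus .minus s * G) =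
        fun a b => mulLin s (fn .plus .minus G) (a + 1) (b + 0) := by
      ext a b; rw [fn_del_mul]; rfl
    rw [fn_del_mul, this, mulLin_translate]
    simp [Sgn.deg]
  rw [tr, tr] at key2
  convert key2 using 3
  · ext a b; rw [fn_fst_mul_snd]
  · ext a b; rw [fn_snd_mul_fst]

/-- Identities over the overring of `RLLData.exists_pair` that come from identities of series. -/
theorem RLLData.exists_descent (ε ε' : Sgn) :
    ∃ (S : Type u) (_ : Ring S) (f : Two B →+* S) (ρ g ρ' g' : Subring.center S),
      Function.Injective f ∧
      Pair ρ g ρ' g' ((d.D ε).map (f.comp fst)) ((d.D ε').map (f.comp snd)) ∧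
      (∀ X W, f X = (g : S) * f W → del ε ε' (d.tau ε ε') * X = eta d.h ε ε' * W) ∧
      (∀ X W, f X = (g' : S) * f W → del ε ε' (-d.tau ε ε') * X = eta d.h ε ε' * W) ∧
      ((ε = ε' ∨ ε = .plus) → ρ = 1 ∧ ρ' = 1) ∧
      (∀ y : S, (g' : S) * y = y * g') ∧
      (ε = ε' → g = g') := by
  obtain ⟨S, _, f, ρ, g, ρ', g', hf, p, gs, gs', h1, -, -, u1, -, -, -, -⟩ := d.exists_pair ε ε'
  refine ⟨S, _, f, ρ, g, ρ', g', hf, p, fun X W e => ?_, fun X W e => ?_, h1,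
    fun y => (Subring.mem_center_iff.1 g'.2 y).symm, fun e => ?_⟩
  · apply hf
    rw [map_mul, e, ← mul_assoc, gs, map_mul]
  · apply hf
    rw [map_mul, e, ← mul_assoc, gs', map_mul]
  · subst e
    rw [d.tau_self] at gs u1
    rw [d.tau_self, neg_zero, ← gs] at gs'
    exact Subtype.ext (u1.mul_left_cancel gs').symm

theorem RLLData.k_k_of_lt (i j : Fin n) (h : i < j) (hε : ε = ε' ∨ ε = .plus) (a b : ℤ) :
    ser ε ((d.D ε).k i) a * ser ε' ((d.D ε').k j) b =
      ser ε' ((d.D ε').k j) b * ser ε ((d.D ε).k i) a := by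
  obtain ⟨S, _, f, ρ, g, ρ', g', hf, p, -, -, h1, -, -⟩ := d.exists_descent ε ε'
  obtain ⟨rfl, rfl⟩ := h1 hε
  have h2 := p.k_k_of_lt h
  rw [one_smul, one_smul] at h2
  rw [← fn_fst_mul_snd, ← fn_snd_mul_fst]
  congr 1
  apply hf
  simpa [Gauss.map] using h2

theorem RLLData.k_k_same (ε : Sgn) (i j : Fin n) (a b : ℤ) :
    ser ε ((d.D ε).k i) a * ser ε ((d.D ε).k j) b =
      ser ε ((d.D ε).k j) b * ser ε ((d.D ε).k i) a := by
  rcases lt_trichotomy i j with h | rfl | h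
  · exact d.k_k_of_lt i j h (Or.inl rfl) a b
  · obtain ⟨S, _, f, ρ, g, ρ', g', hf, p, -, -, h1, -, hg⟩ := d.exists_descent ε ε
    obtain ⟨rfl, rfl⟩ := h1 (Or.inl rfl)
    obtain rfl := hg rfl
    have h2 := p.k_k_self i
    rw [one_mul] at h2
    have h3 := p.add.smul_left_cancel.1 h2
    rw [← fn_fst_mul_snd, ← fn_snd_mul_fst]
    congr 1
    apply hf
    simpa [Gauss.map] using h3
  · exact (d.k_k_of_lt j i h (Or.inl rfl) b a).symm

theorem RLLData.k_commute (ε : Sgn) (i j : Fin n) : Commute ((d.D ε).k i) ((d.D ε).k j) := by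
  have h : ∀ p q : ℕ, PowerSeries.coeff p ((d.D ε).k i) * PowerSeries.coeff q ((d.D ε).k j) =
      PowerSeries.coeff q ((d.D ε).k j) * PowerSeries.coeff p ((d.D ε).k i) := fun p q => by
    cases ε
    · simpa only [ser_plus_neg] using d.k_k_same .plus i j (-p) (-q)
    · simpa only [ser_minus_nat] using d.k_k_same .minus i j p q
  ext m
  rw [PowerSeries.coeff_mul, PowerSeries.coeff_mul, ← Finset.Nat.sum_antidiagonal_swap]
  exact Finset.sum_congr rfl fun p _ => h _ _

theorem fn_del_del_mul (s t : B) (G : Two B) (a b : ℤ) :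
    fn ε ε' (del ε ε' t * (del ε ε' s * G)) (a - ε.deg - ε.deg) (b - ε'.deg - ε'.deg) =
      mulLin t (mulLin s (fn ε ε' G)) a b := by
  have : fn ε ε' (del ε ε' s * G) = fun a b => mulLin s (fn ε ε' G) (a + ε.deg) (b + ε'.deg) := by
    ext a b; rw [fn_del_mul]
  rw [fn_del_mul, this, mulLin_translate, sub_add_cancel, sub_add_cancel, sub_add_cancel,
    sub_add_cancel]

/-- The scalars in `Pair.k_k_of_lt` are `1 - h ^ 2 / (u - v ± t) ^ 2`; their denominators are cleared
here. -/
theorem RLLData.k_k_minus_plus (i j : Fin n) (h : i < j) (a b : ℤ) :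
    mulLin (d.tau .minus .plus) (mulLin (d.tau .minus .plus)
      (mulLin (-d.tau .minus .plus + d.h) (mulLin (-d.tau .minus .plus - d.h)
      (fun a b => ser .minus ((d.D .minus).k i) a * ser .plus ((d.D .plus).k j) b)))) a b =
    mulLin (-d.tau .minus .plus) (mulLin (-d.tau .minus .plus)
      (mulLin (d.tau .minus .plus + d.h) (mulLin (d.tau .minus .plus - d.h)
      (fun a b => ser .plus ((d.D .plus).k j) b * ser .minus ((d.D .minus).k i) a)))) a b := by
  obtain ⟨S, _, f, ρ, g, ρ', g', hf, p, gs, gs', -, h1, -, -, -, ct, ct', ce⟩ :=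
    d.exists_pair .minus .plus
  obtain ⟨rfl, rfl⟩ := h1 (by simp)
  have h2 := p.k_k_of_lt h
  set x := del .minus .plus (d.tau .minus .plus)
  set x' := del .minus .plus (-d.tau .minus .plus)
  set η := eta d.h .minus .plus
  set k := (d.D .minus).k i
  set k' := (d.D .plus).k j
  have key : x * (x * ((x' - η) * ((x' + η) * (fst k * snd k')))) =
      x' * (x' * ((x - η) * ((x + η) * (snd k' * fst k)))) := by
    apply hf
    simp only [map_mul, map_add, map_sub]
    have h3 : (1 - (g' : S) ^ 2) * (f (fst k) * f (snd k')) =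
        (1 - (g : S) ^ 2) * (f (snd k') * f (fst k)) := by
      simpa [Subring.smul_def, Gauss.map] using h2
    have cg : ∀ y, (g : S) * y = y * g := fun y => (Subring.mem_center_iff.1 g.2 y).symm
    have cg' : ∀ y, (g' : S) * y = y * g' := fun y => (Subring.mem_center_iff.1 g'.2 y).symm
    have e1 : (f x' - f η) * (f x' + f η) = f x' * f x' * (1 - (g' : S) ^ 2) := by
      have : f η = f x' * g' := gs'.symm
      rw [this, mul_add, sub_mul, sub_mul, mul_assoc (f x') g' (f x'), cg' (f x'),
        mul_assoc (f x') g' _, ← mul_assoc (g' : S), cg' (f x'), mul_sub, sq]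
      simp only [mul_assoc, mul_one]
      abel
    have e2 : (f x - f η) * (f x + f η) = f x * f x * (1 - (g : S) ^ 2) := by
      have : f η = f x * g := gs.symm
      rw [this, mul_add, sub_mul, sub_mul, mul_assoc (f x) g (f x), cg (f x),
        mul_assoc (f x) g _, ← mul_assoc (g : S), cg (f x), mul_sub, sq]
      simp only [mul_assoc, mul_one]
      abel
    rw [← mul_assoc (f x' - f η), e1, ← mul_assoc (f x - f η), e2, mul_assoc (f x' * f x'), h3,
      mul_assoc (f x * f x)]
    simp only [← mul_assoc]
    congr 3
    rw [mul_assoc (f x * f x), mul_assoc (f x' * f x')]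
    exact ((ct (f x' * f x')).mul_left (ct (f x' * f x'))).eq
  rw [del_add_eta, del_add_eta, del_sub_eta, del_sub_eta] at key
  have tr : ∀ (s t s' t' : B) (G : Two B), fn .minus .plus (del .minus .plus t * (del .minus .plus s *
      (del .minus .plus t' * (del .minus .plus s' * G)))) (a - 0 - 0 - 0 - 0) (b - 1 - 1 - 1 - 1) =
      mulLin t (mulLin s (mulLin t' (mulLin s' (fn .minus .plus G)))) a b := fun s t s' t' G => by
    have e := fn_del_del_mul (ε := .minus) (ε' := .plus) s t
      (del .minus .plus t' * (del .minus .plus s' * G)) (a - 0 - 0) (b - 1 - 1)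
    have e' : fn .minus .plus (del .minus .plus t' * (del .minus .plus s' * G)) =
        fun a b => mulLin t' (mulLin s' (fn .minus .plus G)) (a + 0) (b + 2) := by
      ext a b
      rw [← fn_del_del_mul]
      simp only [Sgn.deg]
      congr 1 <;> ring
    rw [e'] at e
    have e2 : mulLin s (fun a b => mulLin t' (mulLin s' (fn .minus .plus G)) (a + 0) (b + 2)) =
        fun a b => mulLin s (mulLin t' (mulLin s' (fn .minus .plus G))) (a + 0) (b + 2) := by
      ext a b; rw [mulLin_translate]
    rw [e2, mulLin_translate] at e
    refine e.trans ?_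
    congr 1 <;> ring
  have key2 := congrFun (congrFun (congrArg (fn .minus .plus) key) (a - 0 - 0 - 0 - 0))
    (b - 1 - 1 - 1 - 1)
  rw [tr, tr] at key2
  convert key2 using 5
  · ext a b; rw [fn_fst_mul_snd]
  · ext a b; rw [fn_snd_mul_fst]

end SeriesRelations

section SeriesRelations

variable {B : Type u} [Ring B] {n : ℕ} {ε ε' : Sgn} (d : RLLData n B)

/-! #### Off-diagonal components -/

theorem fst_inverse_mul {φ : PowerSeries B} (h : IsUnit φ) :
    fst (Ring.inverse φ) * fst φ = 1 := by
  rw [← map_mul, Ring.inverse_mul_cancel _ h, map_one]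

variable {i j l : Fin n}

theorem RLLData.conj_left (ε ε' : Sgn) (h : j.val = i.val + 1) :
    del ε ε' (-d.tau ε ε') * (fst (Ring.inverse ((d.D ε).k i)) * snd ((d.D ε').E i j) *
        fst ((d.D ε).k i) - snd ((d.D ε').E i j)) =
      eta d.h ε ε' * (snd ((d.D ε').E i j) - fst ((d.D ε).E i j)) := by
  obtain ⟨S, _, f, ρ, g, ρ', g', hf, p, -, gs', -, cg', -⟩ := d.exists_descent ε ε'
  apply gs'
  have h1 := p.e_k_left h
  simp only [Gauss.map, RingHom.comp_apply, Matrix.map_apply, Subring.smul_def, smul_eq_mul] at h1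
  rw [map_sub, mul_assoc, map_mul, map_mul, h1, ← mul_assoc, ← map_mul,
    fst_inverse_mul ((d.D ε).k_unit i), map_one, one_mul, map_sub]
  push_cast
  noncomm_ring

theorem RLLData.conj_right (ε ε' : Sgn) (h : j.val = i.val + 1) :
    del ε ε' (-d.tau ε ε') * (fst (Ring.inverse ((d.D ε).k j)) * snd ((d.D ε').E i j) *
        fst ((d.D ε).k j) - snd ((d.D ε').E i j)) =
      eta d.h ε ε' * (fst ((d.D ε).E i j) - snd ((d.D ε').E i j)) := by
  obtain ⟨S, _, f, ρ, g, ρ', g', hf, p, -, gs', -, cg', -⟩ := d.exists_descent ε ε'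
  apply gs'
  have h1 := p.e_k_right h
  simp only [Gauss.map, RingHom.comp_apply, Matrix.map_apply, Subring.smul_def, smul_eq_mul] at h1
  rw [map_sub, mul_assoc, map_mul, map_mul, h1, ← mul_assoc, ← map_mul,
    fst_inverse_mul ((d.D ε).k_unit j), map_one, one_mul, map_sub]
  push_cast
  noncomm_ring

theorem RLLData.conj_far (ε ε' : Sgn) (h : j.val = i.val + 1) (h1 : l ≠ i) (h2 : l ≠ j) :
    fst (Ring.inverse ((d.D ε).k l)) * snd ((d.D ε').E i j) * fst ((d.D ε).k l) =
      snd ((d.D ε').E i j) := by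
  obtain ⟨S, _, f, ρ, g, ρ', g', hf, p, -, -, -, -, -⟩ := d.exists_descent ε ε'
  apply hf
  have h1 := p.e_k_far h h1 h2
  simp only [Gauss.map, RingHom.comp_apply, Matrix.map_apply] at h1
  rw [mul_assoc, map_mul, map_mul, h1, ← mul_assoc, ← map_mul,
    fst_inverse_mul ((d.D ε).k_unit l), map_one, one_mul]

theorem RLLData.e_e_self (ε ε' : Sgn) (h : j.val = i.val + 1) :
    del ε ε' (-d.tau ε ε') * (fst ((d.D ε).E i j) * snd ((d.D ε').E i j) -
        snd ((d.D ε').E i j) * fst ((d.D ε).E i j)) =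
      -(eta d.h ε ε' * ((fst ((d.D ε).E i j) - snd ((d.D ε').E i j)) *
        (fst ((d.D ε).E i j) - snd ((d.D ε').E i j)))) := by
  obtain ⟨S, _, f, ρ, g, ρ', g', hf, p, -, gs', -, -, -⟩ := d.exists_descent ε ε'
  rw [← mul_neg]
  apply gs'
  have h1 := p.e_e_self h
  simpa only [Gauss.map, RingHom.comp_apply, Matrix.map_apply, Subring.smul_def, smul_eq_mul,
    map_mul, map_sub, map_neg, mul_neg] using h1

theorem RLLData.e_e_far (ε ε' : Sgn) {i' j' : Fin n} (h : j.val = i.val + 1)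
    (h' : j'.val = i'.val + 1) (hij : i.val + 1 < i'.val ∨ i'.val + 1 < i.val) (a b : ℤ) :
    Commute (ser ε ((d.D ε).E i j) a) (ser ε' ((d.D ε').E i' j') b) := by
  obtain ⟨S, _, f, ρ, g, ρ', g', hf, p, -, -, -, -, -⟩ := d.exists_descent ε ε'
  rw [Commute, SemiconjBy, ← fn_fst_mul_snd, ← fn_snd_mul_fst]
  congr 1
  apply hf
  rw [map_mul, map_mul]
  exact p.e_e_far h h' hij

theorem RLLData.e_e_succ (ε ε' : Sgn) (h : j.val = i.val + 1) (h' : l.val = i.val + 2) :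
    del ε ε' (-d.tau ε ε') * (fst ((d.D ε).E i j) * snd ((d.D ε').E j l) -
        snd ((d.D ε').E j l) * fst ((d.D ε).E i j)) =
      eta d.h ε ε' * (fst ((d.D ε).E i l) - snd ((d.D ε').E i l) -
        (fst ((d.D ε).E i j) - snd ((d.D ε').E i j)) * snd ((d.D ε').E j l)) := by
  obtain ⟨S, _, f, ρ, g, ρ', g', hf, p, -, gs', -, -, -⟩ := d.exists_descent ε ε'
  apply gs'
  have h1 := p.e_e_succ h h'
  simpa only [Gauss.map, RingHom.comp_apply, Matrix.map_apply, Subring.smul_def, smul_eq_mul,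
    map_mul, map_sub] using h1

theorem RLLData.e_f_of_ne (ε ε' : Sgn) {i' j' : Fin n} (h : j.val = i.val + 1)
    (h' : j'.val = i'.val + 1) (hij : i ≠ i') (a b : ℤ) :
    Commute (ser ε ((d.D ε).E i j) a) (ser ε' ((d.D ε').F j' i') b) := by
  obtain ⟨S, _, f, ρ, g, ρ', g', hf, p, -, -, -, -, -⟩ := d.exists_descent ε ε'
  rw [Commute, SemiconjBy, ← fn_fst_mul_snd, ← fn_snd_mul_fst]
  congr 1
  apply hf
  rw [map_mul, map_mul]
  exact p.e_f_of_ne h h' hij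

theorem Gauss.map_Y {S S' : Type*} [Ring S] [Ring S'] (f : S →+* S') (D : Gauss n S) :
    (D.map f).Y i j l = f (D.Y i j l) := by
  simp [Gauss.Y, Gauss.map]

theorem map_inverse {S S' : Type*} [Ring S] [Ring S'] (f : S →+* S') {x : S} (h : IsUnit x) :
    Ring.inverse (f x) = f (Ring.inverse x) := by
  obtain ⟨u, rfl⟩ := h
  rw [Ring.inverse_unit]
  exact Ring.inverse_unit (Units.map (f : S →* S') u)

theorem RLLData.e_f_self (ε ε' : Sgn) (h : j.val = i.val + 1) :
    del ε ε' (-d.tau ε ε') * (del ε ε' (d.tau ε ε') * (fst ((d.D ε).E i j) * snd ((d.D ε').F j i) -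
        snd ((d.D ε').F j i) * fst ((d.D ε).E i j))) =
      eta d.h ε ε' * (del ε ε' (d.tau ε ε') * snd ((d.D ε').k j * Ring.inverse ((d.D ε').k i)) -
        del ε ε' (-d.tau ε ε') * fst ((d.D ε).k j * Ring.inverse ((d.D ε).k i))) := by
  obtain ⟨S, _, f, ρ, g, ρ', g', hf, p, gs, gs', -, -, -, -, -, ct, ct', -⟩ := d.exists_pair ε ε'
  apply hf
  have h1 := p.e_f_self h
  have e1 : Ring.inverse ((d.D ε).k i) * (d.D ε).k j = (d.D ε).k j * Ring.inverse ((d.D ε).k i) := by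
    obtain ⟨u, hu⟩ := (d.D ε).k_unit i
    have hc : Commute (u : PowerSeries B) ((d.D ε).k j) := hu ▸ d.k_commute ε i j
    rw [← hu, Ring.inverse_unit]
    exact hc.units_inv_left.eq
  have i1 := map_inverse (f.comp fst) ((d.D ε).k_unit i)
  have i2 := map_inverse (f.comp snd) ((d.D ε').k_unit i)
  have i3 := congrArg (f.comp fst) e1
  simp only [Gauss.map, RingHom.comp_apply, Matrix.map_apply, Subring.smul_def, smul_eq_mul,
    map_mul] at h1 i1 i2 i3
  rw [i1, i2, i3] at h1
  simp only [map_mul, map_sub] at h1 ⊢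
  rw [h1, mul_sub, mul_sub, mul_sub]
  congr 1
  · rw [← mul_assoc, ← mul_assoc, (ct' (f (del ε ε' (d.tau ε ε')))).eq,
      mul_assoc (f (del ε ε' (d.tau ε ε'))) _ (g' : S), gs', (ct (f (eta d.h ε ε'))).eq, mul_assoc]
  · rw [← mul_assoc (f (del ε ε' (d.tau ε ε'))), gs, ← mul_assoc, (ct' (f (eta d.h ε ε'))).eq,
      mul_assoc]

/-! #### The first row and the last column of `E` in rank three -/

/-- `φ(u) - φ(v)` is divisible by `u - v`. -/
theorem exists_fst_sub_snd (ε : Sgn) (φ : PowerSeries B) :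
    ∃ γ : Two B, fst φ - snd φ = del ε ε 0 * γ := by
  let γ : Two B := PowerSeries.mk fun m => PowerSeries.mk fun r => PowerSeries.coeff (m + r + 1) φ
  have key : fst φ - snd φ = (PowerSeries.X - PowerSeries.C PowerSeries.X) * γ := by
    ext m r
    rw [sub_mul, map_sub, map_sub, map_sub, map_sub, PowerSeries.coeff_C_mul]
    cases m with
    | zero =>
      cases r with
      | zero => simp [fst, snd]
      | succ r =>
        simp [fst, snd, γ, PowerSeries.coeff_succ_X_mul, PowerSeries.coeff_C]
    | succ m =>
      cases r with
      | zero =>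
        simp [fst, snd, γ, PowerSeries.coeff_succ_X_mul]
      | succ r =>
        simp [fst, snd, γ, PowerSeries.coeff_succ_X_mul]
        rw [show m + (r + 1) + 1 = m + 1 + r + 1 by ring, sub_self]
  cases ε
  · refine ⟨-γ, ?_⟩
    rw [key, mul_neg, ← neg_mul]
    congr 1
    simp [del, lam, kap, fst, snd]
  · refine ⟨γ, ?_⟩
    rw [key]
    congr 1
    simp [del, lam, kap, fst, snd]

/-- A series `V(u,v)` with powers of both variables of one sign and `(u-v+h) V(u,v) = h w(u)`
vanishes: on the line `u = v - h` the right-hand side has to vanish. -/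
theorem mul_eq_zero_of_mulLin (ε : Sgn) {h : B} (hn : IsNilpotent h) {V : ℤ → ℤ → B} {w : ℤ → B}
    (hV : ∀ a b, ε.Outside a ∨ ε.Outside b → V a b = 0)
    (hw : ∀ a, ε.Outside a → w a = 0)
    (e : ∀ a b, mulLin (-h) V a b = if b = 0 then h * w a else 0) (a : ℤ) : h * w a = 0 := by
  simp only [mulLin, neg_mul, sub_neg_eq_add] at e
  cases ε with
  | plus =>
    have key : ∀ k : ℕ, ∀ a b : ℤ, 1 - (k : ℤ) ≤ a → b < 0 → V a b = 0 := by
      intro k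
      induction k with
      | zero => intro a b hab hb; exact hV a b (Or.inl (show 0 < a by push_cast at hab; omega))
      | succ k ih =>
        intro a b hab hb
        have h1 := e (a + 1) b
        rw [add_sub_cancel_right, ih (a + 1) (b - 1) (by push_cast at hab; omega) (by omega),
          ih (a + 1) b (by push_cast at hab; omega) hb, if_neg hb.ne] at h1
        simpa using h1
    have z : ∀ a, V a 0 = 0 := fun a => by
      have h1 := e a 1
      rw [hV (a - 1) 1 (Or.inr (one_pos : (0 : ℤ) < 1)), hV a 1 (Or.inr (one_pos : (0 : ℤ) < 1))] at h1
      simpa using h1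
    have h1 := e a 0
    rw [z, z, key (1 - a).toNat a (0 - 1) (by omega) (by omega), if_pos rfl] at h1
    simpa using h1.symm
  | minus =>
    obtain ⟨N, hN⟩ := hn
    have key : ∀ k : ℕ, ∀ a : ℤ, a < k → (∀ b, V a b = 0) ∧ h * w a = 0 := by
      intro k
      induction k with
      | zero =>
        intro a ha
        have ha' : Sgn.minus.Outside a := show a < 0 by simpa using ha
        exact ⟨fun b => hV a b (Or.inl ha'), by rw [hw a ha', mul_zero]⟩
      | succ k ih =>
        intro a hab
        rcases lt_or_ge a k with hak | hak
        · exact ih a hak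
        have prev : ∀ b, V (a - 1) b = 0 := (ih (a - 1) (by push_cast at hab; omega)).1
        have hstep : ∀ b, 0 ≤ b → V a b = h * V a (b + 1) := fun b hb => by
          have h1 := e a (b + 1)
          rw [prev, add_sub_cancel_right, if_neg (by omega), zero_sub, neg_add_eq_zero] at h1
          exact h1
        have hpow : ∀ r : ℕ, ∀ b, 0 ≤ b → V a b = h ^ r * V a (b + r) := by
          intro r
          induction r with
          | zero => intro b hb; simp
          | succ r ihr =>
            intro b hb
            rw [ihr b hb, hstep (b + r) (by omega), ← mul_assoc, ← pow_succ]
            push_cast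
            rw [add_assoc]
        have z : ∀ b, V a b = 0 := fun b => by
          rcases lt_or_ge b 0 with hb | hb
          · exact hV a b (Or.inr hb)
          · rw [hpow N b hb, hN, zero_mul]
        refine ⟨z, ?_⟩
        have h1 := e a 0
        rw [prev, z, z, if_pos rfl] at h1
        simpa using h1.symm
    exact (key (a + 1).toNat a (by omega)).2

/-- If `(x + η)(x Z + η x γ) = η x w(u)` with `x = u - v` and `η = h`, then `h w = 0`: the factor `x` cancels,
and `mul_eq_zero_of_mulLin` applies to `V = Z + η γ`. -/
theorem eta_mul_fst_eq_zero (ε : Sgn) {h : B} (hn : IsNilpotent h)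
    {Z γ : Two B} {w : PowerSeries B}
    (e : (del ε ε 0 + eta h ε ε) * (del ε ε 0 * Z + eta h ε ε * (del ε ε 0 * γ)) =
      eta h ε ε * (del ε ε 0 * fst w)) (a : ℤ) : h * ser ε w a = 0 := by
  have c0 : ∀ G, Commute (del ε ε (0 : B)) G := del_commute ε ε (zero_mem _)
  set V := Z + eta h ε ε * γ with hV
  have e1 : del ε ε 0 * ((del ε ε 0 + eta h ε ε) * V - eta h ε ε * fst w) = 0 := by
    have h1 : del ε ε 0 * Z + eta h ε ε * (del ε ε 0 * γ) = del ε ε 0 * V := by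
      rw [hV, mul_add, ← mul_assoc (eta h ε ε), ← mul_assoc (del ε ε 0), (c0 (eta h ε ε)).eq]
    rw [h1, ← mul_assoc, ← (c0 (del ε ε 0 + eta h ε ε)).eq, mul_assoc, ← mul_assoc (eta h ε ε),
      ← (c0 (eta h ε ε)).eq, mul_assoc] at e
    rw [mul_sub, e, sub_self]
  have e2 := sub_eq_zero.1 (del_regular ε ε IsNilpotent.zero e1)
  rw [del_add_eta, zero_sub] at e2
  have e3 := mulLin_fn_of_eta e2
  refine mul_eq_zero_of_mulLin ε hn (V := fn ε ε V) (w := ser ε w)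
    (fun a b hab => hab.elim (fn_side ε ε V b) (fn_side_right ε ε V a))
    (fun a ha => ser_outside ε w ha) (fun a b => ?_) a
  · rw [e3, fn_fst, mul_ite, mul_zero]

theorem eta_mul_fst_of_mul {h : B} {w : PowerSeries B} (hw : ∀ a, h * ser ε w a = 0) :
    eta h ε ε' * fst w = 0 := by
  apply fn_injective ε ε'
  ext a b
  rw [fn_eta_mul, fn_fst, fn_zero]
  split_ifs
  · exact hw _
  · exact mul_zero _

theorem eta_mul_snd_of_mul {h : B} {w : PowerSeries B} (hw : ∀ a, h * ser ε' w a = 0) :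
    eta h ε ε' * snd w = 0 := by
  apply fn_injective ε ε'
  ext a b
  rw [fn_eta_mul, fn_snd, fn_zero]
  split_ifs
  · exact hw _
  · exact mul_zero _

end SeriesRelations

section SeriesRelations

variable {B : Type u} [Ring B] {n : ℕ} {ε ε' : Sgn} (d : RLLData n B) {i j l : Fin n}

theorem add_mul_add_of_row {S : Type*} [Ring S] {x η g Z P W : S} (hx : x * g = η)
    (cx : ∀ y, Commute x y) (e : (1 + g) * (Z + g * P) = g * W) :
    (x + η) * (x * Z + η * P) = η * (x * W) := by
  subst hx
  have e1 : x + x * g = x * (1 + g) := by rw [mul_add, mul_one]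
  have e2 : x * Z + x * g * P = x * (Z + g * P) := by rw [mul_add, mul_assoc]
  rw [e1, e2, mul_assoc, ← mul_assoc _ x, ← (cx (1 + g)).eq, mul_assoc x, e,
    mul_assoc x g, ← mul_assoc g x, ← (cx g).eq, mul_assoc]

theorem eta_neg (h : B) : eta (-h) ε ε' = -eta h ε ε' := by
  rw [eta, map_neg, map_neg, neg_mul, ← eta]

theorem mul_neg_of_eta {S : Type*} [Ring S] {f : Two B →+* S} {x g : S} {h : B}
    (e : x * g = f (eta h ε ε')) : x * -g = f (eta (-h) ε ε') := by
  rw [mul_neg, e, eta_neg, map_neg]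

/-- The relation of the first row in rank three, before the right-hand side is known to vanish. -/
theorem RLLData.e_e_row_aux (ε ε' : Sgn) (h : j.val = i.val + 1) (h' : l.val = i.val + 2) :
    (del ε ε' (-d.tau ε ε') + eta d.h ε ε') *
      (del ε ε' (-d.tau ε ε') * (fst ((d.D ε).E i j) * snd ((d.D ε').E i l) -
        snd ((d.D ε').E i l) * fst ((d.D ε).E i j)) +
      eta d.h ε ε' * ((fst ((d.D ε).E i j) - snd ((d.D ε').E i j)) *
        (fst ((d.D ε).E i l) - snd ((d.D ε').E i l)))) =
      eta d.h ε ε' * (del ε ε' (-d.tau ε ε') *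
        fst ((d.D ε).E i j * (d.D ε).E i l - (d.D ε).E i l * (d.D ε).E i j)) := by
  obtain ⟨S, _, f, ρ, g, ρ', g', hf, p, gs, gs', -, -, -, -, -, ct, ct', -⟩ := d.exists_pair ε ε'
  apply hf
  have h1 := p.e_e_row h h'
  simp only [Gauss.map, RingHom.comp_apply, Matrix.map_apply, Subring.smul_def, smul_eq_mul,
    Subring.coe_add, Subring.coe_one] at h1
  have h2 := add_mul_add_of_row gs' ct' h1
  simpa only [map_mul, map_add, map_sub] using h2

theorem RLLData.e_e_column_aux (ε ε' : Sgn) (h : j.val = i.val + 1) (h' : l.val = i.val + 2) :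
    (del ε ε' (-d.tau ε ε') + eta (-d.h) ε ε') *
      (del ε ε' (-d.tau ε ε') * (fst ((d.D ε).E j l) * snd ((d.D ε').Y i j l) -
        snd ((d.D ε').Y i j l) * fst ((d.D ε).E j l)) +
      eta (-d.h) ε ε' * ((fst ((d.D ε).Y i j l) - snd ((d.D ε').Y i j l)) *
        (snd ((d.D ε').E j l) - fst ((d.D ε).E j l)))) =
      eta (-d.h) ε ε' * (del ε ε' (-d.tau ε ε') *
        fst ((d.D ε).E j l * (d.D ε).Y i j l - (d.D ε).Y i j l * (d.D ε).E j l)) := by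
  obtain ⟨S, _, f, ρ, g, ρ', g', hf, p, gs, gs', -, -, -, -, -, ct, ct', -⟩ := d.exists_pair ε ε'
  apply hf
  have h1 := p.e_e_column h h'
  simp only [Gauss.map_Y, RingHom.comp_apply, Subring.smul_def, smul_eq_mul,
    AddSubgroupClass.coe_sub, Subring.coe_one] at h1
  simp only [Gauss.map, RingHom.comp_apply, Matrix.map_apply] at h1
  rw [sub_eq_add_neg 1, ← neg_mul (g' : S) _, ← neg_mul_neg (g' : S), neg_mul_eq_mul_neg _ (_ - _),
    neg_sub] at h1
  have h2 := add_mul_add_of_row (mul_neg_of_eta gs') ct' h1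
  simpa only [map_mul, map_add, map_sub] using h2

/-- `RLLData.e_e_row_aux` with the roles of the two variables interchanged. -/
theorem RLLData.e_e_row_swap_aux (ε ε' : Sgn) (h : j.val = i.val + 1) (h' : l.val = i.val + 2) :
    (del ε ε' (-d.tau ε ε') + eta (-d.h) ε ε') *
      (del ε ε' (-d.tau ε ε') * (snd ((d.D ε').E i j) * fst ((d.D ε).E i l) -
        fst ((d.D ε).E i l) * snd ((d.D ε').E i j)) +
      eta (-d.h) ε ε' * ((snd ((d.D ε').E i j) - fst ((d.D ε).E i j)) *
        (snd ((d.D ε').E i l) - fst ((d.D ε).E i l)))) =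
      eta (-d.h) ε ε' * (del ε ε' (-d.tau ε ε') *
        snd ((d.D ε').E i j * (d.D ε').E i l - (d.D ε').E i l * (d.D ε').E i j)) := by
  obtain ⟨S, _, f, ρ, g, ρ', g', hf, p, gs, gs', -, -, -, -, -, ct, ct', -⟩ := d.exists_pair ε ε'
  apply hf
  have h1 := p.swap.e_e_row h h'
  simp only [Gauss.map, RingHom.comp_apply, Matrix.map_apply, Subring.smul_def, smul_eq_mul,
    Subring.coe_add, Subring.coe_one] at h1
  have h2 := add_mul_add_of_row (mul_neg_of_eta gs') ct' h1
  simpa only [map_mul, map_add, map_sub] using h2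

/-- `RLLData.e_e_column_aux` with the roles of the two variables interchanged. -/
theorem RLLData.e_e_column_swap_aux (ε ε' : Sgn) (h : j.val = i.val + 1) (h' : l.val = i.val + 2) :
    (del ε ε' (-d.tau ε ε') + eta d.h ε ε') *
      (del ε ε' (-d.tau ε ε') * (snd ((d.D ε').E j l) * fst ((d.D ε).Y i j l) -
        fst ((d.D ε).Y i j l) * snd ((d.D ε').E j l)) +
      eta d.h ε ε' * ((snd ((d.D ε').Y i j l) - fst ((d.D ε).Y i j l)) *
        (fst ((d.D ε).E j l) - snd ((d.D ε').E j l)))) =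
      eta d.h ε ε' * (del ε ε' (-d.tau ε ε') *
        snd ((d.D ε').E j l * (d.D ε').Y i j l - (d.D ε').Y i j l * (d.D ε').E j l)) := by
  obtain ⟨S, _, f, ρ, g, ρ', g', hf, p, gs, gs', -, -, -, -, -, ct, ct', -⟩ := d.exists_pair ε ε'
  apply hf
  have h1 := p.swap.e_e_column h h'
  simp only [Gauss.map_Y, RingHom.comp_apply, Subring.smul_def, smul_eq_mul,
    AddSubgroupClass.coe_sub, Subring.coe_one] at h1
  simp only [Gauss.map, RingHom.comp_apply, Matrix.map_apply] at h1
  rw [NegMemClass.coe_neg, sub_neg_eq_add, neg_mul (g' : S), neg_mul (g' : S), neg_neg,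
    neg_mul_eq_mul_neg (g' : S), neg_mul_eq_mul_neg _ (_ - _), neg_sub] at h1
  have h2 := add_mul_add_of_row gs' ct' h1
  simpa only [map_mul, map_add, map_sub] using h2

/-- The commutator of `e_{ij}(u)` and `e_{il}(u)` is annihilated by `h`. For equal signs the
difference `e_{ij}(u) - e_{ij}(v)` is divisible by `u - v`, so that `eta_mul_fst_eq_zero` applies to
`RLLData.e_e_row_aux`. -/
theorem RLLData.h_mul_row (ε : Sgn) (h : j.val = i.val + 1) (h' : l.val = i.val + 2) (a : ℤ) :
    d.h * ser ε ((d.D ε).E i j * (d.D ε).E i l - (d.D ε).E i l * (d.D ε).E i j) a = 0 := by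
  obtain ⟨γ, hγ⟩ := exists_fst_sub_snd ε ((d.D ε).E i j)
  have h1 := d.e_e_row_aux ε ε h h'
  rw [d.tau_self, neg_zero, hγ, mul_assoc (del _ _ _) γ] at h1
  exact eta_mul_fst_eq_zero ε d.h_nil h1 a

/-- The analogue of `RLLData.h_mul_row` for the last column. -/
theorem RLLData.h_mul_column (ε : Sgn) (h : j.val = i.val + 1) (h' : l.val = i.val + 2) (a : ℤ) :
    d.h * ser ε ((d.D ε).E j l * (d.D ε).Y i j l - (d.D ε).Y i j l * (d.D ε).E j l) a = 0 := by
  obtain ⟨γ, hγ⟩ := exists_fst_sub_snd ε ((d.D ε).Y i j l)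
  have h1 := d.e_e_column_aux ε ε h h'
  rw [d.tau_self, neg_zero, hγ, mul_assoc (del _ _ _) γ] at h1
  have h2 := eta_mul_fst_eq_zero ε d.h_nil.neg h1 a
  rwa [neg_mul, neg_eq_zero] at h2

theorem eq_neg_of_add_mul_add {x η Z P : Two B} {t : B} (ht : IsNilpotent t)
    (hx : x + η = del ε ε' t) (e : (x + η) * (x * Z + η * P) = 0) : x * Z = -(η * P) := by
  rw [hx] at e
  exact eq_neg_of_add_eq_zero_left (del_regular ε ε' ht e)

theorem RLLData.nil_sub_h {t : B} (ht : IsNilpotent t) : IsNilpotent (t - d.h) :=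
  Commute.isNilpotent_sub (Subring.mem_center_iff.1 d.h_center t) ht d.h_nil

theorem RLLData.nil_add_h {t : B} (ht : IsNilpotent t) : IsNilpotent (t + d.h) :=
  Commute.isNilpotent_add (Subring.mem_center_iff.1 d.h_center t) ht d.h_nil

theorem RLLData.e_e_row (ε ε' : Sgn) (h : j.val = i.val + 1) (h' : l.val = i.val + 2) :
    del ε ε' (-d.tau ε ε') * (fst ((d.D ε).E i j) * snd ((d.D ε').E i l) -
        snd ((d.D ε').E i l) * fst ((d.D ε).E i j)) =
      -(eta d.h ε ε' * ((fst ((d.D ε).E i j) - snd ((d.D ε').E i j)) *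
        (fst ((d.D ε).E i l) - snd ((d.D ε').E i l)))) := by
  refine eq_neg_of_add_mul_add (d.nil_sub_h (d.tau_nil ε ε').neg) (del_add_eta _ _) ?_
  rw [d.e_e_row_aux ε ε' h h', ← mul_assoc, (eta_commute d.h_center _).eq, mul_assoc,
    eta_mul_fst_of_mul (d.h_mul_row ε h h'), mul_zero]

theorem RLLData.e_e_row_swap (ε ε' : Sgn) (h : j.val = i.val + 1) (h' : l.val = i.val + 2) :
    del ε ε' (-d.tau ε ε') * (snd ((d.D ε').E i j) * fst ((d.D ε).E i l) -
        fst ((d.D ε).E i l) * snd ((d.D ε').E i j)) =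
      eta d.h ε ε' * ((fst ((d.D ε).E i j) - snd ((d.D ε').E i j)) *
        (fst ((d.D ε).E i l) - snd ((d.D ε').E i l))) := by
  have h1 := eq_neg_of_add_mul_add (d.nil_add_h (d.tau_nil ε ε').neg)
    ((del_add_eta _ _).trans (by rw [sub_neg_eq_add])) ((d.e_e_row_swap_aux ε ε' h h').trans ?_)
  · rw [h1, eta_neg, neg_mul, neg_neg, ← neg_sub (fst ((d.D ε).E i j)),
      ← neg_sub (fst ((d.D ε).E i l)), neg_mul_neg]
  · rw [← mul_assoc, (eta_commute (neg_center d.h_center) _).eq, mul_assoc, eta_neg, neg_mul,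
      eta_mul_snd_of_mul (d.h_mul_row ε' h h'), neg_zero, mul_zero]

theorem RLLData.e_e_column (ε ε' : Sgn) (h : j.val = i.val + 1) (h' : l.val = i.val + 2) :
    del ε ε' (-d.tau ε ε') * (fst ((d.D ε).E j l) * snd ((d.D ε').Y i j l) -
        snd ((d.D ε').Y i j l) * fst ((d.D ε).E j l)) =
      -(eta d.h ε ε' * ((fst ((d.D ε).Y i j l) - snd ((d.D ε').Y i j l)) *
        (fst ((d.D ε).E j l) - snd ((d.D ε').E j l)))) := by
  have h1 := eq_neg_of_add_mul_add (d.nil_add_h (d.tau_nil ε ε').neg)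
    ((del_add_eta _ _).trans (by rw [sub_neg_eq_add])) ((d.e_e_column_aux ε ε' h h').trans ?_)
  · rw [h1, eta_neg, neg_mul, ← neg_sub (snd ((d.D ε').E j l)) (fst ((d.D ε).E j l)), mul_neg, mul_neg]
  · rw [← mul_assoc, (eta_commute (neg_center d.h_center) _).eq, mul_assoc, eta_neg, neg_mul,
      eta_mul_fst_of_mul (d.h_mul_column ε h h'), neg_zero, mul_zero]

theorem RLLData.e_e_column_swap (ε ε' : Sgn) (h : j.val = i.val + 1) (h' : l.val = i.val + 2) :
    del ε ε' (-d.tau ε ε') * (snd ((d.D ε').E j l) * fst ((d.D ε).Y i j l) -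
        fst ((d.D ε).Y i j l) * snd ((d.D ε').E j l)) =
      eta d.h ε ε' * ((fst ((d.D ε).Y i j l) - snd ((d.D ε').Y i j l)) *
        (fst ((d.D ε).E j l) - snd ((d.D ε').E j l))) := by
  have h1 := eq_neg_of_add_mul_add (d.nil_sub_h (d.tau_nil ε ε').neg)
    (del_add_eta _ _) ((d.e_e_column_swap_aux ε ε' h h').trans ?_)
  · rw [h1, ← mul_neg, ← neg_mul, neg_sub]
  · rw [← mul_assoc, (eta_commute d.h_center _).eq, mul_assoc,
      eta_mul_snd_of_mul (d.h_mul_column ε' h h'), mul_zero]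

/-- `RLLData.e_e_succ` with the roles of the two variables interchanged, in terms of the last
column. -/
theorem RLLData.e_e_pred (ε ε' : Sgn) (h : j.val = i.val + 1) (h' : l.val = i.val + 2) :
    del ε ε' (-d.tau ε ε') * (fst ((d.D ε).E j l) * snd ((d.D ε').E i j) -
        snd ((d.D ε').E i j) * fst ((d.D ε).E j l)) =
      eta d.h ε ε' * (fst ((d.D ε).Y i j l) - snd ((d.D ε').Y i j l) -
        snd ((d.D ε').E i j) * (fst ((d.D ε).E j l) - snd ((d.D ε').E j l))) := by
  obtain ⟨S, _, f, ρ, g, ρ', g', hf, p, -, gs', -, -, -⟩ := d.exists_descent ε ε'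
  apply gs'
  have h1 := p.swap.e_e_succ h h'
  simp only [Gauss.map, RingHom.comp_apply, Matrix.map_apply, Subring.smul_def, smul_eq_mul,
    NegMemClass.coe_neg] at h1
  rw [map_sub, map_mul, map_mul, ← neg_sub, h1, neg_mul, neg_neg]
  simp only [Gauss.Y, map_sub, map_mul]
  noncomm_ring

end SeriesRelations

/-! ### Serre relations between Gaussian components -/

section SerreAlgebra

variable {Z R : Type*} [CommRing Z] [Ring R] [Algebra Z R]

/-- `[a₁, [a₂, b₃]]` from the commutators of `a₁` and `a₂` with the other components. -/
theorem smul_double_commutator {Δ Δ₁ Δ₂ η η₁ η₂ : Z} {a₁ a₂ a₃ b₃ c₁ c₂ c₃ : R}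
    (haa : Δ • (a₁ * a₂ - a₂ * a₁) = -(η • ((a₁ - a₂) * (a₁ - a₂))))
    (haa₁ : Δ₁ • (a₁ * a₃ - a₃ * a₁) = -(η₁ • ((a₁ - a₃) * (a₁ - a₃))))
    (hac : Δ • (a₁ * c₂ - c₂ * a₁) = -(η • ((a₁ - a₂) * (c₁ - c₂))))
    (hac₁ : Δ₁ • (a₁ * c₃ - c₃ * a₁) = -(η₁ • ((a₁ - a₃) * (c₁ - c₃))))
    (hab₁ : Δ₁ • (a₁ * b₃ - b₃ * a₁) = η₁ • (c₁ - c₃ - (a₁ - a₃) * b₃))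
    (hab₂ : Δ₂ • (a₂ * b₃ - b₃ * a₂) = η₂ • (c₂ - c₃ - (a₂ - a₃) * b₃)) :
    (Δ * Δ₁ * Δ₂) • (a₁ * (a₂ * b₃ - b₃ * a₂) - (a₂ * b₃ - b₃ * a₂) * a₁) =
      -((η * η₂ * Δ₁) • ((a₁ - a₂) * (c₁ - c₂) - (a₁ - a₂) * (a₁ - a₂) * b₃)) +
      (η₁ * η₂ * Δ) • ((a₁ - a₃) * (c₁ - c₃) - (a₁ - a₃) * (a₁ - a₃) * b₃ -
        (a₂ - a₃) * (c₁ - c₃ - (a₁ - a₃) * b₃)) := by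
  have e1 : Δ₂ • (a₁ * (a₂ * b₃ - b₃ * a₂) - (a₂ * b₃ - b₃ * a₂) * a₁) =
      η₂ • ((a₁ * c₂ - c₂ * a₁) - (a₁ * c₃ - c₃ * a₁) - ((a₁ * a₂ - a₂ * a₁) * b₃ -
        (a₁ * a₃ - a₃ * a₁) * b₃) - (a₂ - a₃) * (a₁ * b₃ - b₃ * a₁)) := by
    rw [smul_sub, ← mul_smul_comm, ← smul_mul_assoc, hab₂, mul_smul_comm, smul_mul_assoc, ← smul_sub]
    congr 1
    noncomm_ring
  have e2 : (Δ * Δ₁) • ((a₁ * c₂ - c₂ * a₁) - (a₁ * c₃ - c₃ * a₁) - ((a₁ * a₂ - a₂ * a₁) * b₃ -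
        (a₁ * a₃ - a₃ * a₁) * b₃) - (a₂ - a₃) * (a₁ * b₃ - b₃ * a₁)) =
      Δ₁ • (Δ • (a₁ * c₂ - c₂ * a₁)) - Δ • (Δ₁ • (a₁ * c₃ - c₃ * a₁)) -
        (Δ₁ • ((Δ • (a₁ * a₂ - a₂ * a₁)) * b₃) - Δ • ((Δ₁ • (a₁ * a₃ - a₃ * a₁)) * b₃)) -
        Δ • ((a₂ - a₃) * (Δ₁ • (a₁ * b₃ - b₃ * a₁))) := by
    rw [smul_mul_assoc, smul_mul_assoc, mul_smul_comm]
    module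
  rw [mul_smul, e1, smul_comm, e2, haa, haa₁, hac, hac₁, hab₁]
  simp only [mul_smul_comm, smul_mul_assoc, neg_mul, smul_neg]
  module

/-- The cubic relation of three-variable commutators. It comes down to the identity
`η₁₂ η₂₃ Δ₁₃ = η₁₂ η₁₃ Δ₂₃ + η₁₃ η₂₃ Δ₁₂` for `Δᵢⱼ = uᵢ - uⱼ`. -/
theorem smul_serre {Δ Δ₁ Δ₂ η η₁ η₂ : Z} (arnold : η * η₂ * Δ₁ = η * η₁ * Δ₂ + η₁ * η₂ * Δ)
    {a₁ a₂ a₃ b₃ c₁ c₂ c₃ : R}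
    (haa : Δ • (a₁ * a₂ - a₂ * a₁) = -(η • ((a₁ - a₂) * (a₁ - a₂))))
    (haa₁ : Δ₁ • (a₁ * a₃ - a₃ * a₁) = -(η₁ • ((a₁ - a₃) * (a₁ - a₃))))
    (haa₂ : Δ₂ • (a₂ * a₃ - a₃ * a₂) = -(η₂ • ((a₂ - a₃) * (a₂ - a₃))))
    (hac : Δ • (a₁ * c₂ - c₂ * a₁) = -(η • ((a₁ - a₂) * (c₁ - c₂))))
    (hca : Δ • (a₂ * c₁ - c₁ * a₂) = η • ((a₁ - a₂) * (c₁ - c₂)))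
    (hac₁ : Δ₁ • (a₁ * c₃ - c₃ * a₁) = -(η₁ • ((a₁ - a₃) * (c₁ - c₃))))
    (hac₂ : Δ₂ • (a₂ * c₃ - c₃ * a₂) = -(η₂ • ((a₂ - a₃) * (c₂ - c₃))))
    (hab₁ : Δ₁ • (a₁ * b₃ - b₃ * a₁) = η₁ • (c₁ - c₃ - (a₁ - a₃) * b₃))
    (hab₂ : Δ₂ • (a₂ * b₃ - b₃ * a₂) = η₂ • (c₂ - c₃ - (a₂ - a₃) * b₃)) :
    (Δ * Δ₁ * Δ₂) • ((a₁ * a₂ * b₃ - 2 * (a₁ * b₃ * a₂) + b₃ * a₁ * a₂) +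
      (a₂ * a₁ * b₃ - 2 * (a₂ * b₃ * a₁) + b₃ * a₂ * a₁)) = 0 := by
  have h1 := smul_double_commutator haa haa₁ hac hac₁ hab₁ hab₂
  have h2 := smul_double_commutator (Δ := -Δ) (Δ₁ := Δ₂) (Δ₂ := Δ₁) (η := η) (η₁ := η₂) (η₂ := η₁)
    (a₁ := a₂) (a₂ := a₁) (a₃ := a₃) (b₃ := b₃) (c₁ := c₂) (c₂ := c₁) (c₃ := c₃)
    (by rw [neg_smul, ← smul_neg, neg_sub, haa, ← neg_sub a₁ a₂, neg_mul_neg]) haa₂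
    (by rw [neg_smul, hca, ← neg_sub a₁ a₂, ← neg_sub c₁ c₂, neg_mul_neg]) hac₂ hab₂ hab₁
  have e : (a₁ * a₂ * b₃ - 2 * (a₁ * b₃ * a₂) + b₃ * a₁ * a₂) +
      (a₂ * a₁ * b₃ - 2 * (a₂ * b₃ * a₁) + b₃ * a₂ * a₁) =
      (a₁ * (a₂ * b₃ - b₃ * a₂) - (a₂ * b₃ - b₃ * a₂) * a₁) +
      (a₂ * (a₁ * b₃ - b₃ * a₁) - (a₁ * b₃ - b₃ * a₁) * a₂) := by noncomm_ring
  have e2 : (Δ * Δ₁ * Δ₂) • (a₂ * (a₁ * b₃ - b₃ * a₁) - (a₁ * b₃ - b₃ * a₁) * a₂) =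
      -((-Δ * Δ₂ * Δ₁) • (a₂ * (a₁ * b₃ - b₃ * a₁) - (a₁ * b₃ - b₃ * a₁) * a₂)) := by module
  have e3 : (a₁ - a₂) * (c₁ - c₂) - (a₁ - a₂) * (a₁ - a₂) * b₃ =
      ((a₁ - a₃) * (c₁ - c₃) - (a₁ - a₃) * (a₁ - a₃) * b₃ -
        (a₂ - a₃) * (c₁ - c₃ - (a₁ - a₃) * b₃)) +
      ((a₂ - a₃) * (c₂ - c₃) - (a₂ - a₃) * (a₂ - a₃) * b₃ -
        (a₁ - a₃) * (c₂ - c₃ - (a₂ - a₃) * b₃)) := by noncomm_ring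
  have e4 : (a₂ - a₁) * (c₂ - c₁) - (a₂ - a₁) * (a₂ - a₁) * b₃ =
      (a₁ - a₂) * (c₁ - c₂) - (a₁ - a₂) * (a₁ - a₂) * b₃ := by noncomm_ring
  rw [e, smul_add, e2, h1, h2, e4, e3, arnold]
  module

/-- `smul_serre` for the opposite multiplication and the opposite sign of `η`. -/
theorem smul_serre_op {Δ Δ₁ Δ₂ η η₁ η₂ : Z} (arnold : η * η₂ * Δ₁ = η * η₁ * Δ₂ + η₁ * η₂ * Δ)
    {a₁ a₂ a₃ b₃ c₁ c₂ c₃ : R}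
    (haa : Δ • (a₁ * a₂ - a₂ * a₁) = -(η • ((a₁ - a₂) * (a₁ - a₂))))
    (haa₁ : Δ₁ • (a₁ * a₃ - a₃ * a₁) = -(η₁ • ((a₁ - a₃) * (a₁ - a₃))))
    (haa₂ : Δ₂ • (a₂ * a₃ - a₃ * a₂) = -(η₂ • ((a₂ - a₃) * (a₂ - a₃))))
    (hac : Δ • (a₁ * c₂ - c₂ * a₁) = -(η • ((c₁ - c₂) * (a₁ - a₂))))
    (hca : Δ • (a₂ * c₁ - c₁ * a₂) = η • ((c₁ - c₂) * (a₁ - a₂)))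
    (hac₁ : Δ₁ • (a₁ * c₃ - c₃ * a₁) = -(η₁ • ((c₁ - c₃) * (a₁ - a₃))))
    (hac₂ : Δ₂ • (a₂ * c₃ - c₃ * a₂) = -(η₂ • ((c₂ - c₃) * (a₂ - a₃))))
    (hab₁ : Δ₁ • (a₁ * b₃ - b₃ * a₁) = η₁ • (c₁ - c₃ - b₃ * (a₁ - a₃)))
    (hab₂ : Δ₂ • (a₂ * b₃ - b₃ * a₂) = η₂ • (c₂ - c₃ - b₃ * (a₂ - a₃))) :
    (Δ * Δ₁ * Δ₂) • ((a₁ * a₂ * b₃ - 2 * (a₁ * b₃ * a₂) + b₃ * a₁ * a₂) +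
      (a₂ * a₁ * b₃ - 2 * (a₂ * b₃ * a₁) + b₃ * a₂ * a₁)) = 0 := by
  have flip : ∀ {δ θ : Z} {x y w : R}, δ • (x * y - y * x) = θ • w →
      δ • (MulOpposite.op x * MulOpposite.op y - MulOpposite.op y * MulOpposite.op x) =
        (-θ) • MulOpposite.op w := fun {δ θ x y w} h => by
    apply MulOpposite.unop_injective
    simp only [MulOpposite.unop_smul, MulOpposite.unop_sub, MulOpposite.unop_mul,
      MulOpposite.unop_op]
    rw [← neg_sub, smul_neg, h, neg_smul]
  have key := smul_serre (η := -η) (η₁ := -η₁) (η₂ := -η₂)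
    (by rw [neg_mul_neg, neg_mul_neg, neg_mul_neg, arnold])
    ((flip (haa.trans (smul_neg _ _).symm)).trans (smul_neg _ _))
    ((flip (haa₁.trans (smul_neg _ _).symm)).trans (smul_neg _ _))
    ((flip (haa₂.trans (smul_neg _ _).symm)).trans (smul_neg _ _))
    ((flip (hac.trans (smul_neg _ _).symm)).trans (smul_neg _ _)) (flip hca)
    ((flip (hac₁.trans (smul_neg _ _).symm)).trans (smul_neg _ _))
    ((flip (hac₂.trans (smul_neg _ _).symm)).trans (smul_neg _ _)) (flip hab₁) (flip hab₂)
  have key2 := congrArg MulOpposite.unop key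
  rw [MulOpposite.unop_smul, MulOpposite.unop_zero] at key2
  rw [← key2]
  congr 1
  simp only [MulOpposite.unop_add, MulOpposite.unop_sub, MulOpposite.unop_mul, MulOpposite.unop_op,
    two_mul, mul_assoc]
  abel

end SerreAlgebra

section ThreeVariables

variable {B : Type u} [Ring B]

/-- Power series over `B` in three variables. -/
abbrev Three (B : Type*) [Ring B] : Type _ := PowerSeries (Two B)

/-- Series in the first and second of three variables. -/
def incl₁₂ : Two B →+* Three B := PowerSeries.map (PowerSeries.map PowerSeries.C)

/-- Series in the first and third of three variables. -/
def incl₁₃ : Two B →+* Three B := PowerSeries.map PowerSeries.C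

/-- Series in the second and third of three variables. -/
def incl₂₃ : Two B →+* Three B := PowerSeries.C

/-- Series in the first of three variables. -/
def var₁ : PowerSeries B →+* Three B := incl₁₂.comp fst

/-- Series in the second of three variables. -/
def var₂ : PowerSeries B →+* Three B := incl₁₂.comp snd

/-- Series in the third of three variables. -/
def var₃ : PowerSeries B →+* Three B := incl₁₃.comp snd

theorem incl₁₂_fst (φ : PowerSeries B) : incl₁₂ (fst φ) = var₁ φ := rfl

theorem incl₁₂_snd (φ : PowerSeries B) : incl₁₂ (snd φ) = var₂ φ := rfl

theorem incl₁₃_snd (φ : PowerSeries B) : incl₁₃ (snd φ) = var₃ φ := rfl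

theorem incl₁₃_fst (φ : PowerSeries B) : incl₁₃ (fst φ) = var₁ φ := by
  ext m r s
  simp only [var₁, incl₁₂, incl₁₃, fst, RingHom.comp_apply, PowerSeries.coeff_map,
    PowerSeries.map_C]

theorem incl₂₃_fst (φ : PowerSeries B) : incl₂₃ (fst φ) = var₂ φ := by
  simp only [var₂, incl₁₂, incl₂₃, fst, snd, RingHom.comp_apply, PowerSeries.map_C]

theorem incl₂₃_snd (φ : PowerSeries B) : incl₂₃ (snd φ) = var₃ φ := by
  simp only [var₃, incl₁₃, incl₂₃, snd, RingHom.comp_apply, PowerSeries.map_C]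

theorem var₂_eq (φ : PowerSeries B) : var₂ φ = PowerSeries.C (PowerSeries.map PowerSeries.C φ) :=
  (incl₂₃_fst φ).symm

theorem var₃_eq (φ : PowerSeries B) : var₃ φ = PowerSeries.C (PowerSeries.C φ) :=
  (incl₂₃_snd φ).symm

theorem var₁_eq (φ : PowerSeries B) :
    var₁ φ = PowerSeries.map (PowerSeries.map PowerSeries.C) (PowerSeries.map PowerSeries.C φ) :=
  rfl

/-- The coefficient of `u₁ ^ a * u₂ ^ b * u₃ ^ c`. -/
def fn₃ (ε₁ ε₂ ε₃ : Sgn) (G : Three B) (a b c : ℤ) : B := ser ε₃ (ser ε₂ (ser ε₁ G a) b) c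

variable (ε₁ ε₂ ε₃ : Sgn)

theorem fn₃_sub (G H : Three B) (a b c : ℤ) :
    fn₃ ε₁ ε₂ ε₃ (G - H) a b c = fn₃ ε₁ ε₂ ε₃ G a b c - fn₃ ε₁ ε₂ ε₃ H a b c := by
  simp only [fn₃, ser_sub]

theorem fn₃_injective {G : Three B} (h : ∀ a b c, fn₃ ε₁ ε₂ ε₃ G a b c = 0) : G = 0 :=
  ser_injective ε₁ fun a => ser_injective ε₂ fun b => ser_injective ε₃ fun c => by
    simpa only [fn₃, ser_zero] using h a b c

theorem var₁_kap : var₁ (kap B ε₁) = kap (Two B) ε₁ := by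
  cases ε₁ <;> simp [var₁_eq, kap]

theorem var₁_lam : var₁ (lam B ε₁) = lam (Two B) ε₁ := by
  cases ε₁ <;> simp [var₁_eq, lam]

theorem var₂_kap : var₂ (kap B ε₂) = PowerSeries.C (kap (PowerSeries B) ε₂) := by
  cases ε₂ <;> simp [var₂_eq, kap]

theorem var₂_lam : var₂ (lam B ε₂) = PowerSeries.C (lam (PowerSeries B) ε₂) := by
  cases ε₂ <;> simp [var₂_eq, lam]

theorem fn₃_kap_mul (G : Three B) (a b c : ℤ) :
    fn₃ ε₁ ε₂ ε₃ (var₁ (kap B ε₁) * G) a b c = fn₃ ε₁ ε₂ ε₃ G (a + ε₁.deg) b c ∧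
    fn₃ ε₁ ε₂ ε₃ (var₂ (kap B ε₂) * G) a b c = fn₃ ε₁ ε₂ ε₃ G a (b + ε₂.deg) c ∧
    fn₃ ε₁ ε₂ ε₃ (var₃ (kap B ε₃) * G) a b c = fn₃ ε₁ ε₂ ε₃ G a b (c + ε₃.deg) := by
  refine ⟨?_, ?_, ?_⟩
  · rw [fn₃, var₁_kap, ser_kap_mul, fn₃]
  · rw [fn₃, var₂_kap, ser_C_mul, ser_kap_mul, fn₃]
  · rw [fn₃, var₃_eq, ser_C_mul, ser_C_mul, ser_kap_mul, fn₃]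

theorem fn₃_lam_mul (G : Three B) (a b c : ℤ) :
    fn₃ ε₁ ε₂ ε₃ (var₁ (lam B ε₁) * G) a b c = fn₃ ε₁ ε₂ ε₃ G (a + ε₁.deg - 1) b c ∧
    fn₃ ε₁ ε₂ ε₃ (var₂ (lam B ε₂) * G) a b c = fn₃ ε₁ ε₂ ε₃ G a (b + ε₂.deg - 1) c ∧
    fn₃ ε₁ ε₂ ε₃ (var₃ (lam B ε₃) * G) a b c = fn₃ ε₁ ε₂ ε₃ G a b (c + ε₃.deg - 1) := by
  refine ⟨?_, ?_, ?_⟩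
  · rw [fn₃, var₁_lam, ser_lam_mul, fn₃]
  · rw [fn₃, var₂_lam, ser_C_mul, ser_lam_mul, fn₃]
  · rw [fn₃, var₃_eq, ser_C_mul, ser_C_mul, ser_lam_mul, fn₃]

/-- A constant as a series in three variables. -/
def const₃ (x : B) : Three B := PowerSeries.C (PowerSeries.C (PowerSeries.C x))

theorem fn₃_const_mul (x : B) (G : Three B) (a b c : ℤ) :
    fn₃ ε₁ ε₂ ε₃ (const₃ x * G) a b c = x * fn₃ ε₁ ε₂ ε₃ G a b c := by
  simp only [fn₃, const₃, ser_C_mul]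

theorem incl_const (x : B) : incl₁₂ (PowerSeries.C (PowerSeries.C x)) = const₃ x ∧
    incl₁₃ (PowerSeries.C (PowerSeries.C x)) = const₃ x ∧
    incl₂₃ (PowerSeries.C (PowerSeries.C x)) = const₃ x := by
  simp [incl₁₂, incl₁₃, incl₂₃, const₃]

theorem incl_kk : incl₁₂ (kk (B := B) ε₁ ε₂) = var₁ (kap B ε₁) * var₂ (kap B ε₂) ∧
    incl₁₃ (kk (B := B) ε₁ ε₃) = var₁ (kap B ε₁) * var₃ (kap B ε₃) ∧
    incl₂₃ (kk (B := B) ε₂ ε₃) = var₂ (kap B ε₂) * var₃ (kap B ε₃) := by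
  simp only [kk, map_mul, incl₁₂_fst, incl₁₂_snd, incl₁₃_fst, incl₁₃_snd, incl₂₃_fst, incl₂₃_snd,
    and_self]

theorem incl_del (t : B) :
    incl₁₂ (del ε₁ ε₂ t) = var₁ (lam B ε₁) * var₂ (kap B ε₂) - var₁ (kap B ε₁) * var₂ (lam B ε₂) -
      const₃ t * (var₁ (kap B ε₁) * var₂ (kap B ε₂)) ∧
    incl₁₃ (del ε₁ ε₃ t) = var₁ (lam B ε₁) * var₃ (kap B ε₃) - var₁ (kap B ε₁) * var₃ (lam B ε₃) -
      const₃ t * (var₁ (kap B ε₁) * var₃ (kap B ε₃)) ∧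
    incl₂₃ (del ε₂ ε₃ t) = var₂ (lam B ε₂) * var₃ (kap B ε₃) - var₂ (kap B ε₂) * var₃ (lam B ε₃) -
      const₃ t * (var₂ (kap B ε₂) * var₃ (kap B ε₃)) := by
  simp only [del, map_sub, map_mul, (incl_kk ε₁ ε₂ ε₃).1, (incl_kk ε₁ ε₂ ε₃).2.1,
    (incl_kk ε₁ ε₂ ε₃).2.2, incl_const, incl₁₂_fst, incl₁₂_snd, incl₁₃_fst, incl₁₃_snd, incl₂₃_fst,
    incl₂₃_snd, and_self]

theorem fn₃_incl_del_mul (t : B) (G : Three B) (a b c : ℤ) :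
    fn₃ ε₁ ε₂ ε₃ (incl₁₂ (del ε₁ ε₂ t) * G) a b c =
      mulLin t (fun a b => fn₃ ε₁ ε₂ ε₃ G a b c) (a + ε₁.deg) (b + ε₂.deg) ∧
    fn₃ ε₁ ε₂ ε₃ (incl₁₃ (del ε₁ ε₃ t) * G) a b c =
      mulLin t (fun a c => fn₃ ε₁ ε₂ ε₃ G a b c) (a + ε₁.deg) (c + ε₃.deg) ∧
    fn₃ ε₁ ε₂ ε₃ (incl₂₃ (del ε₂ ε₃ t) * G) a b c =
      mulLin t (fun b c => fn₃ ε₁ ε₂ ε₃ G a b c) (b + ε₂.deg) (c + ε₃.deg) := by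
  obtain ⟨h₁, h₂, h₃⟩ := incl_del ε₁ ε₂ ε₃ t
  simp only [h₁, h₂, h₃, sub_mul, fn₃_sub, mul_assoc, fn₃_const_mul, fn₃_kap_mul, fn₃_lam_mul,
    mulLin, and_self]

theorem mulLin_sided {t : B} (ht : IsNilpotent t) {ε ε' : Sgn} {F : ℤ → ℤ → B}
    (hF : ∀ a b, ε.Outside a → F a b = 0)
    (h : ∀ a b, mulLin t F (a + ε.deg) (b + ε'.deg) = 0) (a b : ℤ) : F a b = 0 := by
  rw [eq_zero_of_mulLin ε ht hF fun a b => ?_]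
  · rfl
  · have := h (a - ε.deg) (b - ε'.deg)
    rwa [sub_add_cancel, sub_add_cancel] at this

theorem incl_del_regular {t : B} (ht : IsNilpotent t) {G : Three B} :
    (incl₁₂ (del ε₁ ε₂ t) * G = 0 → G = 0) ∧ (incl₁₃ (del ε₁ ε₃ t) * G = 0 → G = 0) ∧
      (incl₂₃ (del ε₂ ε₃ t) * G = 0 → G = 0) := by
  have z : ∀ a b c, fn₃ ε₁ ε₂ ε₃ (0 : Three B) a b c = 0 := fun a b c => by
    simp only [fn₃, ser_zero]
  have o₁ : ∀ a b c, ε₁.Outside a → fn₃ ε₁ ε₂ ε₃ G a b c = 0 := fun a b c h => by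
    rw [fn₃, ser_outside _ _ h, ser_zero, ser_zero]
  have o₂ : ∀ a b c, ε₂.Outside b → fn₃ ε₁ ε₂ ε₃ G a b c = 0 := fun a b c h => by
    rw [fn₃, ser_outside _ _ h, ser_zero]
  refine ⟨fun h => ?_, fun h => ?_, fun h => ?_⟩
  · refine fn₃_injective ε₁ ε₂ ε₃ fun a b c => mulLin_sided (ε' := ε₂)
      (F := fun a b => fn₃ ε₁ ε₂ ε₃ G a b c) ht (fun a b => o₁ a b c) (fun a b => ?_) a b
    rw [← (fn₃_incl_del_mul ε₁ ε₂ ε₃ t G a b c).1, h, z]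
  · refine fn₃_injective ε₁ ε₂ ε₃ fun a b c => mulLin_sided (ε' := ε₃)
      (F := fun a c => fn₃ ε₁ ε₂ ε₃ G a b c) ht (fun a c => o₁ a b c) (fun a c => ?_) a c
    rw [← (fn₃_incl_del_mul ε₁ ε₂ ε₃ t G a b c).2.1, h, z]
  · refine fn₃_injective ε₁ ε₂ ε₃ fun a b c => mulLin_sided (ε' := ε₃)
      (F := fun b c => fn₃ ε₁ ε₂ ε₃ G a b c) ht (fun b c => o₂ a b c) (fun b c => ?_) b c
    rw [← (fn₃_incl_del_mul ε₁ ε₂ ε₃ t G a b c).2.2, h, z]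

theorem var_commute (G : Three B) : Commute (var₁ (kap B ε₁)) G ∧ Commute (var₁ (lam B ε₁)) G ∧
    Commute (var₂ (kap B ε₂)) G ∧ Commute (var₂ (lam B ε₂)) G ∧ Commute (var₃ (kap B ε₃)) G ∧
    Commute (var₃ (lam B ε₃)) G := by
  rw [var₁_kap, var₁_lam, var₂_kap, var₂_lam, var₃_eq, var₃_eq]
  refine ⟨kap_commute _ _, lam_commute _ _, ?_, ?_, ?_, ?_⟩ <;> ext1 m <;>
    rw [PowerSeries.coeff_C_mul, PowerSeries.coeff_mul_C]
  · exact kap_commute _ _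
  · exact lam_commute _ _
  · exact snd_kap_commute ε₃ _
  · exact snd_lam_commute ε₃ _

theorem const₃_commute {t : B} (ht : t ∈ Subring.center B) (G : Three B) :
    Commute (const₃ t) G := by
  ext1 m
  rw [const₃, PowerSeries.coeff_C_mul, PowerSeries.coeff_mul_C]
  exact CC_commute ht _

end ThreeVariables

section SerreSeries

variable {B : Type u} [Ring B] {n : ℕ} (d : RLLData n B) (ε₁ ε₂ ε₃ : Sgn)

theorem RLLData.tau_add : d.tau ε₁ ε₃ = d.tau ε₁ ε₂ + d.tau ε₂ ε₃ := by
  rw [RLLData.tau, RLLData.tau, RLLData.tau, ← add_smul, sub_add_sub_cancel]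

theorem incl_eta (h : B) : incl₁₂ (eta h ε₁ ε₂) = const₃ h * (var₁ (kap B ε₁) * var₂ (kap B ε₂)) ∧
    incl₁₃ (eta h ε₁ ε₃) = const₃ h * (var₁ (kap B ε₁) * var₃ (kap B ε₃)) ∧
    incl₂₃ (eta h ε₂ ε₃) = const₃ h * (var₂ (kap B ε₂) * var₃ (kap B ε₃)) := by
  obtain ⟨h₁, h₂, h₃⟩ := incl_kk (B := B) ε₁ ε₂ ε₃
  simp only [eta, map_mul, h₁, h₂, h₃, incl_const, and_self]

/-- The factors `uᵢ - uⱼ` and `h` as central elements, with the identity that they satisfy. -/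
theorem RLLData.exists_arnold : ∃ Δ Δ₁ Δ₂ η η₁ η₂ : Subring.center (Three B),
    (Δ : Three B) = incl₁₂ (del ε₁ ε₂ (-d.tau ε₁ ε₂)) ∧
    (Δ₁ : Three B) = incl₁₃ (del ε₁ ε₃ (-d.tau ε₁ ε₃)) ∧
    (Δ₂ : Three B) = incl₂₃ (del ε₂ ε₃ (-d.tau ε₂ ε₃)) ∧
    (η : Three B) = incl₁₂ (eta d.h ε₁ ε₂) ∧ (η₁ : Three B) = incl₁₃ (eta d.h ε₁ ε₃) ∧
    (η₂ : Three B) = incl₂₃ (eta d.h ε₂ ε₃) ∧ η * η₂ * Δ₁ = η * η₁ * Δ₂ + η₁ * η₂ * Δ := by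
  have cen : ∀ x : Three B, (∀ G, Commute x G) → x ∈ Subring.center (Three B) := fun x hx =>
    Subring.mem_center_iff.2 fun y => (hx y).symm
  have hv := var_commute (B := B) ε₁ ε₂ ε₃
  let k₁ : Subring.center (Three B) := ⟨var₁ (kap B ε₁), cen _ fun G => (hv G).1⟩
  let u₁ : Subring.center (Three B) := ⟨var₁ (lam B ε₁), cen _ fun G => (hv G).2.1⟩
  let k₂ : Subring.center (Three B) := ⟨var₂ (kap B ε₂), cen _ fun G => (hv G).2.2.1⟩
  let u₂ : Subring.center (Three B) := ⟨var₂ (lam B ε₂), cen _ fun G => (hv G).2.2.2.1⟩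
  let k₃ : Subring.center (Three B) := ⟨var₃ (kap B ε₃), cen _ fun G => (hv G).2.2.2.2.1⟩
  let u₃ : Subring.center (Three B) := ⟨var₃ (lam B ε₃), cen _ fun G => (hv G).2.2.2.2.2⟩
  let η₀ : Subring.center (Three B) := ⟨const₃ d.h, cen _ (const₃_commute d.h_center)⟩
  let t : Sgn → Sgn → Subring.center (Three B) := fun ε ε' =>
    ⟨const₃ (-d.tau ε ε'), cen _ (const₃_commute (neg_center (d.tau_center ε ε')))⟩
  have ht : t ε₁ ε₃ = t ε₁ ε₂ + t ε₂ ε₃ := Subtype.ext (by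
    change const₃ _ = const₃ _ + const₃ _
    rw [d.tau_add ε₁ ε₂ ε₃]
    simp only [const₃, map_neg, map_add]
    abel)
  obtain ⟨d₁, -, -⟩ := incl_del ε₁ ε₂ ε₃ (-d.tau ε₁ ε₂)
  obtain ⟨-, d₂, -⟩ := incl_del ε₁ ε₂ ε₃ (-d.tau ε₁ ε₃)
  obtain ⟨-, -, d₃⟩ := incl_del ε₁ ε₂ ε₃ (-d.tau ε₂ ε₃)
  obtain ⟨e₁, e₂, e₃⟩ := incl_eta ε₁ ε₂ ε₃ d.h
  refine ⟨u₁ * k₂ - k₁ * u₂ - t ε₁ ε₂ * (k₁ * k₂), u₁ * k₃ - k₁ * u₃ - t ε₁ ε₃ * (k₁ * k₃),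
    u₂ * k₃ - k₂ * u₃ - t ε₂ ε₃ * (k₂ * k₃), η₀ * (k₁ * k₂), η₀ * (k₁ * k₃), η₀ * (k₂ * k₃),
    d₁.symm, d₂.symm, d₃.symm, e₁.symm, e₂.symm, e₃.symm, ?_⟩
  rw [ht]
  ring

variable {ε₁ ε₂ ε₃} in
theorem RLLData.three_eq_zero {Δ Δ₁ Δ₂ : Subring.center (Three B)}
    (h : (Δ : Three B) = incl₁₂ (del ε₁ ε₂ (-d.tau ε₁ ε₂)))
    (h₁ : (Δ₁ : Three B) = incl₁₃ (del ε₁ ε₃ (-d.tau ε₁ ε₃)))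
    (h₂ : (Δ₂ : Three B) = incl₂₃ (del ε₂ ε₃ (-d.tau ε₂ ε₃))) {G : Three B}
    (hG : (Δ * Δ₁ * Δ₂) • G = 0) : G = 0 := by
  rw [Subring.smul_def, Subring.coe_mul, Subring.coe_mul, h, h₁, h₂, smul_eq_mul, mul_assoc,
    mul_assoc] at hG
  exact (incl_del_regular ε₁ ε₂ ε₃ (d.tau_nil _ _).neg).2.2
    ((incl_del_regular ε₁ ε₂ ε₃ (d.tau_nil _ _).neg).2.1
      ((incl_del_regular ε₁ ε₂ ε₃ (d.tau_nil _ _).neg).1 hG))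

theorem fn₃_add (G H : Three B) (a b c : ℤ) :
    fn₃ ε₁ ε₂ ε₃ (G + H) a b c = fn₃ ε₁ ε₂ ε₃ G a b c + fn₃ ε₁ ε₂ ε₃ H a b c := by
  simp only [fn₃, ser_add]

/-- The coefficients of the cubic expression in three variables. -/
theorem serre_of_three {x₁ x₂ y : PowerSeries B}
    (e : (var₁ x₁ * var₂ x₂ * var₃ y - 2 * (var₁ x₁ * var₃ y * var₂ x₂) + var₃ y * var₁ x₁ * var₂ x₂) +
      (var₂ x₂ * var₁ x₁ * var₃ y - 2 * (var₂ x₂ * var₃ y * var₁ x₁) +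
        var₃ y * var₂ x₂ * var₁ x₁) = 0) (a b c : ℤ) :
    (ser ε₁ x₁ a * ser ε₂ x₂ b * ser ε₃ y c - 2 * (ser ε₁ x₁ a * ser ε₃ y c * ser ε₂ x₂ b) +
      ser ε₃ y c * ser ε₁ x₁ a * ser ε₂ x₂ b) +
    (ser ε₂ x₂ b * ser ε₁ x₁ a * ser ε₃ y c - 2 * (ser ε₂ x₂ b * ser ε₃ y c * ser ε₁ x₁ a) +
      ser ε₃ y c * ser ε₂ x₂ b * ser ε₁ x₁ a) = 0 := by
  have h := congrArg (fun G => fn₃ ε₁ ε₂ ε₃ G a b c) e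
  simp only [two_mul, fn₃_add, fn₃_sub] at h
  simp only [fn₃, var₁_eq, var₂_eq, var₃_eq, ser_mul_C, ser_C_mul, ser_map, ser_zero,
    PowerSeries.map_C] at h
  simp only [mul_assoc, ser_mul_C, ser_C_mul, ser_map, PowerSeries.map_C] at h
  simp only [← mul_assoc, ser_mul_C, ser_C_mul, ser_map] at h
  simpa only [two_mul, mul_assoc] using h

variable {i j l : Fin n}

/-- The Serre relation holds already between the components `e_{ij}`, for every choice of the three signs.
It is multiplied by the three factors `uᵢ - uⱼ - t`, which are regular, to use the quadratic relations. -/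
theorem RLLData.e_e_serre_succ (h : j.val = i.val + 1) (h' : l.val = i.val + 2) :
    (var₁ ((d.D ε₁).E i j) * var₂ ((d.D ε₂).E i j) * var₃ ((d.D ε₃).E j l) -
        2 * (var₁ ((d.D ε₁).E i j) * var₃ ((d.D ε₃).E j l) * var₂ ((d.D ε₂).E i j)) +
        var₃ ((d.D ε₃).E j l) * var₁ ((d.D ε₁).E i j) * var₂ ((d.D ε₂).E i j)) +
      (var₂ ((d.D ε₂).E i j) * var₁ ((d.D ε₁).E i j) * var₃ ((d.D ε₃).E j l) -
        2 * (var₂ ((d.D ε₂).E i j) * var₃ ((d.D ε₃).E j l) * var₁ ((d.D ε₁).E i j)) +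
        var₃ ((d.D ε₃).E j l) * var₂ ((d.D ε₂).E i j) * var₁ ((d.D ε₁).E i j)) = 0 := by
  obtain ⟨Δ, Δ₁, Δ₂, η, η₁, η₂, hΔ, hΔ₁, hΔ₂, hη, hη₁, hη₂, arnold⟩ := d.exists_arnold ε₁ ε₂ ε₃
  refine d.three_eq_zero hΔ hΔ₁ hΔ₂ (smul_serre arnold (a₃ := var₃ ((d.D ε₃).E i j))
    (c₁ := var₁ ((d.D ε₁).E i l)) (c₂ := var₂ ((d.D ε₂).E i l)) (c₃ := var₃ ((d.D ε₃).E i l))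
    ?_ ?_ ?_ ?_ ?_ ?_ ?_ ?_ ?_) <;>
    simp only [Subring.smul_def, smul_eq_mul, hΔ, hΔ₁, hΔ₂, hη, hη₁, hη₂]
  · have := congrArg incl₁₂ (d.e_e_self ε₁ ε₂ h)
    simpa only [map_mul, map_sub, map_neg, incl₁₂_fst, incl₁₂_snd] using this
  · have := congrArg incl₁₃ (d.e_e_self ε₁ ε₃ h)
    simpa only [map_mul, map_sub, map_neg, incl₁₃_fst, incl₁₃_snd] using this
  · have := congrArg incl₂₃ (d.e_e_self ε₂ ε₃ h)
    simpa only [map_mul, map_sub, map_neg, incl₂₃_fst, incl₂₃_snd] using this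
  · have := congrArg incl₁₂ (d.e_e_row ε₁ ε₂ h h')
    simpa only [map_mul, map_sub, map_neg, incl₁₂_fst, incl₁₂_snd] using this
  · have := congrArg incl₁₂ (d.e_e_row_swap ε₁ ε₂ h h')
    simpa only [map_mul, map_sub, map_neg, incl₁₂_fst, incl₁₂_snd] using this
  · have := congrArg incl₁₃ (d.e_e_row ε₁ ε₃ h h')
    simpa only [map_mul, map_sub, map_neg, incl₁₃_fst, incl₁₃_snd] using this
  · have := congrArg incl₂₃ (d.e_e_row ε₂ ε₃ h h')
    simpa only [map_mul, map_sub, map_neg, incl₂₃_fst, incl₂₃_snd] using this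
  · have := congrArg incl₁₃ (d.e_e_succ ε₁ ε₃ h h')
    simpa only [map_mul, map_sub, map_neg, incl₁₃_fst, incl₁₃_snd] using this
  · have := congrArg incl₂₃ (d.e_e_succ ε₂ ε₃ h h')
    simpa only [map_mul, map_sub, map_neg, incl₂₃_fst, incl₂₃_snd] using this

/-- The other Serre relation. It is of the same form in the opposite ring, with the last column in place
of the first row. -/
theorem RLLData.e_e_serre_pred (h : j.val = i.val + 1) (h' : l.val = i.val + 2) :
    (var₁ ((d.D ε₁).E j l) * var₂ ((d.D ε₂).E j l) * var₃ ((d.D ε₃).E i j) -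
        2 * (var₁ ((d.D ε₁).E j l) * var₃ ((d.D ε₃).E i j) * var₂ ((d.D ε₂).E j l)) +
        var₃ ((d.D ε₃).E i j) * var₁ ((d.D ε₁).E j l) * var₂ ((d.D ε₂).E j l)) +
      (var₂ ((d.D ε₂).E j l) * var₁ ((d.D ε₁).E j l) * var₃ ((d.D ε₃).E i j) -
        2 * (var₂ ((d.D ε₂).E j l) * var₃ ((d.D ε₃).E i j) * var₁ ((d.D ε₁).E j l)) +
        var₃ ((d.D ε₃).E i j) * var₂ ((d.D ε₂).E j l) * var₁ ((d.D ε₁).E j l)) = 0 := by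
  obtain ⟨Δ, Δ₁, Δ₂, η, η₁, η₂, hΔ, hΔ₁, hΔ₂, hη, hη₁, hη₂, arnold⟩ := d.exists_arnold ε₁ ε₂ ε₃
  refine d.three_eq_zero hΔ hΔ₁ hΔ₂ (smul_serre_op arnold (a₃ := var₃ ((d.D ε₃).E j l))
    (c₁ := var₁ ((d.D ε₁).Y i j l)) (c₂ := var₂ ((d.D ε₂).Y i j l)) (c₃ := var₃ ((d.D ε₃).Y i j l))
    ?_ ?_ ?_ ?_ ?_ ?_ ?_ ?_ ?_) <;>
    simp only [Subring.smul_def, smul_eq_mul, hΔ, hΔ₁, hΔ₂, hη, hη₁, hη₂]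
  · have := congrArg incl₁₂ (d.e_e_self ε₁ ε₂ (i := j) (j := l) (by omega))
    simpa only [map_mul, map_sub, map_neg, incl₁₂_fst, incl₁₂_snd] using this
  · have := congrArg incl₁₃ (d.e_e_self ε₁ ε₃ (i := j) (j := l) (by omega))
    simpa only [map_mul, map_sub, map_neg, incl₁₃_fst, incl₁₃_snd] using this
  · have := congrArg incl₂₃ (d.e_e_self ε₂ ε₃ (i := j) (j := l) (by omega))
    simpa only [map_mul, map_sub, map_neg, incl₂₃_fst, incl₂₃_snd] using this
  · have := congrArg incl₁₂ (d.e_e_column ε₁ ε₂ h h')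
    simpa only [map_mul, map_sub, map_neg, incl₁₂_fst, incl₁₂_snd] using this
  · have := congrArg incl₁₂ (d.e_e_column_swap ε₁ ε₂ h h')
    simpa only [map_mul, map_sub, map_neg, incl₁₂_fst, incl₁₂_snd] using this
  · have := congrArg incl₁₃ (d.e_e_column ε₁ ε₃ h h')
    simpa only [map_mul, map_sub, map_neg, incl₁₃_fst, incl₁₃_snd] using this
  · have := congrArg incl₂₃ (d.e_e_column ε₂ ε₃ h h')
    simpa only [map_mul, map_sub, map_neg, incl₂₃_fst, incl₂₃_snd] using this
  · have := congrArg incl₁₃ (d.e_e_pred ε₁ ε₃ h h')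
    simpa only [map_mul, map_sub, map_neg, incl₁₃_fst, incl₁₃_snd] using this
  · have := congrArg incl₂₃ (d.e_e_pred ε₂ ε₃ h h')
    simpa only [map_mul, map_sub, map_neg, incl₂₃_fst, incl₂₃_snd] using this

end SerreSeries

/-! ### Shifts of formal series -/

section Shift

variable {B : Type u} [Ring B]

/-- The coefficients of `G(u + s)`, for `s ^ N = 0`. -/
def sh (N : ℕ) (s : B) (G : ℤ → B) (m : ℤ) : B :=
  ∑ i ∈ Finset.range N, (Ring.choose (m + i) i : ℤ) • (s ^ i * G (m + i))

variable {N : ℕ} {s : B}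

theorem sh_sub (G H : ℤ → B) (m : ℤ) : sh N s (fun m => G m - H m) m = sh N s G m - sh N s H m := by
  simp only [sh, mul_sub, smul_sub, Finset.sum_sub_distrib]

theorem sh_add (G H : ℤ → B) (m : ℤ) : sh N s (fun m => G m + H m) m = sh N s G m + sh N s H m := by
  simp only [sh, mul_add, smul_add, Finset.sum_add_distrib]

theorem sh_mul_left (hs : s ∈ Subring.center B) (x : B) (G : ℤ → B) (m : ℤ) :
    sh N s (fun m => x * G m) m = x * sh N s G m := by
  simp only [sh, Finset.mul_sum]
  refine Finset.sum_congr rfl fun i _ => ?_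
  rw [mul_smul_comm, ← mul_assoc, ← mul_assoc, Subring.mem_center_iff.1 (pow_mem hs i)]

theorem sh_mul_right (x : B) (G : ℤ → B) (m : ℤ) :
    sh N s (fun m => G m * x) m = sh N s G m * x := by
  simp only [sh, Finset.sum_mul, smul_mul_assoc, mul_assoc]

theorem choose_add_natCast (m : ℤ) {i : ℕ} (h : m < 0) (h' : 0 ≤ m + i) :
    Ring.choose (m + i : ℤ) i = 0 := by
  obtain ⟨k, hk⟩ := Int.eq_ofNat_of_zero_le h'
  rw [hk, Ring.choose_natCast, Nat.choose_eq_zero_of_lt (by omega)]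
  rfl

theorem sh_pow_zero (h0 : 0 < N) (G : ℤ → B) : sh N s G (-1) = G (-1) := by
  rw [sh, Finset.sum_eq_single_of_mem 0 (Finset.mem_range.2 h0)]
  · simp
  · intro i _ hi
    rw [choose_add_natCast (-1) (by omega) (by omega), zero_smul]

theorem sh_const (h0 : 0 < N) (x : B) (m : ℤ) :
    sh N s (fun m => if m = 0 then x else 0) m = if m = 0 then x else 0 := by
  rw [sh, Finset.sum_eq_single_of_mem 0 (Finset.mem_range.2 h0)]
  · simp
  · intro i _ hi
    by_cases hm : m + i = 0
    · rw [hm, Ring.choose_zero_pos _ (by omega), zero_smul]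
    · rw [if_neg hm, mul_zero, smul_zero]

theorem sh_outside (ε : Sgn) {G : ℤ → B} (hG : ∀ m, ε.Outside m → G m = 0) {m : ℤ}
    (hm : ε.Outside m) : sh N s G m = 0 := by
  refine Finset.sum_eq_zero fun i _ => ?_
  cases ε
  · rw [hG (m + i) (show 0 < m + i by have : 0 < m := hm; omega), mul_zero, smul_zero]
  · rcases lt_or_ge (m + i) 0 with h | h
    · rw [hG (m + i) h, mul_zero, smul_zero]
    · rw [choose_add_natCast m hm h, zero_smul]

/-- Multiplication by `u` becomes multiplication by `u + s`. -/
theorem sh_mul_var (hs : s ^ N = 0) (G : ℤ → B) (m : ℤ) :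
    sh N s (fun m => G (m - 1)) m = sh N s G (m - 1) + s * sh N s G m := by
  have h : ∀ K : ℕ, sh (K + 1) s (fun m => G (m - 1)) m = sh (K + 1) s G (m - 1) + s * sh K s G m := by
    intro K
    induction K with
    | zero => simp [sh]
    | succ K ih =>
      have e : ∀ (K : ℕ) (G : ℤ → B) (m : ℤ), sh (K + 1) s G m =
          sh K s G m + (Ring.choose (m + K) K : ℤ) • (s ^ K * G (m + K)) := fun K G m =>
        Finset.sum_range_succ _ _
      rw [e (K + 1), e (K + 1) G (m - 1), ih, e K G m, mul_add]
      have p : (Ring.choose (m + (K + 1 : ℕ)) (K + 1) : ℤ) =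
          Ring.choose (m + K) K + Ring.choose (m - 1 + (K + 1 : ℕ)) (K + 1) := by
        have := Ring.choose_succ_succ (m + K) K
        rw [show m + ((K + 1 : ℕ) : ℤ) = m + K + 1 by push_cast; ring, this,
          show m - 1 + ((K + 1 : ℕ) : ℤ) = m + K by push_cast; ring]
      rw [p, add_smul, mul_smul_comm, ← mul_assoc, ← pow_succ',
        show m + ((K + 1 : ℕ) : ℤ) - 1 = m + K by push_cast; ring,
        show m - 1 + ((K + 1 : ℕ) : ℤ) = m + K by push_cast; ring]
      abel
  cases N with
  | zero =>
    rw [pow_zero] at hs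
    have : ∀ x : B, x = 0 := fun x => by rw [← one_mul x, hs, zero_mul]
    rw [this (sh _ _ _ _), this (_ + _)]
  | succ K =>
    rw [h]
    congr 1
    conv_rhs => rw [sh, Finset.sum_range_succ]
    rw [mul_add, mul_smul_comm, ← mul_assoc s, ← pow_succ', hs, zero_mul, smul_zero, add_zero]
    rfl

/-- The coefficients of `F(u + s, v + s')`. -/
def sh₂ (N : ℕ) (s s' : B) (F : ℤ → ℤ → B) (a b : ℤ) : B :=
  sh N s (fun a => sh N s' (F a) b) a

variable {s' : B}

theorem sh₂_sub (F G : ℤ → ℤ → B) (a b : ℤ) :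
    sh₂ N s s' (fun a b => F a b - G a b) a b = sh₂ N s s' F a b - sh₂ N s s' G a b := by
  simp only [sh₂, sh_sub]

theorem sh₂_mul_left (hc : s ∈ Subring.center B) (hc' : s' ∈ Subring.center B) (x : B)
    (F : ℤ → ℤ → B) (a b : ℤ) : sh₂ N s s' (fun a b => x * F a b) a b = x * sh₂ N s s' F a b := by
  simp only [sh₂, sh_mul_left hc, sh_mul_left hc']

theorem sh₂_mul (hc' : s' ∈ Subring.center B) (G G' : ℤ → B) (a b : ℤ) :
    sh₂ N s s' (fun a b => G a * G' b) a b = sh N s G a * sh N s' G' b := by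
  simp only [sh₂, sh_mul_left hc', sh_mul_right]

theorem sh₂_mul_swap (hc : s ∈ Subring.center B) (G G' : ℤ → B) (a b : ℤ) :
    sh₂ N s s' (fun a b => G' b * G a) a b = sh N s' G' b * sh N s G a := by
  simp only [sh₂, sh_mul_left hc, sh_mul_right]

theorem sh_zero (G : ℤ → B) (h : ∀ m, G m = 0) (m : ℤ) : sh N s G m = 0 := by
  simp only [sh, h, mul_zero, smul_zero, Finset.sum_const_zero]

theorem sh₂_inU (h0 : 0 < N) (G : ℤ → B) (a b : ℤ) :
    sh₂ N s s' (inU G) a b = inU (sh N s G) a b := by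
  have e : ∀ a, sh N s' (fun b => if b = 0 then G a else 0) b = if b = 0 then G a else 0 := fun a =>
    sh_const h0 _ _
  change sh N s (fun a => sh N s' (fun b => if b = 0 then G a else 0) b) a =
    if b = 0 then sh N s G a else 0
  simp only [e]
  split_ifs with h
  · rfl
  · exact sh_zero _ (fun _ => rfl) a

theorem sh₂_inV (h0 : 0 < N) (G : ℤ → B) (a b : ℤ) :
    sh₂ N s s' (inV G) a b = inV (sh N s' G) a b := by
  have : ∀ a : ℤ, sh N s' (fun b => if a = 0 then G b else 0) b = if a = 0 then sh N s' G b else 0 :=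
    fun a => by
      split_ifs
      · rfl
      · exact sh_zero _ (fun _ => rfl) b
  change sh N s (fun a => sh N s' (fun b => if a = 0 then G b else 0) b) a = _
  simp only [this]
  exact sh_const h0 _ _

/-- A shift of both variables moves the zero of a linear factor. -/
theorem sh₂_mulLin (hs : s ^ N = 0) (hs' : s' ^ N = 0) (hc : s ∈ Subring.center B)
    (hc' : s' ∈ Subring.center B) (t : B) (F : ℤ → ℤ → B) :
    sh₂ N s s' (mulLin t F) = mulLin (t - s + s') (sh₂ N s s' F) := by
  ext a b
  have e1 : ∀ a, sh N s' (fun b => mulLin t F a b) b =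
      sh N s' (F (a - 1)) b - (sh N s' (F a) (b - 1) + s' * sh N s' (F a) b) - t * sh N s' (F a) b :=
    fun a => by
      simp only [mulLin, sh_sub, sh_mul_left hc', sh_mul_var hs']
  rw [sh₂]
  change sh N s (fun a => sh N s' (fun b => mulLin t F a b) b) a = _
  simp only [e1, sh_sub, sh_add, sh_mul_left hc]
  rw [sh_mul_var hs (fun a => sh N s' (F a) b) a]
  simp only [mulLin, sh₂, add_mul, sub_mul]
  abel

theorem sh_mem_span (hs : s ∈ Subring.center B) (G : ℤ → B) (m : ℤ) :
    sh N s G m ∈ Submodule.span (Subring.center B) (Set.range G) := by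
  refine Submodule.sum_mem _ fun i _ => ?_
  have h : (⟨s ^ i, pow_mem hs i⟩ : Subring.center B) • G (m + i) ∈
      Submodule.span (Subring.center B) (Set.range G) :=
    Submodule.smul_mem _ _ (Submodule.subset_span ⟨_, rfl⟩)
  exact zsmul_mem h _

end Shift

/-! ### Relations between the currents -/

section Currents

variable {B : Type u} [Ring B] {n : ℕ} (d : RLLData n B) {N : ℕ} (ε ε' : Sgn)

/-- The shift of the argument of `e^ε(u)` in the current. -/
def RLLData.sig (ε : Sgn) : B := -(ε.val • d.s)

theorem RLLData.sig_center : d.sig ε ∈ Subring.center B := neg_mem (zsmul_mem d.s_center _)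

variable {d} in
theorem RLLData.sig_pow (hs : d.s ^ N = 0) : d.sig ε ^ N = 0 := by
  rw [RLLData.sig, neg_pow, smul_pow, hs, smul_zero, mul_zero]

theorem RLLData.tau_sig : -d.tau ε ε' - d.sig ε + d.sig ε' = 0 := by
  rw [RLLData.tau, RLLData.sig, RLLData.sig, sub_smul]
  abel

/-- The coefficients of `φ(u ∓ h c / 4)`. -/
def RLLData.shSer (N : ℕ) (ε : Sgn) (φ : PowerSeries B) : ℤ → B := sh N (d.sig ε) (ser ε φ)

/-- The coefficients of a series in `u` and `v`, with the shifts of the currents. -/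
def RLLData.shFn (N : ℕ) (ε ε' : Sgn) (G : Two B) : ℤ → ℤ → B :=
  sh₂ N (d.sig ε) (d.sig ε') (fn ε ε' G)

variable {ε ε'}

theorem RLLData.shFn_sub (G H : Two B) (a b : ℤ) :
    d.shFn N ε ε' (G - H) a b = d.shFn N ε ε' G a b - d.shFn N ε ε' H a b := by
  rw [RLLData.shFn, RLLData.shFn, RLLData.shFn, ← sh₂_sub]
  congr 1
  ext a b
  exact fn_sub ε ε' G H a b

theorem RLLData.shFn_neg (G : Two B) (a b : ℤ) :
    d.shFn N ε ε' (-G) a b = -d.shFn N ε ε' G a b := by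
  have h0 := d.shFn_sub (N := N) (ε := ε) (ε' := ε') 0 0 a b
  have h1 := d.shFn_sub (N := N) (ε := ε) (ε' := ε') 0 G a b
  rw [sub_self, sub_self] at h0
  rwa [h0, zero_sub, zero_sub] at h1

theorem RLLData.shFn_fst_mul_snd (φ ψ : PowerSeries B) (a b : ℤ) :
    d.shFn N ε ε' (fst φ * snd ψ) a b = d.shSer N ε φ a * d.shSer N ε' ψ b := by
  rw [RLLData.shFn, RLLData.shSer, RLLData.shSer, ← sh₂_mul (d.sig_center ε')]
  congr 1
  ext a b
  exact fn_fst_mul_snd ε ε' φ ψ a b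

theorem RLLData.shFn_snd_mul_fst (φ ψ : PowerSeries B) (a b : ℤ) :
    d.shFn N ε ε' (snd ψ * fst φ) a b = d.shSer N ε' ψ b * d.shSer N ε φ a := by
  rw [RLLData.shFn, RLLData.shSer, RLLData.shSer, ← sh₂_mul_swap (d.sig_center ε)]
  congr 1
  ext a b
  exact fn_snd_mul_fst ε ε' φ ψ a b

theorem RLLData.shFn_fst (h0 : 0 < N) (φ : PowerSeries B) (a b : ℤ) :
    d.shFn N ε ε' (fst φ) a b = inU (d.shSer N ε φ) a b := by
  rw [RLLData.shFn, RLLData.shSer, ← sh₂_inU h0]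
  congr 1
  ext a b
  exact fn_fst ε ε' φ a b

theorem RLLData.shFn_snd (h0 : 0 < N) (ψ : PowerSeries B) (a b : ℤ) :
    d.shFn N ε ε' (snd ψ) a b = inV (d.shSer N ε' ψ) a b := by
  rw [RLLData.shFn, RLLData.shSer, ← sh₂_inV h0]
  congr 1
  ext a b
  exact fn_snd ε ε' ψ a b

/-- The shifts of the currents turn all the denominators `u - v ± h c / 2` into `u - v`. -/
theorem RLLData.mulLin_shFn (hs : d.s ^ N = 0) {G H : Two B}
    (e : del ε ε' (-d.tau ε ε') * G = eta d.h ε ε' * H) (a b : ℤ) :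
    mulLin 0 (d.shFn N ε ε' G) a b = d.h * d.shFn N ε ε' H a b := by
  rw [← d.tau_sig ε ε', RLLData.shFn, ← sh₂_mulLin (RLLData.sig_pow ε hs) (RLLData.sig_pow ε' hs)
    (d.sig_center ε) (d.sig_center ε'), RLLData.shFn,
    ← sh₂_mul_left (d.sig_center ε) (d.sig_center ε')]
  congr 1
  ext a b
  exact mulLin_fn_of_eta e a b

/-- The coefficients of the current `e^+_{ij}(u - h c / 4) - e^-_{ij}(u + h c / 4)`. -/
def RLLData.cur (N : ℕ) (i j : Fin n) (m : ℤ) : B :=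
  d.shSer N .plus ((d.D .plus).E i j) m - d.shSer N .minus ((d.D .minus).E i j) m

variable {i j l : Fin n}

/-- The relations of `RLLData.e_e_self` for all signs `ε` and `ε'`, shifted to the common factor `u - v`, add up
with the signs `ε ε'`; the terms in one variable cancel in the sum. -/
theorem RLLData.cur_self (h0 : 0 < N) (hs : d.s ^ N = 0) (h : j.val = i.val + 1) (a b : ℤ) :
    mulLin d.h (fun a b => d.cur N i j a * d.cur N i j b) a b =
      mulLin (-d.h) (fun a b => d.cur N i j b * d.cur N i j a) a b := by
  have key : ∀ ε ε', mulLin 0 (fun a b => d.shSer N ε ((d.D ε).E i j) a *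
      d.shSer N ε' ((d.D ε').E i j) b - d.shSer N ε' ((d.D ε').E i j) b *
        d.shSer N ε ((d.D ε).E i j) a) a b = -(d.h * (
      inU (d.shSer N ε ((d.D ε).E i j * (d.D ε).E i j)) a b -
      d.shSer N ε' ((d.D ε').E i j) b * d.shSer N ε ((d.D ε).E i j) a -
      (d.shSer N ε ((d.D ε).E i j) a * d.shSer N ε' ((d.D ε').E i j) b -
      inV (d.shSer N ε' ((d.D ε').E i j * (d.D ε').E i j)) a b))) := fun ε ε' => by
    have h1 := d.mulLin_shFn hs ((d.e_e_self ε ε' h).trans (mul_neg _ _).symm) a b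
    have e1 : d.shFn N ε ε' (fst ((d.D ε).E i j) * snd ((d.D ε').E i j) -
        snd ((d.D ε').E i j) * fst ((d.D ε).E i j)) = fun a b => d.shSer N ε ((d.D ε).E i j) a *
      d.shSer N ε' ((d.D ε').E i j) b - d.shSer N ε' ((d.D ε').E i j) b *
        d.shSer N ε ((d.D ε).E i j) a := by
      ext a b
      rw [d.shFn_sub, d.shFn_fst_mul_snd, d.shFn_snd_mul_fst]
    rw [e1] at h1
    rw [h1, d.shFn_neg, mul_sub, sub_mul, sub_mul, d.shFn_sub, d.shFn_sub, d.shFn_sub, ← map_mul,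
      ← map_mul, d.shFn_fst h0, d.shFn_snd h0, d.shFn_fst_mul_snd, d.shFn_snd_mul_fst, mul_neg]
  have k1 := key .plus .plus
  have k2 := key .plus .minus
  have k3 := key .minus .plus
  have k4 := key .minus .minus
  simp only [mulLin, RLLData.cur] at k1 k2 k3 k4 ⊢
  linear_combination (norm := noncomm_ring) k1 - k2 - k3 + k4

/-- The alternating sum of the shifted relations `RLLData.e_e_succ`; all terms in one variable cancel. -/
theorem RLLData.cur_succ (h0 : 0 < N) (hs : d.s ^ N = 0) (h : j.val = i.val + 1)
    (h' : l.val = i.val + 2) (a b : ℤ) :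
    mulLin (-d.h) (fun a b => d.cur N i j a * d.cur N j l b) a b =
      mulLin 0 (fun a b => d.cur N j l b * d.cur N i j a) a b := by
  have key : ∀ ε ε', mulLin 0 (fun a b => d.shSer N ε ((d.D ε).E i j) a *
      d.shSer N ε' ((d.D ε').E j l) b - d.shSer N ε' ((d.D ε').E j l) b *
        d.shSer N ε ((d.D ε).E i j) a) a b = d.h * (
      inU (d.shSer N ε ((d.D ε).E i l)) a b - inV (d.shSer N ε' ((d.D ε').E i l)) a b -
      (d.shSer N ε ((d.D ε).E i j) a * d.shSer N ε' ((d.D ε').E j l) b -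
      inV (d.shSer N ε' ((d.D ε').E i j * (d.D ε').E j l)) a b)) := fun ε ε' => by
    have h1 := d.mulLin_shFn hs (d.e_e_succ ε ε' h h') a b
    have e1 : d.shFn N ε ε' (fst ((d.D ε).E i j) * snd ((d.D ε').E j l) -
        snd ((d.D ε').E j l) * fst ((d.D ε).E i j)) = fun a b => d.shSer N ε ((d.D ε).E i j) a *
      d.shSer N ε' ((d.D ε').E j l) b - d.shSer N ε' ((d.D ε').E j l) b *
        d.shSer N ε ((d.D ε).E i j) a := by
      ext a b
      rw [d.shFn_sub, d.shFn_fst_mul_snd, d.shFn_snd_mul_fst]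
    rw [e1] at h1
    rw [h1, d.shFn_sub, d.shFn_sub, sub_mul, d.shFn_sub, ← map_mul, d.shFn_fst h0, d.shFn_snd h0,
      d.shFn_snd h0, d.shFn_fst_mul_snd]
  have k1 := key .plus .plus
  have k2 := key .plus .minus
  have k3 := key .minus .plus
  have k4 := key .minus .minus
  simp only [mulLin, RLLData.cur] at k1 k2 k3 k4 ⊢
  linear_combination (norm := noncomm_ring) k1 - k2 - k3 + k4

theorem RLLData.cur_mem_span (m : ℤ) : d.cur N i j m ∈
    Submodule.span (Subring.center B) {x | ∃ ε m, x = ser ε ((d.D ε).E i j) m} := by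
  refine sub_mem ?_ ?_ <;> refine Submodule.span_mono ?_ (sh_mem_span (d.sig_center _) _ m)
  · rintro _ ⟨m, rfl⟩
    exact ⟨_, m, rfl⟩
  · rintro _ ⟨m, rfl⟩
    exact ⟨_, m, rfl⟩

theorem commute_of_mem_span {S T : Set B} (h : ∀ x ∈ S, ∀ y ∈ T, Commute x y) {x y : B}
    (hx : x ∈ Submodule.span (Subring.center B) S) (hy : y ∈ Submodule.span (Subring.center B) T) :
    Commute x y := by
  induction hx using Submodule.span_induction with
  | mem x hx =>
    induction hy using Submodule.span_induction with
    | mem y hy => exact h x hx y hy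
    | zero => exact Commute.zero_right x
    | add y y' _ _ h h' => exact h.add_right h'
    | smul c y _ h => exact h.smul_right c
  | zero => exact Commute.zero_left y
  | add x x' _ _ h h' => exact h.add_left h'
  | smul c x _ h => exact h.smul_left c

/-- A coefficient of a current is a combination with central coefficients of those of the components, so that
the commutation of the components passes to the currents. -/
theorem RLLData.cur_far {i' j' : Fin n} (h : j.val = i.val + 1)
    (h' : j'.val = i'.val + 1) (hij : i.val + 1 < i'.val ∨ i'.val + 1 < i.val) (a b : ℤ) :
    d.cur N i j a * d.cur N i' j' b = d.cur N i' j' b * d.cur N i j a := by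
  refine commute_of_mem_span ?_ (d.cur_mem_span a) (d.cur_mem_span b)
  rintro _ ⟨ε, m, rfl⟩ _ ⟨ε', m', rfl⟩
  exact d.e_e_far ε ε' h h' hij m m'

/-- The symmetrized cubic Serre expression. -/
def serreSum (x₁ x₂ y : B) : B :=
  (x₁ * x₂ * y - 2 * (x₁ * y * x₂) + y * x₁ * x₂) + (x₂ * x₁ * y - 2 * (x₂ * y * x₁) + y * x₂ * x₁)

/-- The Serre expression is linear in each argument. -/
theorem serreSum_eq_zero_of_mem_span {S T : Set B}
    (h : ∀ x₁ ∈ S, ∀ x₂ ∈ S, ∀ y ∈ T, serreSum x₁ x₂ y = 0) {x₁ x₂ y : B}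
    (h₁ : x₁ ∈ Submodule.span (Subring.center B) S) (h₂ : x₂ ∈ Submodule.span (Subring.center B) S)
    (hy : y ∈ Submodule.span (Subring.center B) T) : serreSum x₁ x₂ y = 0 := by
  induction h₁ using Submodule.span_induction with
  | mem x₁ h₁ =>
    induction h₂ using Submodule.span_induction with
    | mem x₂ h₂ =>
      induction hy using Submodule.span_induction with
      | mem y hy => exact h x₁ h₁ x₂ h₂ y hy
      | zero => simp [serreSum]
      | add y y' _ _ h h' =>
        rw [← add_zero 0]
        nth_rewrite 1 [← h]
        rw [← h']
        simp only [serreSum]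
        noncomm_ring
      | smul c y _ h =>
        rw [← smul_zero c, ← h]
        simp only [serreSum, smul_add, smul_sub, smul_mul_assoc, mul_smul_comm]
    | zero => simp [serreSum]
    | add x x' _ _ h h' =>
      rw [← add_zero 0]
      nth_rewrite 1 [← h]
      rw [← h']
      simp only [serreSum]
      noncomm_ring
    | smul c x _ h =>
      rw [← smul_zero c, ← h]
      simp only [serreSum, smul_add, smul_sub, smul_mul_assoc, mul_smul_comm]
  | zero => simp [serreSum]
  | add x x' _ _ h h' =>
    rw [← add_zero 0]
    nth_rewrite 1 [← h]
    rw [← h']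
    simp only [serreSum]
    noncomm_ring
  | smul c x _ h =>
    rw [← smul_zero c, ← h]
    simp only [serreSum, smul_add, smul_sub, smul_mul_assoc, mul_smul_comm]

theorem RLLData.cur_serre {i' j' : Fin n} (h : j.val = i.val + 1) (h' : j'.val = i'.val + 1)
    (hij : i.val + 1 = i'.val ∨ i'.val + 1 = i.val) (a₁ a₂ b : ℤ) :
    serreSum (d.cur N i j a₁) (d.cur N i j a₂) (d.cur N i' j' b) = 0 := by
  refine serreSum_eq_zero_of_mem_span ?_ (d.cur_mem_span a₁) (d.cur_mem_span a₂) (d.cur_mem_span b)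
  rintro _ ⟨ε₁, m₁, rfl⟩ _ ⟨ε₂, m₂, rfl⟩ _ ⟨ε₃, m₃, rfl⟩
  rcases hij with hij | hij
  · obtain rfl : i' = j := Fin.ext (by omega)
    exact serre_of_three ε₁ ε₂ ε₃ (d.e_e_serre_succ ε₁ ε₂ ε₃ h (by omega)) m₁ m₂ m₃
  · obtain rfl : j' = i := Fin.ext (by omega)
    exact serre_of_three ε₁ ε₂ ε₃ (d.e_e_serre_pred ε₁ ε₂ ε₃ h' (by omega)) m₁ m₂ m₃

/-! #### Conjugation of the currents by the diagonal components -/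

/-- The coefficients of `k_l(u)⁻¹ y k_l(u)`. -/
def RLLData.conj (ε : Sgn) (l : Fin n) (y : B) (a : ℤ) : B :=
  ser ε (Ring.inverse ((d.D ε).k l) * PowerSeries.C y * (d.D ε).k l) a

theorem RLLData.conj_sub (ε : Sgn) (l : Fin n) (y y' : B) (a : ℤ) :
    d.conj ε l (y - y') a = d.conj ε l y a - d.conj ε l y' a := by
  rw [RLLData.conj, map_sub, mul_sub, sub_mul, ser_sub]
  rfl

theorem RLLData.conj_sh (ε : Sgn) (l : Fin n) {s : B} (hs : s ∈ Subring.center B) (G : ℤ → B)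
    (a b : ℤ) : sh N s (fun b => d.conj ε l (G b) a) b = d.conj ε l (sh N s G b) a := by
  let T : B →+ B :=
    { toFun := fun y => d.conj ε l y a
      map_zero' := by simp [RLLData.conj, ser_zero]
      map_add' := fun y y' => by
        rw [RLLData.conj, map_add, mul_add, add_mul, ser_add]
        rfl }
  have hT : ∀ x ∈ Subring.center B, ∀ y, T (x * y) = x * T y := fun x hx y => by
    change ser ε (_ * PowerSeries.C (x * y) * _) a = x * ser ε _ a
    have : ∀ φ : PowerSeries B, φ * PowerSeries.C x = PowerSeries.C x * φ := fun φ => by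
      ext m
      rw [PowerSeries.coeff_C_mul, PowerSeries.coeff_mul_C]
      exact Subring.mem_center_iff.1 hx _
    rw [← ser_C_mul, map_mul, ← mul_assoc, this, mul_assoc (PowerSeries.C x),
      mul_assoc (PowerSeries.C x)]
  change _ = T _
  rw [sh, sh, map_sum]
  refine Finset.sum_congr rfl fun i _ => ?_
  rw [map_zsmul, hT _ (pow_mem hs i)]
  rfl

theorem sh_shift_zero (h0 : 0 < N) (G : ℤ → B) (m : ℤ) : sh N 0 G m = G m := by
  rw [sh, Finset.sum_eq_single_of_mem 0 (Finset.mem_range.2 h0)]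
  · simp
  · intro i _ hi
    rw [zero_pow hi, zero_mul, smul_zero]

theorem RLLData.mulLin_conj_sub (h0 : 0 < N) (hs : d.s ^ N = 0) {θ : B}
    (e : ∀ ε', del ε ε' (-d.tau ε ε') * (fst (Ring.inverse ((d.D ε).k l)) * snd ((d.D ε').E i j) *
        fst ((d.D ε).k l) - snd ((d.D ε').E i j)) =
      eta θ ε ε' * (snd ((d.D ε').E i j) - fst ((d.D ε).E i j))) (a b : ℤ) :
    mulLin (-(ε.val • d.s)) (fun a b => d.conj ε l (d.cur N i j b) a) a b =
      mulLin (-(ε.val • d.s) - θ) (inV (d.cur N i j)) a b := by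
  have key : ∀ ε', mulLin (-(ε.val • d.s)) (fun a b => d.conj ε l (d.shSer N ε' ((d.D ε').E i j) b) a -
      inV (d.shSer N ε' ((d.D ε').E i j)) a b) a b =
      θ * (inV (d.shSer N ε' ((d.D ε').E i j)) a b - inU (ser ε ((d.D ε).E i j)) a b) := fun ε' => by
    have ht : -d.tau ε ε' - 0 + d.sig ε' = -(ε.val • d.s) := by
      rw [RLLData.tau, RLLData.sig, sub_smul]
      abel
    have h1 : sh₂ N 0 (d.sig ε') (mulLin (-d.tau ε ε') (fn ε ε' (fst (Ring.inverse ((d.D ε).k l)) *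
        snd ((d.D ε').E i j) * fst ((d.D ε).k l) - snd ((d.D ε').E i j)))) a b =
        sh₂ N 0 (d.sig ε') (fun a b => θ * (fn ε ε' (snd ((d.D ε').E i j)) a b -
          fn ε ε' (fst ((d.D ε).E i j)) a b)) a b := by
      congr 1
      ext a b
      rw [mulLin_fn_of_eta (e ε'), fn_sub]
    rw [sh₂_mulLin (zero_pow h0.ne') (RLLData.sig_pow ε' hs) (zero_mem _) (d.sig_center ε'), ht,
      sh₂_mul_left (zero_mem _) (d.sig_center ε'), sh₂_sub] at h1
    have e2 : fn ε ε' (fst (Ring.inverse ((d.D ε).k l)) *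
        snd ((d.D ε').E i j) * fst ((d.D ε).k l) - snd ((d.D ε').E i j)) =
        fun a b => d.conj ε l (ser ε' ((d.D ε').E i j) b) a - inV (ser ε' ((d.D ε').E i j)) a b := by
      ext a b
      rw [fn_sub, ser_fst_mul_snd_mul_fst, fn_snd]
      rfl
    have e3 : sh₂ N 0 (d.sig ε') (fun a b => d.conj ε l (ser ε' ((d.D ε').E i j) b) a -
        inV (ser ε' ((d.D ε').E i j)) a b) =
        fun a b => d.conj ε l (d.shSer N ε' ((d.D ε').E i j) b) a -
        inV (d.shSer N ε' ((d.D ε').E i j)) a b := by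
      ext a b
      rw [sh₂_sub, sh₂_inV h0]
      congr 1
      rw [sh₂, sh_shift_zero h0, d.conj_sh ε l (d.sig_center ε')]
      rfl
    rw [e2, e3] at h1
    have e4 : sh N 0 (ser ε ((d.D ε).E i j)) = ser ε ((d.D ε).E i j) :=
      funext (sh_shift_zero h0 _)
    rw [h1]
    congr 2
    · rw [RLLData.shSer, ← sh₂_inV h0]
      congr 1
      ext a b
      exact fn_snd _ _ _ _ _
    · rw [← e4, ← sh₂_inU (s' := d.sig ε') h0]
      congr 1
      ext a b
      exact fn_fst _ _ _ _ _
  have k1 := key .plus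
  have k2 := key .minus
  have e : ∀ b, d.conj ε l (d.cur N i j b) = fun a => d.conj ε l (d.shSer N .plus ((d.D .plus).E i j) b) a -
      d.conj ε l (d.shSer N .minus ((d.D .minus).E i j) b) a := fun b => by
    ext a
    exact d.conj_sub ε l _ _ a
  have e' : ∀ a b, inV (d.cur N i j) a b = inV (d.shSer N .plus ((d.D .plus).E i j)) a b -
      inV (d.shSer N .minus ((d.D .minus).E i j)) a b := fun a b => by
    simp only [inV, RLLData.cur]
    split_ifs <;> simp
  simp only [mulLin, e, e'] at k1 k2 ⊢
  linear_combination (norm := noncomm_ring) k1 - k2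

theorem RLLData.mulLin_conj_left (h0 : 0 < N) (hs : d.s ^ N = 0) (ε : Sgn) (h : j.val = i.val + 1)
    (a b : ℤ) : mulLin (-(ε.val • d.s)) (fun a b => d.conj ε i (d.cur N i j b) a) a b =
      mulLin (-(ε.val • d.s) - d.h) (inV (d.cur N i j)) a b :=
  d.mulLin_conj_sub h0 hs (fun ε' => d.conj_left ε ε' h) a b

theorem RLLData.mulLin_conj_right (h0 : 0 < N) (hs : d.s ^ N = 0) (ε : Sgn) (h : j.val = i.val + 1)
    (a b : ℤ) : mulLin (-(ε.val • d.s)) (fun a b => d.conj ε j (d.cur N i j b) a) a b =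
      mulLin (-(ε.val • d.s) + d.h) (inV (d.cur N i j)) a b := by
  rw [← sub_neg_eq_add]
  refine d.mulLin_conj_sub h0 hs (fun ε' => ?_) a b
  rw [d.conj_right ε ε' h, eta_neg, neg_mul, ← mul_neg, neg_sub]

theorem RLLData.conj_cur_far (ε : Sgn) (h : j.val = i.val + 1) (h1 : l ≠ i) (h2 : l ≠ j) (a b : ℤ) :
    d.conj ε l (d.cur N i j b) a = inV (d.cur N i j) a b := by
  have key : ∀ ε', d.conj ε l (d.shSer N ε' ((d.D ε').E i j) b) a =
      inV (d.shSer N ε' ((d.D ε').E i j)) a b := fun ε' => by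
    rw [RLLData.shSer, ← d.conj_sh ε l (d.sig_center ε')]
    have e : ∀ b, d.conj ε l (ser ε' ((d.D ε').E i j) b) a = if a = 0 then ser ε' ((d.D ε').E i j) b
        else 0 := fun b => by
      rw [RLLData.conj, ← ser_fst_mul_snd_mul_fst, d.conj_far ε ε' h h1 h2, fn_snd]
    simp only [e, inV]
    split_ifs
    · rfl
    · exact sh_zero _ (fun _ => rfl) b
  rw [RLLData.cur, d.conj_sub, key, key]
  simp only [inV, RLLData.cur]
  split_ifs <;> simp

end Currents

/-! #### The commutator of the two kinds of currents -/

section Commutator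

variable {B : Type u} [Ring B]

theorem eq_zero_of_mulLin_mulLin (ε : Sgn) {t t' : B} (ht : IsNilpotent t) (ht' : IsNilpotent t')
    {F : ℤ → ℤ → B} (hF : ∀ a b, ε.Outside a → F a b = 0)
    (h : ∀ a b, mulLin t' (mulLin t F) a b = 0) : F = 0 := by
  refine eq_zero_of_mulLin ε ht hF fun a b => ?_
  have h1 : (fun a b => mulLin t F (a + ε.deg) (b + 0)) = 0 := by
    refine eq_zero_of_mulLin ε ht' (fun a b ha => ?_) fun a b => ?_
    · cases ε
      · have ha : 0 < a := ha
        simp only [mulLin, Sgn.deg, add_sub_cancel_right, hF a _ ha,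
          hF (a + 1) _ (show 0 < a + 1 by omega), mul_zero, sub_zero]
      · have ha : a < 0 := ha
        simp only [mulLin, Sgn.deg, add_zero, hF a _ ha, hF (a - 1) _ (show a - 1 < 0 by omega),
          mul_zero, sub_zero]
    · rw [mulLin_translate, h]
  have h2 := congrFun (congrFun h1 (a - ε.deg)) b
  simpa using h2

theorem mulLin_comm {s t : B} (h : Commute s t) (F : ℤ → ℤ → B) :
    mulLin s (mulLin t F) = mulLin t (mulLin s F) := by
  ext a b
  have e : ∀ x, s * (t * x) = t * (s * x) := fun x => by rw [← mul_assoc, h.eq, mul_assoc]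
  simp only [mulLin, mul_sub, e]
  abel

theorem mulLin_mul_left {h : B} (hh : h ∈ Subring.center B) (t : B) (F : ℤ → ℤ → B) (a b : ℤ) :
    mulLin t (fun a b => h * F a b) a b = h * mulLin t F a b := by
  have e : ∀ x, t * (h * x) = h * (t * x) := fun x => by
    rw [← mul_assoc, ← mul_assoc, Subring.mem_center_iff.1 hh]
  simp only [mulLin, mul_sub, e]

theorem mulLin_sub (t : B) (F G : ℤ → ℤ → B) (a b : ℤ) :
    mulLin t (fun a b => F a b - G a b) a b = mulLin t F a b - mulLin t G a b := by
  simp only [mulLin, mul_sub]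
  abel

variable {n : ℕ} (d : RLLData n B) {N : ℕ} {i j : Fin n}

/-- The coefficients of the current `f^+_{ji}(u + h c / 4) - f^-_{ji}(u - h c / 4)`. -/
def RLLData.curF (N : ℕ) (i j : Fin n) (m : ℤ) : B :=
  sh N (-d.sig .plus) (ser .plus ((d.D .plus).F j i)) m -
    sh N (-d.sig .minus) (ser .minus ((d.D .minus).F j i)) m

/-- `k_j(u) k_i(u)⁻¹`. -/
def RLLData.ratioK (ε : Sgn) (i j : Fin n) : PowerSeries B :=
  (d.D ε).k j * Ring.inverse ((d.D ε).k i)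

/-- The coefficients of `δ(u_∓ - v_±) k_j(u_∓) k_i(u_∓)⁻¹`. -/
def RLLData.deltaK (N : ℕ) (ε : Sgn) (i j : Fin n) : ℤ → ℤ → B :=
  sh₂ N (d.sig ε) (-d.sig ε) fun a b => ser ε (d.ratioK ε i j) (a + b + 1)

theorem RLLData.neg_sig_pow {d : RLLData n B} (hs : d.s ^ N = 0) (ε : Sgn) :
    (-d.sig ε) ^ N = 0 := by
  rw [neg_pow, RLLData.sig_pow ε hs, mul_zero]

theorem RLLData.mulLin_deltaK (hs : d.s ^ N = 0) (ε : Sgn) (a b : ℤ) :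
    mulLin (-d.sig ε - d.sig ε) (d.deltaK N ε i j) a b = 0 := by
  have h := sh₂_mulLin (RLLData.sig_pow ε hs) (RLLData.neg_sig_pow hs ε) (d.sig_center ε)
    (neg_mem (d.sig_center ε)) 0 fun a b => ser ε (d.ratioK ε i j) (a + b + 1)
  rw [zero_sub, ← sub_eq_add_neg] at h
  rw [RLLData.deltaK, ← h]
  have e : mulLin (0 : B) (fun a b => ser ε (d.ratioK ε i j) (a + b + 1)) = fun _ _ => 0 := by
    ext a b
    simp only [mulLin, zero_mul, sub_zero]
    rw [show a - 1 + b + 1 = a + (b - 1) + 1 by ring, sub_self]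
  rw [e, sh₂]
  exact sh_zero _ (fun a => sh_zero _ (fun b => rfl) b) a

theorem RLLData.deltaK_neg_one (h0 : 0 < N) (ε : Sgn) (b : ℤ) :
    d.deltaK N ε i j (-1) b = sh N (-d.sig ε) (ser ε (d.ratioK ε i j)) b := by
  rw [RLLData.deltaK, sh₂, sh_pow_zero h0]
  congr 1
  ext b
  congr 1
  ring

theorem RLLData.deltaK_right_neg_one (h0 : 0 < N) (ε : Sgn) (a : ℤ) :
    d.deltaK N ε i j a (-1) = d.shSer N ε (d.ratioK ε i j) a := by
  rw [RLLData.deltaK, sh₂, RLLData.shSer]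
  congr 1
  ext a
  rw [sh_pow_zero h0]
  congr 1
  ring

theorem RLLData.deltaK_plus (a b : ℤ) (ha : 0 ≤ a) (hb : 0 ≤ b) :
    d.deltaK N .plus i j a b = 0 := by
  rw [RLLData.deltaK, sh₂]
  refine Finset.sum_eq_zero fun p _ => ?_
  simp only [sh]
  rw [Finset.sum_eq_zero fun q _ => ?_, mul_zero, smul_zero]
  rw [ser_plus_pos _ (by omega), mul_zero, smul_zero]

theorem RLLData.deltaK_minus (a b : ℤ) (ha : a < 0) (hb : b < 0) :
    d.deltaK N .minus i j a b = 0 := by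
  rw [RLLData.deltaK, sh₂]
  refine Finset.sum_eq_zero fun p _ => ?_
  rcases lt_or_ge (a + p) 0 with h | h
  · simp only [sh]
    rw [Finset.sum_eq_zero fun q _ => ?_, mul_zero, smul_zero]
    rcases lt_or_ge (b + q) 0 with h' | h'
    · rw [ser_minus_neg _ (by omega), mul_zero, smul_zero]
    · rw [choose_add_natCast b hb h', zero_smul]
  · rw [choose_add_natCast a ha h, zero_smul]

theorem sig_nil {ε : Sgn} : IsNilpotent (-d.sig ε - d.sig ε) := by
  have h : IsNilpotent (d.sig ε) := by
    obtain ⟨N, hN⟩ := d.s_nil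
    exact ⟨N, RLLData.sig_pow ε hN⟩
  exact Commute.isNilpotent_sub ((Commute.refl _).neg_left) h.neg h

/-- The part of `Φ` with exponents of `u` as in the expansion of `1 / (u-v)` for `|u| > |v|` if `ε` is
`+`, and minus the part with the other exponents if `ε` is `-`. -/
def cutU (ε : Sgn) (Φ : ℤ → ℤ → B) (a b : ℤ) : B :=
  match ε with
  | .plus => if a < 0 then Φ a b else 0
  | .minus => if a < 0 then 0 else -Φ a b

/-- The part of `Φ` with nonnegative exponents of `v` if `ε` is `+`, and minus the part with the other
exponents if `ε` is `-`. -/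
def cutV (ε : Sgn) (Φ : ℤ → ℤ → B) (a b : ℤ) : B :=
  match ε with
  | .plus => if b < 0 then 0 else Φ a b
  | .minus => if b < 0 then -Φ a b else 0

/-- The two halves of a series annihilated by `u - v - t` differ in sign after multiplication by
`u - v - t`: the only contribution comes from the cut. -/
theorem mulLin_cutU (ε : Sgn) {t : B} {Φ : ℤ → ℤ → B} (h : ∀ a b, mulLin t Φ a b = 0) (a b : ℤ) :
    mulLin t (cutU ε Φ) a b = inV (Φ (-1)) a b := by
  have h1 := h a b
  simp only [mulLin] at h1
  cases ε <;> simp only [mulLin, cutU, inV]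
  · rcases lt_trichotomy a 0 with ha | rfl | ha
    · rw [if_pos (by omega), if_pos ha, if_pos ha, if_neg ha.ne, h1]
    · simp
    · rw [if_neg (by omega), if_neg (by omega), if_neg (by omega), if_neg ha.ne']
      simp
  · rcases lt_trichotomy a 0 with ha | rfl | ha
    · rw [if_pos (by omega), if_pos ha, if_pos ha, if_neg ha.ne]
      simp
    · simp only [zero_sub, Int.reduceNeg, Left.neg_neg_iff, zero_lt_one, if_true, lt_irrefl,
        if_false] at h1 ⊢
      linear_combination (norm := noncomm_ring) -h1
    · rw [if_neg (by omega), if_neg (by omega), if_neg (by omega), if_neg ha.ne', ← neg_zero, ← h1,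
        mul_neg]
      abel

theorem mulLin_cutV (ε : Sgn) {t : B} {Φ : ℤ → ℤ → B} (h : ∀ a b, mulLin t Φ a b = 0) (a b : ℤ) :
    mulLin t (cutV ε Φ) a b = inU (fun a => Φ a (-1)) a b := by
  have h1 := h a b
  simp only [mulLin] at h1
  cases ε <;> simp only [mulLin, cutV, inU]
  · rcases lt_trichotomy b 0 with hb | rfl | hb
    · rw [if_pos (by omega), if_pos (by omega), if_pos hb, if_neg hb.ne]
      simp
    · simp only [zero_sub, Int.reduceNeg, Left.neg_neg_iff, zero_lt_one, if_true, lt_irrefl,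
        if_false] at h1 ⊢
      linear_combination (norm := noncomm_ring) h1
    · rw [if_neg (by omega), if_neg (by omega), if_neg (by omega), if_neg hb.ne', h1]
  · rcases lt_trichotomy b 0 with hb | rfl | hb
    · rw [if_pos (by omega), if_pos (by omega), if_pos hb, if_neg hb.ne, ← neg_zero, ← h1, mul_neg]
      abel
    · simp
    · rw [if_neg (by omega), if_neg (by omega), if_neg (by omega), if_neg hb.ne']
      simp

theorem RLLData.mulLin_mulLin_e_f (ε ε' : Sgn) (h : j.val = i.val + 1) (a b : ℤ) :
    mulLin (-d.tau ε ε') (mulLin (d.tau ε ε') (fun a b => ser ε ((d.D ε).E i j) a *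
      ser ε' ((d.D ε').F j i) b - ser ε' ((d.D ε').F j i) b * ser ε ((d.D ε).E i j) a)) a b =
    d.h * (mulLin (d.tau ε ε') (inV (ser ε' (d.ratioK ε' i j))) a b -
      mulLin (-d.tau ε ε') (inU (ser ε (d.ratioK ε i j))) a b) := by
  have h1 := congrArg (fun G => fn ε ε' G (a - ε.deg - ε.deg) (b - ε'.deg - ε'.deg))
    (d.e_f_self ε ε' h)
  have e1 : fn ε ε' (fst ((d.D ε).E i j) * snd ((d.D ε').F j i) -
      snd ((d.D ε').F j i) * fst ((d.D ε).E i j)) = fun a b => ser ε ((d.D ε).E i j) a *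
      ser ε' ((d.D ε').F j i) b - ser ε' ((d.D ε').F j i) b * ser ε ((d.D ε).E i j) a := by
    ext a b
    rw [fn_sub, fn_fst_mul_snd, fn_snd_mul_fst]
  have e2 : fn ε ε' (snd ((d.D ε').k j * Ring.inverse ((d.D ε').k i))) =
      inV (ser ε' (d.ratioK ε' i j)) := by
    ext a b
    exact fn_snd _ _ _ _ _
  have e3 : fn ε ε' (fst ((d.D ε).k j * Ring.inverse ((d.D ε).k i))) =
      inU (ser ε (d.ratioK ε i j)) := by
    ext a b
    exact fn_fst _ _ _ _ _
  beta_reduce at h1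
  rwa [fn_del_del_mul, fn_eta_mul, fn_sub, fn_del_mul, fn_del_mul, sub_add_cancel, sub_add_cancel,
    sub_add_cancel, sub_add_cancel, e1, e2, e3] at h1

/-- The commutator of two components is the difference of the expansions of
`k_j(v) k_i(v)⁻¹ / (u - v)` and `k_j(u) k_i(u)⁻¹ / (u - v)`, each with its own shifts; these expansions are
the halves of the delta series. Both sides agree after multiplication by the two denominators, and are
one-sided in `u`. -/
theorem RLLData.sh_e_f (h0 : 0 < N) (hs : d.s ^ N = 0) (ε ε' : Sgn) (h : j.val = i.val + 1) (a b : ℤ) :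
    d.shSer N ε ((d.D ε).E i j) a * sh N (-d.sig ε') (ser ε' ((d.D ε').F j i)) b -
      sh N (-d.sig ε') (ser ε' ((d.D ε').F j i)) b * d.shSer N ε ((d.D ε).E i j) a =
    d.h * (cutU ε (d.deltaK N ε' i j) a b - cutV ε (d.deltaK N ε i j) a b) := by
  set z : ℤ → ℤ → B := fun a b => ser ε ((d.D ε).E i j) a *
      ser ε' ((d.D ε').F j i) b - ser ε' ((d.D ε').F j i) b * ser ε ((d.D ε).E i j) a with hz
  have cs := d.sig_center ε
  have cs' := neg_mem (d.sig_center ε')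
  have ps := RLLData.sig_pow ε hs
  have ps' := RLLData.neg_sig_pow hs ε'
  have t1 : d.tau ε ε' - d.sig ε + -d.sig ε' = -d.sig ε - d.sig ε := by
    rw [RLLData.tau, RLLData.sig, RLLData.sig, sub_smul]
    abel
  have t2 : -d.tau ε ε' - d.sig ε + -d.sig ε' = -d.sig ε' - d.sig ε' := by
    rw [RLLData.tau, RLLData.sig, RLLData.sig, sub_smul]
    abel
  have key : ∀ a b, mulLin (-d.sig ε' - d.sig ε') (mulLin (-d.sig ε - d.sig ε)
      (sh₂ N (d.sig ε) (-d.sig ε') z)) a b =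
      d.h * (mulLin (-d.sig ε - d.sig ε) (inV (sh N (-d.sig ε') (ser ε' (d.ratioK ε' i j)))) a b -
      mulLin (-d.sig ε' - d.sig ε') (inU (d.shSer N ε (d.ratioK ε i j))) a b) := fun a b => by
    have e1 : inV (sh N (-d.sig ε') (ser ε' (d.ratioK ε' i j))) =
        sh₂ N (d.sig ε) (-d.sig ε') (inV (ser ε' (d.ratioK ε' i j))) := by
      ext a b
      rw [sh₂_inV h0]
    have e2 : inU (d.shSer N ε (d.ratioK ε i j)) =
        sh₂ N (d.sig ε) (-d.sig ε') (inU (ser ε (d.ratioK ε i j))) := by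
      ext a b
      rw [sh₂_inU h0]
      rfl
    rw [e1, e2, ← t1, ← t2, ← sh₂_mulLin ps ps' cs cs', ← sh₂_mulLin ps ps' cs cs',
      ← sh₂_mulLin ps ps' cs cs', ← sh₂_mulLin ps ps' cs cs', ← sh₂_sub, ← sh₂_mul_left cs cs']
    congr 1
    ext a b
    exact d.mulLin_mulLin_e_f ε ε' h a b
  have key2 : ∀ a b, mulLin (-d.sig ε' - d.sig ε') (mulLin (-d.sig ε - d.sig ε)
      (fun a b => d.h * (cutU ε (d.deltaK N ε' i j) a b - cutV ε (d.deltaK N ε i j) a b))) a b =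
      d.h * (mulLin (-d.sig ε - d.sig ε) (inV (sh N (-d.sig ε') (ser ε' (d.ratioK ε' i j)))) a b -
      mulLin (-d.sig ε' - d.sig ε') (inU (d.shSer N ε (d.ratioK ε i j))) a b) := fun a b => by
    have e0 : mulLin (-d.sig ε - d.sig ε) (fun a b => d.h * (cutU ε (d.deltaK N ε' i j) a b -
        cutV ε (d.deltaK N ε i j) a b)) = fun a b => d.h *
        (mulLin (-d.sig ε - d.sig ε) (cutU ε (d.deltaK N ε' i j)) a b -
          mulLin (-d.sig ε - d.sig ε) (cutV ε (d.deltaK N ε i j)) a b) := by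
      ext a b
      rw [mulLin_mul_left d.h_center, mulLin_sub]
    have e1 : mulLin (-d.sig ε' - d.sig ε') (mulLin (-d.sig ε - d.sig ε)
        (cutU ε (d.deltaK N ε' i j))) = mulLin (-d.sig ε - d.sig ε)
        (inV (sh N (-d.sig ε') (ser ε' (d.ratioK ε' i j)))) := by
      rw [mulLin_comm (Commute.symm (Subring.mem_center_iff.1 (sub_mem cs' (d.sig_center ε')) _))]
      congr 1
      ext a b
      rw [mulLin_cutU ε (d.mulLin_deltaK hs ε')]
      congr 1
      ext b
      exact d.deltaK_neg_one h0 ε' b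
    have e2 : mulLin (-d.sig ε - d.sig ε) (cutV ε (d.deltaK N ε i j)) =
        inU (d.shSer N ε (d.ratioK ε i j)) := by
      ext a b
      rw [mulLin_cutV ε (d.mulLin_deltaK hs ε)]
      congr 1
      ext a
      exact d.deltaK_right_neg_one h0 ε a
    rw [e0, mulLin_mul_left d.h_center, mulLin_sub]
    change d.h * (mulLin _ (mulLin _ (cutU ε _)) a b - mulLin _ (mulLin _ (cutV ε _)) a b) = _
    rw [e1, e2]
  have uniq := eq_zero_of_mulLin_mulLin ε (sig_nil d (ε := ε)) (sig_nil d (ε := ε'))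
    (F := fun a b => sh₂ N (d.sig ε) (-d.sig ε') z a b -
      d.h * (cutU ε (d.deltaK N ε' i j) a b - cutV ε (d.deltaK N ε i j) a b)) (fun a b ha => ?_)
    (fun a b => ?_)
  · have h3 := congrFun (congrFun uniq a) b
    rw [RLLData.shSer, ← sh₂_mul cs', ← sh₂_mul_swap cs, ← sh₂_sub]
    exact sub_eq_zero.1 h3
  · have e1 : sh₂ N (d.sig ε) (-d.sig ε') z a b = 0 := by
      rw [sh₂]
      refine sh_outside ε (fun a ha => sh_zero _ (fun b => ?_) b) ha
      simp only [hz, ser_outside ε _ ha, zero_mul, mul_zero, sub_zero]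
    have e2 : cutU ε (d.deltaK N ε' i j) a b = 0 := by
      cases ε
      · exact if_neg (not_lt.2 (le_of_lt ha))
      · exact if_pos ha
    have e3 : cutV ε (d.deltaK N ε i j) a b = 0 := by
      cases ε <;> simp only [cutV] <;> split_ifs with hb
      · rfl
      · exact d.deltaK_plus a b (le_of_lt ha) (not_lt.1 hb)
      · rw [d.deltaK_minus a b ha hb, neg_zero]
      · rfl
    simp only [e1, e2, e3, sub_zero, mul_zero]
  · have e0 : mulLin (-d.sig ε - d.sig ε) (fun a b => sh₂ N (d.sig ε) (-d.sig ε') z a b -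
      d.h * (cutU ε (d.deltaK N ε' i j) a b - cutV ε (d.deltaK N ε i j) a b)) = fun a b =>
      mulLin (-d.sig ε - d.sig ε) (sh₂ N (d.sig ε) (-d.sig ε') z) a b - mulLin (-d.sig ε - d.sig ε)
        (fun a b => d.h * (cutU ε (d.deltaK N ε' i j) a b - cutV ε (d.deltaK N ε i j) a b)) a b := by
      ext a b
      rw [mulLin_sub]
    rw [e0, mulLin_sub]
    change mulLin _ (mulLin _ _) a b - mulLin _ (mulLin _ _) a b = _
    rw [key, key2, sub_self]

/-- In the alternating sum of the four commutators the halves of the delta series add up to the whole. -/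
theorem RLLData.cur_curF (h0 : 0 < N) (hs : d.s ^ N = 0) (h : j.val = i.val + 1) (a b : ℤ) :
    d.cur N i j a * d.curF N i j b - d.curF N i j b * d.cur N i j a =
      d.h * (d.deltaK N .plus i j a b - d.deltaK N .minus i j a b) := by
  have k1 := d.sh_e_f h0 hs .plus .plus h a b
  have k2 := d.sh_e_f h0 hs .plus .minus h a b
  have k3 := d.sh_e_f h0 hs .minus .plus h a b
  have k4 := d.sh_e_f h0 hs .minus .minus h a b
  have e : ∀ Φ : ℤ → ℤ → B, cutU .plus Φ a b - cutU .minus Φ a b = Φ a b := fun Φ => by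
    simp only [cutU]
    split_ifs <;> simp
  rw [← e (d.deltaK N .plus i j), ← e (d.deltaK N .minus i j)]
  simp only [RLLData.cur, RLLData.curF]
  linear_combination (norm := noncomm_ring) k1 - k2 - k3 + k4

theorem RLLData.cur_curF_of_ne {i' j' : Fin n} (h : j.val = i.val + 1)
    (h' : j'.val = i'.val + 1) (hij : i ≠ i') (a b : ℤ) :
    d.cur N i j a * d.curF N i' j' b = d.curF N i' j' b * d.cur N i j a := by
  refine commute_of_mem_span (T := {x | ∃ ε m, x = ser ε ((d.D ε).F j' i') m}) ?_
    (d.cur_mem_span a) ?_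
  · rintro _ ⟨ε, m, rfl⟩ _ ⟨ε', m', rfl⟩
    exact d.e_f_of_ne ε ε' h h' hij m m'
  · refine sub_mem ?_ ?_ <;>
      refine Submodule.span_mono ?_ (sh_mem_span (neg_mem (d.sig_center _)) _ b)
    · rintro _ ⟨m, rfl⟩
      exact ⟨_, m, rfl⟩
    · rintro _ ⟨m, rfl⟩
      exact ⟨_, m, rfl⟩

end Commutator

/-! ### Transposition -/

section Transpose

variable {B : Type u} [Ring B]

/-- Power series over the opposite ring. -/
def opSer (B : Type*) [Ring B] : (PowerSeries B)ᵐᵒᵖ →+* PowerSeries Bᵐᵒᵖ where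
  toFun φ := PowerSeries.mk fun m => MulOpposite.op (PowerSeries.coeff m φ.unop)
  map_one' := by
    ext m
    simp [PowerSeries.coeff_one, apply_ite MulOpposite.op]
  map_mul' φ ψ := by
    ext m
    rw [PowerSeries.coeff_mk, MulOpposite.unop_mul, PowerSeries.coeff_mul, PowerSeries.coeff_mul,
      Finset.op_sum, ← Finset.Nat.sum_antidiagonal_swap]
    refine Finset.sum_congr rfl fun p _ => ?_
    simp
  map_zero' := by
    ext m
    simp
  map_add' φ ψ := by
    ext m
    simp

theorem ser_opSer (ε : Sgn) (φ : (PowerSeries B)ᵐᵒᵖ) (m : ℤ) :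
    ser ε (opSer B φ) m = MulOpposite.op (ser ε φ.unop m) := by
  cases ε <;> simp only [ser, opSer] <;> split_ifs <;> simp

theorem mulLin_op (t : B) (ht : t ∈ Subring.center B) (F : ℤ → ℤ → B) (a b : ℤ) :
    mulLin (MulOpposite.op t) (fun a b => MulOpposite.op (F a b)) a b =
      MulOpposite.op (mulLin t F a b) := by
  simp only [mulLin, MulOpposite.op_sub, ← MulOpposite.op_mul]
  rw [Subring.mem_center_iff.1 ht]

theorem op_center {x : B} (hx : x ∈ Subring.center B) :
    MulOpposite.op x ∈ Subring.center Bᵐᵒᵖ :=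
  Subring.mem_center_iff.2 fun y => MulOpposite.unop_injective
    (Subring.mem_center_iff.1 hx y.unop).symm

theorem SeriesRLL.op {n : ℕ} {h t : B} {ε ε' : Sgn} {A A' : Matrix (Fin n) (Fin n) (PowerSeries B)}
    (ht : t ∈ Subring.center B) (hh : h ∈ Subring.center B) (H : SeriesRLL h t ε ε' A A') :
    SeriesRLL (MulOpposite.op h) (-MulOpposite.op t) ε ε' (fun i j => opSer B (MulOpposite.op (A j i)))
      (fun i j => opSer B (MulOpposite.op (A' j i))) := by
  intro i j k l a b
  simp only [ser_opSer, MulOpposite.unop_op, neg_neg, ← MulOpposite.op_mul, ← MulOpposite.op_sub,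
    ← MulOpposite.op_neg]
  have e : (fun a b => mulLin (MulOpposite.op (-t)) (fun a b => MulOpposite.op
      (ser ε' (A' l k) b * ser ε (A j i) a - ser ε (A j i) a * ser ε' (A' l k) b)) a b) =
      fun a b => MulOpposite.op (mulLin (-t)
      (fun a b => ser ε' (A' l k) b * ser ε (A j i) a - ser ε (A j i) a * ser ε' (A' l k) b) a b) := by
    ext a b : 2
    exact mulLin_op _ (neg_mem ht) _ a b
  change mulLin (MulOpposite.op t) (fun a b => mulLin (MulOpposite.op (-t)) _ a b) a b = _
  rw [e, mulLin_op _ ht, mulLin_op _ (neg_mem ht), mulLin_op _ ht, ← MulOpposite.op_sub,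
    ← MulOpposite.op_mul]
  congr 1
  have h1 := H j i l k a b
  have e2 : (fun a b => ser ε' (A' l k) b * ser ε (A j i) a - ser ε (A j i) a * ser ε' (A' l k) b) =
      fun a b => 0 - (ser ε (A j i) a * ser ε' (A' l k) b - ser ε' (A' l k) b * ser ε (A j i) a) := by
    ext a b
    rw [zero_sub, neg_sub]
  change mulLin t (mulLin (-t) _) a b = _
  rw [mulLin_comm (Commute.symm (Subring.mem_center_iff.1 ht _)), e2]
  have e3 : ∀ (s : B) (F : ℤ → ℤ → B), mulLin s (fun a b => 0 - F a b) = fun a b => 0 - mulLin s F a b :=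
    fun s F => by
      ext a b
      simp only [mulLin, mul_sub, mul_zero]
      abel
  rw [e3, e3]
  beta_reduce
  rw [h1, zero_sub, ← mul_neg, neg_sub, Subring.mem_center_iff.1 hh]

variable {n : ℕ} (d : RLLData n B) {N : ℕ} {i j l : Fin n}

/-- The transposed matrices over the opposite ring. They satisfy the same relations with the opposite
sign of `s`, and the lower triangular factors become upper triangular ones. -/
def RLLData.op : RLLData n Bᵐᵒᵖ where
  h := MulOpposite.op d.h
  s := -MulOpposite.op d.s
  D ε := (d.D ε).op.map (opSer B)
  h_center := op_center d.h_center
  s_center := neg_mem (op_center d.s_center)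
  h_nil := by
    obtain ⟨N, hN⟩ := d.h_nil
    exact ⟨N, by rw [← MulOpposite.op_pow, hN, MulOpposite.op_zero]⟩
  s_nil := by
    obtain ⟨N, hN⟩ := d.s_nil
    exact ⟨N, by rw [neg_pow, ← MulOpposite.op_pow, hN, MulOpposite.op_zero, mul_zero]⟩
  rel ε ε' hε := by
    have h := (d.rel ε ε' hε).op (zsmul_mem d.s_center _) d.h_center
    rw [smul_neg, ← MulOpposite.op_smul]
    have e : ∀ ε, ((d.D ε).op.map (opSer B)).mat =
        fun i j => opSer B (MulOpposite.op ((d.D ε).mat j i)) := fun ε => by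
      rw [Gauss.map_mat, Gauss.op_mat]
      rfl
    rw [e, e]
    exact h

variable {d} in
theorem RLLData.op_s_pow (hs : d.s ^ N = 0) : d.op.s ^ N = 0 := by
  change (-MulOpposite.op d.s) ^ N = 0
  rw [neg_pow, ← MulOpposite.op_pow, hs, MulOpposite.op_zero, mul_zero]

theorem sh_op {s : B} (hs : s ∈ Subring.center B) (G : ℤ → B) (m : ℤ) :
    sh N (MulOpposite.op s) (fun m => MulOpposite.op (G m)) m = MulOpposite.op (sh N s G m) := by
  simp only [sh, Finset.op_sum, MulOpposite.op_smul]
  refine Finset.sum_congr rfl fun i _ => ?_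
  rw [← MulOpposite.op_pow, ← MulOpposite.op_mul, Subring.mem_center_iff.1 (pow_mem hs i)]

theorem RLLData.op_cur (m : ℤ) : d.op.cur N i j m = MulOpposite.op (d.curF N i j m) := by
  have key : ∀ ε, d.op.shSer N ε ((d.op.D ε).E i j) m =
      MulOpposite.op (sh N (-d.sig ε) (ser ε ((d.D ε).F j i)) m) := fun ε => by
    rw [← sh_op (neg_mem (d.sig_center ε)), RLLData.shSer]
    congr 1
    · rw [RLLData.sig, RLLData.sig, neg_neg]
      change -(ε.val • -MulOpposite.op d.s) = _
      rw [smul_neg, neg_neg]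
      rfl
    · ext m : 1
      exact ser_opSer ε _ m
  rw [RLLData.cur, key, key]
  rfl

theorem RLLData.curF_self (h0 : 0 < N) (hs : d.s ^ N = 0) (h : j.val = i.val + 1) (a b : ℤ) :
    mulLin (-d.h) (fun a b => d.curF N i j a * d.curF N i j b) a b =
      mulLin d.h (fun a b => d.curF N i j b * d.curF N i j a) a b := by
  have h1 := d.op.cur_self h0 (RLLData.op_s_pow hs) h a b
  simp only [d.op_cur, ← MulOpposite.op_mul] at h1
  change mulLin (MulOpposite.op d.h) _ a b = mulLin (MulOpposite.op (-d.h)) _ a b at h1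
  rw [mulLin_op _ d.h_center, mulLin_op _ (neg_mem d.h_center)] at h1
  exact (MulOpposite.op_injective h1).symm

theorem RLLData.curF_succ (h0 : 0 < N) (hs : d.s ^ N = 0) (h : j.val = i.val + 1)
    (h' : l.val = i.val + 2) (a b : ℤ) :
    mulLin 0 (fun a b => d.curF N i j a * d.curF N j l b) a b =
      mulLin (-d.h) (fun a b => d.curF N j l b * d.curF N i j a) a b := by
  have h1 := d.op.cur_succ h0 (RLLData.op_s_pow hs) h h' a b
  simp only [d.op_cur, ← MulOpposite.op_mul] at h1
  change mulLin (MulOpposite.op (-d.h)) _ a b = mulLin (MulOpposite.op 0) _ a b at h1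
  rw [mulLin_op _ (zero_mem _), mulLin_op _ (neg_mem d.h_center)] at h1
  exact (MulOpposite.op_injective h1).symm

theorem RLLData.curF_far {i' j' : Fin n} (h : j.val = i.val + 1)
    (h' : j'.val = i'.val + 1) (hij : i.val + 1 < i'.val ∨ i'.val + 1 < i.val) (a b : ℤ) :
    d.curF N i j a * d.curF N i' j' b = d.curF N i' j' b * d.curF N i j a := by
  have h1 := d.op.cur_far (N := N) h h' hij a b
  simp only [d.op_cur, ← MulOpposite.op_mul] at h1
  exact (MulOpposite.op_injective h1).symm

theorem RLLData.curF_serre {i' j' : Fin n} (h : j.val = i.val + 1) (h' : j'.val = i'.val + 1)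
    (hij : i.val + 1 = i'.val ∨ i'.val + 1 = i.val) (a₁ a₂ b : ℤ) :
    serreSum (d.curF N i j a₁) (d.curF N i j a₂) (d.curF N i' j' b) = 0 := by
  have h1 := congrArg MulOpposite.unop (d.op.cur_serre (N := N) h h' hij a₁ a₂ b)
  rw [d.op_cur, d.op_cur, d.op_cur] at h1
  rw [← MulOpposite.unop_zero, ← h1]
  simp only [serreSum, two_mul, MulOpposite.unop_add, MulOpposite.unop_sub, MulOpposite.unop_mul,
    MulOpposite.unop_op, mul_assoc]
  abel

/-- The coefficients of `k_l(u) y k_l(u)⁻¹`. -/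
def RLLData.conjInv (ε : Sgn) (l : Fin n) (y : B) (a : ℤ) : B :=
  ser ε ((d.D ε).k l * PowerSeries.C y * Ring.inverse ((d.D ε).k l)) a

theorem RLLData.op_conj (ε : Sgn) (l : Fin n) (y : B) (a : ℤ) :
    d.op.conj ε l (MulOpposite.op y) a = MulOpposite.op (d.conjInv ε l y a) := by
  have e : PowerSeries.C (MulOpposite.op y) = opSer B (MulOpposite.op (PowerSeries.C y)) := by
    ext m
    simp only [opSer, RingHom.coe_mk, MonoidHom.coe_mk, OneHom.coe_mk, PowerSeries.coeff_mk,
      PowerSeries.coeff_C, MulOpposite.unop_op]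
    split_ifs <;> rfl
  have e2 : Ring.inverse (opSer B (MulOpposite.op ((d.D ε).k l))) =
      opSer B (MulOpposite.op (Ring.inverse ((d.D ε).k l))) := by
    rw [map_inverse _ ((d.D ε).k_unit l).op]
    congr 1
    obtain ⟨u, hu⟩ := (d.D ε).k_unit l
    rw [← hu, Ring.inverse_unit]
    exact Ring.inverse_unit (Units.opEquiv.symm (MulOpposite.op u))
  rw [RLLData.conj, RLLData.conjInv, e]
  change ser ε (Ring.inverse (opSer B (MulOpposite.op ((d.D ε).k l))) * _ *
    opSer B (MulOpposite.op ((d.D ε).k l))) a = _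
  rw [e2, ← map_mul, ← map_mul, ser_opSer, mul_assoc]
  rfl

theorem inV_op (G : ℤ → B) : inV (fun b => MulOpposite.op (G b)) =
    fun a b => MulOpposite.op (inV G a b) := by
  ext a b : 2
  simp only [inV]
  split_ifs <;> rfl

theorem RLLData.mulLin_conjInv_left (h0 : 0 < N) (hs : d.s ^ N = 0) (ε : Sgn)
    (h : j.val = i.val + 1) (a b : ℤ) :
    mulLin (ε.val • d.s) (fun a b => d.conjInv ε i (d.curF N i j b) a) a b =
      mulLin (ε.val • d.s - d.h) (inV (d.curF N i j)) a b := by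
  have h1 := d.op.mulLin_conj_left h0 (RLLData.op_s_pow hs) ε h a b
  have e : d.op.cur N i j = fun b => MulOpposite.op (d.curF N i j b) := funext d.op_cur
  have c : ε.val • d.s ∈ Subring.center B := zsmul_mem d.s_center _
  have e2 : -(ε.val • d.op.s) = MulOpposite.op (ε.val • d.s) := by
    change -(ε.val • -MulOpposite.op d.s) = _
    rw [smul_neg, neg_neg]
    rfl
  rw [e, e2, inV_op] at h1
  simp only [d.op_conj] at h1
  change _ = mulLin (MulOpposite.op (ε.val • d.s - d.h)) _ a b at h1
  rw [mulLin_op _ c, mulLin_op _ (sub_mem c d.h_center)] at h1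
  exact MulOpposite.op_injective h1

theorem RLLData.mulLin_conjInv_right (h0 : 0 < N) (hs : d.s ^ N = 0) (ε : Sgn)
    (h : j.val = i.val + 1) (a b : ℤ) :
    mulLin (ε.val • d.s) (fun a b => d.conjInv ε j (d.curF N i j b) a) a b =
      mulLin (ε.val • d.s + d.h) (inV (d.curF N i j)) a b := by
  have h1 := d.op.mulLin_conj_right h0 (RLLData.op_s_pow hs) ε h a b
  have e : d.op.cur N i j = fun b => MulOpposite.op (d.curF N i j b) := funext d.op_cur
  have c : ε.val • d.s ∈ Subring.center B := zsmul_mem d.s_center _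
  have e2 : -(ε.val • d.op.s) = MulOpposite.op (ε.val • d.s) := by
    change -(ε.val • -MulOpposite.op d.s) = _
    rw [smul_neg, neg_neg]
    rfl
  rw [e, e2, inV_op] at h1
  simp only [d.op_conj] at h1
  change _ = mulLin (MulOpposite.op (ε.val • d.s + d.h)) _ a b at h1
  rw [mulLin_op _ c, mulLin_op _ (add_mem c d.h_center)] at h1
  exact MulOpposite.op_injective h1

theorem RLLData.conjInv_curF_far (ε : Sgn) (h : j.val = i.val + 1) (h1 : l ≠ i) (h2 : l ≠ j)
    (a b : ℤ) : d.conjInv ε l (d.curF N i j b) a = inV (d.curF N i j) a b := by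
  have h3 := d.op.conj_cur_far (N := N) ε h h1 h2 a b
  have e : d.op.cur N i j = fun b => MulOpposite.op (d.curF N i j b) := funext d.op_cur
  rw [e, inV_op, d.op_conj] at h3
  exact MulOpposite.op_injective h3

end Transpose

/-! ### Products with expansions of rational functions -/

section FormalProduct

variable {A : Type*} [Ring A]

/-- All the coefficient sums of the product of two formal series are finite. -/
def FinConv (F G : ℤ → ℤ → A) : Prop :=
  ∀ a b, (Function.support fun p : ℤ × ℤ => F p.1 p.2 * G (a - p.1) (b - p.2)).Finite

theorem FinConv.map {A' : Type*} [Ring A'] (f : A →+* A') {F G : ℤ → ℤ → A} (h : FinConv F G) :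
    FinConv (fun a b => f (F a b)) (fun a b => f (G a b)) := fun a b =>
  (h a b).subset fun p hp => by
    rw [Function.mem_support] at hp ⊢
    intro h0
    exact hp (by rw [← map_mul, h0, map_zero])

theorem map_finProd {A' : Type*} [Ring A'] (f : A →+* A') {F G : ℤ → ℤ → A} (h : FinConv F G)
    (a b : ℤ) : f (finProd F G a b) = finProd (fun a b => f (F a b)) (fun a b => f (G a b)) a b := by
  rw [finProd, finProd]
  refine (AddMonoidHom.map_finsum f.toAddMonoidHom (h a b)).trans ?_
  exact finsum_congr fun p => map_mul f _ _

theorem finProd_sub_left (F G : ℤ → ℤ → A) (c d a b : ℤ) :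
    finProd F G (a - c) (b - d) = finProd (fun a b => F (a - c) (b - d)) G a b := by
  rw [finProd, finProd, ← finsum_comp_equiv (Equiv.subRight ((c, d) : ℤ × ℤ))]
  refine finsum_congr fun p => ?_
  simp only [Equiv.subRight_apply, Prod.fst_sub, Prod.snd_sub, sub_sub_sub_cancel_right]

theorem FinConv.translate {F G : ℤ → ℤ → A} (h : FinConv F G) (c d : ℤ) :
    FinConv (fun a b => F (a - c) (b - d)) G := fun a b => by
  refine ((h (a - c) (b - d)).preimage
    (f := Equiv.subRight ((c, d) : ℤ × ℤ)) (Equiv.injective _).injOn).subset fun p hp => ?_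
  simpa only [Set.mem_preimage, Function.mem_support, Equiv.subRight_apply, Prod.fst_sub,
    Prod.snd_sub, sub_sub_sub_cancel_right] using hp

theorem FinConv.sub {F F' G : ℤ → ℤ → A} (h : FinConv F G) (h' : FinConv F' G) :
    FinConv (fun a b => F a b - F' a b) G := fun a b => by
  refine ((h a b).union (h' a b)).subset fun p hp => ?_
  simp only [Set.mem_union, Function.mem_support] at hp ⊢
  by_contra! h0
  exact hp (by rw [sub_mul, h0.1, h0.2, sub_zero])

theorem FinConv.mul_left {F G : ℤ → ℤ → A} (h : FinConv F G) (t : A) :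
    FinConv (fun a b => t * F a b) G := fun a b => by
  refine (h a b).subset fun p hp => ?_
  simp only [Function.mem_support] at hp ⊢
  intro h0
  exact hp (by rw [mul_assoc, h0, mul_zero])

theorem FinConv.mulLin {F G : ℤ → ℤ → A} (h : FinConv F G) (t : A) :
    FinConv (YangianDouble.mulLin t F) G := by
  have h1 := ((h.translate 1 0).sub (h.translate 0 1)).sub (h.mul_left t)
  simp only [sub_zero] at h1
  exact h1

theorem finProd_sub {F F' G : ℤ → ℤ → A} (h : FinConv F G) (h' : FinConv F' G) (a b : ℤ) :
    finProd (fun a b => F a b - F' a b) G a b = finProd F G a b - finProd F' G a b := by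
  rw [finProd, finProd, finProd, ← finsum_sub_distrib (h a b) (h' a b)]
  exact finsum_congr fun p => sub_mul _ _ _

theorem finProd_mul_left {F G : ℤ → ℤ → A} (h : FinConv F G) (t : A) (a b : ℤ) :
    finProd (fun a b => t * F a b) G a b = t * finProd F G a b := by
  rw [finProd, finProd]
  refine Eq.trans ?_ (AddMonoidHom.map_finsum (AddMonoidHom.mulLeft t) (h a b)).symm
  exact finsum_congr fun p => mul_assoc _ _ _

theorem mulLin_finProd {F G : ℤ → ℤ → A} (h : FinConv F G) (t : A) (a b : ℤ) :
    mulLin t (finProd F G) a b = finProd (mulLin t F) G a b := by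
  have e1 := finProd_sub_left F G 1 0 a b
  have e2 := finProd_sub_left F G 0 1 a b
  have h1 := h.translate 1 0
  have h2 := h.translate 0 1
  simp only [sub_zero] at e1 e2 h1 h2
  rw [mulLin, e1, e2, ← finProd_mul_left h, ← finProd_sub h1 h2,
    ← finProd_sub (h1.sub h2) (h.mul_left t)]
  rfl

theorem finProd_one (G : ℤ → ℤ → A) (a b : ℤ) :
    finProd (fun a b => if a = 0 ∧ b = 0 then 1 else 0) G a b = G a b := by
  rw [finProd, finsum_eq_single _ ((0, 0) : ℤ × ℤ)]
  · simp
  · intro p hp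
    rw [if_neg (fun h => hp (Prod.ext h.1 h.2)), zero_mul]

theorem finProd_comm {F G : ℤ → ℤ → A} (h : ∀ a b c d, F a b * G c d = G c d * F a b) (a b : ℤ) :
    finProd F G a b = finProd G F a b := by
  rw [finProd, finProd, ← finsum_comp_equiv (Equiv.subLeft ((a, b) : ℤ × ℤ))]
  refine finsum_congr fun p => ?_
  simp only [Equiv.subLeft_apply, Prod.fst_sub, Prod.snd_sub, sub_sub_cancel]
  exact h _ _ _ _

/-! #### Expansions -/

theorem coeffXY_pos (φ : PowerSeries (Polynomial A)) {a : ℤ} (b : ℤ) (h : 0 < a) :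
    coeffXY φ a b = 0 := if_neg fun h' => absurd h'.1 (by omega)

theorem coeffXY_neg (φ : PowerSeries (Polynomial A)) (a : ℤ) {b : ℤ} (h : b < 0) :
    coeffXY φ a b = 0 := if_neg fun h' => absurd h'.2 (by omega)

theorem coeffXY_nat (φ : PowerSeries (Polynomial A)) (a b : ℕ) :
    coeffXY φ (-a) b = (PowerSeries.coeff a φ).coeff b := by
  simp [coeffXY]

theorem coeffXY_finite (φ : PowerSeries (Polynomial A)) (a : ℤ) : {b | coeffXY φ a b ≠ 0}.Finite := by
  refine ((PowerSeries.coeff (-a).toNat φ).support.finite_toSet.image (fun m : ℕ => (m : ℤ))).subset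
    fun b hb => ?_
  have hb' : coeffXY φ a b ≠ 0 := hb
  rw [coeffXY] at hb'
  split_ifs at hb' with h
  · exact ⟨b.toNat, by simpa using hb', Int.toNat_of_nonneg h.2⟩
  · exact absurd rfl hb'

theorem coeffXY_add (φ ψ : PowerSeries (Polynomial A)) (a b : ℤ) :
    coeffXY (φ + ψ) a b = coeffXY φ a b + coeffXY ψ a b := by
  simp only [coeffXY]
  split_ifs <;> simp

theorem coeffXY_CC_mul (t : A) (φ : PowerSeries (Polynomial A)) (a b : ℤ) :
    coeffXY (PowerSeries.C (Polynomial.C t) * φ) a b = t * coeffXY φ a b := by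
  simp only [coeffXY]
  split_ifs <;> simp

theorem coeffXY_one (a b : ℤ) :
    coeffXY (1 : PowerSeries (Polynomial A)) a b = if a = 0 ∧ b = 0 then 1 else 0 := by
  rw [coeffXY]
  split_ifs with h h' h'
  · simp [h'.1, h'.2]
  · rw [PowerSeries.coeff_one]
    split_ifs with h0
    · rw [Polynomial.coeff_one, if_neg (by omega)]
    · simp
  · omega
  · rfl

theorem coeffXY_lin_mul (t : A) (φ : PowerSeries (Polynomial A)) (a b : ℤ) :
    coeffXY (lin t * φ) (a - 1) b = mulLin t (coeffXY φ) a b := by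
  have e : lin t * φ = φ - PowerSeries.X * (PowerSeries.C (Polynomial.X + Polynomial.C t) * φ) := by
    rw [lin, sub_mul, one_mul, ← mul_assoc, (PowerSeries.commute_X _).eq]
  rw [mulLin]
  rcases lt_or_ge b 0 with hb | hb
  · rw [coeffXY_neg _ _ hb, coeffXY_neg _ _ hb, coeffXY_neg _ _ hb,
      coeffXY_neg _ _ (show b - 1 < 0 by omega)]
    simp
  rcases lt_or_ge 1 a with ha | ha
  · rw [coeffXY_pos _ _ (show 0 < a by omega), coeffXY_pos _ _ (show 0 < a by omega),
      coeffXY_pos _ _ (show 0 < a - 1 by omega), coeffXY_pos _ _ (show 0 < a - 1 by omega)]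
    simp
  obtain ⟨k, hk⟩ : ∃ k : ℕ, a - 1 = -(k : ℤ) := ⟨(1 - a).toNat, by omega⟩
  obtain ⟨m, rfl⟩ : ∃ m : ℕ, b = m := ⟨b.toNat, by omega⟩
  rw [hk, coeffXY_nat, coeffXY_nat, e, map_sub, Polynomial.coeff_sub]
  cases k with
  | zero =>
    rw [coeffXY_pos _ _ (show 0 < a by omega), coeffXY_pos _ _ (show 0 < a by omega)]
    simp
  | succ k =>
    have ha' : a = -(k : ℤ) := by push_cast at hk; omega
    rw [PowerSeries.coeff_succ_X_mul, PowerSeries.coeff_C_mul, add_mul, Polynomial.coeff_add,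
      Polynomial.coeff_C_mul, ha', coeffXY_nat, sub_sub]
    congr 2
    cases m with
    | zero =>
      rw [coeffXY_neg _ _ (show ((0 : ℕ) : ℤ) - 1 < 0 by simp)]
      simp
    | succ m =>
      rw [show ((m + 1 : ℕ) : ℤ) - 1 = m by push_cast; ring, coeffXY_nat, Polynomial.coeff_X_mul]

theorem constantCoeff_lin (t : A) : PowerSeries.constantCoeff (lin t) = 1 := by
  simp [lin]

theorem lin_mul_pole (t : A) : lin t * pole t = PowerSeries.X := by
  rw [pole, ← mul_assoc, (PowerSeries.commute_X (lin t)).eq, mul_assoc, PowerSeries.mul_invOfUnit,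
    mul_one]
  exact constantCoeff_lin t

theorem coeffXY_X_mul (φ : PowerSeries (Polynomial A)) (a b : ℤ) :
    coeffXY (PowerSeries.X * φ) (a - 1) b = coeffXY φ a b := by
  rcases lt_or_ge b 0 with hb | hb
  · rw [coeffXY_neg _ _ hb, coeffXY_neg _ _ hb]
  rcases lt_or_ge 1 a with ha | ha
  · rw [coeffXY_pos _ _ (show 0 < a by omega), coeffXY_pos _ _ (show 0 < a - 1 by omega)]
  obtain ⟨k, hk⟩ : ∃ k : ℕ, a - 1 = -(k : ℤ) := ⟨(1 - a).toNat, by omega⟩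
  obtain ⟨m, rfl⟩ : ∃ m : ℕ, b = m := ⟨b.toNat, by omega⟩
  rw [hk, coeffXY_nat]
  cases k with
  | zero =>
    rw [coeffXY_pos _ _ (show 0 < a by omega)]
    simp
  | succ k =>
    rw [PowerSeries.coeff_succ_X_mul, show a = -(k : ℤ) by push_cast at hk; omega, coeffXY_nat]

theorem mulLin_pole (t : A) (a b : ℤ) :
    mulLin t (coeffXY (pole t)) a b = if a = 0 ∧ b = 0 then 1 else 0 := by
  rw [← coeffXY_lin_mul, lin_mul_pole, ← mul_one PowerSeries.X, coeffXY_X_mul, coeffXY_one]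

theorem lin_mul_ratioXY {s t : A} (h : Commute s t) : lin t * ratioXY s t = lin s := by
  have hc : lin t * lin s = lin s * lin t := by
    have h1 : Commute (Polynomial.X + Polynomial.C t) (Polynomial.X + Polynomial.C s) := by
      refine (Commute.add_left ?_ ?_)
      · exact Polynomial.commute_X _
      · refine Commute.add_right (Polynomial.commute_X _).symm ?_
        rw [Commute, SemiconjBy, ← map_mul, ← map_mul, h.eq]
    have h2 : Commute (PowerSeries.C (Polynomial.X + Polynomial.C t) * PowerSeries.X)
        (PowerSeries.C (Polynomial.X + Polynomial.C s) * PowerSeries.X) := by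
      refine Commute.mul_left (Commute.mul_right ?_ (PowerSeries.commute_X _)) (PowerSeries.commute_X _).symm
      rw [Commute, SemiconjBy, ← map_mul, ← map_mul, h1.eq]
    exact (((Commute.one_left _).sub_right (Commute.one_left _)).sub_left
      ((Commute.one_right _).sub_right h2)).eq
  rw [ratioXY, ← mul_assoc, hc, mul_assoc, PowerSeries.mul_invOfUnit, mul_one]
  exact constantCoeff_lin t

/-- The expansion of `(x - y - s) / (x - y - t)`, multiplied by its denominator. -/
theorem mulLin_ratioXY {s t : A} (h : Commute s t) (a b : ℤ) :
    mulLin t (coeffXY (ratioXY s t)) a b =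
      mulLin s (fun a b => if a = 0 ∧ b = 0 then 1 else 0) a b := by
  rw [← coeffXY_lin_mul, lin_mul_ratioXY h, ← mul_one (lin s), coeffXY_lin_mul]
  congr 1
  ext a b
  exact coeffXY_one a b

end FormalProduct

/-! ### Existence and uniqueness of Gauss decompositions -/

section GaussExistence

open Matrix

variable {n : ℕ} {S : Type*} [Ring S]

/-- A matrix that is the identity modulo a right ideal `J` for which `1 + J` consists of units
has a Gauss decomposition: split off the first row and column, and pass to the Schur complement. -/
theorem exists_gauss {J : S → Prop} (hsub : ∀ x y, J x → J y → J (x - y))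
    (hright : ∀ x y, J x → J (x * y))
    (hu : ∀ x, J x → IsUnit (1 + x)) :
    ∀ (n : ℕ) (M : Matrix (Fin n) (Fin n) S),
      (∀ i j, J (M i j - (1 : Matrix (Fin n) (Fin n) S) i j)) → ∃ D : Gauss n S, D.mat = M
  | 0, M, _ => ⟨⟨1, fun i => i.elim0, 1, fun i => i.elim0, fun i => i.elim0, fun i => i.elim0,
      fun i => i.elim0, fun i => i.elim0⟩, by ext i; exact i.elim0⟩
  | n + 1, M, hM => by
    have ha : IsUnit (M 0 0) := by
      have := hu _ (hM 0 0)
      rwa [Matrix.one_apply_eq, add_sub_cancel] at this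
    obtain ⟨a, ha⟩ := ha
    obtain ⟨D, hD⟩ := exists_gauss hsub hright hu n
      (fun i j => M i.succ j.succ - M i.succ 0 * ↑a⁻¹ * M 0 j.succ) (fun i j => by
        have hx := hM i.succ j.succ
        have hy := hM i.succ 0
        rw [Matrix.one_apply_ne (Fin.succ_ne_zero i), sub_zero] at hy
        have := hsub _ _ hx (hright _ (M 0 j.succ) (hright _ (↑a⁻¹ : S) hy))
        rw [Matrix.one_apply] at this ⊢
        simp only [Fin.succ_inj] at this
        rwa [sub_right_comm])
    refine ⟨⟨fun i j => Fin.cases (Fin.cases 1 (fun _ => 0) j)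
        (fun i => Fin.cases (M i.succ 0 * ↑a⁻¹) (fun j => D.F i j) j) i,
      Fin.cases a D.k,
      fun i j => Fin.cases (Fin.cases 1 (fun j => ↑a⁻¹ * M 0 j.succ) j)
        (fun i => Fin.cases 0 (fun j => D.E i j) j) i, ?_, ?_, ?_, ?_, ?_⟩, ?_⟩
    · exact fun i => Fin.cases rfl (fun i => D.F_diag i) i
    · intro i j hij
      induction j using Fin.cases with
      | zero => exact absurd hij (Fin.not_lt_zero i)
      | succ j =>
        induction i using Fin.cases with
        | zero => rfl
        | succ i => exact D.F_upper i j (Fin.succ_lt_succ_iff.1 hij)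
    · exact fun i => Fin.cases rfl (fun i => D.E_diag i) i
    · intro i j hij
      induction i using Fin.cases with
      | zero => exact absurd hij (Fin.not_lt_zero j)
      | succ i =>
        induction j using Fin.cases with
        | zero => rfl
        | succ j => exact D.E_lower i j (Fin.succ_lt_succ_iff.1 hij)
    · exact fun i => Fin.cases a.isUnit D.k_unit i
    · ext i j
      rw [Gauss.mat_apply, Fin.sum_univ_succ]
      induction i using Fin.cases with
      | zero =>
        induction j using Fin.cases with
        | zero => simp [ha]
        | succ j => simp
      | succ i =>
        induction j using Fin.cases with
        | zero => simp
        | succ j =>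
          have e := congrFun (congrFun hD i) j
          rw [Gauss.mat_apply] at e
          simp only [Fin.cases_zero, Fin.cases_succ]
          rw [e]
          simp [mul_assoc]

/-- A Gauss decomposition with invertible diagonal part is unique. -/
theorem Gauss.unique (D : Gauss n S) {F E : Matrix (Fin n) (Fin n) S} {k : Fin n → S}
    (hF : ∀ i, F i i = 1) (hF' : ∀ i j, i < j → F i j = 0) (hE : ∀ i, E i i = 1)
    (hE' : ∀ i j, j < i → E i j = 0) (e : D.mat = F * diagonal k * E) :
    F = D.F ∧ k = D.k ∧ E = D.E := by
  obtain ⟨F₁, g1, g2, g3, g4⟩ := exists_inv_of_lower hF hF'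
  obtain ⟨E₁, g5, g6, g7, g8⟩ := exists_inv_of_upper D.E_diag D.E_lower
  have key : F₁ * D.F * diagonal D.k = diagonal k * (E * E₁) := by
    have e1 : F₁ * (D.F * diagonal D.k * D.E) * E₁ = F₁ * (F * diagonal k * E) * E₁ := by
      rw [← e, Gauss.mat]
    calc F₁ * D.F * diagonal D.k = F₁ * D.F * diagonal D.k * (D.E * E₁) := by rw [g7, mul_one]
      _ = F₁ * (D.F * diagonal D.k * D.E) * E₁ := by simp only [Matrix.mul_assoc]
      _ = (F₁ * F) * diagonal k * (E * E₁) := by rw [e1]; simp only [Matrix.mul_assoc]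
      _ = diagonal k * (E * E₁) := by rw [g4, one_mul]
  have low : ∀ {A B : Matrix (Fin n) (Fin n) S}, (∀ i, A i i = 1) → (∀ i j, i < j → A i j = 0) →
      (∀ i, B i i = 1) → (∀ i j, i < j → B i j = 0) →
      (∀ i, (A * B) i i = 1) ∧ ∀ i j, i < j → (A * B) i j = 0 := by
    intro A B a1 a2 b1 b2
    refine ⟨fun i => ?_, fun i j hij => ?_⟩
    · rw [Matrix.mul_apply, Finset.sum_eq_single i, a1, b1, one_mul]
      · intro l _ hl
        rcases lt_or_gt_of_ne hl with hl | hl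
        · rw [b2 _ _ hl, mul_zero]
        · rw [a2 _ _ hl, zero_mul]
      · exact fun h => absurd (Finset.mem_univ _) h
    · rw [Matrix.mul_apply]
      refine Finset.sum_eq_zero fun l _ => ?_
      rcases lt_or_ge i l with hl | hl
      · rw [a2 _ _ hl, zero_mul]
      · rw [b2 _ _ (lt_of_le_of_lt hl hij), mul_zero]
  have l1 := low g1 g2 D.F_diag D.F_upper
  have u2 : (∀ i, (E * E₁) i i = 1) ∧ ∀ i j, j < i → (E * E₁) i j = 0 := by
    refine ⟨fun i => ?_, fun i j hij => ?_⟩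
    · rw [Matrix.mul_apply, Finset.sum_eq_single i, hE, g5, one_mul]
      · intro l _ hl
        rcases lt_or_gt_of_ne hl with hl | hl
        · rw [hE' _ _ hl, zero_mul]
        · rw [g6 _ _ hl, mul_zero]
      · exact fun h => absurd (Finset.mem_univ _) h
    · rw [Matrix.mul_apply]
      refine Finset.sum_eq_zero fun l _ => ?_
      rcases lt_or_ge l i with hl | hl
      · rw [hE' _ _ hl, zero_mul]
      · rw [g6 _ _ (lt_of_lt_of_le hij hl), mul_zero]
  have key' : ∀ i j, (F₁ * D.F) i j * D.k j = k i * (E * E₁) i j := fun i j => by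
    rw [← Matrix.mul_diagonal, key, Matrix.diagonal_mul]
  have hk : k = D.k := by
    ext i
    have := key' i i
    rw [l1.1, u2.1, one_mul, mul_one] at this
    exact this.symm
  have hF1 : F₁ * D.F = 1 := by
    ext i j
    rcases lt_trichotomy i j with hij | rfl | hij
    · rw [l1.2 _ _ hij, Matrix.one_apply_ne hij.ne]
    · rw [l1.1, Matrix.one_apply_eq]
    · have := key' i j
      rw [u2.2 _ _ hij, mul_zero] at this
      rw [(D.k_unit j).mul_left_eq_zero.1 this, Matrix.one_apply_ne hij.ne']
  have hE1 : E * E₁ = 1 := by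
    ext i j
    rcases lt_trichotomy i j with hij | rfl | hij
    · have := key' i j
      rw [l1.2 _ _ hij, zero_mul, hk] at this
      rw [(D.k_unit i).mul_right_eq_zero.1 this.symm, Matrix.one_apply_ne hij.ne]
    · rw [u2.1, Matrix.one_apply_eq]
    · rw [u2.2 _ _ hij, Matrix.one_apply_ne hij.ne']
  refine ⟨?_, hk, ?_⟩
  · calc F = F * (F₁ * D.F) := by rw [hF1, mul_one]
      _ = D.F := by rw [← Matrix.mul_assoc, g3, one_mul]
  · calc E = E * E₁ * D.E := by rw [Matrix.mul_assoc, g8, mul_one]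
      _ = D.E := by rw [hE1, one_mul]

end GaussExistence

/-! ### The defining relations in the form of `SeriesRLL` -/

section MatrixProduct

variable {A : Type*} [Ring A]

/-- For given indices, only finitely many pairs of nonzero coefficients contribute to the product. -/
def FinSupp (F G : ℤ → ℤ → A) : Prop :=
  ∀ a b, {p : ℤ × ℤ | F p.1 p.2 ≠ 0 ∧ G (a - p.1) (b - p.2) ≠ 0}.Finite

theorem FinSupp.finConv {F G : ℤ → ℤ → A} (h : FinSupp F G) : FinConv F G := fun a b =>
  (h a b).subset fun _ hp => ⟨left_ne_zero_of_mul hp, right_ne_zero_of_mul hp⟩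

theorem FinSupp.symm {F G : ℤ → ℤ → A} (h : FinSupp F G) : FinSupp G F := fun a b => by
  refine ((h a b).preimage
    (f := Equiv.subLeft ((a, b) : ℤ × ℤ)) (Equiv.injective _).injOn).subset fun p hp => ?_
  simp only [Set.mem_preimage, Set.mem_ofPred_eq, Equiv.subLeft_apply, Prod.fst_sub,
    Prod.snd_sub, sub_sub_cancel] at hp ⊢
  exact hp.symm

theorem finSupp_of_fst_le {F G : ℤ → ℤ → A} (hF : ∀ a b, 0 < a → F a b = 0)
    (hF' : ∀ a, {b | F a b ≠ 0}.Finite) (hG : ∀ a b, 0 < a → G a b = 0) : FinSupp F G := fun a b => by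
  refine (Set.Finite.biUnion (Set.finite_Icc a 0) fun c _ =>
    (Set.Finite.image (fun d => (c, d)) (hF' c))).subset fun p ⟨h1, h2⟩ => ?_
  refine Set.mem_biUnion (x := p.1) ⟨?_, ?_⟩ ⟨p.2, h1, rfl⟩
  · by_contra h
    exact h2 (hG _ _ (by omega))
  · by_contra h
    exact h1 (hF _ _ (by omega))

theorem finSupp_of_add_le {F G : ℤ → ℤ → A} (hF : ∀ a b, 0 < a → F a b = 0)
    (hF' : ∀ a b, a + b < -1 → F a b = 0) (hG : ∀ a b, b < 0 → G a b = 0) : FinSupp F G := fun a b => by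
  refine ((Set.finite_Icc (-1 - b) 0).prod (Set.finite_Icc (-1) b)).subset fun p ⟨h1, h2⟩ => ?_
  have h3 : p.1 ≤ 0 := by by_contra h; exact h1 (hF _ _ (by omega))
  have h4 : -1 ≤ p.1 + p.2 := by by_contra h; exact h1 (hF' _ _ (by omega))
  have h5 : p.2 ≤ b := by by_contra h; exact h2 (hG _ _ (by omega))
  exact ⟨⟨by omega, h3⟩, ⟨by omega, h5⟩⟩

theorem finSupp_of_snd {F G : ℤ → ℤ → A} (hF : ∀ a, {b | F a b ≠ 0}.Finite)
    (hG : ∀ a b, a ≠ 0 → G a b = 0) : FinSupp F G := fun a b => by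
  refine (Set.Finite.image (fun d => (a, d)) (hF a)).subset fun p ⟨h1, h2⟩ => ?_
  have h3 : p.1 = a := by by_contra h; exact h2 (hG _ _ (by omega))
  exact ⟨p.2, by rw [← h3]; exact h1, Prod.ext h3.symm rfl⟩

theorem finSupp_of_quadrant {F G : ℤ → ℤ → A} (hF : ∀ a b, a < 0 ∨ 0 < b → F a b = 0)
    (hG : ∀ a b, a < 0 ∨ 0 < b → G a b = 0) : FinSupp F G := fun a b => by
  refine ((Set.finite_Icc 0 a).prod (Set.finite_Icc b 0)).subset fun p ⟨h1, h2⟩ => ?_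
  refine ⟨⟨?_, ?_⟩, ⟨?_, ?_⟩⟩ <;> by_contra h
  · exact h1 (hF _ _ (by omega))
  · exact h2 (hG _ _ (by omega))
  · exact h2 (hG _ _ (by omega))
  · exact h1 (hF _ _ (by omega))

theorem finProd_add {F F' G : ℤ → ℤ → A} (h : FinConv F G) (h' : FinConv F' G) (a b : ℤ) :
    finProd (fun a b => F a b + F' a b) G a b = finProd F G a b + finProd F' G a b := by
  rw [finProd, finProd, finProd, ← finsum_add_distrib (h a b) (h' a b)]
  exact finsum_congr fun p => add_mul _ _ _

theorem finProd_zero (G : ℤ → ℤ → A) (a b : ℤ) : finProd (fun _ _ => 0) G a b = 0 := by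
  rw [finProd]
  simp

theorem finConv_zero (G : ℤ → ℤ → A) : FinConv (fun _ _ => 0) G := fun a b => by
  simp

theorem finConv_one (G : ℤ → ℤ → A) :
    FinConv (fun a b => if a = 0 ∧ b = 0 then 1 else 0) G := fun a b => by
  refine (Set.finite_singleton ((0, 0) : ℤ × ℤ)).subset fun p hp => ?_
  by_contra h
  exact hp (by
    simp only
    rw [if_neg (fun h' => h (Prod.ext h'.1 h'.2)), zero_mul])

/-- A series in `u⁻¹`, up to a positive power of `u`, that is annihilated by `u - v - t` is zero. -/
theorem eq_zero_of_mulLin_of_le {t : A} {G : ℤ → ℤ → A} {c : ℤ} (h : ∀ a b, mulLin t G a b = 0)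
    (hG : ∀ a b, c < a → G a b = 0) (a b : ℤ) : G a b = 0 := by
  have key : ∀ m : ℕ, ∀ b, G (c + 1 - m) b = 0 := by
    intro m
    induction m with
    | zero => exact fun b => hG _ _ (by push_cast; omega)
    | succ m ih =>
      intro b
      have e := h (c + 1 - m) b
      rw [mulLin, ih, ih, mul_zero, sub_zero, sub_zero] at e
      rw [← e]
      congr 1
      push_cast
      ring
  rcases lt_or_ge c a with ha | ha
  · exact hG _ _ ha
  · have := key (c + 1 - a).toNat b
    rwa [show c + 1 - ((c + 1 - a).toNat : ℤ) = a by omega] at this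

theorem map_mulLin {A' : Type*} [Ring A'] (f : A →+* A') (t : A) (F : ℤ → ℤ → A) (a b : ℤ) :
    f (mulLin t F a b) = mulLin (f t) (fun a b => f (F a b)) a b := by
  simp only [mulLin, map_sub, map_mul]

theorem pole_commute {t x : A} (h : Commute x t) (a b : ℤ) :
    Commute x (coeffXY (pole t) a b) := by
  refine sub_eq_zero.1 (eq_zero_of_mulLin_of_le (t := t) (c := 0)
    (G := fun a b => x * coeffXY (pole t) a b - coeffXY (pole t) a b * x) (fun a b => ?_)
    (fun a b ha => ?_) a b)
  · have e := mulLin_pole t a b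
    have e1 : x * mulLin t (coeffXY (pole t)) a b = mulLin t (coeffXY (pole t)) a b * x := by
      rw [e]; split_ifs <;> simp
    simp only [mulLin] at e1 ⊢
    rw [← sub_eq_zero] at e1
    rw [← e1]
    have h1 : x * (t * coeffXY (pole t) a b) = t * (x * coeffXY (pole t) a b) := by
      rw [← mul_assoc, h.eq, mul_assoc]
    simp only [mul_sub, sub_mul, h1, mul_assoc]
    abel
  · rw [coeffXY_pos _ _ ha]; simp

theorem map_pole {A' : Type*} [Ring A'] (f : A →+* A') (t : A) (a b : ℤ) :
    f (coeffXY (pole t) a b) = coeffXY (pole (f t)) a b := by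
  refine sub_eq_zero.1 (eq_zero_of_mulLin_of_le (t := f t) (c := 0)
    (G := fun a b => f (coeffXY (pole t) a b) - coeffXY (pole (f t)) a b) (fun a b => ?_)
    (fun a b ha => ?_) a b)
  · rw [mulLin_sub, ← map_mulLin, mulLin_pole, mulLin_pole]
    split_ifs <;> simp
  · rw [coeffXY_pos _ _ ha, coeffXY_pos _ _ ha, map_zero, sub_zero]

/-- `1 / (u - v)` is homogeneous of degree `-1`. -/
theorem pole_zero_homogeneous (a b : ℤ) (h : a + b ≠ -1) : coeffXY (pole (0 : A)) a b = 0 := by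
  rcases lt_or_ge b 0 with hb | hb
  · exact coeffXY_neg _ _ hb
  obtain ⟨m, rfl⟩ : ∃ m : ℕ, b = m := ⟨b.toNat, by omega⟩
  induction m generalizing a with
  | zero =>
    have e := mulLin_pole (0 : A) (a + 1) 0
    rw [mulLin, coeffXY_neg _ _ (show (0 : ℤ) - 1 < 0 by simp), if_neg (by simp at h; omega)] at e
    simpa using e
  | succ m ih =>
    have e := mulLin_pole (0 : A) (a + 1) (m + 1 : ℕ)
    rw [mulLin, if_neg (by push_cast; omega)] at e
    have := ih (a + 1) (by push_cast at h; omega) (by omega)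
    push_cast at e ⊢
    rw [add_sub_cancel_right, add_sub_cancel_right, this] at e
    simpa using e

variable [Algebra (PowerSeries ℂ) A] {n : ℕ}

theorem hPar_commute (x : A) : hPar A * x = x * hPar A := Algebra.commutes _ _

theorem RMatrix_apply (t : A) (p q : Fin n × Fin n) (a b : ℤ) : RMatrix n t p q a b =
    (if p = q then (if a = 0 ∧ b = 0 then 1 else 0) else 0) +
      (if p = q.swap then hPar A * coeffXY (pole t) a b else 0) := by
  rw [RMatrix, coeffXY_add]
  congr 1
  · split_ifs with h h'
    · rw [coeffXY_one, if_pos h']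
    · rw [coeffXY_one, if_neg h']
    · simp [coeffXY]
  · split_ifs
    · rw [coeffXY_CC_mul]
    · simp [coeffXY]

theorem map_RMatrix {A' : Type*} [Ring A'] [Algebra (PowerSeries ℂ) A']
    (f : A →ₐ[PowerSeries ℂ] A') (t : A) (p q : Fin n × Fin n) (a b : ℤ) :
    f (RMatrix n t p q a b) = RMatrix n (f t) p q a b := by
  have hh : f (hPar A) = hPar A' := by simp [hPar]
  have hp := map_pole (f : A →+* A') t a b
  simp only [RingHom.coe_coe] at hp
  rw [RMatrix_apply, RMatrix_apply, map_add]
  congr 1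
  · split_ifs <;> simp
  · split_ifs
    · rw [map_mul, hh, hp]
    · simp

theorem finProd_RMatrix (t : A) (p q : Fin n × Fin n) (M : ℤ → ℤ → A)
    (h : FinConv (coeffXY (pole t)) M) (a b : ℤ) : finProd (RMatrix n t p q) M a b =
      (if p = q then M a b else 0) +
        (if p = q.swap then hPar A * finProd (coeffXY (pole t)) M a b else 0) := by
  have e : RMatrix n t p q = fun a b =>
      (if p = q then (if a = 0 ∧ b = 0 then 1 else 0) else 0) +
      (if p = q.swap then hPar A * coeffXY (pole t) a b else 0) := by
    ext a b; exact RMatrix_apply t p q a b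
  rw [e]
  have h1 : FinConv (fun a b : ℤ => if p = q then (if a = 0 ∧ b = 0 then (1 : A) else 0) else 0) M := by
    split_ifs
    · exact finConv_one M
    · exact finConv_zero M
  have h2 : FinConv (fun a b : ℤ => if p = q.swap then hPar A * coeffXY (pole t) a b else 0) M := by
    split_ifs
    · exact h.mul_left _
    · exact finConv_zero M
  rw [finProd_add h1 h2]
  congr 1
  · split_ifs
    · exact finProd_one _ _ _
    · exact finProd_zero _ _ _
  · split_ifs
    · exact finProd_mul_left h _ _ _
    · exact finProd_zero _ _ _

theorem matProd_RMatrix (t : A) (M : Matrix (Fin n × Fin n) (Fin n × Fin n) (ℤ → ℤ → A))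
    (h : ∀ p q, FinConv (coeffXY (pole t)) (M p q)) (p q : Fin n × Fin n) (a b : ℤ) :
    ∑ r, finProd (RMatrix n t p r) (M r q) a b =
      M p q a b + hPar A * finProd (coeffXY (pole t)) (M p.swap q) a b := by
  simp only [fun r => finProd_RMatrix t p r (M r q) (h r q), Finset.sum_add_distrib]
  congr 1
  · simp
  · rw [Finset.sum_eq_single p.swap]
    · simp
    · intro r _ hr
      exact if_neg fun h => hr (by rw [h, Prod.swap_swap])
    · exact fun h => absurd (Finset.mem_univ _) h

theorem matProd_RMatrix_right (t : A) (M : Matrix (Fin n × Fin n) (Fin n × Fin n) (ℤ → ℤ → A))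
    (h : ∀ p q, FinConv (coeffXY (pole t)) (M p q)) (p q : Fin n × Fin n) (a b : ℤ) :
    ∑ r, finProd (RMatrix n t r q) (M p r) a b =
      M p q a b + hPar A * finProd (coeffXY (pole t)) (M p q.swap) a b := by
  simp only [fun r => finProd_RMatrix t r q (M p r) (h p r), Finset.sum_add_distrib]
  congr 1
  · simp
  · rw [Finset.sum_eq_single q.swap]
    · simp
    · intro r _ hr
      exact if_neg hr
    · exact fun h => absurd (Finset.mem_univ _) h

theorem RMatrix_commute {t x : A} (h : Commute x t) (p q : Fin n × Fin n) (a b : ℤ) :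
    Commute x (RMatrix n t p q a b) := by
  rw [RMatrix_apply]
  refine Commute.add_right ?_ ?_
  · split_ifs <;> simp
  · split_ifs
    · exact Commute.mul_right (hPar_commute x).symm (pole_commute h a b)
    · simp

theorem RMatrix_pos (t : A) (p q : Fin n × Fin n) (a b : ℤ) (h : 0 < a) :
    RMatrix n t p q a b = 0 := coeffXY_pos _ _ h

theorem RMatrix_finite (t : A) (p q : Fin n × Fin n) (a : ℤ) :
    {b | RMatrix n t p q a b ≠ 0}.Finite := coeffXY_finite _ _

theorem RMatrix_add_lt (p q : Fin n × Fin n) (a b : ℤ) (h : a + b < -1) :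
    RMatrix n (0 : A) p q a b = 0 := by
  have h0 : ¬(a = 0 ∧ b = 0) := by omega
  rw [RMatrix_apply, pole_zero_homogeneous _ _ (by omega), if_neg h0]
  simp

/-- `R(u-v-t) M = M' R(u-v+t)` with the denominators cleared. -/
theorem mulLin_mulLin_of_matProd {t : A}
    {M M' : Matrix (Fin n × Fin n) (Fin n × Fin n) (ℤ → ℤ → A)}
    (h : ∀ p q, FinConv (coeffXY (pole t)) (M p q))
    (h' : ∀ p q, FinConv (coeffXY (pole (-t))) (M' p q))
    (e : ∀ p q a b, ∑ r, finProd (RMatrix n t p r) (M r q) a b =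
      ∑ r, finProd (RMatrix n (-t) r q) (M' p r) a b) (p q : Fin n × Fin n) (a b : ℤ) :
    mulLin (-t) (mulLin t (fun a b => M p q a b - M' p q a b)) a b =
      hPar A * (mulLin t (M' p q.swap) a b - mulLin (-t) (M p.swap q) a b) := by
  have e0 : (fun a b => M p q a b - M' p q a b) = fun a b =>
      hPar A * (finProd (coeffXY (pole (-t))) (M' p q.swap) a b -
        finProd (coeffXY (pole t)) (M p.swap q) a b) := by
    ext a b
    have := e p q a b
    rw [matProd_RMatrix t M h, matProd_RMatrix_right (-t) M' h'] at this
    rw [mul_sub, sub_eq_sub_iff_add_eq_add, this, add_comm]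
  have e1 : ∀ a b, mulLin t (finProd (coeffXY (pole t)) (M p.swap q)) a b = M p.swap q a b :=
    fun a b => by
      rw [mulLin_finProd (h _ _), ← finProd_one (M p.swap q)]
      congr 1; ext a b; exact mulLin_pole t a b
  have e2 : ∀ a b, mulLin (-t) (finProd (coeffXY (pole (-t))) (M' p q.swap)) a b =
      M' p q.swap a b := fun a b => by
      rw [mulLin_finProd (h' _ _), ← finProd_one (M' p q.swap)]
      congr 1; ext a b; exact mulLin_pole (-t) a b
  have lin1 : ∀ (s : A) (F : ℤ → ℤ → A) (a b : ℤ),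
      mulLin s (fun a b => hPar A * F a b) a b = hPar A * mulLin s F a b := fun s F a b => by
    simp only [mulLin, mul_sub]
    rw [← mul_assoc s, ← hPar_commute s, mul_assoc]
  rw [e0]
  have e3 : mulLin t (fun a b => hPar A * (finProd (coeffXY (pole (-t))) (M' p q.swap) a b -
        finProd (coeffXY (pole t)) (M p.swap q) a b)) = fun a b => hPar A *
      (mulLin t (finProd (coeffXY (pole (-t))) (M' p q.swap)) a b -
        mulLin t (finProd (coeffXY (pole t)) (M p.swap q)) a b) := by
    ext a b
    rw [lin1, mulLin_sub]
  rw [e3, lin1, mulLin_sub]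
  have e4 : mulLin (-t) (fun a b => mulLin t (finProd (coeffXY (pole (-t))) (M' p q.swap)) a b) a b =
      mulLin t (M' p q.swap) a b := by
    refine (congrFun (congrFun (mulLin_comm (Commute.refl t).neg_left _) a) b).trans ?_
    congr 1; ext a b; exact e2 a b
  have e5 : mulLin (-t) (fun a b => mulLin t (finProd (coeffXY (pole t)) (M p.swap q)) a b) a b =
      mulLin (-t) (M p.swap q) a b := by
    congr 1; ext a b; exact e1 a b
  rw [e4, e5]

end MatrixProduct

/-! ### The quotients by powers of `h` -/

section LevelRelations

variable {n : ℕ}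

theorem SeriesRLL.of_map {B B' : Type*} [Ring B] [Ring B'] (f : B →+* B')
    (hf : Function.Injective f) {h t : B} {ε ε' : Sgn} {A A' : Matrix (Fin n) (Fin n) (PowerSeries B)}
    (H : SeriesRLL (f h) (f t) ε ε' (A.map (PowerSeries.map f)) (A'.map (PowerSeries.map f))) :
    SeriesRLL h t ε ε' A A' := fun i j k l a b => hf (by
  have e := H i j k l a b
  simp only [Matrix.map_apply, ser_map, ← map_mul, ← map_sub, ← map_neg, ← map_mulLin] at e
  have e1 : ∀ (t : B) (F : ℤ → ℤ → B), mulLin (f t) (fun a b => f (F a b)) =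
      fun a b => f (mulLin t F a b) := fun t F => by
    ext a b; exact (map_mulLin f t F a b).symm
  rw [e1, e1] at e
  exact e)

theorem finSupp_of_sgn {A : Type*} [Ring A] {F G : ℤ → ℤ → A} {ε ε' : Sgn}
    (h : ε = .plus ∨ ε' = .minus ∧ ∀ a b, a + b < -1 → F a b = 0)
    (hF : ∀ a b, 0 < a → F a b = 0) (hF' : ∀ a, {b | F a b ≠ 0}.Finite)
    (hG : ∀ a b, ε.Outside a → G a b = 0) (hG' : ∀ a b, ε'.Outside b → G a b = 0) :
    FinSupp F G := by
  rcases h with rfl | ⟨rfl, h⟩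
  · exact finSupp_of_fst_le hF hF' hG
  · exact finSupp_of_add_le hF h hG'

theorem LMatrix_map {A A' : Type*} [Ring A] [Ring A'] [Algebra (PowerSeries ℂ) A]
    [Algebra (PowerSeries ℂ) A'] (f : A →ₐ[PowerSeries ℂ] A') (l : Fin n → Fin n → ℤ → A) (ε : Sgn)
    (i j : Fin n) : PowerSeries.map (f : A →+* A') (LMatrix l ε i j) =
      LMatrix (fun i j k => f (l i j k)) ε i j := by
  have hh : f (hPar A) = hPar A' := by simp [hPar]
  have h1 : PowerSeries.map (f : A →+* A') ((1 : Matrix (Fin n) (Fin n) (PowerSeries A)) i j) =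
      (1 : Matrix (Fin n) (Fin n) (PowerSeries A')) i j := by
    rw [Matrix.one_apply, Matrix.one_apply]
    split_ifs <;> simp
  cases ε
  · simp only [LMatrix, map_sub, map_mul, h1, PowerSeries.map_C, PowerSeries.map_X, RingHom.coe_coe, hh]
    congr 3
  · simp only [LMatrix, map_add, map_mul, h1, PowerSeries.map_C, RingHom.coe_coe, hh]
    congr 2

/-- The matrix `L^±(u)` over the quotient by `h ^ N`. -/
def levelL (n N : ℕ) (ε : Sgn) : Matrix (Fin n) (Fin n) (PowerSeries (Level n N)) :=
  (freeL n ε).map (PowerSeries.map (toLevel n N : Free n →+* Level n N))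

/-- The central element `c` in the quotient by `h ^ N`. -/
def levelC (n N : ℕ) : Level n N := toLevel n N (freeC n)

theorem commute_coeff_levelL (N : ℕ) (ε : Sgn) (i j : Fin n) (r : ℕ) :
    PowerSeries.coeff r (levelL n N ε i j) * levelC n N =
      levelC n N * PowerSeries.coeff r (levelL n N ε i j) := by
  have := toLevel_rel (N := N) (LevelRel.rel (Rel.central ε i j r))
  rw [map_mul, map_mul] at this
  simpa [levelL, levelC] using this

theorem commute_ser_levelL (N : ℕ) (ε : Sgn) (i j : Fin n) (m : ℤ) :
    Commute (ser ε (levelL n N ε i j) m) (levelC n N) := by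
  cases ε <;> simp only [ser] <;> split_ifs
  · exact commute_coeff_levelL N _ i j _
  · exact Commute.zero_left _
  · exact commute_coeff_levelL N _ i j _
  · exact Commute.zero_left _

theorem hMul_commute {A : Type*} [Ring A] [Algebra (PowerSeries ℂ) A] (z : ℂ) {x c : A}
    (h : Commute x c) : Commute x (hMul z c) :=
  ((Algebra.commute_algebraMap_right _ x).mul_right (Algebra.commute_algebraMap_right _ x)).mul_right h

theorem map_hMul {A A' : Type*} [Ring A] [Ring A'] [Algebra (PowerSeries ℂ) A]
    [Algebra (PowerSeries ℂ) A'] (f : A →ₐ[PowerSeries ℂ] A') (z : ℂ) (x : A) :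
    f (hMul z x) = hMul z (f x) := by
  simp [hMul, hPar]

theorem map_hPar {A A' : Type*} [Ring A] [Ring A'] [Algebra (PowerSeries ℂ) A]
    [Algebra (PowerSeries ℂ) A'] (f : A →ₐ[PowerSeries ℂ] A') : f (hPar A) = hPar A' := by
  simp [hPar]

theorem hMul_half {A : Type*} [Ring A] [Algebra (PowerSeries ℂ) A] (x : A) :
    hMul (1 / 2) x = (2 : ℤ) • hMul (1 / 4) x := by
  have h2 : (1 / 2 : ℂ) = 1 / 4 + 1 / 4 := by norm_num
  rw [h2, hMul, hMul, map_add, map_add, add_mul, add_mul, two_zsmul]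

theorem hMul_pow_eq_zero {N : ℕ} (z : ℂ) (x : Level n N) : hMul z x ^ N = 0 := by
  rw [hMul, ← hPar_commute, mul_assoc, (Commute.mul_pow (hPar_commute _)), level_hPar_pow, zero_mul]

/-- A relation `R(u-v-t) L₁ L₂ = L₂ L₁ R(u-v-t')` over the free algebra, where `t' = -t` in the
quotient, yields the relation with the denominators cleared. -/
theorem seriesRLL_of_rel (N : ℕ) {ε ε' : Sgn} {t t' : Free n} {s : Level n N}
    (hs : toLevel n N t = s) (hs' : toLevel n N t' = -s)
    (hc : ∀ x, Commute x (levelC n N) → Commute x s)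
    (hε : ε = .plus ∨ ε' = .minus ∧ t = 0 ∧ t' = 0)
    (e : ∀ p q a b, toLevel n N (matProd (RMatrix n t)
          (L12 ε ε' (freeL n ε) (freeL n ε')) p q a b) =
        toLevel n N (matProd (L21 ε ε' (freeL n ε) (freeL n ε')) (RMatrix n t') p q a b)) :
    SeriesRLL (hPar (Level n N)) s ε ε' (levelL n N ε) (levelL n N ε') := by
  have out : ∀ {A : Type} [Ring A] (M M' : Matrix (Fin n) (Fin n) (PowerSeries A))
      (p q : Fin n × Fin n) (a b : ℤ), (ε.Outside a ∨ ε'.Outside b) →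
      L12 ε ε' M M' p q a b = 0 ∧ L21 ε ε' M M' p q a b = 0 := by
    rintro A _ M M' p q a b (h | h)
    · simp [L12, L21, ser_outside ε _ h]
    · simp [L12, L21, ser_outside ε' _ h]
  have s1 : ∀ p q r r', FinSupp (RMatrix n t p q) (L12 ε ε' (freeL n ε) (freeL n ε') r r') := by
    intro p q r r'
    refine finSupp_of_sgn (hε.imp_right fun h => ⟨h.1, fun a b hab => ?_⟩) (RMatrix_pos t p q)
      (RMatrix_finite t p q) (fun a b h => (out _ _ _ _ _ _ (.inl h)).1)
      (fun a b h => (out _ _ _ _ _ _ (.inr h)).1)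
    rw [h.2.1]
    exact RMatrix_add_lt p q a b hab
  have s2 : ∀ p q r r', FinSupp (RMatrix n t' p q) (L21 ε ε' (freeL n ε) (freeL n ε') r r') := by
    intro p q r r'
    refine finSupp_of_sgn (hε.imp_right fun h => ⟨h.1, fun a b hab => ?_⟩) (RMatrix_pos t' p q)
      (RMatrix_finite t' p q) (fun a b h => (out _ _ _ _ _ _ (.inl h)).2)
      (fun a b h => (out _ _ _ _ _ _ (.inr h)).2)
    rw [h.2.2]
    exact RMatrix_add_lt p q a b hab
  have s3 : ∀ p q, FinConv (coeffXY (pole s)) (L12 ε ε' (levelL n N ε) (levelL n N ε') p q) := by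
    intro p q
    refine (finSupp_of_sgn (hε.imp_right fun h => ⟨h.1, fun a b hab => ?_⟩)
      (fun a b h => coeffXY_pos _ _ h) (coeffXY_finite _)
      (fun a b h => (out _ _ _ _ _ _ (.inl h)).1) (fun a b h => (out _ _ _ _ _ _ (.inr h)).1)).finConv
    rw [← hs, h.2.1, map_zero]
    exact pole_zero_homogeneous a b (by omega)
  have s4 : ∀ p q, FinConv (coeffXY (pole (-s))) (L21 ε ε' (levelL n N ε) (levelL n N ε') p q) := by
    intro p q
    refine (finSupp_of_sgn (hε.imp_right fun h => ⟨h.1, fun a b hab => ?_⟩)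
      (fun a b h => coeffXY_pos _ _ h) (coeffXY_finite _)
      (fun a b h => (out _ _ _ _ _ _ (.inl h)).2) (fun a b h => (out _ _ _ _ _ _ (.inr h)).2)).finConv
    rw [← hs', h.2.2, map_zero]
    exact pole_zero_homogeneous a b (by omega)
  have m1 : ∀ p q a b, toLevel n N (L12 ε ε' (freeL n ε) (freeL n ε') p q a b) =
      L12 ε ε' (levelL n N ε) (levelL n N ε') p q a b := by
    intro p q a b
    simp only [L12, levelL, Matrix.map_apply, ser_map, map_mul, RingHom.coe_coe]
  have m2 : ∀ p q a b, toLevel n N (L21 ε ε' (freeL n ε) (freeL n ε') p q a b) =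
      L21 ε ε' (levelL n N ε) (levelL n N ε') p q a b := by
    intro p q a b
    simp only [L21, levelL, Matrix.map_apply, ser_map, map_mul, RingHom.coe_coe]
  have key := mulLin_mulLin_of_matProd s3 s4 (fun p q a b => by
    have h0 := e p q a b
    rw [matProd, matProd, map_sum, map_sum] at h0
    refine Eq.trans ?_ (h0.trans ?_)
    · refine Finset.sum_congr rfl fun r _ => ?_
      refine Eq.trans ?_ (map_finProd (toLevel n N : Free n →+* Level n N)
        (s1 p r r q).finConv a b).symm
      simp only [RingHom.coe_coe, map_RMatrix, m1, hs]
    · refine Finset.sum_congr rfl fun r _ => ?_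
      refine (map_finProd (toLevel n N : Free n →+* Level n N)
        (s2 r q p r).symm.finConv a b).trans ?_
      simp only [RingHom.coe_coe, map_RMatrix, m2, hs']
      refine finProd_comm (fun a b c d => RMatrix_commute ?_ r q c d) a b
      refine (hc _ ?_).neg_right
      exact (commute_ser_levelL N _ _ _ _).mul_left (commute_ser_levelL N _ _ _ _))
  intro i j k l a b
  exact key (i, k) (j, l) a b

/-- The defining relations modulo `h ^ N`. In all cases the shift of the argument of `R` is
`(ε - ε') h c / 4`. -/
theorem levelRLL (N : ℕ) (ε ε' : Sgn) (h : ε = ε' ∨ ε = .plus) :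
    SeriesRLL (hPar (Level n N)) ((ε.val - ε'.val) • hMul (1 / 4) (levelC n N)) ε ε'
      (levelL n N ε) (levelL n N ε') := by
  have same : ∀ ε, SeriesRLL (hPar (Level n N)) ((ε.val - ε.val) • hMul (1 / 4) (levelC n N)) ε ε
      (levelL n N ε) (levelL n N ε) := by
    intro ε
    rw [sub_self, zero_smul]
    refine seriesRLL_of_rel N (t := 0) (t' := 0) (map_zero _) (by simp)
      (fun x _ => Commute.zero_right x) ?_
      (fun p q a b => toLevel_rel (LevelRel.rel (Rel.same ε p q a b)))
    cases ε <;> simp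
  rcases h with rfl | rfl
  · exact same ε
  cases ε'
  · exact same .plus
  have ht : (Sgn.plus.val - Sgn.minus.val) • hMul (1 / 4) (levelC n N) =
      hMul (1 / 2) (levelC n N) := (hMul_half _).symm
  rw [ht]
  refine seriesRLL_of_rel N (t := hMul (1 / 2) (freeC n)) (t' := -hMul (1 / 2) (freeC n))
    (map_hMul _ _ _) (by rw [map_neg, map_hMul]; rfl) (fun x hx => hMul_commute _ hx) (.inl rfl)
    (fun p q a b => toLevel_rel (LevelRel.rel (Rel.mixed p q a b)))

end LevelRelations

/-! ### Gauss decompositions modulo powers of `h` -/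

section LevelGauss

variable {n : ℕ}

/-- The centralizer of `c` in the quotient by `h ^ N`; it contains the coefficients of `L^±(u)`, but
not necessarily the generators `l_{ij}^{(k)}` themselves. -/
def levelB (n N : ℕ) : Subring (Level n N) := Subring.centralizer {levelC n N}

theorem mem_levelB {N : ℕ} {x : Level n N} : x ∈ levelB n N ↔ Commute x (levelC n N) := by
  rw [levelB, Subring.mem_centralizer_iff]
  simp only [Set.mem_singleton_iff, forall_eq]
  exact eq_comm

/-- `L^±(u)` over the centralizer of `c`. -/
def levelLB (n N : ℕ) (ε : Sgn) : Matrix (Fin n) (Fin n) (PowerSeries (levelB n N)) := fun i j =>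
  PowerSeries.mk fun r => ⟨PowerSeries.coeff r (levelL n N ε i j),
    mem_levelB.2 (commute_coeff_levelL N ε i j r)⟩

theorem levelLB_map (N : ℕ) (ε : Sgn) :
    (levelLB n N ε).map (PowerSeries.map (levelB n N).subtype) = levelL n N ε := by
  ext i j r
  simp [levelLB]

theorem LMatrix_eq {A : Type*} [Ring A] [Algebra (PowerSeries ℂ) A] (l : Fin n → Fin n → ℤ → A)
    (ε : Sgn) (i j : Fin n) : ∃ φ, LMatrix l ε i j =
      (1 : Matrix (Fin n) (Fin n) (PowerSeries A)) i j + PowerSeries.C (hPar A) * φ := by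
  cases ε
  · exact ⟨-(PowerSeries.X * PowerSeries.mk fun k : ℕ => l i j (k : ℤ)), by
      rw [mul_neg, ← sub_eq_add_neg]; rfl⟩
  · exact ⟨_, rfl⟩

theorem levelL_eq (N : ℕ) (ε : Sgn) (i j : Fin n) : ∃ φ, levelL n N ε i j =
    (1 : Matrix (Fin n) (Fin n) (PowerSeries (Level n N))) i j +
      PowerSeries.C (hPar (Level n N)) * φ := by
  obtain ⟨φ, hφ⟩ := LMatrix_eq (fun i j k => FreeAlgebra.ι (PowerSeries ℂ) (Gen.l i j k)) ε i j
  refine ⟨PowerSeries.map (toLevel n N : Free n →+* Level n N) φ, ?_⟩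
  rw [levelL, Matrix.map_apply, freeL, hφ, map_add, map_mul, PowerSeries.map_C, Matrix.one_apply,
    Matrix.one_apply]
  have := map_hPar (toLevel n N)
  rw [RingHom.coe_coe, this]
  congr 1
  split_ifs <;> simp

theorem C_hPar_commute {A : Type*} [Ring A] [Algebra (PowerSeries ℂ) A] (φ : PowerSeries A) :
    Commute (PowerSeries.C (hPar A)) φ := by
  ext m
  rw [PowerSeries.coeff_C_mul, PowerSeries.coeff_mul_C, hPar_commute]

theorem map_injective_of_injective {R R' : Type*} [Ring R] [Ring R'] {f : R →+* R'}
    (hf : Function.Injective f) : Function.Injective (PowerSeries.map f) := fun φ ψ h => by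
  ext m
  have := congrArg (PowerSeries.coeff m) h
  rw [PowerSeries.coeff_map, PowerSeries.coeff_map] at this
  exact hf this

theorem exists_levelGauss (N : ℕ) (ε : Sgn) :
    ∃ D : Gauss n (PowerSeries (levelB n N)), D.mat = levelLB n N ε := by
  have inj : Function.Injective (PowerSeries.map (levelB n N).subtype) :=
    map_injective_of_injective Subtype.val_injective
  refine exists_gauss (J := fun φ => ∃ ψ, PowerSeries.map (levelB n N).subtype φ =
    PowerSeries.C (hPar (Level n N)) * ψ) ?_ ?_ ?_ n _ ?_
  · rintro x y ⟨φ, hφ⟩ ⟨ψ, hψ⟩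
    exact ⟨φ - ψ, by rw [map_sub, hφ, hψ, mul_sub]⟩
  · rintro x y ⟨φ, hφ⟩
    exact ⟨_, by rw [map_mul, hφ, mul_assoc]⟩
  · rintro x ⟨φ, hφ⟩
    have hx : IsNilpotent x := ⟨N, inj (by
      rw [map_pow, hφ, (C_hPar_commute φ).mul_pow, ← map_pow, level_hPar_pow, map_zero, zero_mul,
        map_zero])⟩
    exact hx.isUnit_one_add
  · intro i j
    obtain ⟨φ, hφ⟩ := levelL_eq (n := n) N ε i j
    refine ⟨φ, ?_⟩
    have h1 : PowerSeries.map (levelB n N).subtype (levelLB n N ε i j) = levelL n N ε i j := by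
      rw [← levelLB_map]; rfl
    rw [map_sub, h1, hφ, Matrix.one_apply, Matrix.one_apply]
    split_ifs <;> simp

/-- The relations of the two matrices `L^±(u)` modulo `h ^ N`, over the centralizer of `c`. -/
def levelData (n N : ℕ) : RLLData n (levelB n N) where
  h := ⟨hPar (Level n N), mem_levelB.2 (hPar_commute _)⟩
  s := ⟨hMul (1 / 4) (levelC n N), mem_levelB.2 (hMul_commute _ (Commute.refl _)).symm⟩
  D ε := (exists_levelGauss N ε).choose
  h_center := Subring.mem_center_iff.2 fun g => Subtype.ext (hPar_commute _).symm
  s_center := Subring.mem_center_iff.2 fun g => Subtype.ext (hMul_commute _ (mem_levelB.1 g.2))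
  h_nil := ⟨N, Subtype.ext (level_hPar_pow n N)⟩
  s_nil := ⟨N, Subtype.ext (hMul_pow_eq_zero _ _)⟩
  rel ε ε' h := by
    refine SeriesRLL.of_map (levelB n N).subtype Subtype.val_injective ?_
    rw [(exists_levelGauss N ε).choose_spec, (exists_levelGauss N ε').choose_spec, levelLB_map,
      levelLB_map, map_zsmul]
    exact levelRLL N ε ε' h

theorem levelData_mat (N : ℕ) (ε : Sgn) : ((levelData n N).D ε).mat = levelLB n N ε :=
  (exists_levelGauss N ε).choose_spec

/-- The projection to the quotient by `h ^ N`. -/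
def proj (n N : ℕ) : DY n →ₐ[PowerSeries ℂ] Level n N :=
  (Pi.evalAlgHom (PowerSeries ℂ) (fun N => Level n N) N).comp (completion n).val

theorem proj_apply (N : ℕ) (x : DY n) : proj n N x = x.1 N := rfl

theorem eq_of_proj {x y : DY n} (h : ∀ N, 0 < N → proj n N x = proj n N y) : x = y := by
  refine Subtype.ext (funext fun N => ?_)
  have h1 := h (N + 1) N.succ_pos
  rw [← x.2 N, ← y.2 N]
  exact congrArg (transition n N) h1

theorem proj_L (N : ℕ) (ε : Sgn) :
    (L n ε).map (PowerSeries.map (proj n N : DY n →+* Level n N)) = levelL n N ε := by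
  ext1 i j
  rw [levelL, Matrix.map_apply, Matrix.map_apply, L, freeL, LMatrix_map, LMatrix_map]
  rfl

theorem proj_hSum (x : ℕ → DY n) (N : ℕ) :
    proj n N (hSum x) = ∑ i ∈ Finset.range N, hPar (Level n N) ^ i * proj n N (x i) := rfl

theorem isUnit_one_add_hPar_mul (x : DY n) : IsUnit (1 + hPar (DY n) * x) := by
  refine ⟨⟨_, hSum fun i => (-x) ^ i, ?_, ?_⟩, rfl⟩ <;>
  · refine eq_of_proj fun N _ => ?_
    have hh := map_hPar (proj n N)
    have e : ∀ i, hPar (Level n N) ^ i * proj n N ((-x) ^ i) =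
        (-(hPar (Level n N) * proj n N x)) ^ i := fun i => by
      rw [map_pow, map_neg, ← mul_neg, Commute.mul_pow (hPar_commute _)]
    have h0 : (-(hPar (Level n N) * proj n N x)) ^ N = 0 := by
      rw [← e, level_hPar_pow, zero_mul]
    rw [map_mul, map_add, map_mul, hh, proj_hSum, map_one]
    simp only [e]
    rw [show 1 + hPar (Level n N) * proj n N x = 1 - -(hPar (Level n N) * proj n N x) by abel]
    first
    | rw [mul_neg_geom_sum, h0, sub_zero]
    | rw [geom_sum_mul_neg, h0, sub_zero]

theorem exists_gauss_L (ε : Sgn) : ∃ D : Gauss n (PowerSeries (DY n)), D.mat = L n ε := by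
  refine exists_gauss (J := fun φ => ∃ ψ, φ = PowerSeries.C (hPar (DY n)) * ψ) ?_ ?_ ?_ n _ ?_
  · rintro x y ⟨φ, hφ⟩ ⟨ψ, hψ⟩
    exact ⟨φ - ψ, by rw [hφ, hψ, mul_sub]⟩
  · rintro x y ⟨φ, hφ⟩
    exact ⟨_, by rw [hφ, mul_assoc]⟩
  · rintro x ⟨φ, rfl⟩
    rw [PowerSeries.isUnit_iff_constantCoeff]
    simpa using isUnit_one_add_hPar_mul (PowerSeries.constantCoeff φ)
  · intro i j
    obtain ⟨φ, hφ⟩ := LMatrix_eq (fun i j k => gen (n := n) (Gen.l i j k)) ε i j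
    exact ⟨φ, by rw [L, hφ, add_sub_cancel_left]⟩

theorem IsGauss.unique {ε : Sgn} {D : GaussData n} (h : IsGauss (L n ε) D)
    {D' : Gauss n (PowerSeries (DY n))} (h' : D'.mat = L n ε) :
    D.F = D'.F ∧ D.k = D'.k ∧ D.E = D'.E :=
  D'.unique h.F_diag h.F_upper h.E_diag h.E_lower (h'.trans h.eq)

theorem existsUnique_gaussData (ε : Sgn) : ∃! D : GaussData n, IsGauss (L n ε) D := by
  obtain ⟨D, hD⟩ := exists_gauss_L (n := n) ε
  refine ⟨⟨D.F, D.k, D.E⟩, ⟨D.F_diag, D.F_upper, D.E_diag, D.E_lower, hD.symm⟩, ?_⟩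
  intro D' h
  obtain ⟨h1, h2, h3⟩ := h.unique hD
  cases D'
  simp only at h1 h2 h3
  rw [h1, h2, h3]

theorem IsGauss.isUnit_k {ε : Sgn} {D : GaussData n} (h : IsGauss (L n ε) D) (i : Fin n) :
    IsUnit (D.k i) := by
  obtain ⟨D', hD⟩ := exists_gauss_L (n := n) ε
  rw [(h.unique hD).2.1]
  exact D'.k_unit i

theorem IsGauss.proj {ε : Sgn} {D : GaussData n} (h : IsGauss (L n ε) D) (N : ℕ) :
    D.F.map (PowerSeries.map (proj n N : DY n →+* Level n N)) =
      ((levelData n N).D ε).F.map (PowerSeries.map (levelB n N).subtype) ∧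
    (fun i => PowerSeries.map (YangianDouble.proj n N : DY n →+* Level n N) (D.k i)) =
      (fun i => PowerSeries.map (levelB n N).subtype (((levelData n N).D ε).k i)) ∧
    D.E.map (PowerSeries.map (YangianDouble.proj n N : DY n →+* Level n N)) =
      ((levelData n N).D ε).E.map (PowerSeries.map (levelB n N).subtype) := by
  obtain ⟨D', hD⟩ := exists_gauss_L (n := n) ε
  obtain ⟨h1, h2, h3⟩ := h.unique hD
  set f := PowerSeries.map (YangianDouble.proj n N : DY n →+* Level n N)
  set g := PowerSeries.map (levelB n N).subtype
  have e := (((levelData n N).D ε).map g).unique (F := (D'.map f).F) (k := (D'.map f).k)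
    (E := (D'.map f).E) (D'.map f).F_diag (D'.map f).F_upper (D'.map f).E_diag (D'.map f).E_lower
    (by
      refine Eq.trans ?_ (show (D'.map f).mat = _ from rfl)
      rw [Gauss.map_mat, Gauss.map_mat, hD, levelData_mat, levelLB_map, proj_L])
  rw [h1, h2, h3]
  exact e

end LevelGauss

/-! ### Reduction of the completed algebra modulo powers of `h` -/

section Reduction

variable {n : ℕ}

/-! #### Convergence -/

theorem toLevel_surjective (N : ℕ) : Function.Surjective (toLevel n N) :=
  RingQuot.mkAlgHom_surjective (PowerSeries ℂ) (LevelRel n N)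

/-- Congruence modulo `h ^ N`. -/
def hCon (A : Type*) [Ring A] [Algebra (PowerSeries ℂ) A] (N : ℕ) : RingCon A where
  r x y := ∃ z, x - y = hPar A ^ N * z
  iseqv :=
    ⟨fun x => ⟨0, by simp⟩, fun ⟨z, hz⟩ => ⟨-z, by rw [mul_neg, ← hz, neg_sub]⟩,
      fun ⟨z, hz⟩ ⟨w, hw⟩ => ⟨z + w, by rw [mul_add, ← hz, ← hw, sub_add_sub_cancel]⟩⟩
  add' := fun ⟨z, hz⟩ ⟨w, hw⟩ => ⟨z + w, by rw [mul_add, ← hz, ← hw]; abel⟩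
  mul' := fun {w x y z} ⟨a, ha⟩ ⟨b, hb⟩ => ⟨a * y + x * b, by
    have h1 : x * hPar A ^ N = hPar A ^ N * x := (Commute.pow_left (hPar_commute x) N).eq.symm
    rw [mul_add, ← mul_assoc, ← ha, ← mul_assoc, ← h1, mul_assoc, ← hb]
    noncomm_ring⟩

theorem hCon_iff {A : Type*} [Ring A] [Algebra (PowerSeries ℂ) A] {N : ℕ} {x y : A} :
    hCon A N x y ↔ ∃ z, x - y = hPar A ^ N * z := Iff.rfl

/-- The kernel of the projection from the quotient by `h ^ (N+1)` to the quotient by `h ^ N` is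
generated by `h ^ N`. -/
theorem exists_of_transition_eq_zero {N : ℕ} {x : Level n (N + 1)} (hx : transition n N x = 0) :
    ∃ z, x = hPar (Level n (N + 1)) ^ N * z := by
  let c := hCon (Level n (N + 1)) N
  let g : Free n →+* c.Quotient := c.mk'.comp (toLevel n (N + 1) : Free n →+* Level n (N + 1))
  have hg : ∀ ⦃x y : Free n⦄, LevelRel n N x y → g x = g y := by
    rintro x y (h | _)
    · exact congrArg c.mk' (toLevel_rel (LevelRel.rel h))
    · refine (RingCon.eq c).2 (hCon_iff.2 ⟨1, ?_⟩)
      rw [map_zero, sub_zero, mul_one, RingHom.coe_coe, map_pow, map_hPar]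
  let G : Level n N →+* c.Quotient := RingQuot.lift ⟨g, hg⟩
  obtain ⟨f, rfl⟩ := toLevel_surjective (N + 1) x
  rw [transition_toLevel] at hx
  have h1 : G (toLevel n N f) = g f := by
    have : toLevel n N f = RingQuot.mkRingHom (LevelRel n N) f := by
      rw [toLevel, ← RingQuot.mkAlgHom_coe (PowerSeries ℂ)]
      rfl
    rw [this]
    exact RingQuot.lift_mkRingHom_apply g hg f
  rw [hx, map_zero] at h1
  obtain ⟨z, hz⟩ := hCon_iff.1 ((RingCon.eq c).1 (show ((0 : Level n (N + 1)) : c.Quotient) =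
    (toLevel n (N + 1) f : Level n (N + 1)) from h1))
  exact ⟨-z, by rw [mul_neg, ← hz, zero_sub, neg_neg]⟩

theorem proj_toDY (N : ℕ) (f : Free n) : proj n N (toDY n f) = toLevel n N f := rfl

theorem proj_of_le {x y : DY n} {M N : ℕ} (h : M ≤ N) (hx : proj n N x = proj n N y) :
    proj n M x = proj n M y := by
  induction N, h using Nat.le_induction with
  | base => exact hx
  | succ N _ ih =>
    refine ih ?_
    have := congrArg (transition n N) hx
    rwa [proj_apply, proj_apply, x.2, y.2] at this

theorem exists_sub_toDY {N : ℕ} {x : DY n} (hx : proj n N x = 0) :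
    ∃ f : Free n, proj n (N + 1) (x - hPar (DY n) ^ N * toDY n f) = 0 := by
  obtain ⟨z, hz⟩ := exists_of_transition_eq_zero (x := proj n (N + 1) x) ((x.2 N).trans hx)
  obtain ⟨f, rfl⟩ := toLevel_surjective (N + 1) z
  exact ⟨f, by rw [map_sub, map_mul, map_pow, map_hPar, proj_toDY, hz, sub_self]⟩

/-- The kernel of the projection to the quotient by `h ^ N` is generated by `h ^ N`. -/
theorem exists_of_proj_eq_zero {N : ℕ} {x : DY n} (hx : proj n N x = 0) :
    ∃ y, x = hPar (DY n) ^ N * y := by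
  classical
  choose! φ hφ using fun (M : ℕ) (x : DY n) => exists_sub_toDY (N := M) (x := x)
  -- `r i` is `x` minus the first `i` terms of its expansion
  let r : ℕ → DY n := fun i => Nat.rec x (fun i y => y - hPar (DY n) ^ (N + i) * toDY n (φ (N + i) y)) i
  have r_succ : ∀ i, r (i + 1) = r i - hPar (DY n) ^ (N + i) * toDY n (φ (N + i) (r i)) := fun _ => rfl
  have hr : ∀ i, proj n (N + i) (r i) = 0 := by
    intro i
    induction i with
    | zero => exact hx
    | succ i ih => exact hφ (N + i) (r i) ih
  have hsum : ∀ i, x = r i + ∑ j ∈ Finset.range i, hPar (DY n) ^ (N + j) * toDY n (φ (N + j) (r j)) := by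
    intro i
    induction i with
    | zero => simp [r]
    | succ i ih =>
      rw [Finset.sum_range_succ, r_succ, sub_add_eq_add_sub, ← add_assoc, ← ih, add_sub_cancel_right]
  refine ⟨hSum fun i => toDY n (φ (N + i) (r i)), eq_of_proj fun M _ => ?_⟩
  have h1 : proj n M (r M) = 0 := by
    have := proj_of_le (show M ≤ N + M by omega) ((hr M).trans (map_zero (proj n (N + M))).symm)
    rwa [map_zero] at this
  conv_lhs => rw [hsum M]
  rw [map_add, h1, zero_add, map_sum, map_mul, proj_hSum, Finset.mul_sum]
  refine Finset.sum_congr rfl fun i _ => ?_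
  rw [map_mul, map_pow, map_pow, map_hPar, pow_add, mul_assoc]

/-- Convergence in the `h`-adic topology may be checked modulo powers of `h`. -/
theorem hasHSum_of_proj {ι : Type*} {f : ι → DY n} {s : DY n}
    (h : ∀ N, 0 < N → (Function.support fun i => proj n N (f i)).Finite ∧
      ∑ᶠ i, proj n N (f i) = proj n N s) : HasHSum f s := by
  classical
  intro N
  rcases Nat.eq_zero_or_pos N with rfl | hN
  · exact ⟨∅, fun S _ => ⟨s - ∑ i ∈ S, f i, by rw [pow_zero, one_mul]⟩⟩
  obtain ⟨h1, h2⟩ := h N hN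
  refine ⟨h1.toFinset, fun S hS => exists_of_proj_eq_zero ?_⟩
  rw [map_sub, ← h2, map_sum, finsum_eq_sum_of_support_subset (s := S) _ (fun i hi =>
    hS (h1.mem_toFinset.2 hi)), sub_self]

/-- Products of formal series may be computed modulo powers of `h`, where they are finite sums. -/
theorem isProd_of_proj {F G H : ℤ → ℤ → DY n}
    (h : ∀ N, 0 < N → FinConv (fun a b => proj n N (F a b)) (fun a b => proj n N (G a b)) ∧
      ∀ a b, finProd (fun a b => proj n N (F a b)) (fun a b => proj n N (G a b)) a b =
        proj n N (H a b)) : IsProd F G H := fun a b => by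
  refine hasHSum_of_proj fun N hN => ⟨?_, ?_⟩
  · simpa only [map_mul] using (h N hN).1 a b
  · simp only [map_mul]
    exact (h N hN).2 a b

theorem isProd_finProd {F G : ℤ → ℤ → DY n} (h : FinConv F G) : IsProd F G (finProd F G) :=
  isProd_of_proj fun N _ => ⟨h.map (proj n N : DY n →+* Level n N), fun a b =>
    (map_finProd (proj n N : DY n →+* Level n N) h a b).symm⟩

/-! #### The currents -/

theorem map_sh {B B' : Type*} [Ring B] [Ring B'] (f : B →+* B') (N : ℕ) (s : B) (G : ℤ → B) (m : ℤ) :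
    f (sh N s G m) = sh N (f s) (fun m => f (G m)) m := by
  simp only [sh, map_sum, map_zsmul, map_mul, map_pow]

theorem proj_shift (N : ℕ) (κ : DY n) (G : ℤ → DY n) (m : ℤ) : proj n N (shift κ G m) =
    sh N (hPar (Level n N) * proj n N κ) (fun m => proj n N (G m)) m := by
  rw [shift, proj_hSum, sh]
  refine Finset.sum_congr rfl fun i _ => ?_
  rw [map_zsmul, map_mul, map_pow, Commute.mul_pow (hPar_commute _), mul_smul_comm, mul_assoc]

variable {D : Sgn → GaussData n}

theorem IsGauss.proj_F {ε : Sgn} {D : GaussData n} (h : IsGauss (L n ε) D) (N : ℕ) (i j : Fin n)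
    (m : ℤ) : YangianDouble.proj n N (ser ε (D.F i j) m) = ser ε (((levelData n N).D ε).F i j) m := by
  have e := congrFun (congrFun (h.proj N).1 i) j
  have e1 := congrArg (fun φ => ser ε φ m) e
  simp only [Matrix.map_apply, ser_map, RingHom.coe_coe] at e1
  exact e1

theorem IsGauss.proj_E {ε : Sgn} {D : GaussData n} (h : IsGauss (L n ε) D) (N : ℕ) (i j : Fin n)
    (m : ℤ) : YangianDouble.proj n N (ser ε (D.E i j) m) = ser ε (((levelData n N).D ε).E i j) m := by
  have e := congrFun (congrFun (h.proj N).2.2 i) j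
  have e1 := congrArg (fun φ => ser ε φ m) e
  simp only [Matrix.map_apply, ser_map, RingHom.coe_coe] at e1
  exact e1

theorem IsGauss.map_k {ε : Sgn} {D : GaussData n} (h : IsGauss (L n ε) D) (N : ℕ) (i : Fin n) :
    PowerSeries.map (YangianDouble.proj n N : DY n →+* Level n N) (D.k i) =
      PowerSeries.map (levelB n N).subtype (((levelData n N).D ε).k i) :=
  congrFun (h.proj N).2.1 i

theorem IsGauss.map_inverse_k {ε : Sgn} {D : GaussData n} (h : IsGauss (L n ε) D) (N : ℕ)
    (i : Fin n) :
    PowerSeries.map (YangianDouble.proj n N : DY n →+* Level n N) (Ring.inverse (D.k i)) =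
      PowerSeries.map (levelB n N).subtype (Ring.inverse (((levelData n N).D ε).k i)) := by
  rw [← map_inverse _ (h.isUnit_k i), ← map_inverse _ (((levelData n N).D ε).k_unit i), h.map_k]

theorem proj_K (hD : ∀ ε, IsGauss (L n ε) (D ε)) (N : ℕ) (ε : Sgn) (i : Fin n) (m : ℤ) :
    proj n N (K D ε i m) = ser ε (((levelData n N).D ε).k i) m := by
  have e1 := congrArg (fun φ => ser ε φ m) ((hD ε).map_k N i)
  simp only [ser_map, RingHom.coe_coe] at e1
  exact e1

theorem proj_phi (hD : ∀ ε, IsGauss (L n ε) (D ε)) (N : ℕ) (ε : Sgn) (i : Fin (n - 1)) (m : ℤ) :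
    proj n N (phi D ε i m) = ser ε ((levelData n N).ratioK ε (lo i) (up i)) m := by
  have e1 := congrArg (fun φ => ser ε φ m) (show
    PowerSeries.map (proj n N : DY n →+* Level n N)
      ((D ε).k (up i) * Ring.inverse ((D ε).k (lo i))) =
      PowerSeries.map (levelB n N).subtype ((levelData n N).ratioK ε (lo i) (up i)) by
    rw [map_mul, (hD ε).map_k, (hD ε).map_inverse_k, ← map_mul]; rfl)
  simp only [ser_map, RingHom.coe_coe] at e1
  exact e1

theorem hPar_mul_proj_quarter (N : ℕ) :
    hPar (Level n N) * proj n N (quarter n) = (levelData n N).s := by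
  have h1 : proj n N (cElt n) = levelC n N := rfl
  change _ = hMul (1 / 4) (levelC n N)
  rw [quarter, map_mul, AlgHom.commutes, h1, hMul, ← mul_assoc, hPar_commute]

theorem proj_X_plus (hD : ∀ ε, IsGauss (L n ε) (D ε)) (N : ℕ) (i : Fin (n - 1)) (m : ℤ) :
    proj n N (X D .plus i m) = (levelData n N).cur N (lo i) (up i) m := by
  have e : ((levelData n N).cur N (lo i) (up i) m : Level n N) = (levelB n N).subtype
    ((levelData n N).cur N (lo i) (up i) m) := rfl
  have s1 : ((levelB n N).subtype ((levelData n N).sig .plus)) = -(levelData n N).s := by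
    simp [RLLData.sig, Sgn.val]
  have s2 : ((levelB n N).subtype ((levelData n N).sig .minus)) = (levelData n N).s := by
    simp [RLLData.sig, Sgn.val]
  rw [e, RLLData.cur, RLLData.shSer, RLLData.shSer, map_sub, map_sh, map_sh, s1, s2, X, map_sub,
    proj_shift, proj_shift, map_neg, mul_neg, hPar_mul_proj_quarter]
  simp only [(hD _).proj_E]
  rfl

theorem proj_X_minus (hD : ∀ ε, IsGauss (L n ε) (D ε)) (N : ℕ) (i : Fin (n - 1)) (m : ℤ) :
    proj n N (X D .minus i m) = (levelData n N).curF N (lo i) (up i) m := by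
  have e : ((levelData n N).curF N (lo i) (up i) m : Level n N) = (levelB n N).subtype
    ((levelData n N).curF N (lo i) (up i) m) := rfl
  have s1 : ((levelB n N).subtype (-(levelData n N).sig .plus)) = (levelData n N).s := by
    simp [RLLData.sig, Sgn.val]
  have s2 : ((levelB n N).subtype (-(levelData n N).sig .minus)) = -(levelData n N).s := by
    simp [RLLData.sig, Sgn.val]
  rw [e, RLLData.curF, map_sub, map_sh, map_sh, s1, s2, X, map_sub,
    proj_shift, proj_shift, map_neg, mul_neg, hPar_mul_proj_quarter]
  simp only [(hD _).proj_F]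
  rfl

theorem proj_conjK_plus (hD : ∀ ε, IsGauss (L n ε) (D ε)) (N : ℕ) (ε : Sgn) (j : Fin n)
    (Y : ℤ → DY n) (y : levelB n N) (a b : ℤ) (hy : proj n N (Y b) = y) :
    proj n N (conjK D ε .plus j Y a b) = (levelData n N).conj ε j y a := by
  have e1 := congrArg (fun φ => ser ε φ a) (show
    PowerSeries.map (proj n N : DY n →+* Level n N)
      (Ring.inverse ((D ε).k j) * PowerSeries.C (Y b) * (D ε).k j) =
      PowerSeries.map (levelB n N).subtype (Ring.inverse (((levelData n N).D ε).k j) *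
        PowerSeries.C y * ((levelData n N).D ε).k j) by
    rw [map_mul, map_mul, (hD ε).map_k, (hD ε).map_inverse_k, map_mul, map_mul, PowerSeries.map_C,
      PowerSeries.map_C, RingHom.coe_coe, hy]; rfl)
  simp only [ser_map, RingHom.coe_coe] at e1
  exact e1

theorem proj_conjK_minus (hD : ∀ ε, IsGauss (L n ε) (D ε)) (N : ℕ) (ε : Sgn) (j : Fin n)
    (Y : ℤ → DY n) (y : levelB n N) (a b : ℤ) (hy : proj n N (Y b) = y) :
    proj n N (conjK D ε .minus j Y a b) = (levelData n N).conjInv ε j y a := by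
  have e1 := congrArg (fun φ => ser ε φ a) (show
    PowerSeries.map (proj n N : DY n →+* Level n N)
      ((D ε).k j * PowerSeries.C (Y b) * Ring.inverse ((D ε).k j)) =
      PowerSeries.map (levelB n N).subtype (((levelData n N).D ε).k j *
        PowerSeries.C y * Ring.inverse (((levelData n N).D ε).k j)) by
    rw [map_mul, map_mul, (hD ε).map_k, (hD ε).map_inverse_k, map_mul, map_mul, PowerSeries.map_C,
      PowerSeries.map_C, RingHom.coe_coe, hy]; rfl)
  simp only [ser_map, RingHom.coe_coe] at e1
  exact e1

end Reduction

/-! ### Multiplication by rational functions -/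

section Rational

variable {A : Type*} [Ring A]

theorem mulLin_congr (t : A) {F G : ℤ → ℤ → A} (h : ∀ a b, F a b = G a b) (a b : ℤ) :
    mulLin t F a b = mulLin t G a b := by
  simp only [mulLin, h]

theorem mulLin_finProd_congr {F F' G : ℤ → ℤ → A} {t : A} (h : FinConv F G)
    (e : ∀ a b, mulLin t F a b = F' a b) (a b : ℤ) :
    mulLin t (finProd F G) a b = finProd F' G a b := by
  rw [mulLin_finProd h]
  congr 1
  ext a b
  exact e a b

/-- Multiplying by `u - v - s` as a polynomial, and as an operator on coefficients. -/
theorem finProd_mulLin_one (s : A) (G : ℤ → ℤ → A) (a b : ℤ) :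
    finProd (mulLin s fun a b => if a = 0 ∧ b = 0 then 1 else 0) G a b = mulLin s G a b := by
  rw [← mulLin_finProd (finConv_one G)]
  exact mulLin_congr s (finProd_one G) a b

theorem finConv_mulLin_one (s : A) (G : ℤ → ℤ → A) :
    FinConv (mulLin s fun a b => if a = 0 ∧ b = 0 then 1 else 0) G := (finConv_one G).mulLin s

theorem mulLin_one_flip (s : A) (a b : ℤ) :
    mulLin s (fun a b => if a = 0 ∧ b = 0 then 1 else 0) a b =
      -mulLin (-s) (fun a b => if a = 0 ∧ b = 0 then 1 else 0) b a := by
  rw [← mulLin_flip]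
  exact mulLin_congr s (fun a b => by simp only [and_comm]) a b

theorem mulLin_ratio (ε : Sgn) {s t : A} (h : Commute s t) (a b : ℤ) :
    mulLin t (ratio ε s t) a b = mulLin s (fun a b => if a = 0 ∧ b = 0 then 1 else 0) a b := by
  cases ε with
  | plus => exact mulLin_ratioXY h a b
  | minus =>
    change mulLin t (fun a b => coeffXY (ratioXY (-s) (-t)) b a) a b = _
    rw [mulLin_flip, mulLin_ratioXY h.neg_left.neg_right, ← mulLin_one_flip]

theorem ratio_outside (ε : Sgn) (s t : A) (a b : ℤ) (h : ε.Outside a) : ratio ε s t a b = 0 := by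
  cases ε with
  | plus => exact coeffXY_pos _ _ h
  | minus => exact coeffXY_neg _ _ h

theorem map_ratioXY {A' : Type*} [Ring A'] (f : A →+* A') {s t : A} (h : Commute s t) (a b : ℤ) :
    f (coeffXY (ratioXY s t) a b) = coeffXY (ratioXY (f s) (f t)) a b := by
  refine sub_eq_zero.1 (eq_zero_of_mulLin_of_le (t := f t) (c := 0)
    (G := fun a b => f (coeffXY (ratioXY s t) a b) - coeffXY (ratioXY (f s) (f t)) a b)
    (fun a b => ?_) (fun a b ha => ?_) a b)
  · rw [mulLin_sub, ← map_mulLin, mulLin_ratioXY h, mulLin_ratioXY (h.map f), map_mulLin, sub_eq_zero]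
    exact mulLin_congr _ (fun a b => by split_ifs <;> simp) a b
  · rw [coeffXY_pos _ _ ha, coeffXY_pos _ _ ha, map_zero, sub_zero]

theorem map_ratio {A' : Type*} [Ring A'] (f : A →+* A') (ε : Sgn) {s t : A} (h : Commute s t)
    (a b : ℤ) : f (ratio ε s t a b) = ratio ε (f s) (f t) a b := by
  cases ε with
  | plus => exact map_ratioXY f h a b
  | minus =>
    change f (coeffXY (ratioXY (-s) (-t)) b a) = coeffXY (ratioXY (-f s) (-f t)) b a
    rw [map_ratioXY f h.neg_left.neg_right, map_neg, map_neg]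

/-- The coefficients of low degree in `y` of the expansion of `(x - y - s) / (x - y - t)` in
`|x| > |y|` contain high powers of `t`. -/
theorem exists_coeffXY_ratioXY_eq {s t : A} (h : Commute s t) (k : ℕ) (b : ℤ) (e : ℕ)
    (he : e + b ≤ k) : ∃ x, coeffXY (ratioXY s t) (-1 - k) b = t ^ e * x := by
  induction k generalizing b e with
  | zero =>
    rcases lt_or_ge b 0 with hb | hb
    · exact ⟨0, by rw [coeffXY_neg _ _ hb, mul_zero]⟩
    · obtain rfl : e = 0 := by push_cast at he; omega
      exact ⟨_, by rw [pow_zero, one_mul]⟩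
  | succ k ih =>
    have h1 := mulLin_ratioXY h (-1 - k) b
    have h2 : mulLin s (fun a b : ℤ => if a = 0 ∧ b = 0 then (1 : A) else 0) (-1 - k) b = 0 := by
      simp only [mulLin]
      rw [if_neg (by omega), if_neg (by omega), if_neg (by omega)]
      simp
    rw [h2, mulLin, sub_sub, sub_eq_zero] at h1
    rw [show (-1 - ((k + 1 : ℕ) : ℤ)) = -1 - (k : ℤ) - 1 by push_cast; ring, h1]
    obtain ⟨x, hx⟩ := ih (b - 1) e (by push_cast at he; omega)
    rw [hx]
    cases e with
    | zero => exact ⟨x + t * coeffXY (ratioXY s t) (-1 - k) b, by rw [pow_zero, one_mul, one_mul]⟩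
    | succ e =>
      obtain ⟨y, hy⟩ := ih b e (by push_cast at he; omega)
      rw [hy]
      exact ⟨x + y, by rw [mul_add, ← mul_assoc t, ← pow_succ']⟩

theorem ratio_finite (ε : Sgn) {s t : A} (h : Commute s t) {N : ℕ} (ht : t ^ N = 0) (a : ℤ) :
    {b | ratio ε s t a b ≠ 0}.Finite := by
  cases ε with
  | plus => exact coeffXY_finite _ a
  | minus =>
    refine (Set.finite_Icc (-1 - (N + a)) 0).subset fun b hb => ?_
    have hb' : coeffXY (ratioXY (-s) (-t)) b a ≠ 0 := hb
    constructor
    · by_contra hlt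
      obtain ⟨x, hx⟩ := exists_coeffXY_ratioXY_eq h.neg_left.neg_right (-1 - b).toNat a N
        (by
          have : 0 ≤ a := by
            by_contra ha
            exact hb' (coeffXY_neg _ _ (by omega))
          omega)
      have ha : 0 ≤ a := by
        by_contra ha
        exact hb' (coeffXY_neg _ _ (by omega))
      rw [show -1 - ((-1 - b).toNat : ℤ) = b by omega, neg_pow, ht, mul_zero, zero_mul] at hx
      exact hb' hx
    · by_contra hlt
      exact hb' (coeffXY_pos _ _ (by omega))

theorem finConv_ratio_inV (ε : Sgn) {s t : A} (h : Commute s t) {N : ℕ} (ht : t ^ N = 0)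
    (Y : ℤ → A) : FinConv (ratio ε s t) (inV Y) :=
  (finSupp_of_snd (ratio_finite ε h ht) fun _ _ ha => if_neg ha).finConv

theorem finProd_outside {ε : Sgn} {F : ℤ → ℤ → A} {Y : ℤ → A}
    (hF : ∀ a b, ε.Outside a → F a b = 0) (a b : ℤ) (h : ε.Outside a) :
    finProd F (inV Y) a b = 0 := by
  rw [finProd]
  refine finsum_eq_zero_of_forall_eq_zero fun p => ?_
  by_cases hp : p.1 = a
  · rw [hp, hF _ _ h, zero_mul]
  · rw [inV, if_neg (by omega), mul_zero]

theorem finProd_ratio_inV (ε : Sgn) {s t : A} (h : Commute s t) {N : ℕ} (ht : t ^ N = 0)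
    {Y : ℤ → A} {H : ℤ → ℤ → A} (hH : ∀ a b, ε.Outside a → H a b = 0)
    (e : ∀ a b, mulLin t H a b = mulLin s (inV Y) a b) (a b : ℤ) :
    finProd (ratio ε s t) (inV Y) a b = H a b := by
  have h0 := eq_zero_of_mulLin (ε := ε) ⟨N, ht⟩
    (F := fun a b => finProd (ratio ε s t) (inV Y) a b - H a b)
    (fun a b ha => by
      rw [finProd_outside (ratio_outside ε s t) a b ha, hH a b ha, sub_zero])
    (fun a b => by
      rw [mulLin_sub, mulLin_finProd_congr (finConv_ratio_inV ε h ht Y) (mulLin_ratio ε h), e,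
        finProd_mulLin_one, sub_self])
  exact sub_eq_zero.1 (congrFun (congrFun h0 a) b)

theorem finConv_ratio_plus (s t : A) {G : ℤ → ℤ → A} (hG : ∀ a b, 0 < a → G a b = 0) :
    FinConv (ratio .plus s t) G :=
  (finSupp_of_fst_le (fun _ _ h => coeffXY_pos _ _ h) (coeffXY_finite _) hG).finConv

theorem finProd_pos {F G : ℤ → ℤ → A} (hF : ∀ a b, 0 < a → F a b = 0)
    (hG : ∀ a b, 0 < a → G a b = 0) (a b : ℤ) (h : 0 < a) : finProd F G a b = 0 := by
  rw [finProd]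
  refine finsum_eq_zero_of_forall_eq_zero fun p => ?_
  rcases lt_or_ge 0 p.1 with hp | hp
  · rw [hF _ _ hp, zero_mul]
  · rw [hG _ _ (by omega), mul_zero]

theorem mulLin_pos {t : A} {F : ℤ → ℤ → A} {c : ℤ} (hF : ∀ a b, c < a → F a b = 0) (a b : ℤ)
    (h : c + 1 < a) : mulLin t F a b = 0 := by
  rw [mulLin, hF _ _ (by omega), hF _ _ (by omega), hF _ _ (by omega)]
  simp

/-- An identity of products with rational functions follows from the identity with cleared denominators if all
series are one-sided in `u`. -/
theorem finProd_ratio_eq {s₁ t₁ s₂ t₂ : A} (h₁ : Commute s₁ t₁) (h₂ : Commute s₂ t₂)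
    (ht : Commute t₁ t₂) {G₁ G₂ : ℤ → ℤ → A} (hG₁ : ∀ a b, 0 < a → G₁ a b = 0)
    (hG₂ : ∀ a b, 0 < a → G₂ a b = 0)
    (e : ∀ a b, mulLin t₂ (mulLin s₁ G₁) a b = mulLin t₁ (mulLin s₂ G₂) a b) (a b : ℤ) :
    finProd (ratio .plus s₁ t₁) G₁ a b = finProd (ratio .plus s₂ t₂) G₂ a b := by
  have e1 : ∀ a b, mulLin t₁ (finProd (ratio .plus s₁ t₁) G₁) a b = mulLin s₁ G₁ a b := fun a b => by
    rw [mulLin_finProd_congr (finConv_ratio_plus s₁ t₁ hG₁) (mulLin_ratio .plus h₁),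
      finProd_mulLin_one]
  have e2 : ∀ a b, mulLin t₂ (finProd (ratio .plus s₂ t₂) G₂) a b = mulLin s₂ G₂ a b := fun a b => by
    rw [mulLin_finProd_congr (finConv_ratio_plus s₂ t₂ hG₂) (mulLin_ratio .plus h₂),
      finProd_mulLin_one]
  have z : ∀ a b, 0 < a → finProd (ratio .plus s₁ t₁) G₁ a b -
      finProd (ratio .plus s₂ t₂) G₂ a b = 0 := fun a b h => by
    rw [finProd_pos (ratio_outside .plus s₁ t₁) hG₁ a b h,
      finProd_pos (ratio_outside .plus s₂ t₂) hG₂ a b h, sub_zero]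
  refine sub_eq_zero.1 (eq_zero_of_mulLin_of_le (t := t₁) (c := 0)
    (G := fun a b => finProd (ratio .plus s₁ t₁) G₁ a b - finProd (ratio .plus s₂ t₂) G₂ a b)
    (fun a b => ?_) z a b)
  refine eq_zero_of_mulLin_of_le (t := t₂) (c := 0 + 1) (fun a b => ?_)
    (fun a b h => mulLin_pos z a b h) a b
  have h3 : mulLin t₂ (mulLin t₁ (fun a b => finProd (ratio .plus s₁ t₁) G₁ a b -
      finProd (ratio .plus s₂ t₂) G₂ a b)) a b =
      mulLin t₂ (mulLin t₁ (finProd (ratio .plus s₁ t₁) G₁)) a b -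
        mulLin t₂ (mulLin t₁ (finProd (ratio .plus s₂ t₂) G₂)) a b := by
    rw [← mulLin_sub]
    exact mulLin_congr _ (fun a b => mulLin_sub _ _ _ a b) a b
  rw [h3, mulLin_comm ht.symm (finProd (ratio .plus s₂ t₂) G₂), mulLin_congr t₂ e1,
    mulLin_congr t₁ e2, e, sub_self]

theorem mulLin_mulLin_coeffXY (s s' : A) (φ : PowerSeries (Polynomial A)) (a b : ℤ) :
    mulLin s (mulLin s' (coeffXY φ)) a b = coeffXY (lin s * (lin s' * φ)) (a - 1 - 1) b := by
  have h : ∀ a b, mulLin s' (coeffXY φ) a b = coeffXY (lin s' * φ) (a - 1) b :=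
    fun a b => (coeffXY_lin_mul s' φ a b).symm
  rw [mulLin_congr s h, coeffXY_lin_mul]
  rfl

end Rational

/-! #### The square factor -/

section Square

variable {A : Type*} [Ring A] [Algebra (PowerSeries ℂ) A]

theorem lin_sub_hPar_mul (t : A) : lin (t + hPar A) * lin (t - hPar A) =
    lin t ^ 2 - PowerSeries.C (Polynomial.C (hPar A)) ^ 2 * PowerSeries.X ^ 2 := by
  have c1 : ∀ φ : PowerSeries (Polynomial A),
      PowerSeries.C (Polynomial.C (hPar A)) * φ = φ * PowerSeries.C (Polynomial.C (hPar A)) := by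
    intro φ
    ext m k
    rw [PowerSeries.coeff_C_mul, PowerSeries.coeff_mul_C, Polynomial.coeff_C_mul,
      Polynomial.coeff_mul_C, hPar_commute]
  have c2 : ∀ φ : PowerSeries (Polynomial A),
      PowerSeries.X * φ = φ * PowerSeries.X := fun φ => (PowerSeries.commute_X φ).eq.symm
  have e1 : lin (t + hPar A) = lin t - PowerSeries.C (Polynomial.C (hPar A)) * PowerSeries.X := by
    simp only [lin, map_add, add_mul]
    abel
  have e2 : lin (t - hPar A) = lin t + PowerSeries.C (Polynomial.C (hPar A)) * PowerSeries.X := by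
    simp only [lin, map_add, map_sub, add_mul, sub_mul]
    abel
  have hc : Commute (PowerSeries.C (Polynomial.C (hPar A)) * PowerSeries.X) (lin t) :=
    Commute.mul_left (c1 _) (c2 _)
  have hc2 : Commute (PowerSeries.C (Polynomial.C (hPar A))) PowerSeries.X := c1 _
  rw [e1, e2, ← hc2.mul_pow, sq, sq, sub_mul, mul_add, mul_add, hc.eq]
  abel

theorem square_commute (t : A) : Commute (lin t ^ 2)
    (lin t ^ 2 - PowerSeries.C (Polynomial.C (hPar A)) ^ 2 * PowerSeries.X ^ 2) := by
  have c1 : Commute (PowerSeries.C (Polynomial.C (hPar A))) (lin t) := by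
    ext m k
    rw [PowerSeries.coeff_C_mul, PowerSeries.coeff_mul_C, Polynomial.coeff_C_mul,
      Polynomial.coeff_mul_C, hPar_commute]
  have c2 : Commute (lin t ^ 2) (PowerSeries.X ^ 2) :=
    (PowerSeries.commute_X (lin t)).pow_pow 2 2
  exact (Commute.refl _).sub_right ((c1.symm.pow_pow 2 2).mul_right c2)

theorem lin_mul_lin_mul_squareXY (t : A) :
    lin (t + hPar A) * (lin (t - hPar A) * squareXY t) = lin t * (lin t * 1) := by
  rw [squareXY, ← mul_assoc, lin_sub_hPar_mul, ← mul_assoc, ← (square_commute t).eq, mul_assoc,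
    PowerSeries.mul_invOfUnit, mul_one, mul_one, sq]
  simp [lin]

theorem mulLin_mulLin_squareXY (t : A) (a b : ℤ) :
    mulLin (t + hPar A) (mulLin (t - hPar A) (coeffXY (squareXY t))) a b =
      mulLin t (mulLin t fun a b => if a = 0 ∧ b = 0 then 1 else 0) a b := by
  rw [mulLin_mulLin_coeffXY, lin_mul_lin_mul_squareXY, ← mulLin_mulLin_coeffXY]
  exact mulLin_congr _ (fun a b => mulLin_congr _ coeffXY_one a b) a b

/-- The series `square t`, multiplied by its denominator `(u - v - t) ^ 2 - h ^ 2`. -/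
theorem mulLin_mulLin_square (t : A) (a b : ℤ) :
    mulLin (t - hPar A) (mulLin (t + hPar A) (square t)) a b =
      mulLin t (mulLin t fun a b => if a = 0 ∧ b = 0 then 1 else 0) a b := by
  have flip2 : ∀ (s s' : A) (F : ℤ → ℤ → A), mulLin s (mulLin s' (fun a b => F b a)) a b =
      mulLin (-s) (mulLin (-s') F) b a := by
    intro s s' F
    rw [mulLin_congr s (mulLin_flip s' F)]
    change mulLin s (fun a b => (fun b a => -mulLin (-s') F b a) b a) a b = _
    rw [mulLin_flip]
    simp only [mulLin]
    noncomm_ring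
  change mulLin (t - hPar A) (mulLin (t + hPar A) (fun a b => coeffXY (squareXY (-t)) b a)) a b = _
  rw [flip2, show -(t - hPar A) = -t + hPar A by abel, show -(t + hPar A) = -t - hPar A by abel,
    mulLin_mulLin_squareXY, ← flip2]
  exact mulLin_congr _ (fun a b => mulLin_congr _ (fun a b => by simp only [and_comm]) a b) a b

theorem square_outside (t : A) (a b : ℤ) (h : a < 0 ∨ 0 < b) : square t a b = 0 := by
  rcases h with h | h
  · exact coeffXY_neg _ _ h
  · exact coeffXY_pos _ _ h

theorem finConv_square (t : A) {G : ℤ → ℤ → A} (hG : ∀ a b, a < 0 ∨ 0 < b → G a b = 0) :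
    FinConv (square t) G := (finSupp_of_quadrant (square_outside t) hG).finConv

end Square

section QuadrantUnique

variable {A : Type*} [Ring A]

theorem eq_zero_of_mulLin_of_snd {t : A} {G : ℤ → ℤ → A} {c : ℤ} (h : ∀ a b, mulLin t G a b = 0)
    (hG : ∀ a b, c < b → G a b = 0) (a b : ℤ) : G a b = 0 :=
  eq_zero_of_mulLin_of_le (t := -t) (c := c) (G := fun a b => G b a)
    (fun a b => by rw [mulLin_flip, neg_neg, h, neg_zero]) (fun a b h => hG _ _ h) b a

theorem mulLin_snd_pos {t : A} {F : ℤ → ℤ → A} {c : ℤ} (hF : ∀ a b, c < b → F a b = 0) (a b : ℤ)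
    (h : c + 1 < b) : mulLin t F a b = 0 := by
  rw [mulLin, hF _ _ (by omega), hF _ _ (by omega), hF _ _ (by omega)]
  simp

theorem finProd_snd_pos {F G : ℤ → ℤ → A} (hF : ∀ a b, 0 < b → F a b = 0)
    (hG : ∀ a b, 0 < b → G a b = 0) (a b : ℤ) (h : 0 < b) : finProd F G a b = 0 := by
  rw [finProd]
  refine finsum_eq_zero_of_forall_eq_zero fun p => ?_
  rcases lt_or_ge 0 p.2 with hp | hp
  · rw [hF _ _ hp, zero_mul]
  · rw [hG _ _ (by omega), mul_zero]

/-- A series in nonpositive powers of `v` is determined by its product with four factors. -/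
theorem eq_of_mulLin_four {t₁ t₂ t₃ t₄ : A} {F G : ℤ → ℤ → A} (hF : ∀ a b, 0 < b → F a b = 0)
    (hG : ∀ a b, 0 < b → G a b = 0)
    (e : ∀ a b, mulLin t₁ (mulLin t₂ (mulLin t₃ (mulLin t₄ F))) a b =
      mulLin t₁ (mulLin t₂ (mulLin t₃ (mulLin t₄ G))) a b) (a b : ℤ) : F a b = G a b := by
  have z : ∀ a b, 0 < b → F a b - G a b = 0 := fun a b h => by rw [hF _ _ h, hG _ _ h, sub_zero]
  have z1 := mulLin_snd_pos (t := t₄) z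
  have z2 := mulLin_snd_pos (t := t₃) z1
  have z3 := mulLin_snd_pos (t := t₂) z2
  have s : ∀ (t : A) {H F G : ℤ → ℤ → A}, (∀ a b, H a b = F a b - G a b) → ∀ a b,
      mulLin t H a b = mulLin t F a b - mulLin t G a b := fun t H F G h a b => by
    rw [mulLin_congr t h, mulLin_sub]
  refine sub_eq_zero.1 (eq_zero_of_mulLin_of_snd (t := t₄) (fun a b => ?_) z a b)
  refine eq_zero_of_mulLin_of_snd (t := t₃) (fun a b => ?_) z1 a b
  refine eq_zero_of_mulLin_of_snd (t := t₂) (fun a b => ?_) z2 a b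
  refine eq_zero_of_mulLin_of_snd (t := t₁) (fun a b => ?_) z3 a b
  rw [s t₁ (s t₂ (s t₃ (s t₄ fun a b => rfl))), e, sub_self]

variable [Algebra (PowerSeries ℂ) A]

theorem mulLin_mulLin_finProd_square (t : A) {G : ℤ → ℤ → A}
    (hG : ∀ a b, a < 0 ∨ 0 < b → G a b = 0) (a b : ℤ) :
    mulLin (t - hPar A) (mulLin (t + hPar A) (finProd (square t) G)) a b =
      mulLin t (mulLin t G) a b := by
  have h := finConv_square t hG
  rw [mulLin_congr (t - hPar A) (mulLin_finProd h (t + hPar A)),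
    mulLin_finProd_congr (h.mulLin _) (mulLin_mulLin_square t),
    ← mulLin_finProd (finConv_mulLin_one t G)]
  exact mulLin_congr t (finProd_mulLin_one t G) a b

/-- The analogue of `finProd_ratio_eq` for the square factors. -/
theorem finProd_square_eq {t : A} {G₁ G₂ : ℤ → ℤ → A}
    (hG₁ : ∀ a b, a < 0 ∨ 0 < b → G₁ a b = 0) (hG₂ : ∀ a b, a < 0 ∨ 0 < b → G₂ a b = 0)
    (e : ∀ a b, mulLin t (mulLin t (mulLin (-t + hPar A) (mulLin (-t - hPar A) G₁))) a b =
      mulLin (-t) (mulLin (-t) (mulLin (t + hPar A) (mulLin (t - hPar A) G₂))) a b) (a b : ℤ) :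
    finProd (square t) G₁ a b = finProd (square (-t)) G₂ a b := by
  have z : ∀ (s : A) {G : ℤ → ℤ → A}, (∀ a b, a < 0 ∨ 0 < b → G a b = 0) → ∀ a b, 0 < b →
      finProd (square s) G a b = 0 := fun s G hG a b h =>
    finProd_snd_pos (fun a b h => square_outside s a b (.inr h)) (fun a b h => hG a b (.inr h)) a b h
  have ct : Commute t (hPar A) := (hPar_commute t).symm
  have c1 : ∀ x ∈ ({t, -t, t + hPar A, t - hPar A, -t + hPar A, -t - hPar A} : Set A),
      ∀ y ∈ ({t, -t, t + hPar A, t - hPar A, -t + hPar A, -t - hPar A} : Set A), Commute x y := by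
    have ch : ∀ x ∈ ({t, -t, t + hPar A, t - hPar A, -t + hPar A, -t - hPar A} : Set A),
        Commute x t ∧ Commute x (hPar A) := by
      intro x hx
      refine ⟨?_, (hPar_commute x).symm⟩
      simp only [Set.mem_insert_iff, Set.mem_singleton_iff] at hx
      rcases hx with rfl | rfl | rfl | rfl | rfl | rfl
      · exact Commute.refl _
      · exact (Commute.refl _).neg_left
      · exact (Commute.refl _).add_left ct.symm
      · exact (Commute.refl _).sub_left ct.symm
      · exact (Commute.refl _).neg_left.add_left ct.symm
      · exact (Commute.refl _).neg_left.sub_left ct.symm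
    intro x hx y hy
    obtain ⟨h1, h2⟩ := ch x hx
    simp only [Set.mem_insert_iff, Set.mem_singleton_iff] at hy
    rcases hy with rfl | rfl | rfl | rfl | rfl | rfl
    · exact h1
    · exact h1.neg_right
    · exact h1.add_right h2
    · exact h1.sub_right h2
    · exact h1.neg_right.add_right h2
    · exact h1.neg_right.sub_right h2
  have C : ∀ x ∈ ({t, -t, t + hPar A, t - hPar A, -t + hPar A, -t - hPar A} : Set A),
      ∀ y ∈ ({t, -t, t + hPar A, t - hPar A, -t + hPar A, -t - hPar A} : Set A), ∀ F : ℤ → ℤ → A,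
      mulLin x (mulLin y F) = mulLin y (mulLin x F) :=
    fun x hx y hy F => mulLin_comm (c1 x hx y hy) F
  have e1 : mulLin (t - hPar A) (mulLin (t + hPar A) (finProd (square t) G₁)) =
      mulLin t (mulLin t G₁) := by
    ext a b
    exact mulLin_mulLin_finProd_square t hG₁ a b
  have e2 : mulLin (-t - hPar A) (mulLin (-t + hPar A) (finProd (square (-t)) G₂)) =
      mulLin (-t) (mulLin (-t) G₂) := by
    ext a b
    exact mulLin_mulLin_finProd_square (-t) hG₂ a b
  have e' : mulLin t (mulLin t (mulLin (-t + hPar A) (mulLin (-t - hPar A) G₁))) =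
      mulLin (-t) (mulLin (-t) (mulLin (t + hPar A) (mulLin (t - hPar A) G₂))) := by
    ext a b
    exact e a b
  refine eq_of_mulLin_four (t₁ := -t + hPar A) (t₂ := -t - hPar A) (t₃ := t - hPar A)
    (t₄ := t + hPar A) (z t hG₁) (z (-t) hG₂) (fun a b => congrFun (congrFun ?_ a) b) a b
  calc mulLin (-t + hPar A) (mulLin (-t - hPar A) (mulLin (t - hPar A) (mulLin (t + hPar A)
        (finProd (square t) G₁))))
      = mulLin (-t + hPar A) (mulLin (-t - hPar A) (mulLin t (mulLin t G₁))) := by rw [e1]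
    _ = mulLin t (mulLin t (mulLin (-t + hPar A) (mulLin (-t - hPar A) G₁))) := by
        rw [C (-t - hPar A) (by simp) t (by simp), C (-t - hPar A) (by simp) t (by simp),
          C (-t + hPar A) (by simp) t (by simp), C (-t + hPar A) (by simp) t (by simp)]
    _ = mulLin (-t) (mulLin (-t) (mulLin (t + hPar A) (mulLin (t - hPar A) G₂))) := e'
    _ = mulLin (t - hPar A) (mulLin (t + hPar A) (mulLin (-t) (mulLin (-t) G₂))) := by
        rw [C (t + hPar A) (by simp) (-t) (by simp), C (t + hPar A) (by simp) (-t) (by simp),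
          C (t - hPar A) (by simp) (-t) (by simp), C (t - hPar A) (by simp) (-t) (by simp),
          C (t - hPar A) (by simp) (t + hPar A) (by simp)]
    _ = mulLin (t - hPar A) (mulLin (t + hPar A) (mulLin (-t - hPar A) (mulLin (-t + hPar A)
        (finProd (square (-t)) G₂)))) := by rw [e2]
    _ = _ := by
        rw [C (-t - hPar A) (by simp) (-t + hPar A) (by simp),
          C (t + hPar A) (by simp) (-t + hPar A) (by simp),
          C (t + hPar A) (by simp) (-t - hPar A) (by simp),
          C (t - hPar A) (by simp) (-t + hPar A) (by simp),
          C (t - hPar A) (by simp) (-t - hPar A) (by simp)]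

end QuadrantUnique

/-! ### Products with shifted delta functions -/

section Delta

variable {B : Type*} [Ring B] {N : ℕ} {s s' : B}

/-- Multiplication of `G(u + s)` by `(u + s) ^ m = ∑ i, (m choose i) s ^ i u ^ (m - i)` gives the shift
of `u ^ m G(u)`. -/
theorem sum_choose_sh (hs : s ^ N = 0) (G : ℤ → B) (m a : ℤ) :
    ∑ i ∈ Finset.range N, (Ring.choose m i : ℤ) • (s ^ i * sh N s G (a - m + i)) =
      sh N s (fun x => G (x - m)) a := by
  cases N with
  | zero => simp [sh]
  | succ K =>
    set H := sh (K + 1) s G with hH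
    set T : ℤ → ℤ → B := fun m a =>
      ∑ i ∈ Finset.range (K + 1), (Ring.choose m i : ℤ) • (s ^ i * H (a - m + i)) with hT
    set W : ℤ → ℤ → B := fun m a => sh (K + 1) s (fun x => G (x - m)) a with hW
    have rT : ∀ m a, T (m + 1) a = T m (a - 1) + s * T m a := by
      intro m a
      simp only [hT]
      rw [Finset.sum_range_succ', Finset.sum_range_succ' _ K, Finset.sum_range_succ _ K, mul_add,
        mul_smul_comm, ← mul_assoc, ← pow_succ', hs, zero_mul, smul_zero, add_zero, Finset.mul_sum]
      simp only [Ring.choose_succ_succ, add_smul, Finset.sum_add_distrib, Ring.choose_zero_right]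
      rw [add_right_comm, add_right_comm, add_comm]
      have e1 : ∀ i : ℕ, a - (m + 1) + ((i + 1 : ℕ) : ℤ) = a - m + i := fun i => by push_cast; ring
      have e2 : ∀ i : ℕ, a - 1 - m + ((i + 1 : ℕ) : ℤ) = a - m + i := fun i => by push_cast; ring
      simp only [e1, e2]
      have e3 : a - (m + 1) + ((0 : ℕ) : ℤ) = a - 1 - m + ((0 : ℕ) : ℤ) := by ring
      rw [e3]
      have e4 : ∀ i : ℕ, s * ((Ring.choose m i : ℤ) • (s ^ i * H (a - m + i))) =
          (Ring.choose m i : ℤ) • (s ^ (i + 1) * H (a - m + i)) := fun i => by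
        rw [mul_smul_comm, ← mul_assoc, ← pow_succ']
      simp only [e4]
      abel
    have rW : ∀ m a, W (m + 1) a = W m (a - 1) + s * W m a := by
      intro m a
      have := sh_mul_var hs (fun x => G (x - m)) a
      simp only [hW]
      rw [← this]
      congr 1
      ext x
      congr 1
      ring
    have key : ∀ a, T m a = W m a := by
      induction m using Int.induction_on with
      | zero =>
        intro a
        simp only [hT, hW, sub_zero]
        rw [Finset.sum_range_succ']
        simp only [Ring.choose_zero_succ, zero_smul, Finset.sum_const_zero, zero_add]
        simp [hH]
      | succ m ih =>
        intro a
        rw [rT, rW, ih, ih]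
      | pred m ih =>
        have h1 : ∀ a, T (-(m : ℤ) - 1) (a - 1) - W (-(m : ℤ) - 1) (a - 1) =
            -(s * (T (-(m : ℤ) - 1) a - W (-(m : ℤ) - 1) a)) := by
          intro a
          have h2 := ih a
          rw [show (-(m : ℤ)) = (-(m : ℤ) - 1) + 1 by ring, rT, rW, ← sub_eq_zero] at h2
          rw [eq_neg_iff_add_eq_zero, ← h2, mul_sub]
          abel
        have h3 : ∀ k : ℕ, ∀ a, T (-(m : ℤ) - 1) a - W (-(m : ℤ) - 1) a =
            (-s) ^ k * (T (-(m : ℤ) - 1) (a + k) - W (-(m : ℤ) - 1) (a + k)) := by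
          intro k
          induction k with
          | zero => intro a; simp
          | succ k ihk =>
            intro a
            have h4 := h1 (a + k + 1)
            rw [add_sub_cancel_right] at h4
            rw [ihk, h4, pow_succ, mul_assoc, neg_mul]
            push_cast
            rw [add_assoc]
        intro a
        have h5 := h3 (K + 1) a
        rw [neg_pow, hs, mul_zero, zero_mul] at h5
        exact sub_eq_zero.1 h5
    exact key a

/-- `δ(u - v) = ∑ k, u ^ (-k-1) * v ^ k`. -/
def deltaFn (B : Type*) [Ring B] (a b : ℤ) : B := if a + b = -1 then 1 else 0

theorem sh₂_deltaFn (a b : ℤ) : sh₂ N s s' (deltaFn B) a b =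
    ∑ i ∈ Finset.range N, ∑ j ∈ Finset.range N, if a + b + i + j = -1 then
      (Ring.choose (a + i) i : ℤ) • (s ^ i * ((Ring.choose (b + j) j : ℤ) • s' ^ j)) else 0 := by
  rw [sh₂, sh]
  refine Finset.sum_congr rfl fun i _ => ?_
  rw [sh, Finset.mul_sum, Finset.smul_sum]
  refine Finset.sum_congr rfl fun j _ => ?_
  simp only [deltaFn, show a + (i : ℤ) + (b + j) = a + b + i + j by ring]
  split_ifs <;> simp

/-- Each row and each column of the shifted delta function is finite, so that its product with a series in
one variable makes sense. -/
theorem sh₂_deltaFn_finite (c : ℤ) :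
    {a | sh₂ N s s' (deltaFn B) a c ≠ 0}.Finite ∧ {b | sh₂ N s s' (deltaFn B) c b ≠ 0}.Finite := by
  have key : ∀ a b, sh₂ N s s' (deltaFn B) a b ≠ 0 → -1 - 2 * (N : ℤ) ≤ a + b ∧ a + b ≤ -1 := by
    intro a b h
    by_contra h'
    refine h ?_
    rw [sh₂_deltaFn]
    refine Finset.sum_eq_zero fun i hi => Finset.sum_eq_zero fun j hj => if_neg ?_
    rw [Finset.mem_range] at hi hj
    omega
  constructor
  · refine (Set.finite_Icc (-1 - 2 * (N : ℤ) - c) (-1 - c)).subset fun a ha => ?_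
    have := key a c ha
    exact ⟨by omega, by omega⟩
  · refine (Set.finite_Icc (-1 - 2 * (N : ℤ) - c) (-1 - c)).subset fun b hb => ?_
    have := key c b hb
    exact ⟨by omega, by omega⟩

theorem finConv_deltaFn_inU (G : ℤ → B) : FinConv (sh₂ N s s' (deltaFn B)) (inU G) := by
  intro a b
  refine (Set.Finite.image (fun c => (c, b)) (sh₂_deltaFn_finite (N := N) (s := s) (s' := s') b).1).subset
    fun p hp => ?_
  have h1 : sh₂ N s s' (deltaFn B) p.1 p.2 ≠ 0 := left_ne_zero_of_mul hp
  have h2 : inU G (a - p.1) (b - p.2) ≠ 0 := right_ne_zero_of_mul hp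
  have h3 : p.2 = b := by by_contra h; exact h2 (if_neg (by omega))
  exact ⟨p.1, by rw [← h3]; exact h1, Prod.ext rfl h3.symm⟩

theorem finConv_deltaFn_inV (G : ℤ → B) : FinConv (sh₂ N s s' (deltaFn B)) (inV G) :=
  (finSupp_of_snd (fun a => (sh₂_deltaFn_finite a).2) fun _ _ ha => if_neg ha).finConv

theorem finProd_deltaFn (G : ℤ → ℤ → B) {a b : ℤ} {q : ℕ → ℕ → ℤ × ℤ}
    (h : ∀ (p : ℤ × ℤ) (i j : ℕ), p.1 + p.2 + i + j = -1 → G (a - p.1) (b - p.2) ≠ 0 → p = q i j)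
    (hq : ∀ i j, (q i j).1 + (q i j).2 + i + j = -1) :
    finProd (sh₂ N s s' (deltaFn B)) G a b = ∑ i ∈ Finset.range N, ∑ j ∈ Finset.range N,
      (Ring.choose ((q i j).1 + i) i : ℤ) • (s ^ i * ((Ring.choose ((q i j).2 + j) j : ℤ) • s' ^ j)) *
        G (a - (q i j).1) (b - (q i j).2) := by
  have supp : ∀ i j : ℕ, ∀ p : ℤ × ℤ, p ≠ q i j → (if p.1 + p.2 + i + j = -1 then
      (Ring.choose (p.1 + i) i : ℤ) • (s ^ i * ((Ring.choose (p.2 + j) j : ℤ) • s' ^ j)) else 0) *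
        G (a - p.1) (b - p.2) = 0 := by
    intro i j p hp
    split_ifs with h1
    · by_cases h2 : G (a - p.1) (b - p.2) = 0
      · rw [h2, mul_zero]
      · exact absurd (h p i j h1 h2) hp
    · rw [zero_mul]
  have fin : ∀ i j : ℕ, (Function.support fun p : ℤ × ℤ => (if p.1 + p.2 + i + j = -1 then
      (Ring.choose (p.1 + i) i : ℤ) • (s ^ i * ((Ring.choose (p.2 + j) j : ℤ) • s' ^ j)) else 0) *
        G (a - p.1) (b - p.2)).Finite := fun i j =>
    (Set.finite_singleton (q i j)).subset fun p hp => by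
      by_contra h'
      exact hp (supp i j p h')
  rw [finProd]
  simp only [sh₂_deltaFn, Finset.sum_mul]
  rw [finsum_sum_comm]
  · refine Finset.sum_congr rfl fun i _ => ?_
    rw [finsum_sum_comm]
    · refine Finset.sum_congr rfl fun j _ => ?_
      rw [finsum_eq_single _ (q i j) (supp i j), if_pos (hq i j)]
    · exact fun j _ => fin i j
  · intro i _
    refine (Set.Finite.biUnion (Finset.finite_toSet (Finset.range N)) fun j _ => fin i j).subset
      fun p hp => ?_
    obtain ⟨j, hj, hj'⟩ := Finset.exists_ne_zero_of_sum_ne_zero hp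
    exact Set.mem_biUnion (Finset.mem_coe.2 hj) hj'

/-- `δ(u + s - v - s') G(u + s)` in terms of the expansion of `δ(u - v) G(u)`. -/
theorem finProd_deltaFn_inU (hs : s ^ N = 0) (h : Commute s s') (G : ℤ → B) (a b : ℤ) :
    finProd (sh₂ N s s' (deltaFn B)) (inU (sh N s G)) a b =
      sh₂ N s s' (fun a b => G (a + b + 1)) a b := by
  rw [finProd_deltaFn (q := fun i j => (-1 - b - j - i, b)) _ (fun p i j h1 h2 => ?_)
    (fun i j => by simp only; ring)]
  · have e1 : sh₂ N s s' (fun a b => G (a + b + 1)) a b = ∑ j ∈ Finset.range N,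
        (Ring.choose (b + j) j : ℤ) • (s' ^ j * sh N s (fun x => G (x - (-1 - b - j))) a) := by
      simp only [sh₂, sh, Finset.mul_sum, Finset.smul_sum]
      rw [Finset.sum_comm]
      refine Finset.sum_congr rfl fun j _ => Finset.sum_congr rfl fun i _ => ?_
      rw [mul_smul_comm, mul_smul_comm, smul_comm, ← mul_assoc, ← mul_assoc, (h.pow_pow i j).eq]
      congr 4
      ring
    rw [e1, Finset.sum_comm]
    refine Finset.sum_congr rfl fun j _ => ?_
    rw [← sum_choose_sh hs, Finset.mul_sum, Finset.smul_sum]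
    refine Finset.sum_congr rfl fun i _ => ?_
    rw [inU, if_pos (sub_self b), sub_add_cancel, mul_smul_comm, mul_smul_comm, smul_mul_assoc,
      smul_mul_assoc, smul_comm, (h.pow_pow i j).eq, mul_assoc]
    congr 5
    ring
  · have h3 : p.2 = b := by by_contra h; exact h2 (if_neg (by omega))
    exact Prod.ext (by simp only; omega) h3

/-- `δ(u + s - v - s') G(v + s')` in terms of the expansion of `δ(u - v) G(v)`. -/
theorem finProd_deltaFn_inV (hs' : s' ^ N = 0) (G : ℤ → B) (a b : ℤ) :
    finProd (sh₂ N s s' (deltaFn B)) (inV (sh N s' G)) a b =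
      sh₂ N s s' (fun a b => G (a + b + 1)) a b := by
  rw [finProd_deltaFn (q := fun i j => (a, -1 - a - i - j)) _ (fun p i j h1 h2 => ?_)
    (fun i j => by simp only; ring)]
  · rw [sh₂, sh]
    refine Finset.sum_congr rfl fun i _ => ?_
    have e1 : sh N s' (fun b => G (a + i + b + 1)) b = sh N s' (fun x => G (x - (-1 - a - i))) b := by
      congr 1
      ext x
      congr 1
      ring
    rw [e1, ← sum_choose_sh hs', Finset.mul_sum, Finset.smul_sum]
    refine Finset.sum_congr rfl fun j _ => ?_
    rw [inV, if_pos (sub_self a), sub_add_cancel, smul_mul_assoc, mul_assoc, smul_mul_assoc]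
    congr 5
    ring
  · have h3 : p.1 = a := by by_contra h; exact h2 (if_neg (by omega))
    exact Prod.ext h3 (by simp only; omega)

end Delta

/-! ### The relations in the completed algebra -/

section Final

variable {n : ℕ} {D : Sgn → GaussData n}

theorem levelData_s_pow (N : ℕ) : (levelData n N).s ^ N = 0 := Subtype.ext (hMul_pow_eq_zero _ _)

theorem levelData_h (N : ℕ) : ((levelData n N).h : Level n N) = hPar (Level n N) := rfl

theorem proj_hPar (N : ℕ) : proj n N (hPar (DY n)) = hPar (Level n N) := map_hPar _

theorem proj_hcHalf (N : ℕ) :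
    proj n N (hcHalf n) = ((levelData n N).tau .plus .minus : Level n N) := by
  have e : ∀ x : levelB n N, (x : Level n N) = (levelB n N).subtype x := fun _ => rfl
  rw [e, RLLData.tau, map_zsmul, hcHalf, map_hMul, hMul_half]
  rfl

theorem proj_tShift (N : ℕ) (ε σ : Sgn) : proj n N (tShift n ε σ) =
    ((-((ε.val * σ.val) • (levelData n N).s) : levelB n N) : Level n N) := by
  have e : ∀ x : levelB n N, (x : Level n N) = (levelB n N).subtype x := fun _ => rfl
  rw [e, tShift, map_neg, map_zsmul, map_hMul, map_neg, map_zsmul]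
  rfl

theorem proj_mulLin (N : ℕ) (t : DY n) (F : ℤ → ℤ → DY n) (a b : ℤ) :
    proj n N (mulLin t F a b) = mulLin (proj n N t) (fun a b => proj n N (F a b)) a b :=
  map_mulLin (proj n N : DY n →+* Level n N) t F a b

theorem coe_mulLin (N : ℕ) (t : levelB n N) (F : ℤ → ℤ → levelB n N) (a b : ℤ) :
    ((mulLin t F a b : levelB n N) : Level n N) = mulLin (t : Level n N) (fun a b => F a b) a b :=
  map_mulLin (levelB n N).subtype t F a b

/-! #### The diagonal series -/

theorem K_commute (hD : ∀ ε, IsGauss (L n ε) (D ε)) (ε : Sgn) (i j : Fin n) (a b : ℤ) :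
    K D ε i a * K D ε j b = K D ε j b * K D ε i a := by
  refine eq_of_proj fun N _ => ?_
  rw [map_mul, map_mul, proj_K hD, proj_K hD]
  exact congrArg Subtype.val ((levelData n N).k_k_same ε i j a b)

theorem K_commute_of_lt (hD : ∀ ε, IsGauss (L n ε) (D ε)) {i j : Fin n} (h : i < j) (a b : ℤ) :
    K D .plus i a * K D .minus j b = K D .minus j b * K D .plus i a := by
  refine eq_of_proj fun N _ => ?_
  rw [map_mul, map_mul, proj_K hD, proj_K hD]
  exact congrArg Subtype.val ((levelData n N).k_k_of_lt i j h (Or.inr rfl) a b)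

theorem exists_isProd_ratio (hD : ∀ ε, IsGauss (L n ε) (D ε)) (i : Fin n) :
    ∃ H : ℤ → ℤ → DY n,
      IsProd (ratio .plus (hcHalf n - hPar (DY n)) (hcHalf n))
        (fun a b => K D .plus i a * K D .minus i b) H ∧
      IsProd (ratio .plus (-hcHalf n - hPar (DY n)) (-hcHalf n))
        (fun a b => K D .minus i b * K D .plus i a) H := by
  have g1 : ∀ a b, 0 < a → K D .plus i a * K D .minus i b = 0 := fun a b h => by
    rw [K, ser_plus_pos _ h, zero_mul]
  have g2 : ∀ a b, 0 < a → K D .minus i b * K D .plus i a = 0 := fun a b h => by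
    rw [K, K, ser_plus_pos _ h, mul_zero]
  have c1 : ∀ t : DY n, Commute (t - hPar (DY n)) t := fun t =>
    (Commute.refl t).sub_left (hPar_commute t)
  have f1 := finConv_ratio_plus (hcHalf n - hPar (DY n)) (hcHalf n) g1
  have f2 := finConv_ratio_plus (-hcHalf n - hPar (DY n)) (-hcHalf n) g2
  refine ⟨_, isProd_finProd f1, ?_⟩
  have e : finProd (ratio .plus (hcHalf n - hPar (DY n)) (hcHalf n))
        (fun a b => K D .plus i a * K D .minus i b) =
      finProd (ratio .plus (-hcHalf n - hPar (DY n)) (-hcHalf n))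
        (fun a b => K D .minus i b * K D .plus i a) := by
    ext1 a
    ext1 b
    refine finProd_ratio_eq (c1 _) (c1 _) (Commute.refl _).neg_right g1 g2 (fun a b => ?_) a b
    refine eq_of_proj fun N _ => ?_
    have h := congrArg Subtype.val ((levelData n N).k_k_mixed i a b)
    simp only [proj_mulLin, map_mul, proj_K hD, map_neg, map_sub, proj_hPar, proj_hcHalf]
    simpa only [coe_mulLin, Subring.coe_mul, Subring.coe_neg, AddSubgroupClass.coe_sub,
      levelData_h] using h
  rw [e]
  exact isProd_finProd f2

theorem exists_isProd_square (hD : ∀ ε, IsGauss (L n ε) (D ε)) {i j : Fin n} (hij : i < j) :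
    ∃ H : ℤ → ℤ → DY n,
      IsProd (square (-hcHalf n)) (fun a b => K D .minus i a * K D .plus j b) H ∧
      IsProd (square (hcHalf n)) (fun a b => K D .plus j b * K D .minus i a) H := by
  have g1 : ∀ a b, a < 0 ∨ 0 < b → K D .minus i a * K D .plus j b = 0 := by
    rintro a b (h | h)
    · rw [K, ser_minus_neg _ h, zero_mul]
    · rw [K, K, ser_plus_pos _ h, mul_zero]
  have g2 : ∀ a b, a < 0 ∨ 0 < b → K D .plus j b * K D .minus i a = 0 := by
    rintro a b (h | h)
    · rw [K, K, ser_minus_neg _ h, mul_zero]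
    · rw [K, ser_plus_pos _ h, zero_mul]
  refine ⟨_, isProd_finProd (finConv_square _ g1), ?_⟩
  have e : finProd (square (-hcHalf n)) (fun a b => K D .minus i a * K D .plus j b) =
      finProd (square (hcHalf n)) (fun a b => K D .plus j b * K D .minus i a) := by
    ext1 a
    ext1 b
    have h0 := finProd_square_eq (t := -hcHalf n) g1 g2 (fun a b => by
      refine eq_of_proj fun N _ => ?_
      have h := congrArg Subtype.val ((levelData n N).k_k_minus_plus i j hij a b)
      have ht : (levelData n N).tau .minus .plus = -(levelData n N).tau .plus .minus := by
        rw [RLLData.tau, RLLData.tau, ← neg_smul, neg_sub]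
      rw [ht] at h
      simp only [proj_mulLin, map_mul, proj_K hD, map_neg, map_sub, map_add, proj_hPar, proj_hcHalf]
      simpa only [coe_mulLin, Subring.coe_mul, Subring.coe_neg, AddSubgroupClass.coe_sub,
        Subring.coe_add, levelData_h] using h) a b
    rwa [neg_neg] at h0
  rw [e]
  exact isProd_finProd (finConv_square _ g2)

/-! #### The diagonal series and the currents -/

theorem isProd_ratio_inV {ε : Sgn} {s t : DY n} (h : Commute s t) (ht : ∀ N, proj n N t ^ N = 0)
    {Y : ℤ → DY n} {H : ℤ → ℤ → DY n} (hH : ∀ a b, ε.Outside a → H a b = 0)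
    (e : ∀ N, 0 < N → ∀ a b, mulLin (proj n N t) (fun a b => proj n N (H a b)) a b =
      mulLin (proj n N s) (fun a b => proj n N (inV Y a b)) a b) :
    IsProd (ratio ε s t) (inV Y) H := by
  refine isProd_of_proj fun N hN => ?_
  have ht' := ht N
  have e1 : (fun a b => proj n N (ratio ε s t a b)) = ratio ε (proj n N s) (proj n N t) := by
    ext a b
    exact map_ratio (proj n N : DY n →+* Level n N) ε h a b
  have e2 : (fun a b => proj n N (inV Y a b)) = inV fun b => proj n N (Y b) := by
    ext a b
    rw [inV, inV]
    split_ifs <;> simp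
  have e3 := e N hN
  rw [e2] at e3
  rw [e1, e2]
  have hc : Commute (proj n N s) (proj n N t) := h.map _
  exact ⟨finConv_ratio_inV ε hc ht' _, fun a b => finProd_ratio_inV ε hc ht'
    (fun a b ha => by rw [hH a b ha, map_zero]) e3 a b⟩

theorem conjK_outside (ε σ : Sgn) (j : Fin n) (Y : ℤ → DY n) (a b : ℤ) (h : ε.Outside a) :
    conjK D ε σ j Y a b = 0 := by
  cases σ <;> exact ser_outside ε _ h

theorem proj_tShift_pow (ε σ : Sgn) (N : ℕ) : proj n N (tShift n ε σ) ^ N = 0 := by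
  rw [proj_tShift, ← SubmonoidClass.coe_pow, ← neg_smul, ← Int.cast_smul_eq_zsmul ℤ, zsmul_eq_mul,
    (Int.cast_commute _ _).mul_pow, levelData_s_pow, mul_zero]
  rfl

theorem proj_inV_X_plus (hD : ∀ ε, IsGauss (L n ε) (D ε)) (N : ℕ) (i : Fin (n - 1)) (a b : ℤ) :
    proj n N (inV (X D .plus i) a b) = inV ((levelData n N).cur N (lo i) (up i)) a b := by
  rw [inV, inV]
  split_ifs
  · exact proj_X_plus hD N i b
  · exact map_zero _

theorem proj_inV_X_minus (hD : ∀ ε, IsGauss (L n ε) (D ε)) (N : ℕ) (i : Fin (n - 1)) (a b : ℤ) :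
    proj n N (inV (X D .minus i) a b) = inV ((levelData n N).curF N (lo i) (up i)) a b := by
  rw [inV, inV]
  split_ifs
  · exact proj_X_minus hD N i b
  · exact map_zero _

theorem proj_conjK_X_plus (hD : ∀ ε, IsGauss (L n ε) (D ε)) (N : ℕ) (ε : Sgn) (j : Fin n)
    (i : Fin (n - 1)) (a b : ℤ) : proj n N (conjK D ε .plus j (X D .plus i) a b) =
      (levelData n N).conj ε j ((levelData n N).cur N (lo i) (up i) b) a :=
  proj_conjK_plus hD N ε j _ _ a b (proj_X_plus hD N i b)

theorem proj_conjK_X_minus (hD : ∀ ε, IsGauss (L n ε) (D ε)) (N : ℕ) (ε : Sgn) (j : Fin n)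
    (i : Fin (n - 1)) (a b : ℤ) : proj n N (conjK D ε .minus j (X D .minus i) a b) =
      (levelData n N).conjInv ε j ((levelData n N).curF N (lo i) (up i) b) a :=
  proj_conjK_minus hD N ε j _ _ a b (proj_X_minus hD N i b)

theorem up_val (i : Fin (n - 1)) : (up i).val = (lo i).val + 1 := rfl

theorem tShift_sub_commute (ε σ : Sgn) : Commute (tShift n ε σ - hPar (DY n)) (tShift n ε σ) :=
  (Commute.refl _).sub_left (hPar_commute _)

theorem tShift_add_commute (ε σ : Sgn) : Commute (tShift n ε σ + hPar (DY n)) (tShift n ε σ) :=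
  (Commute.refl _).add_left (hPar_commute _)

theorem isProd_conjK_lo (hD : ∀ ε, IsGauss (L n ε) (D ε)) (ε σ : Sgn) (i : Fin (n - 1)) :
    IsProd (ratio ε (tShift n ε σ - hPar (DY n)) (tShift n ε σ)) (inV (X D σ i))
      (conjK D ε σ (lo i) (X D σ i)) := by
  refine isProd_ratio_inV (tShift_sub_commute ε σ) (proj_tShift_pow ε σ) (conjK_outside ε σ _ _)
    fun N hN a b => ?_
  cases σ with
  | plus =>
    have h := congrArg Subtype.val ((levelData n N).mulLin_conj_left hN (levelData_s_pow N) ε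
      (up_val i) a b)
    simp only [proj_inV_X_plus hD, proj_conjK_X_plus hD, map_sub, proj_hPar, proj_tShift,
      show Sgn.plus.val = 1 from rfl, mul_one]
    simpa only [coe_mulLin, AddSubgroupClass.coe_sub, levelData_h] using h
  | minus =>
    have h := congrArg Subtype.val ((levelData n N).mulLin_conjInv_left hN (levelData_s_pow N) ε
      (up_val i) a b)
    simp only [proj_inV_X_minus hD, proj_conjK_X_minus hD, map_sub, proj_hPar, proj_tShift,
      show Sgn.minus.val = -1 from rfl, mul_neg, mul_one, neg_smul, neg_neg]
    simpa only [coe_mulLin, AddSubgroupClass.coe_sub, levelData_h] using h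

theorem isProd_conjK_up (hD : ∀ ε, IsGauss (L n ε) (D ε)) (ε σ : Sgn) (i : Fin (n - 1)) :
    IsProd (ratio ε (tShift n ε σ + hPar (DY n)) (tShift n ε σ)) (inV (X D σ i))
      (conjK D ε σ (up i) (X D σ i)) := by
  refine isProd_ratio_inV (tShift_add_commute ε σ) (proj_tShift_pow ε σ) (conjK_outside ε σ _ _)
    fun N hN a b => ?_
  cases σ with
  | plus =>
    have h := congrArg Subtype.val ((levelData n N).mulLin_conj_right hN (levelData_s_pow N) ε
      (up_val i) a b)
    simp only [proj_inV_X_plus hD, proj_conjK_X_plus hD, map_add, proj_hPar, proj_tShift,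
      show Sgn.plus.val = 1 from rfl, mul_one]
    simpa only [coe_mulLin, Subring.coe_add, levelData_h] using h
  | minus =>
    have h := congrArg Subtype.val ((levelData n N).mulLin_conjInv_right hN (levelData_s_pow N) ε
      (up_val i) a b)
    simp only [proj_inV_X_minus hD, proj_conjK_X_minus hD, map_add, proj_hPar, proj_tShift,
      show Sgn.minus.val = -1 from rfl, mul_neg, mul_one, neg_smul, neg_neg]
    simpa only [coe_mulLin, Subring.coe_add, levelData_h] using h

theorem conjK_of_ne (hD : ∀ ε, IsGauss (L n ε) (D ε)) (ε σ : Sgn) (i : Fin (n - 1)) (j : Fin n)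
    (h1 : j ≠ lo i) (h2 : j ≠ up i) : conjK D ε σ j (X D σ i) = inV (X D σ i) := by
  ext1 a
  ext1 b
  refine eq_of_proj fun N _ => ?_
  cases σ with
  | plus =>
    rw [proj_conjK_X_plus hD, proj_inV_X_plus hD]
    exact congrArg Subtype.val ((levelData n N).conj_cur_far ε (up_val i) h1 h2 a b)
  | minus =>
    rw [proj_conjK_X_minus hD, proj_inV_X_minus hD]
    exact congrArg Subtype.val ((levelData n N).conjInv_curF_far ε (up_val i) h1 h2 a b)

/-! #### The currents of one kind -/

theorem X_self (hD : ∀ ε, IsGauss (L n ε) (D ε)) (σ : Sgn) (i : Fin (n - 1)) :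
    mulLin (σ.val • hPar (DY n)) (fun a b => X D σ i a * X D σ i b) =
      mulLin (-(σ.val • hPar (DY n))) (fun a b => X D σ i b * X D σ i a) := by
  ext1 a
  ext1 b
  refine eq_of_proj fun N hN => ?_
  cases σ with
  | plus =>
    have h := congrArg Subtype.val ((levelData n N).cur_self hN (levelData_s_pow N) (up_val i) a b)
    simp only [proj_mulLin, map_mul, proj_X_plus hD, map_neg, proj_hPar, Sgn.val, one_smul]
    simpa only [coe_mulLin, Subring.coe_mul, Subring.coe_neg, levelData_h] using h
  | minus =>
    have h := congrArg Subtype.val ((levelData n N).curF_self hN (levelData_s_pow N) (up_val i) a b)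
    simp only [proj_mulLin, map_mul, proj_X_minus hD, map_neg, proj_hPar, Sgn.val, neg_smul,
      one_smul, neg_neg]
    simpa only [coe_mulLin, Subring.coe_mul, Subring.coe_neg, levelData_h] using h

theorem lo_eq_up {i j : Fin (n - 1)} (h : i.val + 1 = j.val) : lo j = up i := Fin.ext h.symm

theorem up_val_add_two {i j : Fin (n - 1)} (h : i.val + 1 = j.val) :
    (up j).val = (lo i).val + 2 := by
  change j.val + 1 = i.val + 2
  omega

theorem X_plus_succ (hD : ∀ ε, IsGauss (L n ε) (D ε)) (i j : Fin (n - 1)) (hij : i.val + 1 = j.val) :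
    mulLin (-hPar (DY n)) (fun a b => X D .plus i a * X D .plus j b) =
      mulLin 0 (fun a b => X D .plus j b * X D .plus i a) := by
  ext1 a
  ext1 b
  refine eq_of_proj fun N hN => ?_
  have h := congrArg Subtype.val ((levelData n N).cur_succ hN (levelData_s_pow N) (up_val i)
    (up_val_add_two hij) a b)
  simp only [proj_mulLin, map_mul, proj_X_plus hD, map_neg, proj_hPar, map_zero, lo_eq_up hij]
  simpa only [coe_mulLin, Subring.coe_mul, Subring.coe_neg, levelData_h, Subring.coe_zero] using h

theorem X_minus_succ (hD : ∀ ε, IsGauss (L n ε) (D ε)) (i j : Fin (n - 1))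
    (hij : i.val + 1 = j.val) :
    mulLin 0 (fun a b => X D .minus i a * X D .minus j b) =
      mulLin (-hPar (DY n)) (fun a b => X D .minus j b * X D .minus i a) := by
  ext1 a
  ext1 b
  refine eq_of_proj fun N hN => ?_
  have h := congrArg Subtype.val ((levelData n N).curF_succ hN (levelData_s_pow N) (up_val i)
    (up_val_add_two hij) a b)
  simp only [proj_mulLin, map_mul, proj_X_minus hD, map_neg, proj_hPar, map_zero, lo_eq_up hij]
  simpa only [coe_mulLin, Subring.coe_mul, Subring.coe_neg, levelData_h, Subring.coe_zero] using h

theorem X_serre (hD : ∀ ε, IsGauss (L n ε) (D ε)) (σ : Sgn) (i j : Fin (n - 1))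
    (hij : i.val + 1 = j.val ∨ j.val + 1 = i.val) (a₁ a₂ b : ℤ) :
    serre D σ i j a₁ a₂ b + serre D σ i j a₂ a₁ b = 0 := by
  refine eq_of_proj fun N hN => ?_
  cases σ with
  | plus =>
    simp only [serre, map_add, map_sub, map_mul, proj_X_plus hD, map_ofNat, map_zero]
    exact congrArg Subtype.val ((levelData n N).cur_serre (N := N) (up_val i) (up_val j) hij a₁ a₂ b)
  | minus =>
    simp only [serre, map_add, map_sub, map_mul, proj_X_minus hD, map_ofNat, map_zero]
    exact congrArg Subtype.val ((levelData n N).curF_serre (N := N) (up_val i) (up_val j) hij a₁ a₂ b)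

theorem X_far (hD : ∀ ε, IsGauss (L n ε) (D ε)) (σ : Sgn) (i j : Fin (n - 1))
    (hij : i.val + 1 < j.val ∨ j.val + 1 < i.val) (a b : ℤ) :
    X D σ i a * X D σ j b = X D σ j b * X D σ i a := by
  refine eq_of_proj fun N hN => ?_
  cases σ with
  | plus =>
    simp only [map_mul, proj_X_plus hD]
    exact congrArg Subtype.val ((levelData n N).cur_far (N := N) (up_val i) (up_val j) hij a b)
  | minus =>
    simp only [map_mul, proj_X_minus hD]
    exact congrArg Subtype.val ((levelData n N).curF_far (N := N) (up_val i) (up_val j) hij a b)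

/-! #### The currents of different kinds -/

/-- The coefficients of the series `G(u)` multiplied by `δ(u - v)`, after both variables have been
shifted. -/
def shiftDelta (κ μ : DY n) (G : ℤ → DY n) (a b : ℤ) : DY n :=
  shift κ (fun a => shift μ (fun b => G (a + b + 1)) b) a

theorem proj_shiftDelta (N : ℕ) (κ μ : DY n) (G : ℤ → DY n) (a b : ℤ) :
    proj n N (shiftDelta κ μ G a b) = sh₂ N (hPar (Level n N) * proj n N κ)
      (hPar (Level n N) * proj n N μ) (fun a b => proj n N (G (a + b + 1))) a b := by
  simp only [shiftDelta, proj_shift]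
  rfl

theorem proj_deltaShift (N : ℕ) (κ μ : DY n) (a b : ℤ) :
    proj n N (deltaShift κ μ a b) = sh₂ N (hPar (Level n N) * proj n N κ)
      (hPar (Level n N) * proj n N μ) (deltaFn (Level n N)) a b := by
  have e : ∀ a b, proj n N (delta n a b) = deltaFn (Level n N) a b := fun a b => by
    rw [delta, deltaFn]
    split_ifs <;> simp
  simp only [deltaShift, proj_shift, e]
  rfl

theorem hPar_mul_pow (N : ℕ) (x : Level n N) : (hPar (Level n N) * x) ^ N = 0 := by
  rw [Commute.mul_pow (hPar_commute _), level_hPar_pow, zero_mul]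

theorem isProd_deltaShift_inU {κ μ : DY n} (h : Commute κ μ) (G : ℤ → DY n) :
    IsProd (deltaShift κ μ) (inU (shift κ G)) (shiftDelta κ μ G) := by
  refine isProd_of_proj fun N _ => ?_
  have e : (fun a b => proj n N (inU (shift κ G) a b)) =
      inU (sh N (hPar (Level n N) * proj n N κ) fun m => proj n N (G m)) := by
    ext a b
    rw [inU, inU]
    split_ifs
    · exact proj_shift N κ G a
    · exact map_zero _
  have hc : Commute (hPar (Level n N) * proj n N κ) (hPar (Level n N) * proj n N μ) := by
    have h1 : Commute (proj n N κ) (proj n N μ) := h.map _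
    exact (Commute.mul_right (Commute.refl _) (hPar_commute _)).mul_left
      (Commute.mul_right (hPar_commute _).symm h1)
  rw [e]
  simp only [proj_deltaShift, proj_shiftDelta]
  exact ⟨finConv_deltaFn_inU _, finProd_deltaFn_inU (hPar_mul_pow N _) hc _⟩

theorem isProd_deltaShift_inV (κ μ : DY n) (G : ℤ → DY n) :
    IsProd (deltaShift κ μ) (inV (shift μ G)) (shiftDelta κ μ G) := by
  refine isProd_of_proj fun N _ => ?_
  have e : (fun a b => proj n N (inV (shift μ G) a b)) =
      inV (sh N (hPar (Level n N) * proj n N μ) fun m => proj n N (G m)) := by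
    ext a b
    rw [inV, inV]
    split_ifs
    · exact proj_shift N μ G b
    · exact map_zero _
  rw [e]
  simp only [proj_deltaShift, proj_shiftDelta]
  exact ⟨finConv_deltaFn_inV _, finProd_deltaFn_inV (hPar_mul_pow N _) _⟩

theorem coe_deltaK (N : ℕ) (ε : Sgn) (i j : Fin n) (a b : ℤ) :
    ((levelData n N).deltaK N ε i j a b : Level n N) =
      sh₂ N ((levelData n N).sig ε : Level n N) (-(levelData n N).sig ε : Level n N)
        (fun a b => ((ser ε ((levelData n N).ratioK ε i j) (a + b + 1) : levelB n N) : Level n N)) a b := by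
  change (levelB n N).subtype _ = _
  rw [RLLData.deltaK, sh₂, map_sh, sh₂]
  congr 1
  ext a
  exact map_sh _ _ _ _ _

theorem X_plus_X_minus (hD : ∀ ε, IsGauss (L n ε) (D ε)) (i : Fin (n - 1)) (a b : ℤ) :
    X D .plus i a * X D .minus i b - X D .minus i b * X D .plus i a = hPar (DY n) *
      (shiftDelta (-quarter n) (quarter n) (phi D .plus i) a b -
        shiftDelta (quarter n) (-quarter n) (phi D .minus i) a b) := by
  refine eq_of_proj fun N hN => ?_
  have h := congrArg Subtype.val ((levelData n N).cur_curF hN (levelData_s_pow N) (up_val i) a b)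
  have s1 : ((levelData n N).sig .plus : Level n N) = -(levelData n N).s := by
    simp [RLLData.sig, Sgn.val]
  have s2 : ((levelData n N).sig .minus : Level n N) = (levelData n N).s := by
    simp [RLLData.sig, Sgn.val]
  simp only [map_mul, map_sub, proj_X_plus hD, proj_X_minus hD, proj_hPar, proj_shiftDelta,
    proj_phi hD, map_neg, mul_neg, hPar_mul_proj_quarter]
  simpa only [Subring.coe_mul, AddSubgroupClass.coe_sub, levelData_h, coe_deltaK, s1, s2, neg_neg] using h

theorem X_plus_commute_X_minus (hD : ∀ ε, IsGauss (L n ε) (D ε)) {i j : Fin (n - 1)} (hij : i ≠ j)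
    (a b : ℤ) : X D .plus i a * X D .minus j b = X D .minus j b * X D .plus i a := by
  refine eq_of_proj fun N hN => ?_
  simp only [map_mul, proj_X_plus hD, proj_X_minus hD]
  refine congrArg Subtype.val ((levelData n N).cur_curF_of_ne (up_val i) (up_val j) (fun h => ?_) a b)
  have h1 : (lo i).val = (lo j).val := by rw [h]
  exact hij (Fin.ext h1)

theorem exists_isProd_delta (hD : ∀ ε, IsGauss (L n ε) (D ε)) (i j : Fin (n - 1)) :
    ∃ P M : ℤ → ℤ → DY n,
      IsProd (deltaShift (-quarter n) (quarter n))
        (inU (shift (-quarter n) (phi D .plus i))) P ∧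
      IsProd (deltaShift (quarter n) (-quarter n))
        (inV (shift (-quarter n) (phi D .minus i))) M ∧
      ∀ a b : ℤ, X D .plus i a * X D .minus j b - X D .minus j b * X D .plus i a =
        if i = j then hPar (DY n) * (P a b - M a b) else 0 := by
  refine ⟨_, _, isProd_deltaShift_inU (Commute.refl (quarter n)).neg_left _, isProd_deltaShift_inV _ _ _,
    fun a b => ?_⟩
  split_ifs with hij
  · subst hij
    exact X_plus_X_minus hD i a b
  · rw [X_plus_commute_X_minus hD hij, sub_self]

end Final

end YangianDouble

end

open YangianDouble in
theorem theorem2p5 (n : ℕ) :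
    -- the Gaussian components are well defined
    (∀ ε : Sgn, ∃! D : GaussData n, IsGauss (L n ε) D) ∧
    ∀ D : Sgn → GaussData n, (∀ ε, IsGauss (L n ε) (D ε)) →
      (∀ (ε : Sgn) (i : Fin n), IsUnit ((D ε).k i)) ∧
      -- k-k relations
      (∀ (ε : Sgn) (i j : Fin n) (a b : ℤ), K D ε i a * K D ε j b = K D ε j b * K D ε i a) ∧
      (∀ i : Fin n, ∃ H : ℤ → ℤ → DY n,
        IsProd (ratio .plus (hcHalf n - hPar (DY n)) (hcHalf n))
          (fun a b => K D .plus i a * K D .minus i b) H ∧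
        IsProd (ratio .plus (-hcHalf n - hPar (DY n)) (-hcHalf n))
          (fun a b => K D .minus i b * K D .plus i a) H) ∧
      (∀ (i j : Fin n), i < j → ∀ a b : ℤ,
        K D .plus i a * K D .minus j b = K D .minus j b * K D .plus i a) ∧
      (∀ (i j : Fin n), i < j → ∃ H : ℤ → ℤ → DY n,
        IsProd (square (-hcHalf n)) (fun a b => K D .minus i a * K D .plus j b) H ∧
        IsProd (square (hcHalf n)) (fun a b => K D .plus j b * K D .minus i a) H) ∧
      -- k-X relations
      (∀ (ε σ : Sgn) (i : Fin (n - 1)),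
        IsProd (ratio ε (tShift n ε σ - hPar (DY n)) (tShift n ε σ)) (inV (X D σ i))
          (conjK D ε σ (lo i) (X D σ i))) ∧
      (∀ (ε σ : Sgn) (i : Fin (n - 1)),
        IsProd (ratio ε (tShift n ε σ + hPar (DY n)) (tShift n ε σ)) (inV (X D σ i))
          (conjK D ε σ (up i) (X D σ i))) ∧
      (∀ (ε σ : Sgn) (i : Fin (n - 1)) (j : Fin n), j ≠ lo i → j ≠ up i →
        conjK D ε σ j (X D σ i) = inV (X D σ i)) ∧
      -- quadratic X-X relations
      (∀ (σ : Sgn) (i : Fin (n - 1)),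
        mulLin (σ.val • hPar (DY n)) (fun a b => X D σ i a * X D σ i b) =
          mulLin (-(σ.val • hPar (DY n))) (fun a b => X D σ i b * X D σ i a)) ∧
      (∀ i j : Fin (n - 1), i.val + 1 = j.val →
        mulLin (-hPar (DY n)) (fun a b => X D .plus i a * X D .plus j b) =
          mulLin 0 (fun a b => X D .plus j b * X D .plus i a)) ∧
      (∀ i j : Fin (n - 1), i.val + 1 = j.val →
        mulLin 0 (fun a b => X D .minus i a * X D .minus j b) =
          mulLin (-hPar (DY n)) (fun a b => X D .minus j b * X D .minus i a)) ∧
      -- Serre relations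
      (∀ (σ : Sgn) (i j : Fin (n - 1)), (i.val + 1 = j.val ∨ j.val + 1 = i.val) →
        ∀ a₁ a₂ b : ℤ, serre D σ i j a₁ a₂ b + serre D σ i j a₂ a₁ b = 0) ∧
      (∀ (σ : Sgn) (i j : Fin (n - 1)), (i.val + 1 < j.val ∨ j.val + 1 < i.val) →
        ∀ a b : ℤ, X D σ i a * X D σ j b = X D σ j b * X D σ i a) ∧
      -- the relation between the two kinds of currents
      (∀ i j : Fin (n - 1), ∃ P M : ℤ → ℤ → DY n,
        IsProd (deltaShift (-quarter n) (quarter n))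
          (inU (shift (-quarter n) (phi D .plus i))) P ∧
        IsProd (deltaShift (quarter n) (-quarter n))
          (inV (shift (-quarter n) (phi D .minus i))) M ∧
        ∀ a b : ℤ, X D .plus i a * X D .minus j b - X D .minus j b * X D .plus i a =
          if i = j then hPar (DY n) * (P a b - M a b) else 0) := by 
  refine ⟨existsUnique_gaussData, fun D hD => ⟨fun ε i => (hD ε).isUnit_k i, K_commute hD,
    exists_isProd_ratio hD, fun i j h => K_commute_of_lt hD h, fun i j h => exists_isProd_square hD h,
    isProd_conjK_lo hD, isProd_conjK_up hD, conjK_of_ne hD, X_self hD, X_plus_succ hD,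
    X_minus_succ hD, X_serre hD, X_far hD, exists_isProd_delta hD⟩⟩
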